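/- **Setting.** Let $\mathcal B$ be a connected complex manifold of dimension $r$, $\mathcal B''\subset\mathcal B$ a divisor and $\mathcal B'=\mathcal B\setminus\mathcal B''$. Over $\mathcal B'$ let $0\to\Gamma_f\to\hat\Gamma\to\Gamma\to0$ be an exact sequence of local systems of lattices with $\Gamma_f$ constant and $\operatorname{rank}\Gamma=2r$, let $\langle\cdot,\cdot\rangle$ be a flat antisymmetric integral pairing on $\hat\Gamma$ with radical $\Gamma_f$, let $\theta_f:\Gamma_f\to\mathbb R/2\pi\mathbb Z$ be a homomorphism, and let $Z:\hat\Gamma\to\mathbb C$ be a homomorphism that is holomorphic along flat sections and constant on $\Gamma_f$, such that $\langle dZ\wedge dZ\rangle=0$ and $\langle dZ\wedge d\bar Z\rangle$ is a Kähler form. Let $\Omega:\hat\Gamma\to\mathbb Q$ satisfy $\Omega(-\gamma)=\Omega(\gamma)$. Let $\pi:\mathcal M'\to\mathcal B'$ be the bundle whose points over $x$ are the maps $\theta:\hat\Gamma_x\to\mathbb R/2\pi\mathbb Z$ with $\theta_{\gamma+\gamma'}=\theta_\gamma+\theta_{\gamma'}+\pi\langle\gamma,\gamma'\rangle$ that restrict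 to $\theta_f$ on $\Gamma_f$. Its smooth structure is the one for which the base coordinates together with the $\theta_{\gamma_i}$, for flat local sections $\gamma_i$ of $\hat\Gamma$ that induce a basis of $\Gamma\otimes\mathbb Q$, are local coordinates. Let $u\in\mathcal B''$ and let $U\subset\mathcal B$ be an open neighbourhood of $u$ such that the following hold. 1. Over $U\cap\mathcal B'$ there are local subsystems $\hat\Gamma_{\rm light}\subset\hat\Gamma_{\rm local}\subset\hat\Gamma$, where $\hat\Gamma_{\rm local}$ is the orthogonal of $\hat\Gamma_{\rm light}$ for $\langle\cdot,\cdot\rangle$, such that $\hat\Gamma_{\rm light}$, $\hat\Gamma_{\rm local}$, $\hat\Gamma/\hat\Gamma_{\rm light}$ and $\hat\Gamma/\hat\Gamma_{\rm local}$ are trivial local systems of lattices. 2. On $\hat\Gamma_{\rm light}$, $\Omega$ is constant along flat sections, takes values in the non-negative integers and has finite support $\tilde\Gamma_{\rm light}$. 3. For $\gamma\in\hat\Gamma_{\rm local}$, $Z_\gamma$ extends to a holomorphic function on $U$; these extensions satisfy $\operatorname{span}_{\mathbb C}\{dZ_\gamma(x):\gamma\in\hat\Gamma_{\rm local}\}=T_x^*\mathcal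 B$ for every $x\in U$; and $\mathcal B''\cap U=\bigcup_{\gamma\in\tilde\Gamma_{\rm light}}\{Z_\gamma=0\}$. 4. For every flat section $\gamma$ of $\hat\Gamma$ over a connected open subset of $U\cap\mathcal B'$, and any choice there of branches of the logarithms, $$Z_\gamma=\tilde Z_\gamma+\frac1{4\pi i}\sum_{\gamma'\in\tilde\Gamma_{\rm light}}\langle\gamma,\gamma'\rangle\,\Omega(\gamma')\,Z_{\gamma'}\bigl(\log(Z_{\gamma'}/\pi)-1\bigr),$$ where $\tilde Z_\gamma$ (depending on the section and the branches) is the restriction of a holomorphic function on $U$. 5. There is an open subset $U'\subset U\cap\mathcal B'$ on which $$\langle dZ\wedge d\bar Z\rangle-\frac i{2\sqrt\pi}\sum_{\gamma\in\tilde\Gamma_{\rm light}}\frac{\Omega(\gamma)}{\sqrt{|Z_\gamma|}\,(e^{2|Z_\gamma|}-1)}\,dZ_\gamma\wedge d\bar Z_\gamma$$ is a Kähler form, and every point of $U$ lies in a compact complex submanifold with boundary of $U$, of positive dimension and with boundary contained in $U'$, on which $Z$ is constant on some corank-one sublattice of $\hat\Gamma_{\rm light}$ that contains $\hat\Gamma_{\rm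 light}\cap\Gamma_f$. Let $U_a\subset U\cap\mathcal B'$ be open and contractible. Fix a partition of $\mathbb C^\times$ into $2K$ half-open sectors $V_A$, $A\in\mathbb Z/2K$, of opening angle $\pi/K$, $K\ge5$, ordered counterclockwise. Let $r_A$ be the ray from $0$ to $\infty$ separating $V_A$ from $V_{A+1}$; $V_A$ contains $r_{A-1}$ but not $r_A$. For $\gamma\in\tilde\Gamma_{\rm light}$ and $x\in U_a$ put $\ell_\gamma(x)=-Z_\gamma(x)\mathbb R_{>0}$, oriented from $0$ to $\infty$. Suppose that no $\ell_\gamma(x)$ with $x\in U_a$, $\gamma\in\tilde\Gamma_{\rm light}$ coincides with a ray $r_A$, and let $A(\gamma)$ be the index with $\ell_\gamma(x)\subset V_{A(\gamma)}$. For $\zeta\in\mathbb C^\times$ and $(x,\theta)\in\pi^{-1}(U_a)$ put $$\mathcal X^{\rm sf}_\gamma(\zeta)=\exp\bigl(\zeta^{-1}Z_\gamma+i\theta_\gamma+\zeta\bar Z_\gamma\bigr),$$ $$\mathcal X^{(k)}_\gamma(\zeta)=\mathcal X^{\rm sf}_\gamma(\zeta)\exp\Bigl(-\frac1{4\pi i}\sum_{\gamma'\in\tilde\Gamma_{\rm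 light}}\Omega(\gamma')\langle\gamma,\gamma'\rangle\int_{r^-_{A(\gamma')+k}}\frac{d\zeta'}{\zeta'}\,\frac{\zeta'+\zeta}{\zeta'-\zeta}\,\log\bigl(1-\mathcal X^{\rm sf}_{\gamma'}(\zeta')\bigr)\Bigr),\qquad k\in\{0,1,-1\},$$ where $\int_{r_A^-}$ is the limit, as $\varepsilon\to0^+$, of the integrals over the ray obtained from $r_A$ by clockwise rotation by $\varepsilon$. The model twisted character is $\mathcal X^{{\rm model},a}=\mathcal X^{(0)}$; its counterclockwise and clockwise analytic continuations are $\mathcal X^{{\rm model},\pm,a}=\mathcal X^{(\pm1)}$. **Lemma (nondegeneracy of model coordinates).** Let $\zeta\in\mathbb C^\times$ and $k\in\{0,1,-1\}$. (i) All the integrals above converge: those over the rotated rays converge absolutely for all small $\varepsilon>0$, and they have a limit as $\varepsilon\to0^+$. (ii) Let $\gamma_{e_1},\dots,\gamma_{e_r},\gamma_{m_1},\dots,\gamma_{m_r}$ be flat sections of $\hat\Gamma$ over $U_a$ that lift a Frobenius basis of $\Gamma$ over $U_a$: their images form a basis of $\Gamma$, $\langle\gamma_{m_i},\gamma_{e_j}\rangle=p_i\delta_{ij}$,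 $\langle\gamma_{e_i},\gamma_{e_j}\rangle=\langle\gamma_{m_i},\gamma_{m_j}\rangle=0$, with non-zero integers $p_i$ such that $p_i\mid p_j$ for $i\le j$. Then the $2r$ functions $\mathcal X^{(k)}_{\gamma_{e_i}}(\zeta),\mathcal X^{(k)}_{\gamma_{m_i}}(\zeta)$ are valid local coordinates on $\pi^{-1}(U_a)\subset\mathcal M'$: together they define a $C^\infty$ local diffeomorphism $\pi^{-1}(U_a)\to\mathbb C^{2r}$. (iii) Let $\gamma_{e_i},\gamma_{m_i}$ be flat sections of $\hat\Gamma$ over $U_a$ with $\langle\gamma_{m_i},\gamma_{e_j}\rangle=p_i\delta_{ij}$, $\langle\gamma_{e_i},\gamma_{e_j}\rangle=\langle\gamma_{m_i},\gamma_{m_j}\rangle=0$, where the $p_i$ are non-zero integers (so that they induce a basis of $\Gamma\otimes\mathbb Q$), and such that $\gamma_{e_i}\in\hat\Gamma_{\rm local}$ for all $i$. Put $a_i=Z_{\gamma_{e_i}}$, $a^D_i=p_i^{-1}Z_{\gamma_{m_i}}$, $c_{\gamma,i}=\langle\gamma_{m_i},\gamma\rangle$. Then $da_1,\dots,da_r$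 are linearly independent on $U_a$; with $\tau_{ij}=\partial a^D_i/\partial a_j$, the matrix $$V_{ij}(x,\theta)=\operatorname{Im}\tau_{ij}(x)+\frac1{4\pi}\sum_{\gamma\in\tilde\Gamma_{\rm light}}\Omega(\gamma)\,p_i^{-1}p_j^{-1}c_{\gamma,i}c_{\gamma,j}\int_{\ell_\gamma(x)}\frac{d\zeta'}{\zeta'}\,\frac{\mathcal X^{\rm sf}_\gamma(\zeta')}{1-\mathcal X^{\rm sf}_\gamma(\zeta')},$$ which does not depend on $\zeta$, is real, symmetric and positive-definite on $\pi^{-1}(U_a)$; and, with $\mathcal Y=\log\mathcal X^{(k)}(\zeta)$ (any local branch), the Jacobian determinant of $$\bigl(\operatorname{Im}\mathcal Y_{\gamma_{e_i}},\ p_i^{-1}\operatorname{Im}\mathcal Y_{\gamma_{m_i}},\ \operatorname{Re}\mathcal Y_{\gamma_{e_i}},\ p_i^{-1}\operatorname{Re}\mathcal Y_{\gamma_{m_i}}\bigr)_{1\le i\le r}$$ with respect to $(\theta_{\gamma_{e_j}},\,p_j^{-1}\theta_{\gamma_{m_j}},\,a_j,\,\bar a_j)_{1\le j\le r}$ equals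 $$\Bigl|\frac{\zeta^{-1}+\bar\zeta}2\Bigr|^{2r}(-2i)^r\det V .$$ -/

import Mathlib

open scoped Manifold ContDiff Topology ComplexConjugate

noncomputable section

namespace CoulombModel

/-! ### Local systems of lattices -/

/-- A local system of lattices on `X`: a family of lattices `Fiber x` (finitely generated free
abelian groups) together with the parallel transport `tr x y` from `x` to nearby points `y`
(the value of `tr x y` for `y` far from `x` carries no information).
Equivalently, a locally constant sheaf of lattices with stalks `Fiber x`. -/
structure LatticeLocalSystem (X : Type*) [TopologicalSpace X] where
  Fiber : X → Type
  [group : ∀ x, AddCommGroup (Fiber x)]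
  [free : ∀ x, Module.Free ℤ (Fiber x)]
  [finite : ∀ x, Module.Finite ℤ (Fiber x)]
  tr : ∀ x y, Fiber x →+ Fiber y
  tr_self : ∀ x γ, tr x x γ = γ
  tr_bijective : ∀ x, ∀ᶠ y in 𝓝 x, Function.Bijective (tr x y)
  tr_tr : ∀ x, ∀ᶠ y in 𝓝 x, ∀ᶠ z in 𝓝 y, ∀ γ, tr y z (tr x y γ) = tr x z γ

attribute [instance] LatticeLocalSystem.group LatticeLocalSystem.free LatticeLocalSystem.finite

/-- `s` is a flat section over the open set `V`. -/
def LatticeLocalSystem.IsFlatOn {X : Type*} [TopologicalSpace X] (G : LatticeLocalSystem X)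
    (V : Set X) (s : ∀ x, G.Fiber x) : Prop :=
  ∀ x ∈ V, ∀ᶠ y in 𝓝 x, s y = G.tr x y (s x)

/-! ### The base -/

/-- `S` is (the support of) a divisor in the complex manifold `B`: a closed set which is locally
the zero set of a holomorphic function that does not vanish identically on any open set. -/
def IsDivisor {r : ℕ} {B : Type*} [TopologicalSpace B] [ChartedSpace (Fin r → ℂ) B]
    (S : Set B) : Prop :=
  IsClosed S ∧ ∀ x ∈ S, ∃ (W : Set B) (f : B → ℂ), IsOpen W ∧ x ∈ W ∧
    MDifferentiableOn 𝓘(ℂ, Fin r → ℂ) 𝓘(ℂ) f W ∧ (∀ y ∈ W, y ∈ S ↔ f y = 0) ∧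
    ∀ y ∈ W, ¬ ∀ᶠ z in 𝓝 y, f z = 0

/-- Near its point `x`, the subset `D` of the complex manifold `B` is a complex submanifold of
complex dimension `k`. -/
def IsComplexSubmanifoldAt {r : ℕ} {B : Type*} [TopologicalSpace B]
    [ChartedSpace (Fin r → ℂ) B] (D : Set B) (k : ℕ) (x : B) : Prop :=
  ∃ φ ∈ IsManifold.maximalAtlas 𝓘(ℂ, Fin r → ℂ) ω B, x ∈ φ.source ∧
    ∃ S : Submodule ℂ (Fin r → ℂ), Module.finrank ℂ S = k ∧
      ∀ y ∈ φ.source, y ∈ D ↔ φ y - φ x ∈ S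

/-- The differential at `x` of a holomorphic function, as a linear form on `ℂ^r`. The tangent space
at `x` is identified with `ℂ^r` by the preferred chart at `x`, as everywhere in Mathlib. -/
def holDiff {r : ℕ} {X : Type*} [TopologicalSpace X] [ChartedSpace (Fin r → ℂ) X] (f : X → ℂ)
    (x : X) : (Fin r → ℂ) →L[ℂ] ℂ :=
  mfderiv 𝓘(ℂ, Fin r → ℂ) 𝓘(ℂ) f x

/-- The differential at `x` of a complex-valued function, as a real-linear map. -/
def realDiff {r : ℕ} {X : Type*} [TopologicalSpace X] [ChartedSpace (Fin r → ℂ) X] (f : X → ℂ)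
    (x : X) : (Fin r → ℂ) →L[ℝ] ℂ :=
  mfderiv 𝓘(ℝ, Fin r → ℂ) 𝓘(ℝ, ℂ) f x

/-! ### Charge lattices and central charges -/

/-- Charge lattices over the regular locus `R` of the base `B` (`dim_ℂ B = r`), with the pairing,
the central charge and the flavor angles `θ_f : Γ_f → ℝ / 2πℤ`.
`charge` is `Γ̂`; the flavor lattice `Γ_f` is embedded as a constant local subsystem, and is the
radical of the pairing; the gauge lattice is `Γ = Γ̂ / Γ_f`, of rank `2 r`. -/
structure ChargeData (r : ℕ) (B : Type*) [TopologicalSpace B] [ChartedSpace (Fin r → ℂ) B]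
    (R : TopologicalSpace.Opens B) where
  charge : LatticeLocalSystem R
  Flavor : Type
  [flavorGroup : AddCommGroup Flavor]
  [flavorFree : Module.Free ℤ Flavor]
  [flavorFinite : Module.Finite ℤ Flavor]
  flavor : ∀ x, Flavor →+ charge.Fiber x
  flavor_injective : ∀ x, Function.Injective (flavor x)
  flavor_flat : ∀ x, ∀ᶠ y in 𝓝 x, ∀ f, flavor y f = charge.tr x y (flavor x f)
  pair : ∀ x, charge.Fiber x →+ charge.Fiber x →+ ℤ
  pair_antisymm : ∀ x a b, pair x a b = -pair x b a
  pair_flat : ∀ x, ∀ᶠ y in 𝓝 x, ∀ a b,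
    pair y (charge.tr x y a) (charge.tr x y b) = pair x a b
  radical : ∀ x a, (∀ b, pair x a b = 0) ↔ a ∈ (flavor x).range
  rank : ∀ x, Module.finrank ℤ (charge.Fiber x) = Module.finrank ℤ Flavor + 2 * r
  Z : ∀ x, charge.Fiber x →+ ℂ
  Z_flavor : ∀ x y f, Z x (flavor x f) = Z y (flavor y f)
  Z_holomorphic : ∀ x γ, ∀ᶠ y in 𝓝 x,
    MDifferentiableAt 𝓘(ℂ, Fin r → ℂ) 𝓘(ℂ) (fun y' => Z y' (charge.tr x y' γ)) y
  θf : Flavor →+ Real.Angle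

attribute [instance] ChargeData.flavorGroup ChargeData.flavorFree ChargeData.flavorFinite

namespace ChargeData

variable {r : ℕ} {B : Type*} [TopologicalSpace B] [ChartedSpace (Fin r → ℂ) B]
  {R : TopologicalSpace.Opens B} (D : ChargeData r B R)

/-- The differential at `x` of `Z_γ`, for `γ` in the fiber over `x` extended to a flat local
section. -/
def dZ (x : R) (γ : D.charge.Fiber x) : (Fin r → ℂ) →L[ℂ] ℂ :=
  holDiff (fun y => D.Z y (D.charge.tr x y γ)) x

/-- The Gram matrix of `2 r` charges. -/
def gram (x : R) (b : Fin r ⊕ Fin r → D.charge.Fiber x) :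
    Matrix (Fin r ⊕ Fin r) (Fin r ⊕ Fin r) ℂ :=
  Matrix.of fun i j => (D.pair x (b i) (b j) : ℂ)

/-- `b` induces a basis of the vector space `Γ_x ⊗ ℚ`. -/
def IsGaugeBasis (x : R) (b : Fin r ⊕ Fin r → D.charge.Fiber x) : Prop :=
  (D.gram x b).det ≠ 0

/-- The pairing `⟨f, g⟩` on `Γ_x^* ⊗ ℂ` dual to the symplectic pairing, where `f` and `g` are given
by their values on the basis `b` of `Γ_x ⊗ ℚ`: if `f = ⟨α, ·⟩` and `g = ⟨β, ·⟩`
then `⟨f, g⟩ = ⟨α, β⟩`. The value does not depend on `b`. -/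
def dualPair (x : R) (b : Fin r ⊕ Fin r → D.charge.Fiber x) (f g : Fin r ⊕ Fin r → ℂ) : ℂ :=
  -∑ i, ∑ j, f i * (D.gram x b)⁻¹ i j * g j

/-- The complex two-form `⟨dZ ∧ dZ⟩` at `x`. -/
def dZdZ (x : R) (b : Fin r ⊕ Fin r → D.charge.Fiber x) (v w : Fin r → ℂ) : ℂ :=
  D.dualPair x b (fun i => D.dZ x (b i) v) (fun i => D.dZ x (b i) w) -
    D.dualPair x b (fun i => D.dZ x (b i) w) (fun i => D.dZ x (b i) v)

/-- The two-form `⟨dZ ∧ dZ̄⟩` at `x`. -/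
def dZdZbar (x : R) (b : Fin r ⊕ Fin r → D.charge.Fiber x) (v w : Fin r → ℂ) : ℂ :=
  D.dualPair x b (fun i => D.dZ x (b i) v) (fun i => conj (D.dZ x (b i) w)) -
    D.dualPair x b (fun i => D.dZ x (b i) w) (fun i => conj (D.dZ x (b i) v))

end ChargeData

/-- Positivity `ω(v, J v) > 0` of a two-form on `ℂ^r`. The two forms to which this is applied are
automatically real, of type `(1,1)` and closed, so that for them this is the Kähler condition. -/
def IsPositiveForm {r : ℕ} (form : (Fin r → ℂ) → (Fin r → ℂ) → ℂ) : Prop :=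
  ∀ v : Fin r → ℂ, v ≠ 0 → 0 < (form v (Complex.I • v)).re

/-- Charge data whose central charge satisfies `⟨dZ ∧ dZ⟩ = 0` and for which `⟨dZ ∧ dZ̄⟩` is a
Kähler form, together with the BPS indices `Ω`. -/
structure BPSData (r : ℕ) (B : Type*) [TopologicalSpace B] [ChartedSpace (Fin r → ℂ) B]
    (R : TopologicalSpace.Opens B) extends ChargeData r B R where
  dZdZ_eq_zero : ∀ (x : R) (b : Fin r ⊕ Fin r → charge.Fiber x),
    toChargeData.IsGaugeBasis x b → ∀ v w, toChargeData.dZdZ x b v w = 0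
  kahler : ∀ (x : R) (b : Fin r ⊕ Fin r → charge.Fiber x),
    toChargeData.IsGaugeBasis x b → IsPositiveForm (toChargeData.dZdZbar x b)
  Ω : ∀ x, charge.Fiber x → ℚ
  Ω_neg : ∀ x γ, Ω x (-γ) = Ω x γ

/-! ### The torus fibration `M'` -/

section TwistedCharacters

variable {r : ℕ} {B : Type*} [TopologicalSpace B] [ChartedSpace (Fin r → ℂ) B]
  {R : TopologicalSpace.Opens B} (D : ChargeData r B R)

/-- `θ` represents the twisted unitary character `γ ↦ exp (i θ_γ)` of the charge lattice over `x`,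
with restriction `θ_f` to the flavor lattice. The pairs `(x, θ)` are the points of `M'`. -/
structure IsTwistedCharacter (x : R) (θ : D.charge.Fiber x → Real.Angle) : Prop where
  map_add : ∀ a b, θ (a + b) = θ a + θ b + ((Real.pi * (D.pair x a b : ℝ) : ℝ) : Real.Angle)
  map_flavor : ∀ f, θ (D.flavor x f) = D.θf f

/-- `θ` is a flat section over the open set `W` of the local system of tori `M'`. -/
def IsFlatCharacterOn (W : Set R) (θ : ∀ x, D.charge.Fiber x → Real.Angle) : Prop :=
  ∀ x ∈ W, IsTwistedCharacter D x (θ x) ∧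
    ∀ᶠ y in 𝓝 x, ∀ γ, θ y (D.charge.tr x y γ) = θ x γ

/-- Symplectic relations over `Ua`: `⟨m_i, e_j⟩ = p_i δ_ij`, `⟨e_i, e_j⟩ = ⟨m_i, m_j⟩ = 0` for
flat sections `e_i`, `m_i` of `Γ̂` over `Ua` and non-zero integers `p_i`. The images of these
sections in `Γ` form a basis of sections of `Γ ⊗ ℚ`. -/
structure IsSymplecticFrame (Ua : Set R) (e m : Fin r → ∀ x, D.charge.Fiber x)
    (p : Fin r → ℤ) : Prop where
  flat_e : ∀ i, D.charge.IsFlatOn Ua (e i)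
  flat_m : ∀ i, D.charge.IsFlatOn Ua (m i)
  p_ne_zero : ∀ i, p i ≠ 0
  pair_me : ∀ x ∈ Ua, ∀ i j, D.pair x (m i x) (e j x) = if i = j then p i else 0
  pair_ee : ∀ x ∈ Ua, ∀ i j, D.pair x (e i x) (e j x) = 0
  pair_mm : ∀ x ∈ Ua, ∀ i j, D.pair x (m i x) (m j x) = 0

/-- `e_i, m_i` lift to `Γ̂` a Frobenius basis of sections of `Γ` over `Ua`. -/
structure IsFrobeniusLift (Ua : Set R) (e m : Fin r → ∀ x, D.charge.Fiber x)
    (p : Fin r → ℤ) : Prop extends IsSymplecticFrame D Ua e m p where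
  dvd : ∀ i j, i ≤ j → p i ∣ p j
  span : ∀ x ∈ Ua, ∀ γ : D.charge.Fiber x, ∃ (k l : Fin r → ℤ) (f : D.Flavor),
    γ = ∑ i, k i • e i x + ∑ i, l i • m i x + D.flavor x f

/-- The homomorphism `Γ̂_x → ℝ` which vanishes on `Γ_f` and takes the values `s (inl i)` on `e_i`
and `s (inr i)` on `m_i`. -/
def angleShift (e m : Fin r → ∀ x, D.charge.Fiber x) (p : Fin r → ℤ)
    (s : Fin r ⊕ Fin r → ℝ) (x : R) (γ : D.charge.Fiber x) : ℝ :=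
  ∑ i, ((D.pair x (m i x) γ : ℝ) / p i * s (.inl i) - (D.pair x (e i x) γ : ℝ) / p i * s (.inr i))

/-- Given a flat section `θ₀` of `M'` over `W`, the map `(x, s) ↦ (x, charAt … x s)` from
`W × ℝ^{2r}` to `M'` is the local parametrization of `M'` by the base and the fiber coordinates
`θ_{e_i}`, `θ_{m_i}`, which are `s` up to the constants `θ₀_{e_i}`, `θ₀_{m_i}`. The smooth structure
of `M'` is the one for which these are local diffeomorphisms. -/
def charAt (e m : Fin r → ∀ x, D.charge.Fiber x) (p : Fin r → ℤ)
    (θ₀ : ∀ x, D.charge.Fiber x → Real.Angle) (x : R) (s : Fin r ⊕ Fin r → ℝ) :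
    D.charge.Fiber x → Real.Angle :=
  fun γ => θ₀ x γ + (angleShift D e m p s x γ : Real.Angle)

variable {D}

lemma angleShift_e {Ua : Set R} {e m : Fin r → ∀ x, D.charge.Fiber x} {p : Fin r → ℤ}
    (h : IsSymplecticFrame D Ua e m p) (s : Fin r ⊕ Fin r → ℝ) {x : R} (hx : x ∈ Ua) (j : Fin r) :
    angleShift D e m p s x (e j x) = s (.inl j) := by
  have hp : (p j : ℝ) ≠ 0 := by exact_mod_cast h.p_ne_zero j
  simp only [angleShift, h.pair_me x hx, h.pair_ee x hx]
  rw [Finset.sum_eq_single j]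
  · simp [hp]
  · intro b _ hb
    simp [hb]
  · simp

lemma angleShift_m {Ua : Set R} {e m : Fin r → ∀ x, D.charge.Fiber x} {p : Fin r → ℤ}
    (h : IsSymplecticFrame D Ua e m p) (s : Fin r ⊕ Fin r → ℝ) {x : R} (hx : x ∈ Ua) (j : Fin r) :
    angleShift D e m p s x (m j x) = s (.inr j) := by
  have hp : (p j : ℝ) ≠ 0 := by exact_mod_cast h.p_ne_zero j
  simp only [angleShift, h.pair_mm x hx]
  rw [Finset.sum_eq_single j]
  · rw [D.pair_antisymm, h.pair_me x hx]
    simp [hp]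
  · intro b _ hb
    rw [D.pair_antisymm, h.pair_me x hx]
    simp [hb.symm]
  · simp

/-- The local parametrization takes values in `M'`. -/
lemma isTwistedCharacter_charAt {W : Set R} (e m : Fin r → ∀ x, D.charge.Fiber x)
    (p : Fin r → ℤ) {θ₀ : ∀ x, D.charge.Fiber x → Real.Angle} (h₀ : IsFlatCharacterOn D W θ₀)
    {x : R} (hx : x ∈ W) (s : Fin r ⊕ Fin r → ℝ) :
    IsTwistedCharacter D x (charAt D e m p θ₀ x s) where
  map_add a b := by
    have hadd : angleShift D e m p s x (a + b) =
        angleShift D e m p s x a + angleShift D e m p s x b := by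
      simp only [angleShift, ← Finset.sum_add_distrib]
      refine Finset.sum_congr rfl fun i _ => ?_
      simp only [map_add, Int.cast_add]
      ring
    simp only [charAt, (h₀ x hx).1.map_add, hadd, Real.Angle.coe_add]
    abel
  map_flavor f := by
    have hz : ∀ c, D.pair x c (D.flavor x f) = 0 := fun c => by
      rw [D.pair_antisymm, (D.radical x _).2 ⟨f, rfl⟩ c, neg_zero]
    simp [charAt, angleShift, hz, (h₀ x hx).1.map_flavor]

/-- Through every point of `M'` there is a flat local section, so that the local parametrizations
cover `M'`. -/
lemma exists_isFlatCharacterOn (x : R) (θ : D.charge.Fiber x → Real.Angle)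
    (hθ : IsTwistedCharacter D x θ) :
    ∃ (W : Set R) (θ₀ : ∀ y, D.charge.Fiber y → Real.Angle),
      IsOpen W ∧ x ∈ W ∧ IsFlatCharacterOn D W θ₀ ∧ θ₀ x = θ := by
  have hev := (D.charge.tr_bijective x).and ((D.charge.tr_tr x).and
    ((D.flavor_flat x).and (D.pair_flat x)))
  obtain ⟨W, hW, hWo, hxW⟩ := eventually_nhds_iff.1 hev
  let θ₀ : ∀ y, D.charge.Fiber y → Real.Angle := fun y γ => θ (Function.invFun (D.charge.tr x y) γ)
  have key : ∀ y ∈ W, ∀ δ, θ₀ y (D.charge.tr x y δ) = θ δ := fun y hy δ => by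
    simp only [θ₀]
    rw [Function.leftInverse_invFun (hW y hy).1.1 δ]
  refine ⟨W, θ₀, hWo, hxW, fun y hy => ⟨⟨fun a b => ?_, fun f => ?_⟩, ?_⟩, ?_⟩
  · obtain ⟨a, rfl⟩ := (hW y hy).1.2 a
    obtain ⟨b, rfl⟩ := (hW y hy).1.2 b
    rw [← map_add, key y hy, key y hy, key y hy, (hW y hy).2.2.2, hθ.map_add]
  · rw [(hW y hy).2.2.1, key y hy, hθ.map_flavor]
  · filter_upwards [(hW y hy).2.1, hWo.mem_nhds hy] with z hz hzW γ
    obtain ⟨δ, rfl⟩ := (hW y hy).1.2 γ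
    rw [hz, key z hzW, key y hy]
  · funext γ
    have := key x hxW γ
    rwa [D.charge.tr_self] at this

end TwistedCharacters

/-! ### Assumptions near the discriminant locus -/

/-- The standing assumptions on an open subset `U` of the base, `B'' = B \ R`.

`Loc` and `Light` are the (trivial) local systems `Γ̂_local` and `Γ̂_light` over `U ∩ B'`, with
inclusions `loc` and `loc ∘ lightToLoc` into `Γ̂`; `Heavy` and `Nonlocal` are the trivial quotient
local systems `Γ̂ / Γ̂_light` and `Γ̂ / Γ̂_local`. `active` is the set `Γ̃_light` of the charges in
`Γ̂_light` with non-zero `Ω`. -/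
structure DiscriminantAssumptions {r : ℕ} {B : Type*} [TopologicalSpace B]
    [ChartedSpace (Fin r → ℂ) B] {R : TopologicalSpace.Opens B} (D : BPSData r B R)
    (U : Set B) where
  Loc : Type
  [locGroup : AddCommGroup Loc]
  [locFree : Module.Free ℤ Loc]
  [locFinite : Module.Finite ℤ Loc]
  Light : Type
  [lightGroup : AddCommGroup Light]
  [lightFree : Module.Free ℤ Light]
  [lightFinite : Module.Finite ℤ Light]
  Heavy : Type
  [heavyGroup : AddCommGroup Heavy]
  [heavyFree : Module.Free ℤ Heavy]
  [heavyFinite : Module.Finite ℤ Heavy]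
  Nonlocal : Type
  [nonlocalGroup : AddCommGroup Nonlocal]
  [nonlocalFree : Module.Free ℤ Nonlocal]
  [nonlocalFinite : Module.Finite ℤ Nonlocal]
  /-- The two exact sequences. -/
  loc : ∀ x, Loc →+ D.charge.Fiber x
  loc_injective : ∀ x : R, x.1 ∈ U → Function.Injective (loc x)
  loc_flat : ∀ x : R, x.1 ∈ U → ∀ᶠ y in 𝓝 x, ∀ γ, loc y γ = D.charge.tr x y (loc x γ)
  lightToLoc : Light →+ Loc
  lightToLoc_injective : Function.Injective lightToLoc
  loc_range : ∀ x : R, x.1 ∈ U → ∀ a, a ∈ (loc x).range ↔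
    ∀ γ, D.pair x a (loc x (lightToLoc γ)) = 0
  heavy : ∀ x, D.charge.Fiber x →+ Heavy
  heavy_surjective : ∀ x : R, x.1 ∈ U → Function.Surjective (heavy x)
  heavy_exact : ∀ x : R, x.1 ∈ U → ∀ a, heavy x a = 0 ↔ ∃ γ, a = loc x (lightToLoc γ)
  heavy_flat : ∀ x : R, x.1 ∈ U → ∀ᶠ y in 𝓝 x, ∀ a, heavy y (D.charge.tr x y a) = heavy x a
  nonloc : ∀ x, D.charge.Fiber x →+ Nonlocal
  nonloc_surjective : ∀ x : R, x.1 ∈ U → Function.Surjective (nonloc x)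
  nonloc_exact : ∀ x : R, x.1 ∈ U → ∀ a, nonloc x a = 0 ↔ ∃ γ, a = loc x γ
  nonloc_flat : ∀ x : R, x.1 ∈ U → ∀ᶠ y in 𝓝 x, ∀ a, nonloc y (D.charge.tr x y a) = nonloc x a
  /-- On `Γ̂_light`, `Ω` is constant, integral, non-negative and of finite support. -/
  omega : Light → ℕ
  omega_eq : ∀ x : R, x.1 ∈ U → ∀ γ, D.Ω x (loc x (lightToLoc γ)) = omega γ
  active : Finset Light
  mem_active : ∀ γ, γ ∈ active ↔ omega γ ≠ 0
  /-- `Zloc γ` is the holomorphic extension to `U` of `Z_γ`, for `γ` in `Γ̂_local`. -/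
  Zloc : Loc → B → ℂ
  Zloc_holomorphic : ∀ γ, MDifferentiableOn 𝓘(ℂ, Fin r → ℂ) 𝓘(ℂ) (Zloc γ) U
  Zloc_eq : ∀ γ (x : R), x.1 ∈ U → Zloc γ x.1 = D.Z x (loc x γ)
  Zloc_span : ∀ x ∈ U, Submodule.span ℂ (Set.range fun γ => holDiff (r := r) (Zloc γ) x) = ⊤
  discriminant_eq : ∀ x ∈ U, x ∉ R ↔ ∃ γ ∈ active, Zloc (lightToLoc γ) x = 0
  /-- The form of the central charge: for every flat section `s` over a connected open `V ⊆ U ∩ B'`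
  and all branches `lg γ` on `V` of `log (Z_γ / π)`. -/
  central_charge : ∀ V : Set R, IsOpen V → IsConnected V → (∀ x ∈ V, x.1 ∈ U) →
    ∀ s : ∀ x, D.charge.Fiber x, D.charge.IsFlatOn V s →
    ∀ lg : Light → R → ℂ, (∀ γ ∈ active, ContinuousOn (lg γ) V ∧
      ∀ x ∈ V, Complex.exp (lg γ x) = D.Z x (loc x (lightToLoc γ)) / Real.pi) →
    ∃ Zt : B → ℂ, MDifferentiableOn 𝓘(ℂ, Fin r → ℂ) 𝓘(ℂ) Zt U ∧
      ∀ x ∈ V, D.Z x (s x) = Zt x.1 + 1 / (4 * Real.pi * Complex.I) *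
        ∑ γ ∈ active, (D.pair x (s x) (loc x (lightToLoc γ)) : ℂ) * omega γ *
          D.Z x (loc x (lightToLoc γ)) * (lg γ x - 1)
  /-- The open subset `U'` of `U ∩ B'` on which the corrected two-form is Kähler. -/
  U' : Set B
  U'_open : IsOpen U'
  U'_subset : U' ⊆ U
  U'_regular : ∀ x ∈ U', x ∈ R
  U'_kahler : ∀ x : R, x.1 ∈ U' → ∀ b : Fin r ⊕ Fin r → D.charge.Fiber x, D.IsGaugeBasis x b →
    IsPositiveForm fun v w => D.dZdZbar x b v w - Complex.I / (2 * Real.sqrt Real.pi) *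
      ∑ γ ∈ active, (omega γ : ℂ) /
        ((Real.sqrt ‖D.Z x (loc x (lightToLoc γ))‖ *
          (Real.exp (2 * ‖D.Z x (loc x (lightToLoc γ))‖) - 1) : ℝ) : ℂ) *
        (D.dZ x (loc x (lightToLoc γ)) v * conj (D.dZ x (loc x (lightToLoc γ)) w) -
          D.dZ x (loc x (lightToLoc γ)) w * conj (D.dZ x (loc x (lightToLoc γ)) v))
  /-- Every point of `U` lies on a compact positive-dimensional complex submanifold `S` of `U` with
  boundary `bS` contained in `U'`, on which `Z` is constant on a corank one sublattice of
  `Γ̂_light` containing `Γ̂_light ∩ Γ_f`. No regularity of the boundary is needed. -/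
  submanifold : ∀ x ∈ U, ∃ (S bS : Set B) (k : ℕ) (K : AddSubgroup Light),
    IsCompact S ∧ S ⊆ U ∧ x ∈ S ∧ bS ⊆ S ∧ bS ⊆ U' ∧ 1 ≤ k ∧
    (∀ y ∈ S \ bS, IsComplexSubmanifoldAt (r := r) S k y) ∧
    Module.finrank ℤ K + 1 = Module.finrank ℤ Light ∧
    (∀ y : R, y.1 ∈ U → ∀ γ, loc y (lightToLoc γ) ∈ (D.flavor y).range → γ ∈ K) ∧
    ∀ γ ∈ K, ∀ y ∈ S, ∀ z ∈ S, Zloc (lightToLoc γ) y = Zloc (lightToLoc γ) z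

attribute [instance] DiscriminantAssumptions.locGroup DiscriminantAssumptions.locFree
  DiscriminantAssumptions.locFinite DiscriminantAssumptions.lightGroup
  DiscriminantAssumptions.lightFree DiscriminantAssumptions.lightFinite
  DiscriminantAssumptions.heavyGroup DiscriminantAssumptions.heavyFree
  DiscriminantAssumptions.heavyFinite DiscriminantAssumptions.nonlocalGroup
  DiscriminantAssumptions.nonlocalFree DiscriminantAssumptions.nonlocalFinite

/-! ### Sectorial decompositions -/

/-- A sectorial decomposition of `ℂ^×` into `2 K` half-open sectors of opening angle `π / K`,
`K ≥ 5`, ordered counterclockwise. The ray `r_A` has angle `ρ₀ + A π / K`; the index `A ∈ ℤ`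
matters only modulo `2 K`. -/
structure SectorialDecomposition where
  K : ℕ
  five_le : 5 ≤ K
  ρ₀ : ℝ

namespace SectorialDecomposition

variable (S : SectorialDecomposition)

/-- The angle of the ray `r_A`. -/
def rayAngle (A : ℤ) : ℝ := S.ρ₀ + A * (Real.pi / S.K)

/-- The open ray `r_A` from `0` to `∞`. -/
def ray (A : ℤ) : Set ℂ :=
  {w | ∃ t : ℝ, 0 < t ∧ w = t * Complex.exp (S.rayAngle A * Complex.I)}

/-- The sector `V_A`, which contains `r_{A-1}` but not `r_A`. -/
def sector (A : ℤ) : Set ℂ :=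
  {w | ∃ t α : ℝ, 0 < t ∧ α ∈ Set.Ico (S.rayAngle (A - 1)) (S.rayAngle A) ∧
    w = t * Complex.exp (α * Complex.I)}

/-- The index (modulo `2 K`) of the sector containing `w ≠ 0`. -/
def index (w : ℂ) : ℤ := ⌊(Complex.arg w - S.ρ₀) / (Real.pi / S.K)⌋ + 1

lemma mem_sector_index {w : ℂ} (hw : w ≠ 0) : w ∈ S.sector (S.index w) := by
  have hK : (0 : ℝ) < S.K := by exact_mod_cast (by have := S.five_le; omega : 0 < S.K)
  have hφ : 0 < Real.pi / S.K := div_pos Real.pi_pos hK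
  refine ⟨‖w‖, Complex.arg w, norm_pos_iff.2 hw, ⟨?_, ?_⟩, (Complex.norm_mul_exp_arg_mul_I w).symm⟩
  · have h := Int.floor_le ((Complex.arg w - S.ρ₀) / (Real.pi / S.K))
    rw [le_div_iff₀ hφ] at h
    simp only [rayAngle, index, add_sub_cancel_right]
    linarith
  · have h := Int.lt_floor_add_one ((Complex.arg w - S.ρ₀) / (Real.pi / S.K))
    rw [div_lt_iff₀ hφ] at h
    simp only [rayAngle, index, Int.cast_add, Int.cast_one]
    linarith

end SectorialDecomposition

/-- `∫ g(ζ') dζ' / ζ'` over the ray from `0` to `∞` of angle `ρ`. -/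
def rayIntegral (g : ℂ → ℂ) (ρ : ℝ) : ℂ :=
  ∫ t in Set.Ioi (0 : ℝ), g (t * Complex.exp (ρ * Complex.I)) / t

/-- `∫ g(ζ') dζ' / ζ'` over the ray infinitesimally clockwise of the ray of angle `ρ`. -/
def rayIntegralMinus (g : ℂ → ℂ) (ρ : ℝ) : ℂ :=
  Filter.limUnder (𝓝[>] (0 : ℝ)) fun ε => rayIntegral g (ρ - ε)

/-- `rayIntegralMinus g ρ` converges: the integrals over the rays of angle `ρ - ε` are absolutely
convergent for small `ε > 0`, and they have a limit. -/
def RayIntegralMinusConverges (g : ℂ → ℂ) (ρ : ℝ) : Prop :=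
  (∀ᶠ ε in 𝓝[>] (0 : ℝ), MeasureTheory.IntegrableOn
    (fun t : ℝ => g (t * Complex.exp ((ρ - ε : ℝ) * Complex.I)) / t) (Set.Ioi 0)) ∧
  Filter.Tendsto (fun ε => rayIntegral g (ρ - ε)) (𝓝[>] (0 : ℝ)) (𝓝 (rayIntegralMinus g ρ))

/-! ### Semi-flat and model coordinates -/

/-- The semi-flat twisted character `X^sf_γ(ζ)` at the point `(x, θ)` of `M'`. -/
def Xsf {r : ℕ} {B : Type*} [TopologicalSpace B] [ChartedSpace (Fin r → ℂ) B]
    {R : TopologicalSpace.Opens B} (D : ChargeData r B R) (x : R)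
    (θ : D.charge.Fiber x → Real.Angle) (ζ : ℂ) (γ : D.charge.Fiber x) : ℂ :=
  Complex.exp (1 / ζ * D.Z x γ + ζ * conj (D.Z x γ)) * ((θ γ).toCircle : ℂ)

section Model

variable {r : ℕ} {B : Type*} [TopologicalSpace B] [ChartedSpace (Fin r → ℂ) B]
  {R : TopologicalSpace.Opens B} {D : BPSData r B R} {U : Set B}
  (A : DiscriminantAssumptions D U) (S : SectorialDecomposition)

namespace DiscriminantAssumptions

/-- The element of `Γ̂_x` given by a light charge. -/
def light (x : R) (γ : A.Light) : D.charge.Fiber x := A.loc x (A.lightToLoc γ)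

/-- `S` is `(x, Γ̃_light)`-good for all `x ∈ Ua`: no ray `r_A` coincides with the ray
`ℓ_γ(x) = - Z_γ(x) ℝ_{>0}` of an active light charge `γ`. -/
def IsGoodOn (Ua : Set R) : Prop :=
  ∀ x ∈ Ua, ∀ γ ∈ A.active, ∀ n : ℤ, -D.Z x (A.light x γ) ∉ S.ray n

/-- The integrand (with respect to `dζ' / ζ'`) in the definition of the model coordinates. -/
def integrand (x : R) (θ : D.charge.Fiber x → Real.Angle) (ζ : ℂ) (γ : A.Light) (ζ' : ℂ) : ℂ :=
  (ζ' + ζ) / (ζ' - ζ) * Complex.log (1 - Xsf D.toChargeData x θ ζ' (A.light x γ))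

/-- The angle of the ray `r_{A(γ) + k}`, where the sector of index `A(γ)` contains `ℓ_γ(x)`. -/
def contourAngle (x : R) (k : ℤ) (γ : A.Light) : ℝ :=
  S.rayAngle (S.index (-D.Z x (A.light x γ)) + k)

/-- The model twisted character: `k = 0` gives `X^{model,a}_γ(ζ)`, and `k = 1`, `k = -1` give its
counterclockwise and clockwise analytic continuations `X^{model,+,a}_γ(ζ)`, `X^{model,-,a}_γ(ζ)`. -/
def Xmodel (k : ℤ) (x : R) (θ : D.charge.Fiber x → Real.Angle) (ζ : ℂ)
    (γ : D.charge.Fiber x) : ℂ :=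
  Xsf D.toChargeData x θ ζ γ * Complex.exp (-(1 / (4 * Real.pi * Complex.I)) *
    ∑ γ' ∈ A.active, (A.omega γ' : ℂ) * (D.pair x γ (A.light x γ') : ℂ) *
      rayIntegralMinus (A.integrand x θ ζ γ') (A.contourAngle S x k γ'))

/-- The model twisted characters on `e_i` (index `inl i`) and `m_i` (index `inr i`), in the local
parametrization of `M'` defined by `θ₀`. -/
def modelMap (k : ℤ) (ζ : ℂ) (e m : Fin r → ∀ x, D.charge.Fiber x) (p : Fin r → ℤ)
    (θ₀ : ∀ x, D.charge.Fiber x → Real.Angle) (q : R × (Fin r ⊕ Fin r → ℝ)) :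
    Fin r ⊕ Fin r → ℂ :=
  Sum.elim
    (fun i => A.Xmodel S k q.1 (charAt D.toChargeData e m p θ₀ q.1 q.2) ζ (e i q.1))
    (fun i => A.Xmodel S k q.1 (charAt D.toChargeData e m p θ₀ q.1 q.2) ζ (m i q.1))

/-- The integral of `X^sf_γ / (1 - X^sf_γ) dζ / ζ` over the ray `ℓ_γ(x)`. -/
def ellIntegral (x : R) (θ : D.charge.Fiber x → Real.Angle) (γ : A.Light) : ℂ :=
  rayIntegral (fun ζ => Xsf D.toChargeData x θ ζ (A.light x γ) /
    (1 - Xsf D.toChargeData x θ ζ (A.light x γ))) (Complex.arg (-D.Z x (A.light x γ)))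

end DiscriminantAssumptions

/-- The matrix `∂ a_i / ∂ z_k` of the differentials of `a_i = Z_{e_i}` at `x`. -/
def aMatrix (D : BPSData r B R) (x : R) (e : Fin r → D.charge.Fiber x) :
    Matrix (Fin r) (Fin r) ℂ :=
  Matrix.of fun i k => D.dZ x (e i) (Pi.single k 1)

/-- The period matrix `τ_ij = ∂ a^D_i / ∂ a_j`, where `a_i = Z_{e_i}` and
`a^D_i = p_i⁻¹ Z_{m_i}`. -/
def periodMatrix (D : BPSData r B R) (x : R) (e m : Fin r → D.charge.Fiber x) (p : Fin r → ℤ) :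
    Matrix (Fin r) (Fin r) ℂ :=
  (Matrix.of fun i k => (p i : ℂ)⁻¹ * D.dZ x (m i) (Pi.single k 1)) * (aMatrix D x e)⁻¹

/-- The matrix `V_ij(x, θ) = Im τ_ij(x) + (1 / 4π) ∑_γ Ω(γ) p_i⁻¹ p_j⁻¹ c_{γ,i} c_{γ,j}
∫_{ℓ_γ(x)} (dζ / ζ) X^sf_γ(ζ) / (1 - X^sf_γ(ζ))`, with `c_{γ,i} = ⟨m_i, γ⟩`. -/
def DiscriminantAssumptions.V (x : R) (θ : D.charge.Fiber x → Real.Angle)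
    (e m : Fin r → D.charge.Fiber x) (p : Fin r → ℤ) : Matrix (Fin r) (Fin r) ℂ :=
  Matrix.of fun i j => ((periodMatrix D x e m p i j).im : ℂ) + 1 / (4 * Real.pi) *
    ∑ γ ∈ A.active, (A.omega γ : ℂ) * (p i : ℂ)⁻¹ * (p j : ℂ)⁻¹ *
      (D.pair x (m i) (A.light x γ) : ℂ) * (D.pair x (m j) (A.light x γ) : ℂ) *
      A.ellIntegral x θ γ

end Model

/-! ### The Jacobian matrix -/

section Jacobian

variable {r : ℕ} {B : Type*} [TopologicalSpace B] [ChartedSpace (Fin r → ℂ) B]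
  {R : TopologicalSpace.Opens B}

/-- The derivative of `log (F_i)` in the fiber direction `j`, at `q`. Derivatives of logarithms do
not depend on the branch. -/
def dlogFiber (F : R × (Fin r ⊕ Fin r → ℝ) → Fin r ⊕ Fin r → ℂ) (q : R × (Fin r ⊕ Fin r → ℝ))
    (i j : Fin r ⊕ Fin r) : ℂ :=
  (fderiv ℝ (fun s => F (q.1, s) i) q.2 : (Fin r ⊕ Fin r → ℝ) →L[ℝ] ℂ) (Pi.single j 1) / F q i

/-- The real derivative of `log (F_i)` in the direction `v` of the base, at `q`. -/
def dlogBase (F : R × (Fin r ⊕ Fin r → ℝ) → Fin r ⊕ Fin r → ℂ) (q : R × (Fin r ⊕ Fin r → ℝ))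
    (i : Fin r ⊕ Fin r) (v : Fin r → ℂ) : ℂ :=
  realDiff (fun x => F (x, q.2) i) q.1 v / F q i

/-- The vector `v_j` at `x` with `da_i(v_j) = δ_ij`, so that `∂/∂a_j = (v_j - i J v_j) / 2` and
`∂/∂ā_j = (v_j + i J v_j) / 2`. -/
def coordVector (D : BPSData r B R) (x : R) (e : Fin r → D.charge.Fiber x) (j : Fin r) :
    Fin r → ℂ :=
  fun k => (aMatrix D x e)⁻¹ k j

/-- The Jacobian matrix at `q` of
`(Im Y_{e_i}, p_i⁻¹ Im Y_{m_i}, Re Y_{e_i}, p_i⁻¹ Re Y_{m_i})`, `Y_{e_i} = log (F (inl i))`,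
`Y_{m_i} = log (F (inr i))`, with respect to `(θ_{e_j}, p_j⁻¹ θ_{m_j}, a_j, ā_j)`. -/
def jacobianMatrix (D : BPSData r B R) (e : Fin r → ∀ x, D.charge.Fiber x) (p : Fin r → ℤ)
    (F : R × (Fin r ⊕ Fin r → ℝ) → Fin r ⊕ Fin r → ℂ) (q : R × (Fin r ⊕ Fin r → ℝ)) :
    Matrix ((Fin r ⊕ Fin r) ⊕ (Fin r ⊕ Fin r)) ((Fin r ⊕ Fin r) ⊕ (Fin r ⊕ Fin r)) ℂ :=
  Matrix.of fun row col =>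
    let part : ℂ → ℝ := row.elim (fun _ => Complex.im) (fun _ => Complex.re)
    let i : Fin r ⊕ Fin r := row.elim id id
    let weight : ℝ := i.elim (fun _ => 1) (fun l => (p l : ℝ)⁻¹)
    let baseDer : (Fin r → ℂ) → ℂ := fun v => ((weight * part (dlogBase F q i v) : ℝ) : ℂ)
    let v : Fin r → Fin r → ℂ := coordVector D q.1 (fun l => e l q.1)
    match col with
    | .inl (.inl j) => ((weight * part (dlogFiber F q i (.inl j)) : ℝ) : ℂ)
    | .inl (.inr j) => ((weight * (p j * part (dlogFiber F q i (.inr j))) : ℝ) : ℂ)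
    | .inr (.inl j) => (baseDer (v j) - Complex.I * baseDer (Complex.I • v j)) / 2
    | .inr (.inr j) => (baseDer (v j) + Complex.I * baseDer (Complex.I • v j)) / 2

end Jacobian

end CoulombModel

end

open CoulombModel

/-!
# Nondegeneracy of the model coordinates

In the logarithmic coordinate `ζ' = exp v` the integrals along rays become integrals along
horizontal lines, of a weight times a holomorphic function of `X = exp (e ^ (-v) z + e ^ v z̄ + i
φ)` vanishing at `X = 0` (`contourInt`). They converge because `X` decays doubly exponentially as
long as the ray lies in the half plane `Re (z / ζ') < 0`; there they may be differentiated under the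
integral sign (`hasFDerivAt_contourInt`), and the ray may be rotated as long as it does not meet `ζ`
(`contourInt_rotate`). As there are at least ten sectors, the rays `r_{A(γ) + k}` lie in the half
plane, and the limits of the integrals over the rotated rays are integrals over one ray slightly
clockwise of them, which can be kept fixed near a given point (`exists_rayIntegralMinus_eq`). This
gives the convergence, and the smoothness of the model coordinates.

The logarithms of the model coordinates have the derivative `modelForm`: the semi-flat one, and for
each light charge `γ` the `response` of its integral. Let a tangent vector be in the kernel. Light
charges are local, so their model coordinates are semi-flat, and the vector leaves their logarithms
unchanged. In such directions the pole of the kernel at `ζ` cancels (`response_eq`): the response is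
the integral `∫ X / (1 - X) du` over the axis `ℓ_γ`, and a second term that disappears when the
contributions of `γ` and `-γ` are added (`sum_re_response`). Hence, in a symplectic frame with local
electric charges (`exists_adapted_frame`), the vector is in the kernel of a quadratic form that does
not depend on `ζ`: the corrected energy, the Kähler form plus multiples of the real parts of the
axis integrals. So the differential is injective if the corrected energy is positive, and the
inverse function theorem applies (`isLocalDiffeomorphAt_modelMap`). In real directions the corrected
energy is the quadratic form of `V` (`posDef_V`), and block elimination in the Jacobian matrix
leaves a multiple of `V` (`det_jacobianMatrix_modelMap`).

The core is the positivity of the corrected energy, `IsAdapted.energy_pos`. Fix the components of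
the vector in the electric coordinates. By the formula for the central charges, the energy is the
imaginary part of a function holomorphic off the zeros of the light central charges, minus multiples
of `log |Z_γ|`; as regards imaginary parts there is no monodromy, since the periods of the
logarithms and their coefficients are both imaginary, and the discriminant does not disconnect
(`IsAdapted.exists_of_mem_connectedComponentIn`). The angles are treated as independent variables.
The function `Re ∫ X / (1 - X) du - log |z|` of `z` and `φ` satisfies a Laplace equation in both
variables (`hasDeriv2At_contourInt_laplace`), so along holomorphic discs a minimum principle holds
for the corrected energy; a strictly subharmonic barrier makes it strict, and a logarithmic one
keeps minima away from the zeros of the `Z_γ` (`not_eventually_barrierPotential_le`,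
`potential_pos_of_boundary`). The poles of the holomorphic function are harmless, since its
imaginary part is at worst logarithmically negative by the positivity of the energy itself
(`exists_le_im_of_log_le_manifold`). Applied to the compact submanifold through a given point, the
minimum principle reduces the positivity to the boundary, in `U'`, where it follows from the
assumption on the corrected Kähler form and the Gaussian bound `neg_sqrt_div_le_re_axisInt`.
-/

noncomputable section

namespace CoulombModel

open Complex MeasureTheory Set Filter Metric

/-! ### Contour integrals in the logarithmic coordinate -/

/-- Continuous weights on the line of at most exponential growth. -/
def IsTemperate (k : ℝ → ℂ) : Prop :=
  Continuous k ∧ ∃ C N : ℝ, 0 ≤ C ∧ 0 ≤ N ∧ ∀ u, ‖k u‖ ≤ C * Real.exp (N * |u|)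

/-- Holomorphic functions on the open unit disc that vanish at the centre. -/
def IsDiscFun (F : ℂ → ℂ) : Prop :=
  DifferentiableOn ℂ F (ball 0 1) ∧ F 0 = 0

/-- The Euler derivative `X F'(X)`. -/
def eulerDeriv (F : ℂ → ℂ) (X : ℂ) : ℂ := X * deriv F X

lemma IsDiscFun.eulerDeriv {F : ℂ → ℂ} (h : IsDiscFun F) : IsDiscFun (eulerDeriv F) :=
  ⟨differentiableOn_id.mul (h.1.deriv isOpen_ball), by simp [CoulombModel.eulerDeriv]⟩

lemma IsDiscFun.bound {F : ℂ → ℂ} (h : IsDiscFun F) {q : ℝ} (hq : q < 1) :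
    ∃ C, 0 ≤ C ∧ ∀ X : ℂ, ‖X‖ ≤ q → ‖F X‖ ≤ C * ‖X‖ := by
  have hsub : closedBall (0 : ℂ) q ⊆ ball 0 1 := closedBall_subset_ball hq
  have hc : ContinuousOn (dslope F 0) (ball 0 1) :=
    (continuousOn_dslope (ball_mem_nhds _ one_pos)).2
      ⟨h.1.continuousOn, h.1.differentiableAt (ball_mem_nhds _ one_pos)⟩
  obtain ⟨C, hC⟩ := (isCompact_closedBall (0 : ℂ) q).exists_bound_of_continuousOn (hc.mono hsub)
  refine ⟨max C 0, le_max_right _ _, fun X hX => ?_⟩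
  have h1 := sub_smul_dslope F 0 X
  simp only [sub_zero, h.2, smul_eq_mul] at h1
  rw [← h1, norm_mul, mul_comm]
  gcongr
  exact (hC X (by simpa using hX)).trans (le_max_left _ _)

lemma isDiscFun_log : IsDiscFun fun X => Complex.log (1 - X) := by
  refine ⟨fun X hX => ?_, by simp⟩
  have : (1 - X) ∈ slitPlane := by
    have := mem_slitPlane_of_norm_lt_one (z := -X) (by simpa using hX)
    simpa [sub_eq_add_neg] using this
  exact (((differentiableAt_const _).sub differentiableAt_id).clog this).differentiableWithinAt

lemma one_sub_ne_zero_of_norm_lt {X : ℂ} (hX : ‖X‖ < 1) : 1 - X ≠ 0 := by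
  intro h
  rw [← sub_eq_zero.1 h] at hX
  simp at hX

lemma isDiscFun_geom : IsDiscFun fun X => X / (1 - X) := by
  refine ⟨fun X hX => ?_, by simp⟩
  exact (differentiableAt_id.div ((differentiableAt_const _).sub differentiableAt_id)
    (one_sub_ne_zero_of_norm_lt (by simpa using hX))).differentiableWithinAt

lemma eulerDeriv_log {X : ℂ} (hX : ‖X‖ < 1) :
    eulerDeriv (fun X => Complex.log (1 - X)) X = -(X / (1 - X)) := by
  have hs : (1 - X) ∈ slitPlane := by
    have := mem_slitPlane_of_norm_lt_one (z := -X) (by simpa using hX)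
    simpa [sub_eq_add_neg] using this
  have : HasDerivAt (fun X : ℂ => Complex.log (1 - X)) (-1 / (1 - X)) X :=
    HasDerivAt.clog ((hasDerivAt_id X).const_sub 1) hs
  rw [eulerDeriv, this.deriv]
  ring

/-- The exponent of the semi-flat coordinate `exp (ζ⁻¹ z + i φ + ζ z̄)` at `ζ = e ^ v`. -/
def logX (z : ℂ) (φ : ℝ) (v : ℂ) : ℂ := exp (-v) * z + exp v * conj z + φ * I

/-- The semi-flat coordinate decays in both directions along the ray of angle `α`. -/
def InHalfPlane (α : ℝ) (z : ℂ) : Prop := (z * exp (-(α * I))).re < 0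

lemma re_logX (z : ℂ) (φ u α : ℝ) :
    (logX z φ (u + α * I)).re = 2 * (z * exp (-(α * I))).re * Real.cosh u := by
  have h1 : exp (-(u + α * I)) * z = (Real.exp (-u) : ℂ) * (z * exp (-(α * I))) := by
    rw [neg_add, Complex.exp_add]; push_cast; ring
  have h2 : exp (u + α * I) * conj z = (Real.exp u : ℂ) * conj (z * exp (-(α * I))) := by
    rw [Complex.exp_add, map_mul, ← Complex.exp_conj]; push_cast; simp; ring
  rw [logX, h1, h2, Real.cosh_eq]
  simp only [add_re, re_ofReal_mul, conj_re, mul_I_re, ofReal_im]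
  ring

lemma norm_exp_logX (z : ℂ) (φ u α : ℝ) :
    ‖exp (logX z φ (u + α * I))‖ = Real.exp (2 * (z * exp (-(α * I))).re * Real.cosh u) := by
  rw [Complex.norm_exp, re_logX]

lemma norm_exp_logX_le {z : ℂ} {φ u α c : ℝ} (h : (z * exp (-(α * I))).re ≤ -c) :
    ‖exp (logX z φ (u + α * I))‖ ≤ Real.exp (-(2 * c * Real.cosh u)) := by
  rw [norm_exp_logX]
  apply Real.exp_le_exp.2
  nlinarith [Real.cosh_pos u]

lemma norm_exp_logX_lt_one {z : ℂ} {α : ℝ} (h : InHalfPlane α z) (φ u : ℝ) :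
    ‖exp (logX z φ (u + α * I))‖ < 1 := by
  rw [norm_exp_logX, Real.exp_lt_one_iff]
  exact mul_neg_of_neg_of_pos (by unfold InHalfPlane at h; linarith) (Real.cosh_pos u)

lemma continuous_logX (z : ℂ) (φ : ℝ) : Continuous (logX z φ) := by
  unfold logX; fun_prop

lemma one_add_sq_le_cosh (u : ℝ) : 1 + u ^ 2 / 2 ≤ Real.cosh u := by
  have h := Real.cosh_sq' (u / 2)
  have h2 : Real.cosh u = 1 + 2 * Real.sinh (u / 2) ^ 2 := by
    have := Real.cosh_two_mul (u / 2)
    rw [show 2 * (u / 2) = u by ring] at this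
    linarith
  have h3 : (u / 2) ^ 2 ≤ Real.sinh (u / 2) ^ 2 := by
    rw [sq_le_sq, Real.abs_sinh]
    exact Real.self_le_sinh_iff.2 (abs_nonneg _)
  rw [h2]; nlinarith

/-- Weights of exponential growth are dominated by the doubly exponential decay. -/
lemma exp_mul_exp_cosh_le {c N : ℝ} (hc : 0 < c) (u : ℝ) :
    Real.exp (N * |u|) * Real.exp (-(2 * c * Real.cosh u)) ≤
      Real.exp (N ^ 2 / (2 * c)) * Real.exp (-(c / 2) * u ^ 2) := by
  rw [← Real.exp_add, ← Real.exp_add, Real.exp_le_exp]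
  have h1 := one_add_sq_le_cosh u
  have h2 : N * |u| ≤ N ^ 2 / (2 * c) + c / 2 * u ^ 2 := by
    have : N ^ 2 / (2 * c) + c / 2 * u ^ 2 - N * |u| = (N - c * |u|) ^ 2 / (2 * c) := by
      rw [← sq_abs u]; field_simp; ring
    have h4 : 0 ≤ (N - c * |u|) ^ 2 / (2 * c) := by positivity
    linarith
  nlinarith

lemma integrable_exp_mul_exp_cosh {c : ℝ} (hc : 0 < c) (N : ℝ) :
    Integrable fun u : ℝ => Real.exp (N * |u|) * Real.exp (-(2 * c * Real.cosh u)) := by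
  refine ((integrable_exp_neg_mul_sq (half_pos hc)).const_mul (Real.exp (N ^ 2 / (2 * c)))).mono'
    (by fun_prop) (ae_of_all _ fun u => ?_)
  rw [Real.norm_of_nonneg (by positivity)]
  exact exp_mul_exp_cosh_le hc u

lemma tendsto_exp_mul_exp_cosh {c : ℝ} (hc : 0 < c) (N : ℝ) {l : Filter ℝ}
    (hl : Tendsto (fun u : ℝ => |u|) l atTop) :
    Tendsto (fun u : ℝ => Real.exp (N * |u|) * Real.exp (-(2 * c * Real.cosh u))) l (𝓝 0) := by
  refine squeeze_zero (fun u => by positivity) (fun u => exp_mul_exp_cosh_le hc u) ?_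
  rw [← mul_zero (Real.exp (N ^ 2 / (2 * c)))]
  refine Tendsto.const_mul _ (Real.tendsto_exp_atBot.comp ?_)
  have : Tendsto (fun u : ℝ => (c / 2) * |u| ^ 2) l atTop :=
    ((tendsto_pow_atTop two_ne_zero).comp hl).const_mul_atTop (half_pos hc)
  exact (tendsto_neg_atTop_atBot.comp this).congr fun u => by simp

/-- The integral of `k(u) F(X)` over the ray of angle `α`, parametrized by `ζ = e ^ (u + i α)`,
where `X = exp (ζ⁻¹ z + i φ + ζ z̄)`. -/
def contourInt (k : ℝ → ℂ) (F : ℂ → ℂ) (α : ℝ) (p : ℂ × ℝ) : ℂ :=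
  ∫ u : ℝ, k u * F (exp (logX p.1 p.2 (u + α * I)))

lemma norm_integrand_le {k : ℝ → ℂ} {F : ℂ → ℂ} {C N : ℝ} (hC : 0 ≤ C)
    (hk : ∀ u, ‖k u‖ ≤ C * Real.exp (N * |u|)) {c M : ℝ} (hc : 0 < c)
    (hM : ∀ X : ℂ, ‖X‖ ≤ Real.exp (-(2 * c)) → ‖F X‖ ≤ M * ‖X‖) (hM0 : 0 ≤ M)
    {z : ℂ} {α : ℝ} (h : (z * exp (-(α * I))).re ≤ -c) (φ u : ℝ) :
    ‖k u * F (exp (logX z φ (u + α * I)))‖ ≤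
      C * M * (Real.exp (N * |u|) * Real.exp (-(2 * c * Real.cosh u))) := by
  have h1 := norm_exp_logX_le (φ := φ) (u := u) h
  have h2 : ‖exp (logX z φ (u + α * I))‖ ≤ Real.exp (-(2 * c)) := by
    refine h1.trans (Real.exp_le_exp.2 ?_)
    nlinarith [Real.one_le_cosh u]
  calc ‖k u * F (exp (logX z φ (u + α * I)))‖
      ≤ (C * Real.exp (N * |u|)) * (M * Real.exp (-(2 * c * Real.cosh u))) := by
        rw [norm_mul]
        exact mul_le_mul (hk u) ((hM _ h2).trans (by gcongr)) (norm_nonneg _) (by positivity)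
    _ = _ := by ring

lemma continuous_integrand {k : ℝ → ℂ} (hk : Continuous k) {F : ℂ → ℂ} (hF : IsDiscFun F)
    {z : ℂ} {α : ℝ} (h : InHalfPlane α z) (φ : ℝ) :
    Continuous fun u : ℝ => k u * F (exp (logX z φ (u + α * I))) := by
  refine hk.mul (hF.1.continuousOn.comp_continuous ?_ fun u => ?_)
  · exact Complex.continuous_exp.comp ((continuous_logX z φ).comp (by fun_prop))
  · simpa using norm_exp_logX_lt_one h φ u

lemma integrable_integrand {k : ℝ → ℂ} (hk : IsTemperate k) {F : ℂ → ℂ} (hF : IsDiscFun F)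
    {z : ℂ} {α : ℝ} (h : InHalfPlane α z) (φ : ℝ) :
    Integrable fun u : ℝ => k u * F (exp (logX z φ (u + α * I))) := by
  obtain ⟨hkc, C, N, hC, -, hkb⟩ := hk
  have hc : 0 < -(z * exp (-(α * I))).re := by unfold InHalfPlane at h; linarith
  obtain ⟨M, hM0, hM⟩ := hF.bound (q := Real.exp (-(2 * -(z * exp (-(α * I))).re)))
    (by rw [Real.exp_lt_one_iff]; linarith)
  refine ((integrable_exp_mul_exp_cosh hc N).const_mul (C * M)).mono'
    (continuous_integrand hkc hF h φ).aestronglyMeasurable (ae_of_all _ fun u => ?_)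
  exact norm_integrand_le hC hkb hc hM hM0 (by simp) φ u

lemma IsTemperate.mul_exp {k : ℝ → ℂ} (hk : IsTemperate k) (α : ℝ) :
    IsTemperate fun u => k u * exp (u + α * I) := by
  obtain ⟨hkc, C, N, hC, hN, hkb⟩ := hk
  refine ⟨by fun_prop, C, N + 1, hC, by linarith, fun u => ?_⟩
  have : ‖exp (u + α * I)‖ ≤ Real.exp |u| := by
    rw [Complex.norm_exp]; simpa using le_abs_self u
  rw [norm_mul, add_mul, Real.exp_add, ← mul_assoc, one_mul]
  exact mul_le_mul (hkb u) this (norm_nonneg _) (by positivity)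

lemma IsTemperate.mul_exp_neg {k : ℝ → ℂ} (hk : IsTemperate k) (α : ℝ) :
    IsTemperate fun u => k u * exp (-(u + α * I)) := by
  obtain ⟨hkc, C, N, hC, hN, hkb⟩ := hk
  refine ⟨by fun_prop, C, N + 1, hC, by linarith, fun u => ?_⟩
  have : ‖exp (-(u + α * I))‖ ≤ Real.exp |u| := by
    rw [Complex.norm_exp]; simpa using neg_le_abs u
  rw [norm_mul, add_mul, Real.exp_add, ← mul_assoc, one_mul]
  exact mul_le_mul (hkb u) this (norm_nonneg _) (by positivity)

lemma isTemperate_one : IsTemperate fun _ => 1 :=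
  ⟨continuous_const, 1, 0, zero_le_one, le_rfl, by simp⟩

/-- The coordinate differential `dz` on `ℂ × ℝ`. -/
def dzForm : ℂ × ℝ →L[ℝ] ℂ := ContinuousLinearMap.fst ℝ ℂ ℝ

/-- The coordinate differential `dz̄` on `ℂ × ℝ`. -/
def dzbarForm : ℂ × ℝ →L[ℝ] ℂ := (conjCLE : ℂ →L[ℝ] ℂ).comp (ContinuousLinearMap.fst ℝ ℂ ℝ)

/-- The coordinate differential `dφ` on `ℂ × ℝ`, with complex values. -/
def dphiForm : ℂ × ℝ →L[ℝ] ℂ := ofRealCLM.comp (ContinuousLinearMap.snd ℝ ℂ ℝ)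

@[simp] lemma dzForm_apply (p : ℂ × ℝ) : dzForm p = p.1 := rfl
@[simp] lemma dzbarForm_apply (p : ℂ × ℝ) : dzbarForm p = conj p.1 := rfl
@[simp] lemma dphiForm_apply (p : ℂ × ℝ) : dphiForm p = p.2 := rfl

lemma norm_dzForm_le : ‖dzForm‖ ≤ 1 :=
  ContinuousLinearMap.opNorm_le_bound _ zero_le_one fun p => by
    simpa using norm_fst_le p

lemma norm_dzbarForm_le : ‖dzbarForm‖ ≤ 1 :=
  ContinuousLinearMap.opNorm_le_bound _ zero_le_one fun p => by
    simpa using norm_fst_le p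

lemma norm_dphiForm_le : ‖dphiForm‖ ≤ 1 :=
  ContinuousLinearMap.opNorm_le_bound _ zero_le_one fun p => by
    simpa using norm_snd_le p

lemma hasFDerivAt_logX (v : ℂ) (p : ℂ × ℝ) :
    HasFDerivAt (fun p : ℂ × ℝ => logX p.1 p.2 v)
      (exp (-v) • dzForm + exp v • dzbarForm + I • dphiForm) p := by
  have h1 : HasFDerivAt (fun p : ℂ × ℝ => dzForm p) dzForm p := dzForm.hasFDerivAt
  have h2 : HasFDerivAt (fun p : ℂ × ℝ => dzbarForm p) dzbarForm p := dzbarForm.hasFDerivAt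
  have h3 : HasFDerivAt (fun p : ℂ × ℝ => dphiForm p) dphiForm p := dphiForm.hasFDerivAt
  have := ((h1.const_smul (exp (-v))).add (h2.const_smul (exp v))).add (h3.const_smul I)
  refine this.congr_of_eventuallyEq (Eventually.of_forall fun q => ?_)
  simp [logX, mul_comm I]

/-- The derivative of a contour integral: differentiation under the integral sign. The same
contour integrals, with `F` replaced by its Euler derivative, appear. -/
def contourDeriv (k : ℝ → ℂ) (F : ℂ → ℂ) (α : ℝ) (p : ℂ × ℝ) : ℂ × ℝ →L[ℝ] ℂ :=
  contourInt (fun u => k u * exp (-(u + α * I))) (eulerDeriv F) α p • dzForm +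
    contourInt (fun u => k u * exp (u + α * I)) (eulerDeriv F) α p • dzbarForm +
    (I * contourInt k (eulerDeriv F) α p) • dphiForm

lemma eventually_re_le {α : ℝ} {p : ℂ × ℝ} (h : InHalfPlane α p.1) :
    ∃ c > 0, ∀ᶠ q : ℂ × ℝ in 𝓝 p, (q.1 * exp (-(α * I))).re ≤ -c := by
  unfold InHalfPlane at h
  refine ⟨-(p.1 * exp (-(α * I))).re / 2, by linarith, ?_⟩
  have hc : Continuous fun q : ℂ × ℝ => (q.1 * exp (-(α * I))).re := by fun_prop
  filter_upwards [hc.continuousAt.eventually (gt_mem_nhds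
    (show (p.1 * exp (-(α * I))).re < - (-(p.1 * exp (-(α * I))).re / 2) by linarith))] with q hq
  exact hq.le

lemma integrable_sum_smul {V : Type*} [NormedAddCommGroup V] [NormedSpace ℂ V] {a b c : ℝ → ℂ}
    (ha : Integrable a) (hb : Integrable b) (hc : Integrable c) (x y z : V) :
    Integrable fun u => a u • x + b u • y + c u • z :=
  ((ha.smul_const x).add (hb.smul_const y)).add (hc.smul_const z)

lemma integral_sum_smul {V : Type*} [NormedAddCommGroup V] [NormedSpace ℂ V] [CompleteSpace V]
    {a b c : ℝ → ℂ} (ha : Integrable a) (hb : Integrable b) (hc : Integrable c) (x y z : V) :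
    ∫ u, (a u • x + b u • y + c u • z) = (∫ u, a u) • x + (∫ u, b u) • y + (∫ u, c u) • z := by
  have hab : Integrable fun u => a u • x + b u • y := (ha.smul_const x).add (hb.smul_const y)
  rw [integral_add hab (hc.smul_const z), integral_add (ha.smul_const x) (hb.smul_const y),
    integral_smul_const, integral_smul_const, integral_smul_const]

/-- Differentiation under the integral sign: on a neighbourhood of `p` the half plane condition
holds with a uniform constant, so that the doubly exponential decay dominates all the integrands. -/
theorem hasFDerivAt_contourInt {k : ℝ → ℂ} (hk : IsTemperate k) {F : ℂ → ℂ} (hF : IsDiscFun F)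
    {α : ℝ} {p : ℂ × ℝ} (h : InHalfPlane α p.1) :
    HasFDerivAt (contourInt k F α) (contourDeriv k F α p) p := by
  obtain ⟨c, hc, hev⟩ := eventually_re_le h
  have hhalf : ∀ {q : ℂ × ℝ}, (q.1 * exp (-(α * I))).re ≤ -c → InHalfPlane α q.1 := fun hq => by
    unfold InHalfPlane; linarith
  have hE := hF.eulerDeriv
  obtain ⟨M, hM0, hM⟩ := hE.bound (q := Real.exp (-(2 * c)))
    (by rw [Real.exp_lt_one_iff]; linarith)
  obtain ⟨hkc, C, N, hC, hN, hkb⟩ := id hk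
  have i1 := integrable_integrand (hk.mul_exp_neg α) hE h p.2
  have i2 := integrable_integrand (hk.mul_exp α) hE h p.2
  have i3 := integrable_integrand hk hE h p.2
  let G : ℂ × ℝ → ℝ → ℂ × ℝ →L[ℝ] ℂ := fun q u =>
    (k u * exp (-(u + α * I)) * eulerDeriv F (exp (logX q.1 q.2 (u + α * I)))) • dzForm +
    (k u * exp (u + α * I) * eulerDeriv F (exp (logX q.1 q.2 (u + α * I)))) • dzbarForm +
    (I * (k u * eulerDeriv F (exp (logX q.1 q.2 (u + α * I))))) • dphiForm
  have j123 := integrable_sum_smul i1 i2 (i3.const_mul I) dzForm dzbarForm dphiForm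
  have hG : ∫ u, G p u = contourDeriv k F α p := by
    simp only [G]
    rw [integral_sum_smul i1 i2 (i3.const_mul I), integral_const_mul]
    rfl
  rw [← hG]
  obtain ⟨-, C1, N1, hC1, hN1, hkb1⟩ := hk.mul_exp_neg α
  obtain ⟨-, C2, N2, hC2, hN2, hkb2⟩ := hk.mul_exp α
  refine hasFDerivAt_integral_of_dominated_of_fderiv_le (s := {q : ℂ × ℝ | (q.1 * exp (-(α * I))).re ≤ -c})
    (bound := fun u => C1 * M * (Real.exp (N1 * |u|) * Real.exp (-(2 * c * Real.cosh u))) +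
      C2 * M * (Real.exp (N2 * |u|) * Real.exp (-(2 * c * Real.cosh u))) +
      C * M * (Real.exp (N * |u|) * Real.exp (-(2 * c * Real.cosh u)))) hev ?_ ?_ ?_ ?_ ?_ ?_
  · filter_upwards [hev] with q hq
    exact (continuous_integrand hkc hF (hhalf hq) q.2).aestronglyMeasurable
  · exact integrable_integrand hk hF h p.2
  · exact j123.aestronglyMeasurable
  · refine ae_of_all _ fun u q hq => ?_
    refine (norm_add_le _ _).trans (add_le_add ((norm_add_le _ _).trans (add_le_add ?_ ?_)) ?_)
    · rw [norm_smul]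
      exact (mul_le_of_le_one_right (norm_nonneg _) norm_dzForm_le).trans
        (norm_integrand_le hC1 hkb1 hc hM hM0 hq q.2 u)
    · rw [norm_smul]
      exact (mul_le_of_le_one_right (norm_nonneg _) norm_dzbarForm_le).trans
        (norm_integrand_le hC2 hkb2 hc hM hM0 hq q.2 u)
    · rw [norm_smul, norm_mul, Complex.norm_I, one_mul]
      exact (mul_le_of_le_one_right (norm_nonneg _) norm_dphiForm_le).trans
        (norm_integrand_le hC hkb hc hM hM0 hq q.2 u)
  · exact (((integrable_exp_mul_exp_cosh hc N1).const_mul _).add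
      ((integrable_exp_mul_exp_cosh hc N2).const_mul _)).add
      ((integrable_exp_mul_exp_cosh hc N).const_mul _)
  · refine ae_of_all _ fun u q hq => ?_
    have hX : exp (logX q.1 q.2 (u + α * I)) ∈ ball (0 : ℂ) 1 := by
      simpa using norm_exp_logX_lt_one (hhalf hq) q.2 u
    have hd := (hF.1.differentiableAt (isOpen_ball.mem_nhds hX)).hasDerivAt
    have h1 := (hasFDerivAt_logX (u + α * I) q).cexp
    have h2 := (hd.comp_hasFDerivAt q h1).const_mul (k u)
    refine h2.congr_fderiv ?_
    ext w <;> simp [G, eulerDeriv] <;> ring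

/-- The contour of angle `α` remains admissible under small changes of the parameters. -/
lemma isOpen_inHalfPlane (α : ℝ) : IsOpen {p : ℂ × ℝ | InHalfPlane α p.1} := by
  have hc : Continuous fun q : ℂ × ℝ => (q.1 * exp (-(α * I))).re := by fun_prop
  exact isOpen_lt hc continuous_const

/-- The derivative is again given by contour integrals, with weights that are still temperate. -/
theorem contDiffOn_contourInt (n : ℕ) {k : ℝ → ℂ} (hk : IsTemperate k) {F : ℂ → ℂ}
    (hF : IsDiscFun F) (α : ℝ) :
    ContDiffOn ℝ n (contourInt k F α) {p | InHalfPlane α p.1} := by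
  induction n generalizing k F with
  | zero =>
    simp only [CharP.cast_eq_zero, contDiffOn_zero]
    exact fun p hp => (hasFDerivAt_contourInt hk hF hp).continuousAt.continuousWithinAt
  | succ n ih =>
    push_cast
    rw [contDiffOn_succ_iff_hasFDerivWithinAt (by simp)]
    intro p hp
    refine ⟨_, mem_nhdsWithin_of_mem_nhds ((isOpen_inHalfPlane α).mem_nhds hp), by simp,
      contourDeriv k F α, fun q hq => (hasFDerivAt_contourInt hk hF hq).hasFDerivWithinAt, ?_⟩
    have hE := hF.eulerDeriv
    exact (((ih (hk.mul_exp_neg α) hE).smul contDiffOn_const).add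
      ((ih (hk.mul_exp α) hE).smul contDiffOn_const)).add
      ((contDiffOn_const.mul (ih hk hE)).smul contDiffOn_const)

theorem contDiffAt_contourInt {k : ℝ → ℂ} (hk : IsTemperate k) {F : ℂ → ℂ}
    (hF : IsDiscFun F) {α : ℝ} {p : ℂ × ℝ} (hp : InHalfPlane α p.1) :
    ContDiffAt ℝ ∞ (contourInt k F α) p :=
  (contDiffOn_infty.2 fun n => contDiffOn_contourInt n hk hF α).contDiffAt
    ((isOpen_inHalfPlane α).mem_nhds hp)

/-! ### Rotation of contours -/

lemma re_mul_exp_neg_combination (z : ℂ) (α β θ : ℝ) :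
    (z * exp (-(θ * I))).re * Real.sin (β - α) =
      (z * exp (-(α * I))).re * Real.sin (β - θ) + (z * exp (-(β * I))).re * Real.sin (θ - α) := by
  have e : ∀ t : ℝ, (z * exp (-(t * I))).re = z.re * Real.cos t + z.im * Real.sin t := fun t => by
    rw [show -((t : ℂ) * I) = ((-t : ℝ) : ℂ) * I by push_cast; ring, exp_mul_I, ← ofReal_cos,
      ← ofReal_sin]
    simp [-ofReal_cos, -ofReal_sin]
  simp only [e, Real.sin_sub]
  ring

/-- The half plane condition is convex in the angle. -/
lemma InHalfPlane.of_mem_Icc {z : ℂ} {α β θ : ℝ} (hα : InHalfPlane α z) (hβ : InHalfPlane β z)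
    (h : β - α < Real.pi) (hθ : θ ∈ Icc α β) : InHalfPlane θ z := by
  rcases eq_or_lt_of_le hθ.1 with rfl | h1
  · exact hα
  rcases eq_or_lt_of_le hθ.2 with rfl | h2
  · exact hβ
  have s1 : 0 < Real.sin (β - α) := Real.sin_pos_of_pos_of_lt_pi (by linarith) h
  have s2 : 0 < Real.sin (β - θ) := Real.sin_pos_of_pos_of_lt_pi (by linarith) (by linarith)
  have s3 : 0 < Real.sin (θ - α) := Real.sin_pos_of_pos_of_lt_pi (by linarith) (by linarith)
  have key := re_mul_exp_neg_combination z α β θ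
  unfold InHalfPlane at *
  nlinarith

lemma IsTemperate.of_strip {κ : ℂ → ℂ} {α β : ℝ}
    (hκ : DifferentiableOn ℂ κ {v | v.im ∈ Icc α β}) {C N : ℝ} (hC : 0 ≤ C) (hN : 0 ≤ N)
    (hb : ∀ v : ℂ, v.im ∈ Icc α β → ‖κ v‖ ≤ C * Real.exp (N * |v.re|)) {θ : ℝ}
    (hθ : θ ∈ Icc α β) : IsTemperate fun u : ℝ => κ (u + θ * I) := by
  refine ⟨hκ.continuousOn.comp_continuous (by fun_prop) fun u => ?_, C, N, hC, hN, fun u => ?_⟩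
  · simpa using hθ
  · simpa using hb (u + θ * I) (by simpa using hθ)

/-- Cauchy's theorem: a contour can be rotated within the half plane of decay, across a strip
on which the weight is holomorphic of exponential growth. -/
theorem contourInt_rotate {κ F : ℂ → ℂ} (hF : IsDiscFun F) {α β : ℝ} (hαβ : α ≤ β)
    (hκ : DifferentiableOn ℂ κ {v | v.im ∈ Icc α β}) {C N : ℝ} (hC : 0 ≤ C) (hN : 0 ≤ N)
    (hb : ∀ v : ℂ, v.im ∈ Icc α β → ‖κ v‖ ≤ C * Real.exp (N * |v.re|)) {z : ℂ}
    (hz : ∀ θ ∈ Icc α β, InHalfPlane θ z) (φ : ℝ) :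
    contourInt (fun u => κ (u + α * I)) F α (z, φ) =
      contourInt (fun u => κ (u + β * I)) F β (z, φ) := by
  have hcont : Continuous fun θ : ℝ => (z * exp (-(θ * I))).re := by fun_prop
  obtain ⟨θ₀, hθ₀, hmax⟩ := isCompact_Icc.exists_isMaxOn (nonempty_Icc.2 hαβ) hcont.continuousOn
  -- `c` is a rate of decay that is valid on all the rays between the two contours.
  set c := -(z * exp (-(θ₀ * I))).re with hcdef
  have hc : 0 < c := by have := hz θ₀ hθ₀; unfold InHalfPlane at this; linarith
  have hzc : ∀ θ ∈ Icc α β, (z * exp (-(θ * I))).re ≤ -c := fun θ hθ => by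
    rw [hcdef, neg_neg]; exact hmax hθ
  obtain ⟨M, hM0, hM⟩ := hF.bound (q := Real.exp (-(2 * c)))
    (by rw [Real.exp_lt_one_iff]; linarith)
  let g : ℂ → ℂ := fun v => κ v * F (exp (logX z φ v))
  have hsplit : ∀ v : ℂ, v = v.re + v.im * I := fun v => (re_add_im v).symm
  have hg : DifferentiableOn ℂ g {v | v.im ∈ Icc α β} := by
    refine hκ.mul (hF.1.comp (s := {v : ℂ | v.im ∈ Icc α β}) (f := fun v => exp (logX z φ v))
      (Differentiable.differentiableOn (by unfold logX; fun_prop)) fun v hv => ?_)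
    rw [mem_ball_zero_iff, hsplit v]
    exact norm_exp_logX_lt_one (hz _ hv) φ _
  have hgb : ∀ u y : ℝ, y ∈ Icc α β → ‖g (u + y * I)‖ ≤
      C * M * (Real.exp (N * |u|) * Real.exp (-(2 * c * Real.cosh u))) := fun u y hy => by
    have := norm_integrand_le (k := fun u : ℝ => κ (u + y * I)) (F := F) hC
      (fun u => by simpa using hb (u + y * I) (by simpa using hy)) hc hM hM0 (hzc y hy) φ u
    exact this
  have hint : ∀ θ ∈ Icc α β, Tendsto (fun T : ℝ => ∫ u in (-T)..T, g (u + θ * I)) atTop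
      (𝓝 (contourInt (fun u => κ (u + θ * I)) F θ (z, φ))) := fun θ hθ =>
    intervalIntegral_tendsto_integral
      (integrable_integrand (IsTemperate.of_strip hκ hC hN hb hθ) hF (hz θ hθ) φ)
      tendsto_neg_atTop_atBot tendsto_id
  -- The vertical sides of the rectangles tend to zero.
  have hside : ∀ l : ℝ → ℝ, Tendsto (fun T => |l T|) atTop atTop →
      Tendsto (fun T : ℝ => I • ∫ y in α..β, g (l T + y * I)) atTop (𝓝 0) := fun l hl => by
    have h0 := ((tendsto_exp_mul_exp_cosh hc N (l := map l atTop)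
      (by rwa [tendsto_map'_iff])).const_mul (C * M)).mul_const |β - α|
    rw [mul_zero, zero_mul, tendsto_map'_iff] at h0
    refine squeeze_zero_norm (fun T => ?_) h0
    rw [norm_smul, norm_I, one_mul]
    refine intervalIntegral.norm_integral_le_of_norm_le_const fun y hy => hgb _ _ ?_
    rw [uIoc_of_le hαβ] at hy
    exact Ioc_subset_Icc_self hy
  have hrect : ∀ T : ℝ, ((∫ u in (-T)..T, g (u + α * I)) - ∫ u in (-T)..T, g (u + β * I)) +
      I • (∫ y in α..β, g (T + y * I)) - I • (∫ y in α..β, g ((-T : ℝ) + y * I)) = 0 := fun T => by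
    have h := integral_boundary_rect_eq_zero_of_differentiableOn g ((-T : ℝ) + α * I) (T + β * I)
      (hg.mono fun v hv => ?_)
    · simpa using h
    · have := hv.2
      simp only [add_im, ofReal_im, mul_im, ofReal_re, I_im, mul_one, I_re, mul_zero, add_zero,
        zero_add, mem_preimage] at this
      rwa [uIcc_of_le hαβ] at this
  have hlim := (((hint α ⟨le_rfl, hαβ⟩).sub (hint β ⟨hαβ, le_rfl⟩)).add
    (hside (fun T => T) tendsto_abs_atTop_atTop)).sub
    (hside (fun T => -T) (by simpa using tendsto_abs_atTop_atTop))
  have hzero := tendsto_nhds_unique hlim ((tendsto_const_nhds (x := (0 : ℂ))).congr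
    fun T => (hrect T).symm)
  simpa [sub_eq_zero] using hzero

lemma exp_int_mul_add_two_pi (m j : ℤ) (u β : ℝ) :
    exp (m * (u + ((β + 2 * Real.pi * j : ℝ) : ℂ) * I)) = exp (m * (u + β * I)) := by
  rw [exp_eq_exp_iff_exists_int]
  exact ⟨m * j, by push_cast; ring⟩

lemma exp_add_two_pi_int (j : ℤ) (u β : ℝ) :
    exp (u + ((β + 2 * Real.pi * j : ℝ) : ℂ) * I) = exp (u + β * I) := by
  simpa using exp_int_mul_add_two_pi 1 j u β

lemma exp_neg_add_two_pi_int (j : ℤ) (u β : ℝ) :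
    exp (-(u + ((β + 2 * Real.pi * j : ℝ) : ℂ) * I)) = exp (-(u + β * I)) := by
  simpa using exp_int_mul_add_two_pi (-1) j u β

lemma logX_add_two_pi_int (z : ℂ) (φ : ℝ) (j : ℤ) (u β : ℝ) :
    logX z φ (u + ((β + 2 * Real.pi * j : ℝ) : ℂ) * I) = logX z φ (u + β * I) := by
  rw [logX, logX, exp_add_two_pi_int, exp_neg_add_two_pi_int]

lemma inHalfPlane_add_two_pi_int {z : ℂ} {β : ℝ} (j : ℤ) :
    InHalfPlane (β + 2 * Real.pi * j) z ↔ InHalfPlane β z := by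
  have := exp_neg_add_two_pi_int j 0 β
  simp only [ofReal_zero, zero_add] at this
  rw [InHalfPlane, InHalfPlane, this]

/-- For a weight which is a power of `ζ`, any two admissible contours give the same integral. -/
theorem contourInt_zpow_eq {F : ℂ → ℂ} (hF : IsDiscFun F) (m : ℤ) {α β : ℝ} {z : ℂ}
    (hα : InHalfPlane α z) (hβ : InHalfPlane β z) (φ : ℝ) :
    contourInt (fun u => exp (m * (u + α * I))) F α (z, φ) =
      contourInt (fun u => exp (m * (u + β * I))) F β (z, φ) := by
  have main : ∀ α β : ℝ, α ≤ β → β - α < Real.pi → InHalfPlane α z → InHalfPlane β z →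
      contourInt (fun u => exp (m * (u + α * I))) F α (z, φ) =
        contourInt (fun u => exp (m * (u + β * I))) F β (z, φ) := fun α β hle hlt hα hβ => by
    refine contourInt_rotate (κ := fun v => exp (m * v)) hF hle
      (Differentiable.differentiableOn (by fun_prop)) zero_le_one (abs_nonneg (m : ℝ))
      (fun v _ => ?_) (fun θ hθ => hα.of_mem_Icc hβ hlt hθ) φ
    rw [Complex.norm_exp, one_mul, Real.exp_le_exp, ← abs_mul]
    simpa using le_abs_self ((m : ℝ) * v.re)
  -- Choose the representative of `β` modulo `2 π` which is closest to `α`.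
  set j := toIocDiv Real.two_pi_pos (α - Real.pi) β with hj
  have hmem := sub_toIocDiv_zsmul_mem_Ioc Real.two_pi_pos (α - Real.pi) β
  rw [← hj, zsmul_eq_mul] at hmem
  obtain ⟨h1, h2⟩ := hmem
  set β' := β + 2 * Real.pi * ((-j : ℤ) : ℝ) with hβ'
  have e : β - j * (2 * Real.pi) = β' := by rw [hβ']; push_cast; ring
  rw [e] at h1 h2
  have hβ2 : InHalfPlane β' z := (inHalfPlane_add_two_pi_int (-j)).2 hβ
  have hcon : contourInt (fun u => exp (m * (u + β' * I))) F β' (z, φ) =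
      contourInt (fun u => exp (m * (u + β * I))) F β (z, φ) := by
    simp only [contourInt, hβ', exp_int_mul_add_two_pi, logX_add_two_pi_int]
  rw [← hcon]
  have hne : β' ≠ α + Real.pi := fun h => by
    have e2 : exp (-((β' : ℂ) * I)) = -exp (-(α * I)) := by
      rw [h, show -(((α + Real.pi : ℝ) : ℂ) * I) = -(α * I) - Real.pi * I by push_cast; ring,
        Complex.exp_sub, exp_pi_mul_I]
      ring
    unfold InHalfPlane at hα hβ2
    rw [e2, mul_neg, neg_re] at hβ2
    linarith
  have h2' : β' < α + Real.pi := lt_of_le_of_ne (by linarith) hne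
  rcases le_total α β' with h | h
  · exact main α β' h (by linarith) hα hβ2
  · exact (main β' α h (by linarith) hβ2 hα).symm

/-- Integrals over the axis of steepest descent `ζ ∈ - z ℝ_{>0}`, `ρ = |z|`. -/
def axisInt (g : ℝ → ℝ) (ρ φ : ℝ) : ℂ :=
  ∫ u : ℝ, (g u : ℂ) * (exp (-(2 * ρ * Real.cosh u : ℝ) + φ * I) /
    (1 - exp (-(2 * ρ * Real.cosh u : ℝ) + φ * I)))

lemma exp_arg_neg_mul_I {z : ℂ} (hz : z ≠ 0) : exp (arg (-z) * I) = -z / ‖z‖ := by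
  have h := norm_mul_exp_arg_mul_I (-z)
  rw [norm_neg] at h
  have : (‖z‖ : ℂ) ≠ 0 := by exact_mod_cast norm_ne_zero_iff.2 hz
  rw [eq_div_iff this, mul_comm, h]

lemma conj_exp_mul_I (t : ℝ) : conj (exp (t * I)) = exp (-(t * I)) := by
  rw [← exp_conj]; simp

/-- On the ray of direction `-z`, the two exponentials combine to a hyperbolic cosine. -/
lemma logX_axis {z : ℂ} {α : ℝ} (h : exp (α * I) = -z / ‖z‖) (φ u : ℝ) :
    logX z φ (u + α * I) = -(2 * ‖z‖ * Real.cosh u : ℝ) + φ * I := by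
  have h2 : exp (-(α * I)) = -conj z / ‖z‖ := by
    rw [← conj_exp_mul_I, h]; simp
  rw [logX, neg_add, Complex.exp_add, Complex.exp_add, h, h2, Real.cosh_eq]
  rcases eq_or_ne z 0 with rfl | hz
  · simp
  have h4 : (‖z‖ : ℂ) ≠ 0 := by exact_mod_cast norm_ne_zero_iff.2 hz
  have h5 := mul_conj' z
  have h6 : conj z * z = (‖z‖ : ℂ) ^ 2 := by rw [mul_comm]; exact_mod_cast h5
  push_cast
  field_simp
  linear_combination (-(exp (-(u : ℂ))) - exp u) * h6

lemma inHalfPlane_arg {z : ℂ} (hz : z ≠ 0) : InHalfPlane (arg (-z)) z := by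
  have h := exp_arg_neg_mul_I hz
  have h2 : z * exp (-(arg (-z) * I)) = ((-‖z‖ : ℝ) : ℂ) := by
    rw [← conj_exp_mul_I, h]
    have h4 : (‖z‖ : ℂ) ≠ 0 := by exact_mod_cast norm_ne_zero_iff.2 hz
    simp only [map_div₀, map_neg, conj_ofReal]
    field_simp
    rw [mul_conj']
    push_cast
    ring
  rw [InHalfPlane, h2, ofReal_re]
  exact neg_lt_zero.2 (norm_pos_iff.2 hz)

lemma InHalfPlane.ne_zero {z : ℂ} {α : ℝ} (h : InHalfPlane α z) : z ≠ 0 := by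
  rintro rfl
  simp [InHalfPlane] at h

/-- An admissible contour can be moved to the axis, where the integral depends on `|z|` and the
angle only. -/
theorem contourInt_one_eq_axisInt {α : ℝ} {z : ℂ} (h : InHalfPlane α z) (φ : ℝ) :
    contourInt (fun _ => 1) (fun X => X / (1 - X)) α (z, φ) = axisInt (fun _ => 1) ‖z‖ φ := by
  have hz := h.ne_zero
  have := contourInt_zpow_eq isDiscFun_geom 0 h (inHalfPlane_arg hz) φ
  simp only [Int.cast_zero, zero_mul, exp_zero] at this
  rw [this]
  simp only [contourInt, axisInt, logX_axis (exp_arg_neg_mul_I hz)]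
  simp

/-- The combination of weights `c ζ + c̄ ζ⁻¹` on an admissible contour. -/
theorem contourInt_exp_add_eq_axisInt {α : ℝ} {z : ℂ} (h : InHalfPlane α z) (φ : ℝ) (c : ℂ) :
    c * contourInt (fun u => exp (u + α * I)) (fun X => X / (1 - X)) α (z, φ) +
      conj c * contourInt (fun u => exp (-(u + α * I))) (fun X => X / (1 - X)) α (z, φ) =
      ((2 * (c * (-z / ‖z‖)).re : ℝ) : ℂ) * axisInt Real.cosh ‖z‖ φ := by
  have hz := h.ne_zero
  have h1 := contourInt_zpow_eq isDiscFun_geom 1 h (inHalfPlane_arg hz) φ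
  have h2 := contourInt_zpow_eq isDiscFun_geom (-1) h (inHalfPlane_arg hz) φ
  simp only [Int.cast_one, one_mul, Int.cast_neg, neg_mul] at h1 h2
  rw [h1, h2]
  have hax := exp_arg_neg_mul_I hz
  set d := -z / ‖z‖ with hd
  have hax2 : exp (-(arg (-z) * I)) = conj d := by rw [← conj_exp_mul_I, hax]
  have i1 := integrable_integrand (isTemperate_one.mul_exp (arg (-z))) isDiscFun_geom
    (inHalfPlane_arg hz) φ
  have i2 := integrable_integrand (isTemperate_one.mul_exp_neg (arg (-z))) isDiscFun_geom
    (inHalfPlane_arg hz) φ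
  simp only [one_mul, logX_axis hax] at i1 i2
  set f : ℝ → ℂ := fun u => exp (-(2 * ‖z‖ * Real.cosh u : ℝ) + φ * I) /
    (1 - exp (-(2 * ‖z‖ * Real.cosh u : ℝ) + φ * I)) with hf
  have hfe : ∀ u, f (-u) = f u := fun u => by simp [hf]
  simp only [contourInt, axisInt, logX_axis hax]
  -- Symmetrize in `u`.
  have hsym : ∀ s : ℝ, Integrable (fun u : ℝ => exp (s * u) * f u) →
      ∫ u : ℝ, exp (-(s * u)) * f u = ∫ u : ℝ, exp (s * u) * f u := fun s _ => by
    rw [← integral_neg_eq_self (fun u : ℝ => exp (s * u) * f u)]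
    simp [hfe]
  have e1 : ∀ u : ℝ, exp (u + arg (-z) * I) = d * exp u := fun u => by
    rw [Complex.exp_add, hax, mul_comm]
  have e2 : ∀ u : ℝ, exp (-(u + arg (-z) * I)) = conj d * exp (-u) := fun u => by
    rw [neg_add, Complex.exp_add, hax2, mul_comm]
  have hd0 : d ≠ 0 := by
    have h4 : (‖z‖ : ℂ) ≠ 0 := by exact_mod_cast norm_ne_zero_iff.2 hz
    simp [hd, hz]
  change Integrable fun u : ℝ => exp (u + arg (-z) * I) * f u at i1
  change Integrable fun u : ℝ => exp (-(u + arg (-z) * I)) * f u at i2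
  change c * (∫ u : ℝ, exp (u + arg (-z) * I) * f u) +
    conj c * (∫ u : ℝ, exp (-(u + arg (-z) * I)) * f u) = _ * ∫ u : ℝ, (Real.cosh u : ℂ) * f u
  simp only [e1, e2, mul_assoc] at i1 i2 ⊢
  have i1' : Integrable fun u : ℝ => exp u * f u := by
    have := i1.const_mul d⁻¹
    simpa only [← mul_assoc, inv_mul_cancel₀ hd0, one_mul] using this
  have i2' : Integrable fun u : ℝ => exp (-u) * f u := by
    have := i2.const_mul (conj d)⁻¹
    simpa only [← mul_assoc, inv_mul_cancel₀ ((map_ne_zero conj).2 hd0), one_mul] using this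
  have s1 := hsym 1 (by simpa using i1')
  simp only [ofReal_one, one_mul] at s1
  rw [integral_const_mul, integral_const_mul]
  have hch : ∫ u : ℝ, (Real.cosh u : ℂ) * f u = ∫ u : ℝ, exp u * f u := by
    have : ∀ u : ℝ, (Real.cosh u : ℂ) * f u = (1 / 2) * (exp u * f u + exp (-u) * f u) := fun u => by
      rw [Real.cosh_eq]; push_cast; ring
    simp only [this]
    rw [integral_const_mul, integral_add i1' i2', s1]
    ring
  rw [s1, hch]
  have : ((2 * (c * d).re : ℝ) : ℂ) = c * d + conj (c * d) := by
    rw [add_conj]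
  rw [this, map_mul]
  ring

/-- Reversing the charge conjugates the integrals over the axis. -/
lemma axisInt_neg (g : ℝ → ℝ) (ρ φ : ℝ) : axisInt g ρ (-φ) = conj (axisInt g ρ φ) := by
  rw [axisInt, axisInt, ← integral_conj]
  congr 1
  ext u
  simp only [map_mul, map_div₀, conj_ofReal, map_sub, map_one, ← exp_conj, map_add, map_neg, conj_I]
  push_cast
  simp

lemma axisInt_congr_angle (g : ℝ → ℝ) (ρ : ℝ) {φ φ' : ℝ} (h : (φ : Real.Angle) = φ') :
    axisInt g ρ φ = axisInt g ρ φ' := by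
  obtain ⟨j, hj⟩ := Real.Angle.angle_eq_iff_two_pi_dvd_sub.1 h
  have : ∀ a : ℂ, exp (a + φ * I) = exp (a + φ' * I) := fun a => by
    rw [exp_eq_exp_iff_exists_int]
    refine ⟨j, ?_⟩
    have : (φ : ℂ) = φ' + 2 * Real.pi * j := by rw [← sub_eq_iff_eq_add']; exact_mod_cast hj
    rw [this]; ring
  simp only [axisInt, this]

/-! ### Lower bounds for the real part of the integrals over the axis -/

/-- The minimum of `Re (X / (1 - X))` on the circle of radius `|X|` is attained at `-|X|`. -/
lemma neg_le_re_geom {X : ℂ} (hX : ‖X‖ < 1) : -(‖X‖ / (1 + ‖X‖)) ≤ (X / (1 - X)).re := by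
  have h1 : 1 - X ≠ 0 := one_sub_ne_zero_of_norm_lt hX
  have hn : 0 < normSq (1 - X) := normSq_pos.2 h1
  have hq := norm_nonneg X
  have hsq : ‖X‖ ^ 2 = X.re * X.re + X.im * X.im := by rw [← normSq_eq_norm_sq, normSq_apply]
  have hre : (X / (1 - X)).re = (X.re - ‖X‖ ^ 2) / normSq (1 - X) := by
    rw [div_re, hsq]
    simp
    ring
  have hns : normSq (1 - X) = 1 - 2 * X.re + ‖X‖ ^ 2 := by
    rw [normSq_apply, hsq]; simp; ring
  rw [hre, le_div_iff₀ hn, hns, neg_mul, div_mul_eq_mul_div, neg_le_iff_add_nonneg,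
    ← sub_nonneg]
  have hx : 0 ≤ X.re + ‖X‖ := by have := neg_abs_le X.re; have := abs_re_le_norm X; linarith
  have e : X.re - ‖X‖ ^ 2 + ‖X‖ * (1 - 2 * X.re + ‖X‖ ^ 2) / (1 + ‖X‖) - 0 =
      (1 - ‖X‖) * (X.re + ‖X‖) / (1 + ‖X‖) := by
    field_simp; ring
  rw [e]
  have : 0 ≤ 1 - ‖X‖ := by linarith
  positivity

lemma norm_exp_axis (ρ φ u : ℝ) :
    ‖exp (-(2 * ρ * Real.cosh u : ℝ) + φ * I)‖ = Real.exp (-(2 * ρ * Real.cosh u)) := by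
  rw [Complex.norm_exp]; simp

lemma norm_exp_axis_lt_one {ρ : ℝ} (hρ : 0 < ρ) (φ u : ℝ) :
    ‖exp (-(2 * ρ * Real.cosh u : ℝ) + φ * I)‖ < 1 := by
  rw [norm_exp_axis, Real.exp_lt_one_iff]
  have := mul_pos (mul_pos two_pos hρ) (Real.cosh_pos u)
  linarith

lemma integrable_axis {ρ : ℝ} (hρ : 0 < ρ) (φ : ℝ) :
    Integrable fun u : ℝ => exp (-(2 * ρ * Real.cosh u : ℝ) + φ * I) /
      (1 - exp (-(2 * ρ * Real.cosh u : ℝ) + φ * I)) := by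
  have hz : (ρ : ℂ) ≠ 0 := by exact_mod_cast hρ.ne'
  have := integrable_integrand isTemperate_one isDiscFun_geom (inHalfPlane_arg hz) φ
  simp only [one_mul, logX_axis (exp_arg_neg_mul_I hz)] at this
  simpa [abs_of_pos hρ] using this

/-- A pointwise minorant of the integrand gives a lower bound for the integral over the axis. -/
lemma neg_integral_le_re_axisInt {ρ : ℝ} (hρ : 0 < ρ) (φ : ℝ) {b : ℝ → ℝ} (hb : Integrable b)
    (h : ∀ u, Real.exp (-(2 * ρ * Real.cosh u)) / (1 + Real.exp (-(2 * ρ * Real.cosh u))) ≤ b u) :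
    -∫ u, b u ≤ (axisInt (fun _ => 1) ρ φ).re := by
  have hi := integrable_axis hρ φ
  simp only [axisInt, ofReal_one, one_mul]
  rw [← reCLM_apply, ← ContinuousLinearMap.integral_comp_comm _ hi, ← integral_neg]
  refine integral_mono hb.neg (reCLM.integrable_comp hi) fun u => ?_
  have := neg_le_re_geom (norm_exp_axis_lt_one hρ φ u)
  rw [norm_exp_axis] at this
  exact (neg_le_neg (h u)).trans this

/-- The bound behind the correction to the Kähler form on `U'`: since `cosh u ≥ 1 + u² / 2`, the
integrand is dominated by a Gaussian. -/
theorem neg_sqrt_div_le_re_axisInt {ρ : ℝ} (hρ : 0 < ρ) (φ : ℝ) :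
    -(Real.sqrt Real.pi / (Real.sqrt ρ * (Real.exp (2 * ρ) - 1))) ≤
      (axisInt (fun _ => 1) ρ φ).re := by
  have hint : Integrable fun u : ℝ => Real.exp (-(2 * ρ)) * Real.exp (-ρ * u ^ 2) :=
    (integrable_exp_neg_mul_sq hρ).const_mul _
  refine le_trans ?_ (neg_integral_le_re_axisInt hρ φ hint fun u => ?_)
  · rw [integral_const_mul, integral_gaussian, neg_le_neg_iff, Real.sqrt_div Real.pi_pos.le]
    have h1 : 1 < Real.exp (2 * ρ) := Real.one_lt_exp_iff.2 (by linarith)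
    have h2 : 0 < Real.sqrt ρ := Real.sqrt_pos.2 hρ
    rw [Real.exp_neg, ← div_div, div_eq_mul_inv _ (Real.exp (2 * ρ) - 1), mul_comm]
    have h3 : 0 < Real.exp (2 * ρ) - 1 := by linarith
    gcongr
    linarith
  · have hp := Real.exp_pos (-(2 * ρ * Real.cosh u))
    refine (div_le_self hp.le (by linarith)).trans ?_
    rw [← Real.exp_add, Real.exp_le_exp]
    nlinarith [one_add_sq_le_cosh u]

/-- For small `ρ` the real part of the integral is at worst logarithmically negative. -/
theorem log_sub_two_le_re_axisInt {ρ : ℝ} (hρ : 0 < ρ) (φ : ℝ) :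
    Real.log (min ρ 1) - 2 ≤ (axisInt (fun _ => 1) ρ φ).re := by
  set ρ' := min ρ 1 with hρ'
  have hpos : 0 < ρ' := lt_min hρ one_pos
  set ℓ := -Real.log ρ' with hℓ
  have hℓ0 : 0 ≤ ℓ := by rw [hℓ]; have := Real.log_nonpos hpos.le (min_le_right ρ 1); linarith
  have hρe : ρ' = Real.exp (-ℓ) := by rw [hℓ, neg_neg, Real.exp_log hpos]
  -- The integrand is at most `1 / 2`, and at most `exp (ℓ - |u|)`, where `ℓ = - log ρ'`.
  let b : ℝ → ℝ := fun u => (Icc (-ℓ) ℓ).indicator (fun _ => 1 / 2) u +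
    ((Ioi ℓ).indicator (fun u => Real.exp ℓ * Real.exp (-u)) u +
      (Iio (-ℓ)).indicator (fun u => Real.exp ℓ * Real.exp u) u)
  have i1 : Integrable ((Icc (-ℓ) ℓ).indicator fun _ : ℝ => (1 / 2 : ℝ)) :=
    (integrable_indicator_iff measurableSet_Icc).2 (by simp [IntegrableOn])
  have i2 : Integrable ((Ioi ℓ).indicator fun u : ℝ => Real.exp ℓ * Real.exp (-u)) :=
    (integrable_indicator_iff measurableSet_Ioi).2 ((integrableOn_exp_neg_Ioi ℓ).const_mul _)
  have i3 : Integrable ((Iio (-ℓ)).indicator fun u : ℝ => Real.exp ℓ * Real.exp u) :=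
    (integrable_indicator_iff measurableSet_Iio).2
      (((integrableOn_exp_Iic (-ℓ)).mono_set Iio_subset_Iic_self).const_mul _)
  have i23 : Integrable fun u => (Ioi ℓ).indicator (fun u : ℝ => Real.exp ℓ * Real.exp (-u)) u +
      (Iio (-ℓ)).indicator (fun u : ℝ => Real.exp ℓ * Real.exp u) u := i2.add i3
  have hb : Integrable b := i1.add i23
  have hbi : ∫ u, b u = ℓ + 2 := by
    simp only [b]
    rw [integral_add i1 i23, integral_add i2 i3, integral_indicator measurableSet_Icc,
      integral_indicator measurableSet_Ioi, integral_indicator measurableSet_Iio,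
      integral_const_mul, integral_const_mul, integral_exp_neg_Ioi, ← integral_Iic_eq_integral_Iio,
      integral_exp_Iic, ← Real.exp_add]
    simp
    rw [max_eq_left (by linarith)]
    ring
  have hfin := neg_integral_le_re_axisInt hρ φ hb fun u => ?_
  · rw [hbi] at hfin
    rw [hℓ] at hfin
    linarith
  · set q := Real.exp (-(2 * ρ * Real.cosh u)) with hq
    have hq0 : 0 < q := Real.exp_pos _
    have hq1 : q ≤ 1 := by
      rw [hq, Real.exp_le_one_iff]
      have := mul_pos (mul_pos two_pos hρ) (Real.cosh_pos u)
      linarith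
    have hhalf : q / (1 + q) ≤ 1 / 2 := by
      rw [div_le_div_iff₀ (by linarith) two_pos]; linarith
    have hle : q / (1 + q) ≤ q := div_le_self hq0.le (by linarith)
    have hdec : ∀ w : ℝ, 2 * Real.cosh u ≥ Real.exp w → q ≤ Real.exp ℓ * Real.exp (-w) := by
      intro w hw
      rw [← Real.exp_add, hq, Real.exp_le_exp]
      have h1 : ρ' * Real.exp w ≤ 2 * ρ * Real.cosh u := by
        have := min_le_left ρ 1
        nlinarith [Real.exp_pos w, mul_le_mul_of_nonneg_left hw hρ.le]
      rw [hρe, ← Real.exp_add] at h1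
      have := Real.add_one_le_exp (-ℓ + w)
      linarith
    have hcosh : 2 * Real.cosh u = Real.exp u + Real.exp (-u) := by rw [Real.cosh_eq]; ring
    simp only [b, indicator_apply, mem_Icc, mem_Ioi, mem_Iio]
    rcases lt_trichotomy ℓ u with h | h | h
    · rw [if_neg (by intro h'; linarith [h'.2]), if_pos h, if_neg (by linarith)]
      have := hdec u (by rw [hcosh]; linarith [Real.exp_pos (-u)])
      linarith
    · rw [if_pos ⟨by linarith, by linarith⟩, if_neg (by linarith), if_neg (by linarith)]
      linarith
    · rcases le_or_gt (-ℓ) u with h' | h'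
      · rw [if_pos ⟨by linarith, by linarith⟩, if_neg (by linarith), if_neg (by linarith)]
        linarith
      · rw [if_neg (by intro h''; linarith [h''.1]), if_neg (by linarith), if_pos h']
        have := hdec (-u) (by rw [hcosh]; linarith [Real.exp_pos u])
        rw [neg_neg] at this
        linarith

/-! ### Second derivatives along curves -/

/-- `f` is differentiable near `0`, and its derivative has derivative `d` at `0`. -/
def HasDeriv2At {E : Type*} [NormedAddCommGroup E] [NormedSpace ℝ E] (f : ℝ → E) (d : E) : Prop :=
  ∃ f' : ℝ → E, (∀ᶠ t in 𝓝 0, HasDerivAt f (f' t) t) ∧ HasDerivAt f' d 0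

section

variable {E : Type*} [NormedAddCommGroup E] [NormedSpace ℝ E] {f g : ℝ → E} {d e : E}

lemma HasDeriv2At.add (hf : HasDeriv2At f d) (hg : HasDeriv2At g e) :
    HasDeriv2At (fun t => f t + g t) (d + e) := by
  obtain ⟨f', h1, h2⟩ := hf
  obtain ⟨g', h3, h4⟩ := hg
  exact ⟨fun t => f' t + g' t, by filter_upwards [h1, h3] with t a b using a.add b, h2.add h4⟩

lemma HasDeriv2At.sub (hf : HasDeriv2At f d) (hg : HasDeriv2At g e) :
    HasDeriv2At (fun t => f t - g t) (d - e) := by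
  obtain ⟨f', h1, h2⟩ := hf
  obtain ⟨g', h3, h4⟩ := hg
  exact ⟨fun t => f' t - g' t, by filter_upwards [h1, h3] with t a b using a.sub b, h2.sub h4⟩

lemma HasDeriv2At.clm {G : Type*} [NormedAddCommGroup G] [NormedSpace ℝ G] (L : E →L[ℝ] G)
    (hf : HasDeriv2At f d) : HasDeriv2At (fun t => L (f t)) (L d) := by
  obtain ⟨f', h1, h2⟩ := hf
  exact ⟨fun t => L (f' t), by filter_upwards [h1] with t a using L.hasFDerivAt.comp_hasDerivAt t a,
    L.hasFDerivAt.comp_hasDerivAt 0 h2⟩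

lemma hasDeriv2At_const (c : E) : HasDeriv2At (fun _ : ℝ => c) 0 :=
  ⟨fun _ => 0, Eventually.of_forall fun t => hasDerivAt_const t c, hasDerivAt_const 0 0⟩

lemma HasDeriv2At.sum {ι : Type*} (s : Finset ι) {f : ι → ℝ → E} {d : ι → E}
    (h : ∀ i ∈ s, HasDeriv2At (f i) (d i)) :
    HasDeriv2At (fun t => ∑ i ∈ s, f i t) (∑ i ∈ s, d i) := by
  classical
  induction s using Finset.induction_on with
  | empty => simpa using hasDeriv2At_const (0 : E)
  | insert a s ha ih =>
    simp only [Finset.sum_insert ha]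
    exact (h a (Finset.mem_insert_self a s)).add
      (ih fun i hi => h i (Finset.mem_insert_of_mem hi))

lemma HasDeriv2At.congr (hf : HasDeriv2At f d) (h : ∀ᶠ t in 𝓝 0, g t = f t) :
    HasDeriv2At g d := by
  obtain ⟨f', h1, h2⟩ := hf
  refine ⟨f', ?_, h2⟩
  filter_upwards [h1, h.eventually_nhds] with t a b using a.congr_of_eventuallyEq b

end

/-- The second derivative at a local minimum is non-negative. -/
lemma HasDeriv2At.nonneg_of_isLocalMin {f : ℝ → ℝ} {d : ℝ} (hf : HasDeriv2At f d)
    (hmin : IsLocalMin f 0) : 0 ≤ d := by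
  obtain ⟨f', h1, h2⟩ := hf
  have hderiv : deriv f =ᶠ[𝓝 0] f' := by filter_upwards [h1] with t a using a.deriv
  by_contra! hd
  have hmax : IsLocalMax f 0 := by
    refine isLocalMax_of_deriv_deriv_neg ?_ hmin.deriv_eq_zero h1.self_of_nhds.continuousAt
    rw [hderiv.deriv_eq, h2.deriv]
    exact hd
  have hconst : f =ᶠ[𝓝 0] fun _ => f 0 := by
    filter_upwards [hmin, hmax] with t a b using le_antisymm b a
  have hzero : f' =ᶠ[𝓝 0] fun _ => 0 := by
    filter_upwards [hconst.eventually_nhds, h1] with t a b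
    exact b.unique ((hasDerivAt_const t (f 0)).congr_of_eventuallyEq a)
  have := (h2.congr_of_eventuallyEq hzero.symm).unique (hasDerivAt_const 0 0)
  linarith

/-- Two-fold differentiability of a curve, with its derivatives. -/
structure HasDerivsAt (z z' : ℝ → ℂ) (z'' : ℂ) : Prop where
  fst : ∀ᶠ t in 𝓝 0, HasDerivAt z (z' t) t
  snd : HasDerivAt z' z'' 0

lemma hasDerivsAt_real {f : ℂ → ℂ} (hf : ∀ᶠ w in 𝓝 0, DifferentiableAt ℂ f w) :
    HasDerivsAt (fun t : ℝ => f t) (fun t => deriv f t) (deriv (deriv f) 0) := by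
  have hc : Tendsto (fun t : ℝ => (t : ℂ)) (𝓝 0) (𝓝 0) := by
    have := continuous_ofReal.tendsto 0
    simpa using this
  have hd : ∀ᶠ w in 𝓝 (0 : ℂ), DifferentiableAt ℂ (deriv f) w := by
    filter_upwards [hf.eventually_nhds] with w hw
    exact (analyticAt_iff_eventually_differentiableAt.2 hw).deriv.differentiableAt
  refine ⟨?_, ?_⟩
  · filter_upwards [hc.eventually hf] with t ht using ht.hasDerivAt.comp_ofReal
  · have := hd.self_of_nhds.hasDerivAt
    exact HasDerivAt.comp_ofReal (z := 0) (by simpa using this)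

lemma hasDerivsAt_imag {f : ℂ → ℂ} (hf : ∀ᶠ w in 𝓝 0, DifferentiableAt ℂ f w) :
    HasDerivsAt (fun t : ℝ => f (t * I)) (fun t => I * deriv f (t * I)) (-deriv (deriv f) 0) := by
  have hc : Tendsto (fun t : ℝ => (t : ℂ) * I) (𝓝 0) (𝓝 0) := by
    have : Continuous fun t : ℝ => (t : ℂ) * I := by fun_prop
    simpa using this.tendsto 0
  have hd : ∀ᶠ w in 𝓝 (0 : ℂ), DifferentiableAt ℂ (deriv f) w := by
    filter_upwards [hf.eventually_nhds] with w hw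
    exact (analyticAt_iff_eventually_differentiableAt.2 hw).deriv.differentiableAt
  have hlin : ∀ t : ℝ, HasDerivAt (fun t : ℝ => (t : ℂ) * I) I t := fun t => by
    simpa using (Complex.ofRealCLM.hasDerivAt (x := t)).mul_const I
  refine ⟨?_, ?_⟩
  · filter_upwards [hc.eventually hf] with t ht
    have := ht.hasDerivAt.scomp t (hlin t)
    simpa [Function.comp_def] using this
  · have h0 : DifferentiableAt ℂ (deriv f) (((0 : ℝ) : ℂ) * I) := by simpa using hd.self_of_nhds
    have := (h0.hasDerivAt.scomp (0 : ℝ) (hlin 0)).const_mul I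
    simp only [Function.comp_def, ofReal_zero, zero_mul, smul_eq_mul] at this
    rwa [← mul_assoc, I_mul_I, neg_one_mul] at this

lemma HasDerivsAt.comp_contourInt {z z' : ℝ → ℂ} {z'' : ℂ} (hz : HasDerivsAt z z' z'')
    {k : ℝ → ℂ} (hk : IsTemperate k) {F : ℂ → ℂ} (hF : IsDiscFun F) {α φ m : ℝ}
    (h : InHalfPlane α (z 0)) :
    (∀ᶠ t in 𝓝 0, HasDerivAt (fun t => contourInt k F α (z t, φ + m * t))
      (contourDeriv k F α (z t, φ + m * t) (z' t, m)) t) := by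
  have hcz : ContinuousAt z 0 := hz.fst.self_of_nhds.continuousAt
  have hev : ∀ᶠ t in 𝓝 (0 : ℝ), InHalfPlane α (z t) := by
    have : IsOpen {w : ℂ | InHalfPlane α w} :=
      isOpen_lt (f := fun w : ℂ => (w * exp (-(α * I))).re) (by fun_prop) continuous_const
    exact hcz.eventually (this.mem_nhds h)
  filter_upwards [hz.fst, hev] with t ht hzt
  have hp : HasDerivAt (fun t => ((z t, φ + m * t) : ℂ × ℝ)) (z' t, m) t := by
    refine ht.prodMk ?_
    simpa using ((hasDerivAt_id t).const_mul m).const_add φ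
  exact (hasFDerivAt_contourInt hk hF (p := (z t, φ + m * t)) hzt).comp_hasDerivAt t hp

/-- The second derivative along a curve in `z` and a line in `φ`. Each derivative in `z`, `z̄` or
`φ` replaces `F` by its Euler derivative and multiplies the weight by `ζ⁻¹`, `ζ` or `i`. -/
lemma hasDeriv2At_contourInt {z z' : ℝ → ℂ} {z'' : ℂ} (hz : HasDerivsAt z z' z'')
    {F : ℂ → ℂ} (hF : IsDiscFun F) {α φ m : ℝ} (h : InHalfPlane α (z 0)) :
    let p : ℂ × ℝ := (z 0, φ)
    let J : (ℝ → ℂ) → (ℂ → ℂ) → ℂ := fun k F => contourInt k F α p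
    let em : ℝ → ℂ := fun u => exp (-(u + α * I))
    let ep : ℝ → ℂ := fun u => exp (u + α * I)
    HasDeriv2At (fun t => contourInt (fun _ => 1) F α (z t, φ + m * t))
      (J (fun u => em u * em u) (eulerDeriv (eulerDeriv F)) * z' 0 ^ 2 +
        2 * J (fun _ => 1) (eulerDeriv (eulerDeriv F)) * (z' 0 * conj (z' 0)) +
        J (fun u => ep u * ep u) (eulerDeriv (eulerDeriv F)) * conj (z' 0) ^ 2 +
        2 * I * m * (J em (eulerDeriv (eulerDeriv F)) * z' 0 +
          J ep (eulerDeriv (eulerDeriv F)) * conj (z' 0)) -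
        m ^ 2 * J (fun _ => 1) (eulerDeriv (eulerDeriv F)) +
        J em (eulerDeriv F) * z'' + J ep (eulerDeriv F) * conj z'') := by
  intro p J em ep
  have hE := hF.eulerDeriv
  have t1 := isTemperate_one
  have tm : IsTemperate em := by simpa [em] using t1.mul_exp_neg α
  have tp : IsTemperate ep := by simpa [ep] using t1.mul_exp α
  have d1 := (hz.comp_contourInt tm hE (φ := φ) (m := m) h).self_of_nhds.mul hz.snd
  have hcz : HasDerivAt (fun t => conj (z' t)) (conj z'') 0 :=
    (conjCLE : ℂ →L[ℝ] ℂ).hasFDerivAt.comp_hasDerivAt 0 hz.snd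
  have d2 := (hz.comp_contourInt tp hE (φ := φ) (m := m) h).self_of_nhds.mul hcz
  have d3 := ((hz.comp_contourInt t1 hE (φ := φ) (m := m) h).self_of_nhds.const_mul I).mul_const
    (m : ℂ)
  refine ⟨fun t => contourInt em (eulerDeriv F) α (z t, φ + m * t) * z' t +
    contourInt ep (eulerDeriv F) α (z t, φ + m * t) * conj (z' t) +
    I * contourInt (fun _ => 1) (eulerDeriv F) α (z t, φ + m * t) * m, ?_, ?_⟩
  · filter_upwards [hz.comp_contourInt t1 hF (φ := φ) (m := m) h] with t ht
    refine ht.congr_deriv ?_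
    simp [contourDeriv, em, ep]
  · refine ((d1.add d2).add d3).congr_deriv ?_
    have e1 : (fun u => em u * exp (u + α * I)) = fun _ => 1 := by
      ext u; simp only [em]; rw [← Complex.exp_add]; simp
    have e2 : (fun u => ep u * exp (-(u + α * I))) = fun _ => 1 := by
      ext u; simp only [ep]; rw [← Complex.exp_add]; simp
    have e3 : (fun u : ℝ => (1 : ℂ) * exp (u + α * I)) = ep := by ext u; simp [ep]
    have e4 : (fun u : ℝ => (1 : ℂ) * exp (-(u + α * I))) = em := by ext u; simp [em]
    have e5 : (fun u => ep u * exp (u + α * I)) = fun u => ep u * ep u := rfl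
    have e6 : (fun u => em u * exp (-(u + α * I))) = fun u => em u * em u := rfl
    simp only [contourDeriv, e1, e2, e3, e4, e5, e6, mul_zero, add_zero, J, p]
    simp only [FunLike.coe_add, FunLike.coe_smul, Pi.add_apply, Pi.smul_apply, dzForm_apply,
      dzbarForm_apply, dphiForm_apply, smul_eq_mul]
    linear_combination (contourInt (fun x => 1) (eulerDeriv (eulerDeriv F)) α (z 0, φ)) *
      (m : ℂ) ^ 2 * I_sq

/-- The Laplace equation `(∂_z ∂_z̄ + ∂_φ²) P = 0` for contour integrals, tested along a
holomorphic curve `f`: the second derivatives along the curve in the two real directions and in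
the direction of the angle `φ`, suitably scaled, add up to zero. -/
theorem hasDeriv2At_contourInt_laplace {f : ℂ → ℂ} (hf : ∀ᶠ w in 𝓝 0, DifferentiableAt ℂ f w)
    {F : ℂ → ℂ} (hF : IsDiscFun F) {α m : ℝ} (φ : ℝ) (h : InHalfPlane α (f 0))
    (hm : m ^ 2 = 4 * ‖deriv f 0‖ ^ 2) :
    HasDeriv2At (fun t : ℝ => contourInt (fun _ => 1) F α (f t, φ) +
      contourInt (fun _ => 1) F α (f (t * I), φ) +
      contourInt (fun _ => 1) F α (f 0, φ + m * t)) 0 := by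
  have h1 := hasDeriv2At_contourInt (hasDerivsAt_real hf) hF (φ := φ) (m := 0)
    (by simpa using h)
  have h2 := hasDeriv2At_contourInt (hasDerivsAt_imag hf) hF (φ := φ) (m := 0)
    (by simpa using h)
  have hconst : HasDerivsAt (fun _ => f 0) (fun _ => 0) 0 :=
    ⟨Eventually.of_forall fun t => hasDerivAt_const t _, hasDerivAt_const 0 0⟩
  have h3 := hasDeriv2At_contourInt hconst hF (φ := φ) (m := m) h
  have h123 := (h1.add h2).add h3
  simp only [ofReal_zero, zero_mul, add_zero, mul_zero] at h123
  convert h123 using 1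
  -- In the two real directions the terms with `(f')²` and its conjugate cancel; the mixed terms add
  -- up to `4 |f'|²` times the integral that the angle contributes with the factor `-m²`.
  have hm' : (m : ℂ) ^ 2 = 4 * (deriv f 0 * conj (deriv f 0)) := by
    rw [mul_conj']; exact_mod_cast hm
  simp only [map_mul, conj_I, map_neg, map_zero, zero_pow two_ne_zero, hm']
  linear_combination
    (-contourInt (fun u => exp (-(u + α * I)) * exp (-(u + α * I))) (eulerDeriv (eulerDeriv F)) α
      (f 0, φ) * deriv f 0 ^ 2
    - contourInt (fun u => exp (u + α * I) * exp (u + α * I)) (eulerDeriv (eulerDeriv F)) α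
      (f 0, φ) * conj (deriv f 0) ^ 2
    + 2 * contourInt (fun _ => 1) (eulerDeriv (eulerDeriv F)) α (f 0, φ) *
      (deriv f 0 * conj (deriv f 0))) * I_sq

/-- Holomorphic functions are harmonic along the two real directions. -/
theorem hasDeriv2At_holomorphic {f : ℂ → ℂ} (hf : ∀ᶠ w in 𝓝 0, DifferentiableAt ℂ f w) :
    HasDeriv2At (fun t : ℝ => f t + f (t * I)) 0 := by
  have h1 := hasDerivsAt_real hf
  have h2 := hasDerivsAt_imag hf
  have := HasDeriv2At.add ⟨_, h1.fst, h1.snd⟩ ⟨_, h2.fst, h2.snd⟩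
  simpa using this

lemma HasDerivsAt.norm_sq {z z' : ℝ → ℂ} {z'' : ℂ} (hz : HasDerivsAt z z' z'') :
    HasDeriv2At (fun t => z t * conj (z t))
      (z'' * conj (z 0) + 2 * (z' 0 * conj (z' 0)) + z 0 * conj z'') := by
  have hconj : ∀ {g : ℝ → ℂ} {d : ℂ} {t : ℝ}, HasDerivAt g d t →
      HasDerivAt (fun t => conj (g t)) (conj d) t := fun h =>
    (conjCLE : ℂ →L[ℝ] ℂ).hasFDerivAt.comp_hasDerivAt _ h
  refine ⟨fun t => z' t * conj (z t) + z t * conj (z' t), ?_, ?_⟩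
  · filter_upwards [hz.fst] with t ht using ht.mul (hconj ht)
  · have h0 := hz.fst.self_of_nhds
    refine ((hz.snd.mul (hconj h0)).add (h0.mul (hconj hz.snd))).congr_deriv ?_
    ring

/-- Squared absolute values of holomorphic functions are subharmonic. -/
theorem hasDeriv2At_norm_sq {f : ℂ → ℂ} (hf : ∀ᶠ w in 𝓝 0, DifferentiableAt ℂ f w) :
    HasDeriv2At (fun t : ℝ => ‖f t‖ ^ 2 + ‖f (t * I)‖ ^ 2) (4 * ‖deriv f 0‖ ^ 2) := by
  have h := ((hasDerivsAt_real hf).norm_sq.add (hasDerivsAt_imag hf).norm_sq).clm reCLM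
  simp only [reCLM_apply, add_re, mul_conj', ofReal_zero, zero_mul, map_neg, map_mul, conj_I,
    neg_mul, neg_re] at h
  have e1 : ∀ w : ℂ, (((‖w‖ : ℂ)) ^ 2).re = ‖w‖ ^ 2 := fun w => by
    rw [← ofReal_pow, ofReal_re]
  have e2 : ∀ w : ℂ, (2 * ((‖w‖ : ℂ)) ^ 2).re = 2 * ‖w‖ ^ 2 := fun w => by
    rw [← ofReal_pow, ← ofReal_ofNat, re_ofReal_mul, ofReal_re]
  have e3 : 2 * (I * deriv f 0 * (-(I * conj (deriv f 0)))) = 2 * (‖deriv f 0‖ : ℂ) ^ 2 := by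
    rw [← mul_conj']; linear_combination (-2 * deriv f 0 * conj (deriv f 0)) * I_sq
  rw [e3] at h
  simp only [e1, e2, mul_neg, neg_re] at h
  convert h using 1
  ring

/-! ### Ray integrals in the logarithmic coordinate -/

lemma image_exp_univ : Real.exp '' univ = Ioi 0 := by
  rw [image_univ, Real.range_exp]

lemma ray_integrand_eq (g : ℂ → ℂ) (ρ u : ℝ) :
    |Real.exp u| • (g ((Real.exp u : ℝ) * exp (ρ * I)) / (Real.exp u : ℝ)) =
      g (exp (u + ρ * I)) := by
  rw [abs_of_pos (Real.exp_pos u), Complex.exp_add, real_smul, ofReal_exp]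
  exact mul_div_cancel₀ _ (Complex.exp_ne_zero _)

lemma rayIntegral_eq (g : ℂ → ℂ) (ρ : ℝ) :
    rayIntegral g ρ = ∫ u : ℝ, g (exp (u + ρ * I)) := by
  rw [rayIntegral, ← image_exp_univ, integral_image_eq_integral_abs_deriv_smul MeasurableSet.univ
    (fun x _ => (Real.hasDerivAt_exp x).hasDerivWithinAt) Real.exp_injective.injOn]
  simp only [ray_integrand_eq, Measure.restrict_univ]

lemma integrableOn_ray_iff (g : ℂ → ℂ) (ρ : ℝ) :
    IntegrableOn (fun t : ℝ => g (t * exp (ρ * I)) / t) (Ioi 0) ↔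
      Integrable fun u : ℝ => g (exp (u + ρ * I)) := by
  rw [← image_exp_univ, integrableOn_image_iff_integrableOn_abs_deriv_smul MeasurableSet.univ
    (fun x _ => (Real.hasDerivAt_exp x).hasDerivWithinAt) Real.exp_injective.injOn]
  simp only [ray_integrand_eq, integrableOn_univ]

/-- The weight `(ζ' + ζ) / (ζ' - ζ)` at `ζ' = e ^ v`. -/
def modelKernel (ζ v : ℂ) : ℂ := (exp v + ζ) / (exp v - ζ)

lemma exp_ne_of_direction_ne {ζ v : ℂ} (h : exp (v.im * I) ≠ ζ / ‖ζ‖) :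
    exp v ≠ ζ := fun he => by
  apply h
  rw [← he, Complex.norm_exp, ofReal_exp, ← Complex.exp_sub]
  congr 1
  linear_combination re_add_im v

lemma differentiableOn_modelKernel {ζ : ℂ} {α β : ℝ}
    (h : ∀ θ ∈ Icc α β, exp (θ * I) ≠ ζ / ‖ζ‖) :
    DifferentiableOn ℂ (modelKernel ζ) {v | v.im ∈ Icc α β} := fun v hv => by
  have : exp v - ζ ≠ 0 := sub_ne_zero.2 (exp_ne_of_direction_ne (h _ hv))
  have h1 : DifferentiableAt ℂ (fun v => exp v + ζ) v := by fun_prop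
  have h2 : DifferentiableAt ℂ (fun v => exp v - ζ) v := by fun_prop
  exact (h1.div h2 this).differentiableWithinAt

/-- The weight is bounded on a strip whose rays do not contain `ζ`. -/
lemma norm_modelKernel_le {ζ : ℂ} (hζ : ζ ≠ 0) {α β : ℝ}
    (h : ∀ θ ∈ Icc α β, exp (θ * I) ≠ ζ / ‖ζ‖) :
    ∃ C, 0 ≤ C ∧ ∀ v : ℂ, v.im ∈ Icc α β → ‖modelKernel ζ v‖ ≤ C := by
  rcases (Icc α β).eq_empty_or_nonempty with he | hne
  · exact ⟨0, le_rfl, fun v hv => by simp [he] at hv⟩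
  have hζn : (0 : ℝ) < ‖ζ‖ := norm_pos_iff.2 hζ
  have hζc : (‖ζ‖ : ℂ) ≠ 0 := by exact_mod_cast hζn.ne'
  have hc : Continuous fun q : ℝ × ℝ => ‖(q.2 : ℂ) * exp (q.1 * I) - (1 - q.2) * (ζ / ‖ζ‖)‖ := by
    fun_prop
  -- By homogeneity it suffices to bound `|ζ' - ζ|` from below for `|ζ'| + |ζ| = 1`.
  obtain ⟨q, hq, hmin⟩ := (isCompact_Icc.prod isCompact_Icc).exists_isMinOn
    (hne.prod (nonempty_Icc.2 (zero_le_one (α := ℝ)))) hc.continuousOn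
  set η := ‖(q.2 : ℂ) * exp (q.1 * I) - (1 - q.2) * (ζ / ‖ζ‖)‖ with hη
  have hpos : 0 < η := by
    rw [hη, norm_pos_iff, sub_ne_zero]
    intro he
    have hn := congrArg norm he
    have hz1 : ‖ζ / ‖ζ‖‖ = 1 := by simp [hζn.ne']
    rw [norm_mul, norm_mul, hz1, norm_exp_ofReal_mul_I, mul_one, mul_one, ← ofReal_one,
      ← ofReal_sub, norm_real, norm_real, Real.norm_of_nonneg hq.2.1,
      Real.norm_of_nonneg (by linarith [hq.2.2])] at hn
    have h2 : q.2 = 1 / 2 := by linarith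
    rw [h2] at he
    apply h q.1 hq.1
    push_cast at he
    linear_combination 2 * he
  refine ⟨η⁻¹, by positivity, fun v hv => ?_⟩
  have hr : 0 < ‖exp v‖ := norm_pos_iff.2 (Complex.exp_ne_zero v)
  have hlow : η * (‖exp v‖ + ‖ζ‖) ≤ ‖exp v - ζ‖ := by
    have hs : 0 < ‖exp v‖ + ‖ζ‖ := by linarith
    have := hmin (a := (v.im, ‖exp v‖ / (‖exp v‖ + ‖ζ‖)))
      ⟨hv, by positivity, by rw [div_le_one hs]; linarith⟩
    simp only [mem_ofPred_eq] at this
    have hsc : ((‖exp v‖ + ‖ζ‖ : ℝ) : ℂ) ≠ 0 := by exact_mod_cast hs.ne'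
    have e : ((‖exp v‖ / (‖exp v‖ + ‖ζ‖) : ℝ) : ℂ) * exp (v.im * I) -
        (1 - ((‖exp v‖ / (‖exp v‖ + ‖ζ‖) : ℝ) : ℂ)) * (ζ / ‖ζ‖) =
        (exp v - ζ) / ((‖exp v‖ + ‖ζ‖ : ℝ) : ℂ) := by
      have e1 : exp v = ‖exp v‖ * exp (v.im * I) := by
        rw [Complex.norm_exp, ofReal_exp, ← Complex.exp_add, re_add_im]
      rw [eq_div_iff hsc, sub_mul, mul_right_comm, mul_right_comm _ (ζ / (‖ζ‖ : ℂ)), sub_mul,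
        ofReal_div, div_mul_cancel₀ _ hsc, ← e1]
      push_cast
      field_simp
      ring
    rw [e, norm_div, norm_real, Real.norm_of_nonneg hs.le, le_div_iff₀ hs] at this
    exact this
  have hpos2 : 0 < ‖exp v - ζ‖ := lt_of_lt_of_le (by positivity) hlow
  rw [modelKernel, norm_div, div_le_iff₀ hpos2]
  calc ‖exp v + ζ‖ ≤ ‖exp v‖ + ‖ζ‖ := norm_add_le _ _
    _ = η⁻¹ * (η * (‖exp v‖ + ‖ζ‖)) := by field_simp
    _ ≤ η⁻¹ * ‖exp v - ζ‖ := by gcongr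

lemma isTemperate_modelKernel {ζ : ℂ} (hζ : ζ ≠ 0) {α : ℝ} (h : exp (α * I) ≠ ζ / ‖ζ‖) :
    IsTemperate fun u : ℝ => modelKernel ζ (u + α * I) := by
  have h' : ∀ θ ∈ Icc α α, exp (θ * I) ≠ ζ / ‖ζ‖ := fun θ hθ => by
    rw [Icc_self, mem_singleton_iff] at hθ; rwa [hθ]
  obtain ⟨C, hC, hb⟩ := norm_modelKernel_le hζ h'
  exact IsTemperate.of_strip (N := 0) (differentiableOn_modelKernel h') hC le_rfl
    (fun v hv => by simpa using hb v hv) ⟨le_rfl, le_rfl⟩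

/-- Rays slightly clockwise of the ray of angle `ρ` do not contain `ζ`. -/
lemma eventually_direction_ne (ζ : ℂ) (ρ : ℝ) :
    ∀ᶠ ε in 𝓝[>] (0 : ℝ), exp ((ρ - ε : ℝ) * I) ≠ ζ / ‖ζ‖ := by
  by_cases h : exp (ρ * I) = ζ / ‖ζ‖
  · filter_upwards [Ioo_mem_nhdsGT Real.two_pi_pos] with ε hε he
    rw [← h, exp_eq_exp_iff_exists_int] at he
    obtain ⟨n, hn⟩ := he
    have hn' : ((ρ - ε : ℝ) : ℂ) = ρ + n * (2 * Real.pi) := by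
      have : I * ((ρ - ε : ℝ) : ℂ) = I * (ρ + n * (2 * Real.pi)) := by linear_combination hn
      exact mul_left_cancel₀ I_ne_zero this
    have hn2 : ρ - ε = ρ + n * (2 * Real.pi) := by exact_mod_cast hn'
    have h1 : (n : ℝ) < 0 := by nlinarith [hε.1, Real.pi_pos]
    have h2 : (-1 : ℝ) < n := by nlinarith [hε.2, Real.pi_pos]
    have h3 : n < 0 := by exact_mod_cast h1
    have h4 : -1 < n := by exact_mod_cast h2
    omega
  · have hc : ContinuousAt (fun ε : ℝ => exp ((ρ - ε : ℝ) * I)) 0 := by fun_prop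
    exact (hc.eventually_ne (by simpa using h)).filter_mono nhdsWithin_le_nhds

/-- The integrand of the model coordinates, as a function on `ℂ^×`. -/
def modelIntegrand (ζ z : ℂ) (φ : ℝ) (ζ' : ℂ) : ℂ :=
  (ζ' + ζ) / (ζ' - ζ) *
    Complex.log (1 - exp (1 / ζ' * z + ζ' * conj z) * ((φ : Real.Angle).toCircle : ℂ))

lemma exp_logX_eq (z : ℂ) (φ : ℝ) (v : ℂ) :
    exp (1 / exp v * z + exp v * conj z) * ((φ : Real.Angle).toCircle : ℂ) =
      exp (logX z φ v) := by
  rw [Real.Angle.toCircle_coe, Circle.coe_exp, ← Complex.exp_add, logX, Complex.exp_neg, one_div]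

lemma modelIntegrand_exp (ζ z : ℂ) (φ : ℝ) (v : ℂ) :
    modelIntegrand ζ z φ (exp v) = modelKernel ζ v * Complex.log (1 - exp (logX z φ v)) := by
  rw [modelIntegrand, exp_logX_eq, modelKernel]

/-- For `z` in a half plane, the limiting integral over the rays clockwise of the ray of angle `ρ`
is a contour integral over a fixed ray. -/
theorem rayIntegralMinus_modelIntegrand {ζ : ℂ} (hζ : ζ ≠ 0) {ρ ε₀ : ℝ} (hε₀ : 0 < ε₀)
    (hπ : ε₀ < Real.pi) (hav : ∀ ε ∈ Ioc 0 ε₀, exp ((ρ - ε : ℝ) * I) ≠ ζ / ‖ζ‖) {z : ℂ}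
    (h1 : InHalfPlane ρ z) (h2 : InHalfPlane (ρ - ε₀) z) (φ : ℝ) :
    RayIntegralMinusConverges (modelIntegrand ζ z φ) ρ ∧
      rayIntegralMinus (modelIntegrand ζ z φ) ρ =
        contourInt (fun u => modelKernel ζ (u + (ρ - ε₀ : ℝ) * I))
          (fun X => Complex.log (1 - X)) (ρ - ε₀) (z, φ) := by
  have hhalf : ∀ ε ∈ Icc 0 ε₀, InHalfPlane (ρ - ε) z := fun ε hε =>
    h2.of_mem_Icc h1 (by linarith) ⟨by linarith [hε.2], by linarith [hε.1]⟩
  have hray : ∀ ε, rayIntegral (modelIntegrand ζ z φ) (ρ - ε) =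
      contourInt (fun u => modelKernel ζ (u + (ρ - ε : ℝ) * I))
        (fun X => Complex.log (1 - X)) (ρ - ε) (z, φ) := fun ε => by
    simp only [rayIntegral_eq, modelIntegrand_exp, contourInt]
  -- No ray between the angles `ρ - ε₀` and `ρ - ε` contains `ζ`, so the integrals do not depend on
  -- `ε`.
  have hconst : ∀ ε ∈ Ioc 0 ε₀, rayIntegral (modelIntegrand ζ z φ) (ρ - ε) =
      contourInt (fun u => modelKernel ζ (u + (ρ - ε₀ : ℝ) * I))
        (fun X => Complex.log (1 - X)) (ρ - ε₀) (z, φ) := fun ε hε => by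
    have hav' : ∀ θ ∈ Icc (ρ - ε₀) (ρ - ε), exp (θ * I) ≠ ζ / ‖ζ‖ := fun θ hθ => by
      have := hav (ρ - θ) ⟨by linarith [hθ.2, hε.1], by linarith [hθ.1]⟩
      rwa [sub_sub_cancel] at this
    obtain ⟨C, hC, hb⟩ := norm_modelKernel_le hζ hav'
    rw [hray]
    refine (contourInt_rotate (N := 0) isDiscFun_log (by linarith [hε.2])
      (differentiableOn_modelKernel hav') hC le_rfl (fun v hv => by simpa using hb v hv)
      (fun θ hθ => ?_) φ).symm
    have := hhalf (ρ - θ) ⟨by linarith [hθ.2, hε.1], by linarith [hθ.1]⟩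
    rwa [sub_sub_cancel] at this
  have hmem : ∀ᶠ ε in 𝓝[>] (0 : ℝ), ε ∈ Ioc 0 ε₀ := Ioc_mem_nhdsGT hε₀
  have hlim : Tendsto (fun ε => rayIntegral (modelIntegrand ζ z φ) (ρ - ε)) (𝓝[>] (0 : ℝ))
      (𝓝 (contourInt (fun u => modelKernel ζ (u + (ρ - ε₀ : ℝ) * I))
        (fun X => Complex.log (1 - X)) (ρ - ε₀) (z, φ))) :=
    tendsto_const_nhds.congr' (by filter_upwards [hmem] with ε hε using (hconst ε hε).symm)
  have heq := hlim.limUnder_eq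
  refine ⟨⟨?_, ?_⟩, heq⟩
  · filter_upwards [hmem] with ε hε
    rw [integrableOn_ray_iff]
    simp only [modelIntegrand_exp]
    exact integrable_integrand (isTemperate_modelKernel hζ (hav ε hε)) isDiscFun_log
      (hhalf ε ⟨hε.1.le, hε.2⟩) φ
  · rw [rayIntegralMinus, heq]
    exact hlim

lemma rayIntegralMinus_add_two_pi_int (g : ℂ → ℂ) (ρ : ℝ) (j : ℤ) :
    rayIntegralMinus g (ρ + 2 * Real.pi * j) = rayIntegralMinus g ρ := by
  have : ∀ ε, rayIntegral g (ρ + 2 * Real.pi * j - ε) = rayIntegral g (ρ - ε) := fun ε => by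
    rw [rayIntegral_eq, rayIntegral_eq, show ρ + 2 * Real.pi * j - ε = ρ - ε + 2 * Real.pi * j by
      ring]
    simp only [exp_add_two_pi_int]
  simp only [rayIntegralMinus, this]

/-- A rotation angle `ε₀` that works near `z`. -/
lemma exists_rotation (ζ : ℂ) {ρ : ℝ} {z : ℂ} (h : InHalfPlane ρ z) :
    ∃ ε₀, 0 < ε₀ ∧ ε₀ < Real.pi ∧ (∀ ε ∈ Ioc 0 ε₀, exp ((ρ - ε : ℝ) * I) ≠ ζ / ‖ζ‖) ∧
      InHalfPlane (ρ - ε₀) z := by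
  have h1 : ∀ᶠ ε in 𝓝[>] (0 : ℝ), InHalfPlane (ρ - ε) z := by
    have hc : ContinuousAt (fun ε : ℝ => (z * exp (-(((ρ - ε : ℝ) : ℂ) * I))).re) 0 := by fun_prop
    exact (hc.eventually (gt_mem_nhds (by simpa [InHalfPlane] using h))).filter_mono
      nhdsWithin_le_nhds
  have hev := (eventually_direction_ne ζ ρ).and (h1.and (Ioo_mem_nhdsGT Real.pi_pos))
  obtain ⟨b, hb, hsub⟩ := (mem_nhdsGT_iff_exists_Ioo_subset).1 hev
  have hb' : (0 : ℝ) < b := hb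
  refine ⟨b / 2, half_pos hb', ?_, fun ε hε => ?_, ?_⟩
  · exact (hsub ⟨half_pos hb', half_lt_self hb'⟩).2.2.2
  · exact (hsub ⟨hε.1, by linarith [hε.2]⟩).1
  · exact (hsub ⟨half_pos hb', half_lt_self hb'⟩).2.1

/-! ### Sector indices -/

namespace SectorialDecomposition

variable (S : SectorialDecomposition)

lemma width_pos : 0 < Real.pi / S.K :=
  div_pos Real.pi_pos (by exact_mod_cast (by have := S.five_le; omega : 0 < S.K))

lemma five_mul_width_le : 5 * (Real.pi / S.K) ≤ Real.pi := by
  have hK : (5 : ℝ) ≤ S.K := by exact_mod_cast S.five_le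
  rw [mul_div_assoc', div_le_iff₀ (by linarith)]
  nlinarith [Real.pi_pos]

lemma rayAngle_add_mul (n j : ℤ) :
    S.rayAngle (n + 2 * S.K * j) = S.rayAngle n + 2 * Real.pi * j := by
  have hK : (S.K : ℝ) ≠ 0 := by exact_mod_cast (by have := S.five_le; omega : S.K ≠ 0)
  simp only [rayAngle]
  push_cast
  field_simp
  ring

lemma arg_mem_Ico_index (w : ℂ) :
    arg w ∈ Ico (S.rayAngle (S.index w - 1)) (S.rayAngle (S.index w)) := by
  have hφ := S.width_pos
  have h := Int.floor_le ((arg w - S.ρ₀) / (Real.pi / S.K))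
  have h' := Int.lt_floor_add_one ((arg w - S.ρ₀) / (Real.pi / S.K))
  rw [le_div_iff₀ hφ] at h
  rw [div_lt_iff₀ hφ] at h'
  constructor
  · simp only [rayAngle, index, add_sub_cancel_right]; linarith
  · simp only [rayAngle, index]; push_cast; linarith

lemma index_eq_of_arg {w : ℂ} {n : ℤ}
    (h : arg w ∈ Ico (S.rayAngle (n - 1)) (S.rayAngle n)) : S.index w = n := by
  have hφ := S.width_pos
  have : ⌊(arg w - S.ρ₀) / (Real.pi / S.K)⌋ = n - 1 := by
    rw [Int.floor_eq_iff, le_div_iff₀ hφ, div_lt_iff₀ hφ]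
    obtain ⟨h1, h2⟩ := h
    simp only [rayAngle] at h1 h2
    push_cast at h1 h2 ⊢
    constructor <;> linarith
  rw [index, this]; ring

/-- Away from the rays, the sector index is locally constant modulo `2 K`. -/
lemma eventually_index_eq {w₀ : ℂ} (h0 : w₀ ≠ 0) (h : ∀ n : ℤ, w₀ ∉ S.ray n) :
    ∀ᶠ w in 𝓝 w₀, ∃ j : ℤ, S.index w = S.index w₀ + 2 * S.K * j := by
  obtain ⟨h1, h2⟩ := S.arg_mem_Ico_index w₀
  have h1' : S.rayAngle (S.index w₀ - 1) < arg w₀ := by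
    refine lt_of_le_of_ne h1 fun he => h (S.index w₀ - 1) ⟨‖w₀‖, norm_pos_iff.2 h0, ?_⟩
    rw [he, norm_mul_exp_arg_mul_I]
  -- A continuous branch of the argument near `w₀`.
  have hc : ContinuousAt (fun w => arg w₀ + arg (w / w₀)) w₀ := by
    have ha : ContinuousAt arg (w₀ / w₀) := by
      rw [div_self h0]
      exact continuousAt_arg one_mem_slitPlane
    have hq : ContinuousAt (fun w => w / w₀) w₀ := by fun_prop
    exact continuousAt_const.add (ContinuousAt.comp (f := fun w => w / w₀) ha hq)
  have h3 : arg w₀ + arg (w₀ / w₀) = arg w₀ := by rw [div_self h0, arg_one, add_zero]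
  filter_upwards [hc.eventually (lt_mem_nhds (h3.symm ▸ h1')),
    hc.eventually (gt_mem_nhds (h3.symm ▸ h2)), isOpen_ne.mem_nhds h0] with w hw1 hw2 hw0
  have hang : ((arg w : ℝ) : Real.Angle) = ((arg w₀ + arg (w / w₀) : ℝ) : Real.Angle) := by
    rw [Real.Angle.coe_add, ← arg_mul_coe_angle h0 (div_ne_zero hw0 h0), mul_div_cancel₀ w h0]
  obtain ⟨j, hj⟩ := Real.Angle.angle_eq_iff_two_pi_dvd_sub.1 hang
  refine ⟨j, S.index_eq_of_arg ?_⟩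
  rw [show S.index w₀ + 2 * (S.K : ℤ) * j - 1 = (S.index w₀ - 1) + 2 * S.K * j by ring,
    rayAngle_add_mul, rayAngle_add_mul]
  constructor <;> linarith

/-- The contours of the model coordinates lie in the half plane of decay. -/
lemma inHalfPlane_rayAngle {z : ℂ} (hz : z ≠ 0) {k : ℤ} (hk : k = 0 ∨ k = 1 ∨ k = -1) :
    InHalfPlane (S.rayAngle (S.index (-z) + k)) z := by
  set ρ := S.rayAngle (S.index (-z) + k) with hρ
  obtain ⟨h1, h2⟩ := S.arg_mem_Ico_index (-z)
  have hφ := S.width_pos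
  have h5 := S.five_mul_width_le
  -- The ray is at most two sectors away from the direction of `-z`, and `2 π / K < π / 2` for `K ≥
  -- 5`.
  have hd : -(Real.pi / 2) < ρ - arg (-z) ∧ ρ - arg (-z) < Real.pi / 2 := by
    simp only [rayAngle] at h1 h2 hρ
    push_cast at h1 h2 hρ
    rcases hk with rfl | rfl | rfl <;> push_cast at hρ <;> constructor <;> linarith
  have e : z * exp (-(ρ * I)) = ((-‖z‖ : ℝ) : ℂ) * exp (((-(ρ - arg (-z)) : ℝ) : ℂ) * I) := by
    have h := norm_mul_exp_arg_mul_I (-z)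
    rw [norm_neg] at h
    have e2 : exp (((-(ρ - arg (-z)) : ℝ) : ℂ) * I) = exp (arg (-z) * I) * exp (-(ρ * I)) := by
      rw [← Complex.exp_add]; congr 1; push_cast; ring
    rw [e2]
    push_cast
    linear_combination exp (-(ρ * I)) * h
  rw [InHalfPlane, e, re_ofReal_mul, exp_ofReal_mul_I_re, Real.cos_neg]
  have := Real.cos_pos_of_mem_Ioo hd
  have := norm_pos_iff.2 hz
  nlinarith

end SectorialDecomposition

/-! ### Holomorphic functions of several variables -/

section Several

variable {E : Type*} [NormedAddCommGroup E] [NormedSpace ℂ E] {f : E → ℂ} {s : Set E}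

/-- Restricting a holomorphic function to a complex line. -/
lemma hasDerivAt_line {x v : E} {w : ℂ} (hf : DifferentiableAt ℂ f (x + w • v)) :
    HasDerivAt (fun ξ : ℂ => f (x + ξ • v)) (fderiv ℂ f (x + w • v) v) w := by
  have h : HasDerivAt (fun ξ : ℂ => x + ξ • v) v w := by
    simpa using ((hasDerivAt_id w).smul_const v).const_add x
  exact hf.hasFDerivAt.comp_hasDerivAt w h

lemma continuous_line (x v : E) : Continuous fun ξ : ℂ => x + ξ • v := by fun_prop

/-- Cauchy's estimate for the total derivative. -/
lemma norm_fderiv_le_of_ball {x : E} {ρ M : ℝ} (hρ : 0 < ρ) (hM : 0 ≤ M)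
    (hf : ∀ y ∈ ball x ρ, DifferentiableAt ℂ f y) (hb : ∀ y ∈ ball x ρ, ‖f y‖ ≤ M) :
    ‖fderiv ℂ f x‖ ≤ M / (ρ / 2) := by
  refine ContinuousLinearMap.opNorm_le_bound _ (by positivity) fun w => ?_
  rcases eq_or_ne w 0 with rfl | hw
  · simp
  have hw' : 0 < ‖w‖ := norm_pos_iff.2 hw
  set q : ℝ := ρ / 2 / ‖w‖ with hq
  have hq0 : 0 < q := by positivity
  have hmem : ∀ ξ ∈ closedBall (0 : ℂ) q, x + ξ • w ∈ ball x ρ := fun ξ hξ => by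
    rw [mem_ball_iff_norm, add_sub_cancel_left, norm_smul]
    rw [mem_closedBall_zero_iff] at hξ
    calc ‖ξ‖ * ‖w‖ ≤ q * ‖w‖ := by gcongr
      _ = ρ / 2 := by rw [hq]; field_simp
      _ < ρ := by linarith
  have hd : DiffContOnCl ℂ (fun ξ : ℂ => f (x + ξ • w)) (ball 0 q) := by
    refine DifferentiableOn.diffContOnCl fun ξ hξ => ?_
    rw [closure_ball _ hq0.ne'] at hξ
    exact (hasDerivAt_line (hf _ (hmem ξ hξ))).differentiableAt.differentiableWithinAt
  have h1 := norm_deriv_le_of_forall_mem_sphere_norm_le hq0 hd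
    (C := M) fun ξ hξ => hb _ (hmem ξ (sphere_subset_closedBall hξ))
  have h2 := (hasDerivAt_line (f := f) (x := x) (v := w) (w := 0)
    (hf _ (by simpa using hρ))).deriv
  rw [h2] at h1
  simp only [zero_smul, add_zero] at h1
  calc ‖fderiv ℂ f x w‖ ≤ M / q := h1
    _ = M / (ρ / 2) * ‖w‖ := by rw [hq]; field_simp

variable [FiniteDimensional ℂ E]

/-- The directional derivatives of a holomorphic function of several variables are holomorphic:
they are given by Cauchy's integral along complex lines, which may be differentiated under the
integral sign. -/
theorem differentiableOn_fderiv_apply (hs : IsOpen s) (hf : DifferentiableOn ℂ f s) (v : E) :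
    DifferentiableOn ℂ (fun x => fderiv ℂ f x v) s := by
  intro x₀ hx₀
  have : ProperSpace E := FiniteDimensional.proper ℂ E
  obtain ⟨ρ, hρ, hball⟩ := nhds_basis_closedBall.mem_iff.1 (hs.mem_nhds hx₀)
  have hda : ∀ y ∈ closedBall x₀ ρ, DifferentiableAt ℂ f y := fun y hy =>
    hf.differentiableAt (hs.mem_nhds (hball hy))
  obtain ⟨M, hM⟩ := (isCompact_closedBall x₀ ρ).exists_bound_of_continuousOn
    (f := f) fun y hy => (hda y hy).continuousAt.continuousWithinAt
  have hM0 : 0 ≤ M := (norm_nonneg _).trans (hM x₀ (mem_closedBall_self hρ.le))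
  have hder : ∀ y ∈ ball x₀ (ρ / 2), ‖fderiv ℂ f y‖ ≤ M / (ρ / 2 / 2) := fun y hy => by
    have hsub : ball y (ρ / 2) ⊆ closedBall x₀ ρ := by
      refine (ball_subset_ball' ?_).trans ball_subset_closedBall
      rw [mem_ball] at hy; linarith
    exact norm_fderiv_le_of_ball (by positivity) hM0 (fun z hz => hda z (hsub hz))
      fun z hz => hM z (hsub hz)
  set δ : ℝ := ρ / 8 / (‖v‖ + 1) with hδ
  have hδ0 : 0 < δ := by positivity
  have hδv : δ * ‖v‖ ≤ ρ / 8 := by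
    rw [hδ, div_mul_eq_mul_div, div_le_iff₀ (by positivity)]
    nlinarith [norm_nonneg v]
  have hmem : ∀ y ∈ ball x₀ (ρ / 8), ∀ ξ ∈ closedBall (0 : ℂ) δ, y + ξ • v ∈ ball x₀ (ρ / 2) :=
    fun y hy ξ hξ => by
    rw [mem_closedBall_zero_iff] at hξ
    rw [mem_ball_iff_norm] at hy ⊢
    calc ‖y + ξ • v - x₀‖ = ‖(y - x₀) + ξ • v‖ := by congr 1; abel
      _ ≤ ‖y - x₀‖ + ‖ξ‖ * ‖v‖ := by rw [← norm_smul]; exact norm_add_le _ _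
      _ ≤ ‖y - x₀‖ + δ * ‖v‖ := by gcongr
      _ < ρ / 2 := by linarith
  have hsub2 : ball x₀ (ρ / 2) ⊆ closedBall x₀ ρ :=
    (ball_subset_ball (by linarith)).trans ball_subset_closedBall
  -- Cauchy's formula on the circle of radius `δ`
  have hcauchy : ∀ y ∈ ball x₀ (ρ / 8), fderiv ℂ f y v =
      (2 * Real.pi * I : ℂ)⁻¹ • ∫ θ in (0 : ℝ)..2 * Real.pi,
        (deriv (circleMap 0 δ) θ * ((circleMap 0 δ θ - 0) ^ 2)⁻¹) • f (y + circleMap 0 δ θ • v) := by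
    intro y hy
    have hU : IsOpen ((fun ξ : ℂ => y + ξ • v) ⁻¹' ball x₀ (ρ / 2)) :=
      isOpen_ball.preimage (continuous_line y v)
    have hd : DifferentiableOn ℂ (fun ξ : ℂ => f (y + ξ • v))
        ((fun ξ : ℂ => y + ξ • v) ⁻¹' ball x₀ (ρ / 2)) := fun ξ hξ =>
      (hasDerivAt_line (hda _ (hsub2 hξ))).differentiableAt.differentiableWithinAt
    have h1 := two_pi_I_inv_smul_circleIntegral_sub_sq_inv_smul_of_differentiable hU
      (hmem y hy) hd (mem_ball_self hδ0)
    have h2 := (hasDerivAt_line (f := f) (x := y) (v := v) (w := 0)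
      (hda _ (hsub2 (hmem y hy 0 (by simp [hδ0.le]))))).deriv
    rw [h2] at h1
    simp only [zero_smul, add_zero] at h1
    rw [← h1, circleIntegral]
    simp only [smul_eq_mul, mul_assoc]
  have hcirc : ∀ θ : ℝ, circleMap 0 δ θ ∈ closedBall (0 : ℂ) δ := fun θ =>
    circleMap_mem_closedBall 0 hδ0.le θ
  have hk : Continuous fun θ : ℝ => deriv (circleMap 0 δ) θ * ((circleMap 0 δ θ - 0) ^ 2)⁻¹ := by
    simp only [deriv_circleMap, sub_zero]
    refine ((continuous_circleMap 0 δ).mul continuous_const).mul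
      (((continuous_circleMap 0 δ).pow 2).inv₀ fun θ => ?_)
    simp [circleMap, hδ0.ne']
  have hFc : ∀ y ∈ ball x₀ (ρ / 8), Continuous fun θ : ℝ =>
      (deriv (circleMap 0 δ) θ * ((circleMap 0 δ θ - 0) ^ 2)⁻¹) • f (y + circleMap 0 δ θ • v) := by
    intro y hy
    refine hk.smul (continuous_iff_continuousAt.2 fun θ => ?_)
    have h1 := (hda _ (hsub2 (hmem y hy _ (hcirc θ)))).continuousAt
    exact ContinuousAt.comp (f := fun θ : ℝ => y + circleMap 0 δ θ • v) h1
      (((continuous_line y v).comp (continuous_circleMap 0 δ)).continuousAt)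
  borelize E
  have hdiff := intervalIntegral.hasFDerivAt_integral_of_dominated_of_fderiv_le (𝕜 := ℂ)
    (μ := volume) (a := 0) (b := 2 * Real.pi) (x₀ := x₀) (s := ball x₀ (ρ / 8))
    (F := fun y θ => (deriv (circleMap 0 δ) θ * ((circleMap 0 δ θ - 0) ^ 2)⁻¹) •
      f (y + circleMap 0 δ θ • v))
    (F' := fun y θ => (deriv (circleMap 0 δ) θ * ((circleMap 0 δ θ - 0) ^ 2)⁻¹) •
      fderiv ℂ f (y + circleMap 0 δ θ • v))
    (bound := fun θ => ‖deriv (circleMap 0 δ) θ * ((circleMap 0 δ θ - 0) ^ 2)⁻¹‖ *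
      (M / (ρ / 2 / 2)))
    (ball_mem_nhds _ (by positivity))
    (by
      filter_upwards [ball_mem_nhds x₀ (by positivity : (0 : ℝ) < ρ / 8)] with y hy
      exact (hFc y hy).aestronglyMeasurable)
    ((hFc x₀ (mem_ball_self (by positivity))).intervalIntegrable _ _)
    (by
      refine hk.aestronglyMeasurable.smul ?_
      refine ((measurable_fderiv ℂ f).comp ?_).aestronglyMeasurable
      exact ((continuous_line x₀ v).comp (continuous_circleMap 0 δ)).measurable)
    (by
      refine ae_of_all _ fun θ _ y hy => ?_
      rw [norm_smul]
      exact mul_le_mul_of_nonneg_left (hder _ (hmem y hy _ (hcirc θ))) (norm_nonneg _))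
    ((hk.norm.mul continuous_const).intervalIntegrable _ _)
    (by
      refine ae_of_all _ fun θ _ y hy => ?_
      have h1 := (hda _ (hsub2 (hmem y hy _ (hcirc θ)))).hasFDerivAt
      have h2 : HasFDerivAt (fun x => f (x + circleMap 0 δ θ • v))
          (fderiv ℂ f (y + circleMap 0 δ θ • v)) y := (hasFDerivAt_comp_add_right _).2 h1
      exact h2.const_smul (deriv (circleMap 0 δ) θ * ((circleMap 0 δ θ - 0) ^ 2)⁻¹))
  refine DifferentiableAt.differentiableWithinAt ?_
  refine DifferentiableAt.congr_of_eventuallyEq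
    (hdiff.differentiableAt.const_smul (2 * Real.pi * I : ℂ)⁻¹) ?_
  filter_upwards [ball_mem_nhds x₀ (by positivity : (0 : ℝ) < ρ / 8)] with y hy
  exact hcauchy y hy

/-- A holomorphic function of several variables is smooth. -/
theorem contDiffOn_nat_of_differentiableOn (hs : IsOpen s) (n : ℕ) :
    ∀ {f : E → ℂ}, DifferentiableOn ℂ f s → ContDiffOn ℂ n f s := by
  induction n with
  | zero => exact fun hf => contDiffOn_zero.2 hf.continuousOn
  | succ n ih =>
    intro f hf
    push_cast
    refine (contDiffOn_succ_iff_fderiv_of_isOpen hs).2 ⟨hf, by simp, ?_⟩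
    exact contDiffOn_clm_apply.2 fun v => ih (differentiableOn_fderiv_apply hs hf v)

theorem contDiffAt_of_differentiableOn (hs : IsOpen s) (hf : DifferentiableOn ℂ f s) {x : E}
    (hx : x ∈ s) : ContDiffAt ℂ ∞ f x :=
  contDiffAt_infty.2 fun n =>
    (contDiffOn_nat_of_differentiableOn hs n hf).contDiffAt (hs.mem_nhds hx)

end Several

/-! ### Derivatives in the coordinates given by `r` independent functions -/

section Slope

variable {r : ℕ}

/-- The matrix of `r` linear forms. -/
def formMatrix (α : Fin r → (Fin r → ℂ) →L[ℂ] ℂ) : Matrix (Fin r) (Fin r) ℂ :=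
  Matrix.of fun i k => α i (Pi.single k 1)

/-- The value `β t` of a linear form `β` on the vector `t` with `α i t = v i` for all `i`, when the
linear forms `α i` are linearly independent. If `α` and `β` are the differentials of holomorphic
functions `a i` and `b`, this is `∑ i, v i * ∂ b / ∂ a i`. -/
def slope (α : Fin r → (Fin r → ℂ) →L[ℂ] ℂ) (β : (Fin r → ℂ) →L[ℂ] ℂ) (v : Fin r → ℂ) : ℂ :=
  β ((formMatrix α)⁻¹.mulVec v)

lemma apply_eq_sum_single (β : (Fin r → ℂ) →L[ℂ] ℂ) (t : Fin r → ℂ) :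
    β t = ∑ k, β (Pi.single k 1) * t k := by
  conv_lhs => rw [← Finset.univ_sum_single t]
  rw [map_sum]
  refine Finset.sum_congr rfl fun k _ => ?_
  have : (Pi.single k (t k) : Fin r → ℂ) = t k • Pi.single k 1 := by
    rw [← Pi.single_smul]; simp
  rw [this, map_smul, smul_eq_mul, mul_comm]

lemma formMatrix_mulVec (α : Fin r → (Fin r → ℂ) →L[ℂ] ℂ) (t : Fin r → ℂ) (i : Fin r) :
    (formMatrix α).mulVec t i = α i t := by
  rw [apply_eq_sum_single]
  rfl

lemma apply_formMatrix_inv {α : Fin r → (Fin r → ℂ) →L[ℂ] ℂ} (h : (formMatrix α).det ≠ 0)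
    (v : Fin r → ℂ) (i : Fin r) : α i ((formMatrix α)⁻¹.mulVec v) = v i := by
  rw [← formMatrix_mulVec, Matrix.mulVec_mulVec, Matrix.mul_nonsing_inv _ (isUnit_iff_ne_zero.2 h),
    Matrix.one_mulVec]

lemma formMatrix_comp (α : Fin r → (Fin r → ℂ) →L[ℂ] ℂ) (T : (Fin r → ℂ) →L[ℂ] (Fin r → ℂ)) :
    formMatrix (fun i => (α i).comp T) = formMatrix α * LinearMap.toMatrix' (T : (Fin r → ℂ) →ₗ[ℂ] _) := by
  ext i k
  simp only [formMatrix, Matrix.of_apply, ContinuousLinearMap.comp_apply, Matrix.mul_apply,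
    LinearMap.toMatrix'_apply]
  rw [apply_eq_sum_single (α i)]
  refine Finset.sum_congr rfl fun l _ => ?_
  simp

/-- The slope does not depend on the linear coordinates of the tangent space. -/
lemma slope_comp (α : Fin r → (Fin r → ℂ) →L[ℂ] ℂ) (β : (Fin r → ℂ) →L[ℂ] ℂ) (v : Fin r → ℂ)
    (T : (Fin r → ℂ) ≃L[ℂ] (Fin r → ℂ)) :
    slope (fun i => (α i).comp (T : (Fin r → ℂ) →L[ℂ] (Fin r → ℂ))) (β.comp (T : _ →L[ℂ] _)) v =
      slope α β v := by
  have hT : (LinearMap.toMatrix' ((T : (Fin r → ℂ) →L[ℂ] (Fin r → ℂ)) :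
      (Fin r → ℂ) →ₗ[ℂ] (Fin r → ℂ))) *
      (LinearMap.toMatrix' ((T.symm : (Fin r → ℂ) →L[ℂ] (Fin r → ℂ)) :
        (Fin r → ℂ) →ₗ[ℂ] (Fin r → ℂ))) = 1 := by
    rw [← LinearMap.toMatrix'_comp]
    convert LinearMap.toMatrix'_id
    ext; simp
  rw [slope, slope, formMatrix_comp, Matrix.mul_inv_rev, ContinuousLinearMap.comp_apply,
    ← Matrix.mulVec_mulVec, Matrix.inv_eq_right_inv hT]
  congr 1
  have h2 : ∀ (L : (Fin r → ℂ) →L[ℂ] (Fin r → ℂ)) (w : Fin r → ℂ),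
      (LinearMap.toMatrix' (L : (Fin r → ℂ) →ₗ[ℂ] (Fin r → ℂ))).mulVec w = L w := fun L w => by
    rw [LinearMap.toMatrix'_mulVec]; rfl
  rw [h2]
  simp

lemma det_formMatrix_comp_ne_zero {α : Fin r → (Fin r → ℂ) →L[ℂ] ℂ}
    (h : (formMatrix α).det ≠ 0) (T : (Fin r → ℂ) ≃L[ℂ] (Fin r → ℂ)) :
    (formMatrix fun i => (α i).comp (T : (Fin r → ℂ) →L[ℂ] (Fin r → ℂ))).det ≠ 0 := by
  rw [formMatrix_comp, Matrix.det_mul]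
  refine mul_ne_zero h ?_
  rw [LinearMap.det_toMatrix']
  exact (LinearEquiv.isUnit_det' T.toLinearEquiv).ne_zero

lemma differentiableAt_det {E : Type*} [NormedAddCommGroup E] [NormedSpace ℂ E] {n : Type*}
    [Fintype n] [DecidableEq n] {A : E → Matrix n n ℂ} {x : E}
    (h : ∀ i j, DifferentiableAt ℂ (fun z => A z i j) x) :
    DifferentiableAt ℂ (fun z => (A z).det) x := by
  simp only [Matrix.det_apply]
  refine DifferentiableAt.fun_sum fun σ _ => DifferentiableAt.const_smul ?_ _
  exact (HasFDerivAt.finsetProd (u := Finset.univ) (g := fun i z => A z (σ i) i)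
    fun i _ => (h (σ i) i).hasFDerivAt).differentiableAt

lemma differentiableAt_inv_apply {E : Type*} [NormedAddCommGroup E] [NormedSpace ℂ E] {n : Type*}
    [Fintype n] [DecidableEq n] {A : E → Matrix n n ℂ} {x : E}
    (h : ∀ i j, DifferentiableAt ℂ (fun z => A z i j) x) (hdet : (A x).det ≠ 0) (i j : n) :
    DifferentiableAt ℂ (fun z => (A z)⁻¹ i j) x := by
  simp only [Matrix.inv_def, Matrix.smul_apply, Ring.inverse_eq_inv', smul_eq_mul,
    Matrix.adjugate_apply]
  refine ((differentiableAt_det h).inv hdet).mul (differentiableAt_det fun k l => ?_)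
  simp only [Matrix.updateRow_apply]
  split_ifs
  · exact differentiableAt_const _
  · exact h _ _

/-- Derivatives with respect to holomorphic coordinates are holomorphic. -/
lemma differentiableAt_slope {s : Set (Fin r → ℂ)} (hs : IsOpen s) {a : Fin r → (Fin r → ℂ) → ℂ}
    {b : (Fin r → ℂ) → ℂ} (ha : ∀ i, DifferentiableOn ℂ (a i) s) (hb : DifferentiableOn ℂ b s)
    {x : Fin r → ℂ} (hx : x ∈ s) (hdet : (formMatrix fun i => fderiv ℂ (a i) x).det ≠ 0)
    (v : Fin r → ℂ) :
    DifferentiableAt ℂ (fun z => slope (fun i => fderiv ℂ (a i) z) (fderiv ℂ b z) v) x := by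
  have hd : ∀ {f : (Fin r → ℂ) → ℂ}, DifferentiableOn ℂ f s → ∀ w,
      DifferentiableAt ℂ (fun z => fderiv ℂ f z w) x := fun hf w =>
    (differentiableOn_fderiv_apply hs hf w).differentiableAt (hs.mem_nhds hx)
  have h : ∀ z, slope (fun i => fderiv ℂ (a i) z) (fderiv ℂ b z) v =
      ∑ k, fderiv ℂ b z (Pi.single k 1) *
        ∑ j, (formMatrix fun i => fderiv ℂ (a i) z)⁻¹ k j * v j := fun z => by
    rw [slope, apply_eq_sum_single]
    rfl
  simp only [h]
  refine DifferentiableAt.fun_sum fun k _ => (hd hb _).mul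
    (DifferentiableAt.fun_sum fun j _ => DifferentiableAt.mul_const ?_ _)
  exact differentiableAt_inv_apply (fun i l => hd (ha i) _) hdet k j

end Slope

/-! ### Identity theorems -/

section Identity

lemma _root_.IsPreconnected.iff_of_locally {X : Type*} [TopologicalSpace X] {s : Set X}
    (hs : IsPreconnected s) {P : X → Prop} (h : ∀ x ∈ s, ∀ᶠ y in 𝓝[s] x, (P y ↔ P x)) {x y : X}
    (hx : x ∈ s) (hy : y ∈ s) : P x ↔ P y := by
  classical
  have hc : ContinuousOn (fun x => decide (P x)) s := fun x hx => by
    refine ContinuousWithinAt.congr_of_eventuallyEq continuousWithinAt_const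
      (f := fun _ => decide (P x)) ?_ rfl
    filter_upwards [h x hx] with y hy
    simp [hy]
  simpa using hs.constant hc hx hy

lemma isPreconnected_punctured_ball (c : ℂ) (ρ : ℝ) : IsPreconnected (ball c ρ \ {c}) := by
  rcases le_or_gt ρ 0 with hρ | hρ
  · simp [ball_eq_empty.2 hρ, isPreconnected_empty]
  have h : ball c ρ \ {c} = (fun w => c + exp w) '' {w : ℂ | w.re < Real.log ρ} := by
    ext w
    constructor
    · rintro ⟨hw, hne⟩
      have h0 : w - c ≠ 0 := sub_ne_zero.2 hne
      refine ⟨log (w - c), ?_, by simp [exp_log h0]⟩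
      change (log (w - c)).re < _
      rw [log_re]
      exact Real.log_lt_log (norm_pos_iff.2 h0) (mem_ball_iff_norm.1 hw)
    · rintro ⟨w, hw, rfl⟩
      refine ⟨?_, by simp [exp_ne_zero]⟩
      rw [mem_ball_iff_norm, add_sub_cancel_left, norm_exp]
      exact (Real.lt_log_iff_exp_lt hρ).1 hw
  rw [h]
  exact ((convex_halfSpace_re_lt _).isPreconnected).image _ (by fun_prop)

/-- A predicate that is locally constant outside the zeros of a holomorphic function of one
variable, not identically zero, is constant: the zeros do not disconnect. -/
lemma iff_of_locally_off_zeros {T : Set ℂ} (hTo : IsOpen T) (hT : IsPreconnected T) {q : ℂ → ℂ}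
    (hq : DifferentiableOn ℂ q T) {P : ℂ → Prop}
    (hP : ∀ w ∈ T, q w ≠ 0 → ∀ᶠ w' in 𝓝 w, (P w' ↔ P w)) {x y : ℂ} (hx : x ∈ T) (hy : y ∈ T)
    (hqx : q x ≠ 0) (hqy : q y ≠ 0) : P x ↔ P y := by
  have han : AnalyticOnNhd ℂ q T := hq.analyticOnNhd hTo
  have hne : ∀ w ∈ T, ∀ᶠ w' in 𝓝[≠] w, q w' ≠ 0 := fun w hw => by
    by_contra hcon
    refine hqx (han.eqOn_zero_of_preconnected_of_frequently_eq_zero hT hw ?_ hx)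
    exact fun h' => hcon h'
  -- near each point, `P` is constant on a punctured disc
  have key : ∀ w ∈ T, ∃ ρ > 0, ball w ρ ⊆ T ∧ ∀ w₁ ∈ ball w ρ \ {w}, q w₁ ≠ 0 ∧
      ∀ w₂ ∈ ball w ρ \ {w}, (P w₁ ↔ P w₂) := fun w hw => by
    have h1 := (hne w hw)
    rw [eventually_nhdsWithin_iff] at h1
    obtain ⟨ρ, hρ, hb⟩ := Metric.eventually_nhds_iff_ball.1 (h1.and (hTo.mem_nhds hw))
    refine ⟨ρ, hρ, fun z hz => (hb z hz).2, fun w₁ h₁ => ⟨(hb _ h₁.1).1 h₁.2, fun w₂ h₂ => ?_⟩⟩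
    refine (isPreconnected_punctured_ball w ρ).iff_of_locally (fun z hz => ?_) h₁ h₂
    exact (hP z (hb z hz.1).2 ((hb z hz.1).1 hz.2)).filter_mono nhdsWithin_le_nhds
  have hQ : ∀ w ∈ T, q w ≠ 0 → ((∀ᶠ w' in 𝓝[≠] w, P w') ↔ P w) := fun w hw hqw => by
    have h1 : ∀ᶠ w' in 𝓝[≠] w, (P w' ↔ P w) := (hP w hw hqw).filter_mono nhdsWithin_le_nhds
    rw [eventually_congr h1, eventually_const]
  rw [← hQ x hx hqx, ← hQ y hy hqy]
  refine hT.iff_of_locally (P := fun w => ∀ᶠ w' in 𝓝[≠] w, P w') (fun w hw => ?_) hx hy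
  obtain ⟨ρ, hρ, hsub, hb⟩ := key w hw
  refine Filter.Eventually.filter_mono nhdsWithin_le_nhds ?_
  filter_upwards [ball_mem_nhds w hρ] with w₁ hw₁
  rcases eq_or_ne w₁ w with rfl | hne'
  · rfl
  rw [hQ w₁ (hsub hw₁) (hb w₁ ⟨hw₁, hne'⟩).1]
  have h2 : ∀ᶠ w' in 𝓝[≠] w, (P w' ↔ P w₁) := by
    rw [eventually_nhdsWithin_iff]
    filter_upwards [ball_mem_nhds w hρ] with w' hw' hne''
    exact (hb w' ⟨hw', hne''⟩).2 w₁ ⟨hw₁, hne'⟩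
  rw [eventually_congr h2, eventually_const]

variable {E : Type*} [NormedAddCommGroup E] [NormedSpace ℂ E]

lemma isOpen_line_preimage {s : Set E} (hs : IsOpen s) (x v : E) :
    IsOpen {w : ℂ | x + w • v ∈ s} := hs.preimage (continuous_line x v)

lemma isPreconnected_line_preimage [NormedSpace ℝ E] [IsScalarTower ℝ ℂ E] {s : Set E}
    (hs : Convex ℝ s) (x v : E) : IsPreconnected {w : ℂ | x + w • v ∈ s} := by
  refine Convex.isPreconnected fun w hw w' hw' a b ha hb hab => ?_
  have := hs hw hw' ha hb hab
  change x + (a • w + b • w') • v ∈ s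
  convert! this using 1
  rw [smul_add, smul_add, add_add_add_comm, ← add_smul, hab, one_smul, add_smul, smul_assoc,
    smul_assoc]

lemma differentiableOn_line {s : Set E} {f : E → ℂ} (hs : IsOpen s) (hf : DifferentiableOn ℂ f s)
    (x v : E) : DifferentiableOn ℂ (fun w : ℂ => f (x + w • v)) {w : ℂ | x + w • v ∈ s} :=
  fun _ hw => (hasDerivAt_line (hf.differentiableAt (hs.mem_nhds hw))).differentiableAt
    |>.differentiableWithinAt

/-- A holomorphic function on a convex open set, real near one point, is real. -/
theorem im_eq_zero_of_eventually [NormedSpace ℝ E] [IsScalarTower ℝ ℂ E] {s : Set E} {f : E → ℂ}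
    (hs : IsOpen s) (hc : Convex ℝ s) (hf : DifferentiableOn ℂ f s) {x y : E} (hx : x ∈ s)
    (hy : y ∈ s) (h : ∀ᶠ z in 𝓝 x, (f z).im = 0) : (f y).im = 0 := by
  set g : ℂ → ℂ := fun w => f (x + w • (y - x)) with hg
  have han : AnalyticOnNhd ℂ g {w : ℂ | x + w • (y - x) ∈ s} :=
    (differentiableOn_line hs hf x (y - x)).analyticOnNhd (isOpen_line_preimage hs x _)
  have h0 : (0 : ℂ) ∈ {w : ℂ | x + w • (y - x) ∈ s} := by simpa using hx
  have h1 : (1 : ℂ) ∈ {w : ℂ | x + w • (y - x) ∈ s} := by simpa using hy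
  have hev : ∀ᶠ w in 𝓝 (0 : ℂ), (g w).im = 0 :=
    (by simpa using (continuous_line x (y - x)).tendsto 0 :
      Tendsto (fun w : ℂ => x + w • (y - x)) (𝓝 0) (𝓝 x)).eventually h
  have hev' := hev.and ((isOpen_line_preimage hs x (y - x)).mem_nhds h0)
  rcases han.is_constant_or_isOpen (isPreconnected_line_preimage hc x _) with ⟨c, hcst⟩ | hopen
  · have e1 : g 1 = g 0 := by rw [hcst 1 h1, hcst 0 h0]
    have e2 : (g 1).im = 0 := by rw [e1]; exact hev.self_of_nhds
    simpa [hg] using e2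
  -- Otherwise `g` is open, and cannot map a disc into the real line.
  · exfalso
    obtain ⟨ρ, hρ, hb⟩ := Metric.eventually_nhds_iff_ball.1 hev'
    have ho := hopen (ball 0 ρ) (fun z hz => (hb z hz).2) isOpen_ball
    have hmem : g 0 ∈ g '' ball 0 ρ := ⟨0, mem_ball_self hρ, rfl⟩
    obtain ⟨ε, hε, hball⟩ := Metric.isOpen_iff.1 ho _ hmem
    obtain ⟨w, hw, hwe⟩ := hball (show g 0 + (ε / 2 : ℝ) * I ∈ ball (g 0) ε by
      rw [mem_ball_iff_norm, add_sub_cancel_left, norm_mul, norm_I, norm_real, Real.norm_eq_abs,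
        abs_of_pos (by positivity)]
      linarith)
    have e1 := (hb w hw).1
    rw [hwe, add_im, (hb 0 (mem_ball_self hρ)).1] at e1
    simp at e1
    linarith

/-- A predicate that is locally constant outside the zeros of a holomorphic function on a convex
open set, not identically zero on complex lines through the given points, is constant there. -/
theorem iff_of_locally_off_zeros_convex [NormedSpace ℝ E] [IsScalarTower ℝ ℂ E] {s : Set E}
    {q : E → ℂ} (hs : IsOpen s) (hc : Convex ℝ s) (hq : DifferentiableOn ℂ q s) {P : E → Prop}
    (hP : ∀ z ∈ s, q z ≠ 0 → ∀ᶠ z' in 𝓝 z, (P z' ↔ P z)) {x y : E} (hx : x ∈ s) (hy : y ∈ s)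
    (hqx : q x ≠ 0) (hqy : q y ≠ 0) : P x ↔ P y := by
  -- Restrict to the complex line through `x` and `y`.
  have h := iff_of_locally_off_zeros (isOpen_line_preimage hs x (y - x))
    (isPreconnected_line_preimage hc x (y - x)) (differentiableOn_line hs hq x (y - x))
    (P := fun w => P (x + w • (y - x)))
    (fun w hw hqw => ((continuous_line x (y - x)).tendsto w).eventually (hP _ hw hqw))
    (x := 0) (y := 1) (by simpa using hx) (by simpa using hy) (by simpa using hqx)
    (by simpa using hqy)
  simpa using h

end Identity

/-! ### Functions whose imaginary part has at most a logarithmic pole -/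

/-- If `Im F` is bounded below by a multiple of `log |q|` near an isolated zero of `q`, then it is
bounded below: for large `N`, the singularity of `exp (i F / N)` is so mild that it is removable. -/
lemma exists_le_im_of_log_le {q F : ℂ → ℂ} {w₀ : ℂ} (hq : AnalyticAt ℂ q w₀)
    (hq0 : ¬ ∀ᶠ w in 𝓝 w₀, q w = 0) (hF : ∀ᶠ w in 𝓝[≠] w₀, DifferentiableAt ℂ F w) {c C : ℝ}
    (hc : 0 ≤ c) (hb : ∀ᶠ w in 𝓝[≠] w₀, c * Real.log ‖q w‖ - C ≤ (F w).im) :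
    ∃ C₁ : ℝ, ∀ᶠ w in 𝓝[≠] w₀, -C₁ ≤ (F w).im := by
  obtain ⟨m, g, hg, hg0, hqg⟩ := hq.exists_eventuallyEq_pow_smul_nonzero_iff.2 hq0
  set a : ℝ := ‖g w₀‖ / 2 with ha
  have ha0 : 0 < a := by have := norm_pos_iff.2 hg0; positivity
  have hga : ∀ᶠ w in 𝓝[≠] w₀, a < ‖g w‖ := by
    refine Filter.Eventually.filter_mono nhdsWithin_le_nhds ?_
    exact hg.continuousAt.norm.eventually (lt_mem_nhds (by
      have := norm_pos_iff.2 hg0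
      rw [ha]; linarith))
  set C₂ : ℝ := C - c * Real.log a with hC₂
  have hsmall : ∀ᶠ w in 𝓝[≠] w₀, ‖w - w₀‖ < 1 := by
    refine Filter.Eventually.filter_mono nhdsWithin_le_nhds ?_
    filter_upwards [ball_mem_nhds w₀ one_pos] with w hw
    exact mem_ball_iff_norm.1 hw
  have hb2 : ∀ᶠ w in 𝓝[≠] w₀, c * (m * Real.log ‖w - w₀‖) - C₂ ≤ (F w).im := by
    filter_upwards [hb, hga, (hqg.filter_mono nhdsWithin_le_nhds), self_mem_nhdsWithin]
      with w h1 h2 h3 hne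
    have h0 : 0 < ‖w - w₀‖ := norm_pos_iff.2 (sub_ne_zero.2 hne)
    refine le_trans ?_ h1
    rw [h3, norm_smul, norm_pow, Real.log_mul (pow_pos h0 m).ne' (ha0.trans h2).ne', Real.log_pow]
    have := mul_le_mul_of_nonneg_left (Real.log_le_log ha0 h2.le) hc
    rw [hC₂]; linarith
  obtain ⟨N, hN⟩ := exists_nat_gt (2 * (c * m))
  have hN0 : (0 : ℝ) < N := lt_of_le_of_lt (by positivity) hN
  set H : ℂ → ℂ := fun w => (w - w₀) * exp (I * F w / N) with hH
  have hnorm : ∀ w, ‖H w‖ = ‖w - w₀‖ * Real.exp (-(F w).im / N) := fun w => by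
    rw [hH]
    simp only [norm_mul, norm_exp]
    congr 2
    rw [show I * F w / N = (((N : ℝ)⁻¹ : ℝ) : ℂ) * (I * F w) by push_cast; ring, re_ofReal_mul]
    simp only [I_mul_re]
    ring
  have hHd : ∀ᶠ w in 𝓝[≠] w₀, DifferentiableAt ℂ H w := by
    filter_upwards [hF] with w hw
    exact (differentiableAt_id.sub_const w₀).mul (((hw.const_mul I).div_const _).cexp)
  have hHb : ∀ᶠ w in 𝓝[≠] w₀, ‖H w‖ ≤ Real.exp (C₂ / N) * Real.sqrt ‖w - w₀‖ := by
    filter_upwards [hb2, hsmall, self_mem_nhdsWithin] with w h1 h2 hne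
    have h0 : 0 < ‖w - w₀‖ := norm_pos_iff.2 (sub_ne_zero.2 hne)
    rw [hnorm]
    have hlog : Real.log ‖w - w₀‖ ≤ 0 := Real.log_nonpos h0.le h2.le
    have hs : Real.sqrt ‖w - w₀‖ = Real.exp (Real.log ‖w - w₀‖ / 2) := by
      rw [Real.sqrt_eq_rpow, Real.rpow_def_of_pos h0]; congr 1; ring
    rw [hs, ← Real.exp_add]
    nth_rewrite 1 [← Real.exp_log h0]
    rw [← Real.exp_add, Real.exp_le_exp]
    have h3 : -(F w).im / N ≤ C₂ / N - (c * m / N) * Real.log ‖w - w₀‖ := by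
      rw [div_mul_eq_mul_div, ← sub_div]
      gcongr
      linarith
    have h4 : c * m / N ≤ 1 / 2 := by rw [div_le_iff₀ hN0]; linarith
    have h5 := mul_le_mul_of_nonpos_right h4 hlog
    linarith
  have hHc : ContinuousAt H w₀ := by
    have h0 : H w₀ = 0 := by simp [hH]
    rw [continuousAt_iff_punctured_nhds, h0]
    refine squeeze_zero_norm' hHb ?_
    have : Tendsto (fun w => Real.exp (C₂ / N) * Real.sqrt ‖w - w₀‖) (𝓝 w₀)
        (𝓝 (Real.exp (C₂ / N) * Real.sqrt ‖w₀ - w₀‖)) :=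
      Continuous.tendsto (by fun_prop) w₀
    simp only [sub_self, norm_zero, Real.sqrt_zero, mul_zero] at this
    exact this.mono_left nhdsWithin_le_nhds
  have hHan := analyticAt_of_differentiable_on_punctured_nhds_of_continuousAt hHd hHc
  obtain ⟨C₃, hC₃⟩ := hHan.differentiableAt.isBigO_sub.bound
  refine ⟨N * Real.log (max C₃ 1), ?_⟩
  filter_upwards [hC₃.filter_mono nhdsWithin_le_nhds, self_mem_nhdsWithin] with w h1 hne
  have h0 : 0 < ‖w - w₀‖ := norm_pos_iff.2 (sub_ne_zero.2 hne)
  have h00 : H w₀ = 0 := by simp [hH]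
  rw [h00, sub_zero, hnorm, mul_comm] at h1
  have h2 : Real.exp (-(F w).im / N) ≤ max C₃ 1 :=
    (le_of_mul_le_mul_right h1 h0).trans (le_max_left _ _)
  have h3 := (Real.le_log_iff_exp_le (by positivity)).2 h2
  rw [div_le_iff₀ hN0] at h3
  linarith

/-- The minimum principle for imaginary parts of functions with at most logarithmic poles. -/
lemma le_im_of_log_le {q F : ℂ → ℂ} {T : Set ℂ} (hTo : IsOpen T) (hT : IsPreconnected T) {δ : ℝ}
    (hδ : 0 < δ) (hδT : closedBall 0 δ ⊆ T) (hq : DifferentiableOn ℂ q T) (hq0 : q 0 ≠ 0)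
    (hF : ∀ w ∈ T, q w ≠ 0 → DifferentiableAt ℂ F w) {c C : ℝ} (hc : 0 ≤ c)
    (hb : ∀ w ∈ T, q w ≠ 0 → c * Real.log ‖q w‖ - C ≤ (F w).im) {C' : ℝ}
    (hcirc : ∀ w ∈ sphere (0 : ℂ) δ, -C' ≤ (F w).im) : -C' ≤ (F 0).im := by
  have han : AnalyticOnNhd ℂ q T := hq.analyticOnNhd hTo
  have h0T : (0 : ℂ) ∈ T := hδT (mem_closedBall_self hδ.le)
  have hne : ∀ w ∈ T, ∀ᶠ w' in 𝓝[≠] w, q w' ≠ 0 := fun w hw => by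
    by_contra hcon
    refine hq0 (han.eqOn_zero_of_preconnected_of_frequently_eq_zero hT hw ?_ h0T)
    exact fun h' => hcon h'
  have hmem : ∀ w ∈ T, ∀ᶠ w' in 𝓝[≠] w, w' ∈ T ∧ q w' ≠ 0 := fun w hw =>
    (Filter.Eventually.filter_mono nhdsWithin_le_nhds (hTo.mem_nhds hw)).and (hne w hw)
  have hloc : ∀ w ∈ T, ∃ C₁ : ℝ, ∀ᶠ w' in 𝓝[≠] w, -C₁ ≤ (F w').im := fun w hw => by
    refine exists_le_im_of_log_le (han w hw) (fun h => ?_) ?_ hc (C := C) ?_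
    · obtain ⟨w', h1, h2⟩ := ((h.filter_mono nhdsWithin_le_nhds).and (hne w hw)).exists
      exact h2 h1
    · filter_upwards [hmem w hw] with w' h using hF w' h.1 h.2
    · filter_upwards [hmem w hw] with w' h using hb w' h.1 h.2
  set H : ℕ → ℂ → ℂ := fun n w => q w * exp (n * (I * F w)) with hH
  have hnorm : ∀ n w, ‖H n w‖ = ‖q w‖ * Real.exp (n * -(F w).im) := fun n w => by
    rw [hH]
    simp only [norm_mul, norm_exp]
    congr 2
    rw [← ofReal_natCast, re_ofReal_mul, I_mul_re]
  have hHd' : ∀ n, ∀ w ∈ T, q w ≠ 0 → DifferentiableAt ℂ (H n) w := fun n w hw hqw =>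
    (hq.differentiableAt (hTo.mem_nhds hw)).mul (((hF w hw hqw).const_mul I).const_mul _).cexp
  -- the zeros of `q` are removable singularities
  have hHd : ∀ n, ∀ w ∈ T, DifferentiableAt ℂ (H n) w := fun n w hw => by
    by_cases hqw : q w = 0
    · refine (analyticAt_of_differentiable_on_punctured_nhds_of_continuousAt ?_ ?_).differentiableAt
      · filter_upwards [hmem w hw] with w' h using hHd' n w' h.1 h.2
      · obtain ⟨C₁, hC₁⟩ := hloc w hw
        have h0 : H n w = 0 := by simp [hH, hqw]
        rw [continuousAt_iff_punctured_nhds, h0]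
        refine squeeze_zero_norm' (a := fun w' => ‖q w'‖ * Real.exp (n * C₁)) ?_ ?_
        · filter_upwards [hC₁] with w' h1
          rw [hnorm]
          gcongr
          linarith
        · have : Tendsto (fun w' => ‖q w'‖ * Real.exp (n * C₁)) (𝓝 w)
              (𝓝 (‖q w‖ * Real.exp (n * C₁))) :=
            ((han w hw).continuousAt.norm.mul continuousAt_const)
          rw [hqw, norm_zero, zero_mul] at this
          exact this.mono_left nhdsWithin_le_nhds
    · exact hHd' n w hw hqw
  obtain ⟨M, hM⟩ := (isCompact_closedBall (0 : ℂ) δ).exists_bound_of_continuousOn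
    (hq.continuousOn.mono hδT)
  -- The maximum principle for `q exp (i n F)`; then let `n` tend to infinity.
  have hbound : ∀ n : ℕ, ‖q 0‖ * Real.exp (n * -(F 0).im) ≤ M * Real.exp (n * C') := fun n => by
    rw [← hnorm]
    refine norm_le_of_forall_mem_frontier_norm_le (U := ball 0 δ) isBounded_ball ?_ ?_
      (subset_closure (mem_ball_self hδ))
    · refine DifferentiableOn.diffContOnCl fun w hw => ?_
      rw [closure_ball _ hδ.ne'] at hw
      exact (hHd n w (hδT hw)).differentiableWithinAt
    · intro w hw
      rw [frontier_ball _ hδ.ne'] at hw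
      rw [hnorm]
      have h1 := hM w (sphere_subset_closedBall hw)
      have h2 := hcirc w hw
      have hM0 : 0 ≤ M := (norm_nonneg _).trans h1
      gcongr
      linarith
  by_contra hcon
  push Not at hcon
  have hpos : 0 < -(F 0).im - C' := by linarith
  have hq0' : 0 < ‖q 0‖ := norm_pos_iff.2 hq0
  have hall : ∀ n : ℕ, (n : ℝ) * (-(F 0).im - C') ≤ M / ‖q 0‖ := fun n => by
    have h1 := hbound n
    have h2 : Real.exp (n * (-(F 0).im - C')) ≤ M / ‖q 0‖ := by
      rw [le_div_iff₀ hq0', mul_sub, Real.exp_sub, div_mul_eq_mul_div, div_le_iff₀ (Real.exp_pos _)]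
      linarith
    linarith [Real.add_one_le_exp (n * (-(F 0).im - C'))]
  obtain ⟨n, hn⟩ := exists_nat_gt (M / ‖q 0‖ / (-(F 0).im - C'))
  rw [div_lt_iff₀ hpos] at hn
  linarith [hall n]

/-- Several variables: a function on the complement of the zeros of `q` whose imaginary part is
bounded below by a multiple of `log |q|` has locally bounded below imaginary part. -/
theorem exists_le_im_of_log_le_several {E : Type*} [NormedAddCommGroup E] [NormedSpace ℂ E]
    {q F : E → ℂ} {z₀ : E} (hq : ∀ᶠ z in 𝓝 z₀, DifferentiableAt ℂ q z)
    (hq0 : ¬ ∀ᶠ z in 𝓝 z₀, q z = 0)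
    (hF : ∀ᶠ z in 𝓝 z₀, q z ≠ 0 → DifferentiableAt ℂ F z) {c C : ℝ} (hc : 0 ≤ c)
    (hb : ∀ᶠ z in 𝓝 z₀, q z ≠ 0 → c * Real.log ‖q z‖ - C ≤ (F z).im) :
    ∃ C' : ℝ, ∀ᶠ z in 𝓝 z₀, q z ≠ 0 → -C' ≤ (F z).im := by
  let _ : NormedSpace ℝ E := NormedSpace.restrictScalars ℝ ℂ E
  obtain ⟨ρ, hρ, hball⟩ := Metric.eventually_nhds_iff_ball.1 (hq.and (hF.and hb))
  have hqd : DifferentiableOn ℂ q (ball z₀ ρ) := fun z hz =>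
    (hball z hz).1.differentiableWithinAt
  obtain ⟨z₁, hz₁, hqz₁⟩ : ∃ z₁ ∈ ball z₀ ρ, q z₁ ≠ 0 := by
    by_contra hcon
    push Not at hcon
    exact hq0 (Filter.eventually_of_mem (ball_mem_nhds _ hρ) hcon)
  -- a complex line through `z₀` on which `q` does not vanish identically
  set η : E := z₁ - z₀ with hη
  have hT : ∀ z : E, IsOpen {w : ℂ | z + w • η ∈ ball z₀ ρ} := fun z =>
    isOpen_line_preimage isOpen_ball z η
  have hTc : ∀ z : E, IsPreconnected {w : ℂ | z + w • η ∈ ball z₀ ρ} := fun z =>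
    isPreconnected_line_preimage (convex_ball _ _) z η
  have h0T : (0 : ℂ) ∈ {w : ℂ | z₀ + w • η ∈ ball z₀ ρ} := by simpa using hρ
  have h1T : (1 : ℂ) ∈ {w : ℂ | z₀ + w • η ∈ ball z₀ ρ} := by
    change z₀ + (1 : ℂ) • η ∈ ball z₀ ρ
    rwa [one_smul, hη, add_sub_cancel]
  have han := (differentiableOn_line isOpen_ball hqd z₀ η).analyticOnNhd (hT z₀)
  have hne : ∀ᶠ w in 𝓝[≠] (0 : ℂ), q (z₀ + w • η) ≠ 0 := by
    by_contra hcon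
    have := han.eqOn_zero_of_preconnected_of_frequently_eq_zero (hTc z₀) h0T
      (fun h' => hcon h') h1T
    exact hqz₁ (by simpa [hη] using this)
  rw [eventually_nhdsWithin_iff] at hne
  obtain ⟨δ₀, hδ₀, hδb⟩ := Metric.eventually_nhds_iff_ball.1 (hne.and ((hT z₀).mem_nhds h0T))
  set δ : ℝ := δ₀ / 2 with hδdef
  have hδ : 0 < δ := by positivity
  have hcl : ∀ w ∈ closedBall (0 : ℂ) δ, w ∈ ball (0 : ℂ) δ₀ := fun w hw => by
    rw [mem_closedBall_zero_iff] at hw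
    rw [mem_ball_zero_iff]
    linarith
  have hsph : ∀ w ∈ sphere (0 : ℂ) δ, q (z₀ + w • η) ≠ 0 := fun w hw =>
    (hδb w (hcl w (sphere_subset_closedBall hw))).1 fun h => by
      rw [mem_singleton_iff.1 h, mem_sphere_zero_iff_norm, norm_zero] at hw
      exact hδ.ne hw
  have hFd : ∀ w ∈ sphere (0 : ℂ) δ, DifferentiableAt ℂ F (z₀ + w • η) := fun w hw =>
    (hball _ (hδb w (hcl w (sphere_subset_closedBall hw))).2).2.1 (hsph w hw)
  obtain ⟨M, hM⟩ := (isCompact_sphere (0 : ℂ) δ).exists_bound_of_continuousOn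
    (f := fun w => F (z₀ + w • η)) fun w hw =>
    (ContinuousAt.comp (f := fun w : ℂ => z₀ + w • η) (hFd w hw).continuousAt
      (continuous_line z₀ η).continuousAt).continuousWithinAt
  have hcont : Continuous fun p : E × ℂ => p.1 + p.2 • η := by fun_prop
  have h1 : ∀ᶠ z in 𝓝 z₀, ∀ w ∈ sphere (0 : ℂ) δ, -(M + 1) ≤ (F (z + w • η)).im := by
    refine (isCompact_sphere (0 : ℂ) δ).eventually_forall_of_forall_eventually fun w hw => ?_
    have hc1 : ContinuousAt (fun p : E × ℂ => (F (p.1 + p.2 • η)).im) (z₀, w) :=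
      continuous_im.continuousAt.comp (ContinuousAt.comp (f := fun p : E × ℂ => p.1 + p.2 • η)
        (x := (z₀, w)) (hFd w hw).continuousAt hcont.continuousAt)
    refine (hc1.eventually (lt_mem_nhds (a := -(M + 1)) ?_)).mono fun p hp => hp.le
    have := (abs_le.1 ((abs_im_le_norm _).trans (hM w hw))).1
    simp only
    linarith
  have h2 : ∀ᶠ z in 𝓝 z₀, ∀ w ∈ closedBall (0 : ℂ) δ, z + w • η ∈ ball z₀ ρ := by
    refine (isCompact_closedBall (0 : ℂ) δ).eventually_forall_of_forall_eventually fun w hw => ?_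
    exact hcont.continuousAt.eventually (isOpen_ball.mem_nhds (hδb w (hcl w hw)).2)
  refine ⟨M + 1, ?_⟩
  filter_upwards [h1, h2] with z hz1 hz2 hqz
  have := le_im_of_log_le (hT z) (hTc z) hδ (fun w hw => hz2 w hw)
    (differentiableOn_line isOpen_ball hqd z η) (F := fun w => F (z + w • η)) (by simpa using hqz)
    (fun w hw hqw => (hasDerivAt_line ((hball _ hw).2.1 hqw)).differentiableAt) hc (C := C)
    (fun w hw hqw => (hball _ hw).2.2 hqw) (C' := M + 1) hz1
  simpa using this

/-! ### Holomorphic functions on complex manifolds, in charts -/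

/-- On a neighbourhood of a point, a chart is an isomorphism with a ball. -/
lemma exists_ball_chart {r : ℕ} {B : Type*} [TopologicalSpace B] {x : B}
    (φ : OpenPartialHomeomorph B (Fin r → ℂ)) (hx : x ∈ φ.source) {P : B → Prop}
    (h : ∀ᶠ y in 𝓝 x, P y) : ∃ ρ > 0, ball (φ x) ρ ⊆ φ.target ∧
      (∀ z ∈ ball (φ x) ρ, P (φ.symm z)) ∧ ∀ᶠ y in 𝓝 x, y ∈ φ.source ∧ φ y ∈ ball (φ x) ρ := by
  have hxt : φ x ∈ φ.target := φ.map_source hx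
  have h1 := h
  rw [← φ.left_inv hx] at h1
  obtain ⟨ρ, hρ, hb⟩ := Metric.eventually_nhds_iff_ball.1
    ((φ.open_target.eventually_mem hxt).and
      ((φ.continuousAt_symm hxt).eventually h1))
  refine ⟨ρ, hρ, fun z hz => (hb z hz).1, fun z hz => (hb z hz).2, ?_⟩
  exact (φ.open_source.eventually_mem hx).and
    ((φ.continuousAt hx).eventually (ball_mem_nhds _ hρ))

section Charts

variable {r : ℕ} {B : Type*} [TopologicalSpace B] [ChartedSpace (Fin r → ℂ) B]

/-- Holomorphy near a point is expressed by complex differentiability at all nearby points. -/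
abbrev HolAt (f : B → ℂ) (x : B) : Prop := MDifferentiableAt 𝓘(ℂ, Fin r → ℂ) 𝓘(ℂ) f x

variable {φ : OpenPartialHomeomorph B (Fin r → ℂ)} {f g : B → ℂ} {x : B} {z : Fin r → ℂ}

lemma holDiff_congr (h : f =ᶠ[𝓝 x] g) : holDiff (r := r) f x = holDiff g x := h.mfderiv_eq

lemma HolAt.comp_symm (hφ : φ ∈ IsManifold.maximalAtlas 𝓘(ℂ, Fin r → ℂ) 1 B) (hz : z ∈ φ.target)
    (hf : HolAt (r := r) f (φ.symm z)) : DifferentiableAt ℂ (f ∘ φ.symm) z :=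
  mdifferentiableAt_iff_differentiableAt.1
    (MDifferentiableAt.comp z hf (mdifferentiableAt_symm_of_mem_maximalAtlas hφ hz))

lemma HolAt.of_comp_symm (hφ : φ ∈ IsManifold.maximalAtlas 𝓘(ℂ, Fin r → ℂ) 1 B)
    (hx : x ∈ φ.source) (hf : DifferentiableAt ℂ (f ∘ φ.symm) (φ x)) : HolAt (r := r) f x := by
  have h := MDifferentiableAt.comp x (mdifferentiableAt_iff_differentiableAt.2 hf)
    (mdifferentiableAt_of_mem_maximalAtlas hφ hx)
  refine h.congr_of_eventuallyEq ?_
  filter_upwards [φ.open_source.mem_nhds hx] with y hy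
  simp [φ.left_inv hy]

/-- The change of trivialization of the tangent space at a point of the domain of a chart. -/
lemma exists_chart_equiv [IsManifold 𝓘(ℂ, Fin r → ℂ) 1 B]
    (hφ : φ ∈ IsManifold.maximalAtlas 𝓘(ℂ, Fin r → ℂ) 1 B) (hz : z ∈ φ.target) :
    ∃ T : (Fin r → ℂ) ≃L[ℂ] (Fin r → ℂ), ∀ f : B → ℂ, HolAt (r := r) f (φ.symm z) →
      fderiv ℂ (f ∘ φ.symm) z =
        (holDiff f (φ.symm z)).comp (T : (Fin r → ℂ) →L[ℂ] (Fin r → ℂ)) := by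
  have hd : φ.symm.MDifferentiable 𝓘(ℂ, Fin r → ℂ) 𝓘(ℂ, Fin r → ℂ) :=
    ⟨fun y hy => (mdifferentiableAt_symm_of_mem_maximalAtlas hφ hy).mdifferentiableWithinAt,
      fun y hy => (mdifferentiableAt_of_mem_maximalAtlas hφ hy).mdifferentiableWithinAt⟩
  refine ⟨hd.mfderiv hz, fun f hf => ?_⟩
  rw [← mfderiv_eq_fderiv, mfderiv_comp z hf (mdifferentiableAt_symm_of_mem_maximalAtlas hφ hz)]
  rfl

lemma slope_chart [IsManifold 𝓘(ℂ, Fin r → ℂ) 1 B]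
    (hφ : φ ∈ IsManifold.maximalAtlas 𝓘(ℂ, Fin r → ℂ) 1 B) (hz : z ∈ φ.target)
    {a : Fin r → B → ℂ} (ha : ∀ i, HolAt (r := r) (a i) (φ.symm z))
    (hf : HolAt (r := r) f (φ.symm z)) (v : Fin r → ℂ) :
    slope (fun i => fderiv ℂ (a i ∘ φ.symm) z) (fderiv ℂ (f ∘ φ.symm) z) v =
      slope (fun i => holDiff (a i) (φ.symm z)) (holDiff f (φ.symm z)) v := by
  obtain ⟨T, hT⟩ := exists_chart_equiv hφ hz
  rw [hT f hf, funext fun i => hT (a i) (ha i)]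
  exact slope_comp _ _ v T

/-- Derivatives with respect to holomorphic coordinates are holomorphic. -/
lemma holAt_slope [IsManifold 𝓘(ℂ, Fin r → ℂ) 1 B] {a : Fin r → B → ℂ}
    (ha : ∀ i, ∀ᶠ y in 𝓝 x, HolAt (r := r) (a i) y) (hf : ∀ᶠ y in 𝓝 x, HolAt (r := r) f y)
    (hdet : (formMatrix fun i => holDiff (a i) x).det ≠ 0) (v : Fin r → ℂ) :
    HolAt (r := r) (fun y => slope (fun i => holDiff (a i) y) (holDiff f y) v) x := by
  set φ := chartAt (Fin r → ℂ) x
  have hφ : φ ∈ IsManifold.maximalAtlas 𝓘(ℂ, Fin r → ℂ) 1 B := IsManifold.chart_mem_maximalAtlas x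
  have hx : x ∈ φ.source := mem_chart_source _ x
  have hxt : φ x ∈ φ.target := φ.map_source hx
  have hev : ∀ᶠ z in 𝓝 (φ x), (z ∈ φ.target ∧ (∀ i, HolAt (r := r) (a i) (φ.symm z)) ∧
      HolAt (r := r) f (φ.symm z)) := by
    have h1 := (eventually_all.2 ha).and hf
    rw [← φ.left_inv hx] at h1
    exact (φ.open_target.eventually_mem hxt).and
      ((φ.continuousAt_symm hxt).eventually h1)
  obtain ⟨s, hs, hso, hxs⟩ := _root_.eventually_nhds_iff.1 hev
  refine HolAt.of_comp_symm hφ hx ?_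
  have hd : DifferentiableAt ℂ (fun z => slope (fun i => fderiv ℂ (a i ∘ φ.symm) z)
      (fderiv ℂ (f ∘ φ.symm) z) v) (φ x) := by
    refine differentiableAt_slope hso (fun i z hz => ?_) (fun z hz => ?_) hxs ?_ v
    · exact (HolAt.comp_symm hφ (hs z hz).1 ((hs z hz).2.1 i)).differentiableWithinAt
    · exact (HolAt.comp_symm hφ (hs z hz).1 (hs z hz).2.2).differentiableWithinAt
    · obtain ⟨T, hT⟩ := exists_chart_equiv hφ hxt
      rw [funext fun i => hT (a i) ((hs _ hxs).2.1 i)]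
      refine det_formMatrix_comp_ne_zero ?_ T
      rwa [φ.left_inv hx]
  refine hd.congr_of_eventuallyEq ?_
  filter_upwards [hev] with z hz
  exact (slope_chart hφ hz.1 hz.2.1 hz.2.2 v).symm

/-- A holomorphic function which is real near a point of a small ball is real on the ball. -/
lemma exists_nhd_im_eq_zero [IsManifold 𝓘(ℂ, Fin r → ℂ) 1 B]
    (hf : ∀ᶠ y in 𝓝 x, HolAt (r := r) f y) : ∀ {P : B → Prop}, (∀ᶠ y in 𝓝 x, P y) →
    ∃ N ∈ 𝓝 x, IsOpen N ∧ (∀ y ∈ N, P y) ∧ ∀ y ∈ N, ∀ y' ∈ N,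
      (∀ᶠ w in 𝓝 y, (f w).im = 0) → (f y').im = 0 := by
  intro P hP
  set φ := chartAt (Fin r → ℂ) x
  have hφ : φ ∈ IsManifold.maximalAtlas 𝓘(ℂ, Fin r → ℂ) 1 B := IsManifold.chart_mem_maximalAtlas x
  have hx : x ∈ φ.source := mem_chart_source _ x
  obtain ⟨ρ, hρ, ht, hb, hN⟩ := exists_ball_chart φ hx (hf.and hP)
  have hNo : IsOpen (φ.source ∩ φ ⁻¹' ball (φ x) ρ) := φ.isOpen_inter_preimage isOpen_ball
  refine ⟨_, hN, hNo, fun y hy => ?_, fun y hy y' hy' h => ?_⟩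
  · have := (hb _ hy.2).2
    rwa [φ.left_inv hy.1] at this
  · have h1 : ∀ᶠ z in 𝓝 (φ y), ((f ∘ φ.symm) z).im = 0 := by
      have h2 := φ.continuousAt_symm (φ.map_source hy.1)
      rw [ContinuousAt, φ.left_inv hy.1] at h2
      exact h2.eventually h
    have := im_eq_zero_of_eventually isOpen_ball (convex_ball _ _) (f := f ∘ φ.symm)
      (fun z hz => (HolAt.comp_symm hφ (ht hz) (hb z hz).1).differentiableWithinAt) hy.2 hy'.2 h1
    simpa [φ.left_inv hy'.1] using this

/-- Regular points are dense. -/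
lemma frequently_mem_of_isDivisor {S : Set B} (hS : IsDivisor (r := r) S) (x : B) :
    ∃ᶠ y in 𝓝 x, y ∉ S := by
  by_cases hx : x ∈ S
  · obtain ⟨W, f, hW, hxW, -, hf, hne⟩ := hS.2 x hx
    intro h
    refine hne x hxW ?_
    filter_upwards [h, hW.mem_nhds hxW] with y hy hyW
    exact (hf y hyW).1 (not_not.1 hy)
  · exact (Filter.Eventually.frequently (hS.1.isOpen_compl.mem_nhds hx))

/-- Predicates that are locally constant off a divisor are constant on connected open sets: a
divisor does not disconnect. -/
theorem iff_of_locally_off_divisor [IsManifold 𝓘(ℂ, Fin r → ℂ) 1 B] {S U : Set B}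
    (hS : IsDivisor (r := r) S) (hU : IsOpen U) (hUc : IsPreconnected U) {P : B → Prop}
    (hP : ∀ y ∈ U, y ∉ S → ∀ᶠ y' in 𝓝 y, (P y' ↔ P y)) {x y : B} (hx : x ∈ U) (hy : y ∈ U)
    (hxS : x ∉ S) (hyS : y ∉ S) : P x ↔ P y := by
  -- near every point of `U`, the predicate is constant off `S`
  have key : ∀ y ∈ U, ∃ p : Prop, ∀ᶠ y' in 𝓝 y, y' ∉ S → (P y' ↔ p) := fun y hy => by
    by_cases hyS : y ∈ S
    · obtain ⟨W, f, hW, hyW, hf, hfS, hne⟩ := hS.2 y hyS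
      set φ := chartAt (Fin r → ℂ) y
      have hφ : φ ∈ IsManifold.maximalAtlas 𝓘(ℂ, Fin r → ℂ) 1 B :=
        IsManifold.chart_mem_maximalAtlas y
      have hys : y ∈ φ.source := mem_chart_source _ y
      obtain ⟨ρ, hρ, ht, hb, hN⟩ := exists_ball_chart φ hys
        ((hW.eventually_mem hyW).and (hU.eventually_mem hy))
      obtain ⟨y₁, hy₁S, hy₁⟩ := ((frequently_mem_of_isDivisor hS y).and_eventually hN).exists
      refine ⟨P y₁, ?_⟩
      filter_upwards [hN] with y' hy' hy'S
      have hd : DifferentiableOn ℂ (f ∘ φ.symm) (ball (φ y) ρ) := fun z hz =>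
        (HolAt.comp_symm hφ (ht hz)
          (hf.mdifferentiableAt (hW.mem_nhds (hb z hz).1))).differentiableWithinAt
      have hq : ∀ w, w ∈ φ.source → φ w ∈ ball (φ y) ρ → w ∉ S → (f ∘ φ.symm) (φ w) ≠ 0 :=
        fun w hw hwb hwS => by
        have h1 := (hb _ hwb).1
        rw [φ.left_inv hw] at h1
        rw [Function.comp_apply, φ.left_inv hw]
        exact fun h => hwS ((hfS w h1).2 h)
      have := iff_of_locally_off_zeros_convex isOpen_ball (convex_ball (φ y) ρ) hd
        (P := fun z => P (φ.symm z)) (fun z hz hqz =>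
          (φ.continuousAt_symm (ht hz)).eventually
            (hP _ (hb z hz).2 fun h => hqz ((hfS _ (hb z hz).1).1 h)))
        hy'.2 hy₁.2 (hq y' hy'.1 hy'.2 hy'S) (hq y₁ hy₁.1 hy₁.2 hy₁S)
      rwa [φ.left_inv hy'.1, φ.left_inv hy₁.1] at this
    · exact ⟨P y, (hP y hy hyS).mono fun _ h _ => h⟩
  have hQ : ∀ y ∈ U, y ∉ S → ((∀ᶠ y' in 𝓝 y, y' ∉ S → P y') ↔ P y) := fun y hy hyS => by
    have h1 : ∀ᶠ y' in 𝓝 y, ((y' ∉ S → P y') ↔ P y) := by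
      filter_upwards [hP y hy hyS, hS.1.isOpen_compl.mem_nhds hyS] with y' h hyS'
      rw [← h]
      exact ⟨fun h' => h' hyS', fun h' _ => h'⟩
    rw [eventually_congr h1, eventually_const]
  rw [← hQ x hx hxS, ← hQ y hy hyS]
  refine hUc.iff_of_locally (P := fun y => ∀ᶠ y' in 𝓝 y, y' ∉ S → P y') (fun w hw => ?_) hx hy
  refine Filter.Eventually.filter_mono nhdsWithin_le_nhds ?_
  obtain ⟨p, hp⟩ := key w hw
  have heq : ∀ w', (∀ᶠ y' in 𝓝 w', y' ∉ S → (P y' ↔ p)) → ((∀ᶠ y' in 𝓝 w', y' ∉ S → P y') ↔ p) :=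
    fun w' hw' => by
    constructor
    · intro h
      obtain ⟨y', h1, h2, h3⟩ :=
        ((frequently_mem_of_isDivisor hS w').and_eventually (h.and hw')).exists
      exact (h3 h1).1 (h2 h1)
    · intro h
      filter_upwards [hw'] with y' h1 h2 using (h1 h2).2 h
  filter_upwards [hp.eventually_nhds] with w' hw'
  rw [heq w' hw', heq w hp]

/-- The manifold version of `exists_le_im_of_log_le_several`. -/
theorem exists_le_im_of_log_le_manifold [IsManifold 𝓘(ℂ, Fin r → ℂ) 1 B] {q F : B → ℂ}
    (hq : ∀ᶠ y in 𝓝 x, HolAt (r := r) q y) (hq0 : ∃ᶠ y in 𝓝 x, q y ≠ 0)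
    (hF : ∀ᶠ y in 𝓝 x, q y ≠ 0 → HolAt (r := r) F y) {c C : ℝ} (hc : 0 ≤ c)
    (hb : ∀ᶠ y in 𝓝 x, q y ≠ 0 → c * Real.log ‖q y‖ - C ≤ (F y).im) :
    ∃ C' : ℝ, ∀ᶠ y in 𝓝 x, q y ≠ 0 → -C' ≤ (F y).im := by
  set φ := chartAt (Fin r → ℂ) x
  have hφ : φ ∈ IsManifold.maximalAtlas 𝓘(ℂ, Fin r → ℂ) 1 B := IsManifold.chart_mem_maximalAtlas x
  have hx : x ∈ φ.source := mem_chart_source _ x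
  obtain ⟨ρ, hρ, ht, hball, -⟩ := exists_ball_chart φ hx (hq.and (hF.and hb))
  have hnb : ball (φ x) ρ ∈ 𝓝 (φ x) := ball_mem_nhds _ hρ
  have hne : ¬ ∀ᶠ z in 𝓝 (φ x), (q ∘ φ.symm) z = 0 := fun h => hq0 <| by
    filter_upwards [(φ.continuousAt hx).eventually h, φ.open_source.mem_nhds hx] with y hy hys
    simpa [φ.left_inv hys] using hy
  obtain ⟨C', hC'⟩ := exists_le_im_of_log_le_several (q := q ∘ φ.symm) (F := F ∘ φ.symm)
    (z₀ := φ x) (Filter.eventually_of_mem hnb fun z hz => HolAt.comp_symm hφ (ht hz) (hball z hz).1)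
    hne (Filter.eventually_of_mem hnb fun z hz hqz =>
      HolAt.comp_symm hφ (ht hz) ((hball z hz).2.1 hqz)) hc
    (Filter.eventually_of_mem hnb fun z hz hqz => (hball z hz).2.2 hqz)
  refine ⟨C', ?_⟩
  filter_upwards [(φ.continuousAt hx).eventually hC', φ.open_source.mem_nhds hx] with y hy hys
  simpa [φ.left_inv hys] using hy

end Charts

/-! ### Open submanifolds -/

section Opens

variable {r : ℕ} {B : Type*} [TopologicalSpace B] [ChartedSpace (Fin r → ℂ) B]
  {R : TopologicalSpace.Opens B}

lemma eventually_opens {x : R} {P : B → Prop} :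
    (∀ᶠ y : R in 𝓝 x, P y.1) ↔ ∀ᶠ b in 𝓝 x.1, P b := by
  rw [← R.isOpenEmbedding'.map_nhds_eq x]
  rfl

lemma eventually_opens_exists {x : R} {P : R → Prop} (h : ∀ᶠ y in 𝓝 x, P y) :
    ∀ᶠ b in 𝓝 x.1, ∃ hb : b ∈ R, P ⟨b, hb⟩ := by
  rw [← eventually_opens]
  filter_upwards [h] with y hy using ⟨y.2, hy⟩

lemma holAt_comp_val {f : B → ℂ} {x : R} :
    MDifferentiableAt 𝓘(ℂ, Fin r → ℂ) 𝓘(ℂ) (f ∘ Subtype.val : R → ℂ) x ↔ HolAt (r := r) f x.1 :=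
  (differentiableWithinAt_localInvariantProp.liftPropAt_iff_comp_subtype_val f x).symm

lemma holDiff_comp_val {f : B → ℂ} {x : R} (hf : HolAt (r := r) f x.1) :
    holDiff (r := r) (f ∘ Subtype.val : R → ℂ) x = holDiff f x.1 := by
  have hf' := holAt_comp_val.2 hf
  rw [holDiff, holDiff, hf'.mfderiv, hf.mfderiv]
  simp only [writtenInExtChartAt, extChartAt, mfld_simps, fderivWithin_univ]
  exact Filter.EventuallyEq.fderiv_eq
    ((R.chartAt_subtype_val_symm_eventuallyEq (x := x)).fun_comp f).symm

/-- The extension by zero of a function on an open subset. -/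
def zeroExt (F : R → ℂ) (b : B) : ℂ := by
  classical exact if h : b ∈ R then F ⟨b, h⟩ else 0

lemma zeroExt_comp_val (F : R → ℂ) : zeroExt F ∘ Subtype.val = F := by
  funext y
  simp [zeroExt, y.2]

lemma zeroExt_val (F : R → ℂ) (y : R) : zeroExt F y.1 = F y := congrFun (zeroExt_comp_val F) y

lemma holAt_zeroExt {F : R → ℂ} {x : R} :
    HolAt (r := r) (zeroExt F) x.1 ↔ MDifferentiableAt 𝓘(ℂ, Fin r → ℂ) 𝓘(ℂ) F x := by
  rw [← holAt_comp_val, zeroExt_comp_val]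

lemma holDiff_zeroExt {F : R → ℂ} {x : R} (hF : MDifferentiableAt 𝓘(ℂ, Fin r → ℂ) 𝓘(ℂ) F x) :
    holDiff (r := r) (zeroExt F) x.1 = holDiff F x := by
  rw [← holDiff_comp_val (holAt_zeroExt.2 hF), zeroExt_comp_val]

end Opens

/-! ### A minimum principle -/

section Potential

variable {ι J : Type*}

/-- The function `Im f + ∑ γ, c γ (Re P (|z γ|, φ γ) - log |z γ|)`, where
`P (ρ, φ) = ∫ X / (1 - X) du`, `X = exp (- 2 ρ cosh u + i φ)`. -/
def potential (s : Finset ι) (c : ι → ℝ) (f : ℂ) (z : ι → ℂ) (φ : ι → ℝ) : ℝ :=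
  f.im + ∑ γ ∈ s, c γ * ((axisInt (fun _ => 1) ‖z γ‖ (φ γ)).re - Real.log ‖z γ‖)

/-- The potential minus a strictly plurisubharmonic function and a function with logarithmic
poles. -/
def barrierPotential (s : Finset ι) (c : ι → ℝ) (t : Finset J) (ε δ : ℝ) (f : ℂ) (z : ι → ℂ)
    (b : J → ℂ) (φ : ι → ℝ) : ℝ :=
  potential s c f z φ - ε * ∑ j ∈ t, ‖b j‖ ^ 2 - δ * ∑ γ ∈ s, Real.log ‖z γ‖

lemma exists_angle_mem_Icc (φ : ι → ℝ) :
    ∃ φ' ∈ Set.pi univ fun _ : ι => Icc (0 : ℝ) (2 * Real.pi), ∀ (s : Finset ι) (c : ι → ℝ) (f : ℂ)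
      (z : ι → ℂ), potential s c f z φ = potential s c f z φ' := by
  refine ⟨fun γ => toIcoMod Real.two_pi_pos 0 (φ γ), fun γ _ => ?_, fun s c f z => ?_⟩
  · have := toIcoMod_mem_Ico Real.two_pi_pos 0 (φ γ)
    rw [zero_add] at this
    exact Ico_subset_Icc_self this
  · simp only [potential]
    congr 1
    refine Finset.sum_congr rfl fun γ _ => ?_
    rw [axisInt_congr_angle _ _ (Real.Angle.coe_toIcoMod (φ γ) 0).symm]

lemma continuousAt_axisInt {z₀ : ℂ} (hz : z₀ ≠ 0) (φ₀ : ℝ) :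
    ContinuousAt (fun p : ℂ × ℝ => axisInt (fun _ => 1) ‖p.1‖ p.2) (z₀, φ₀) := by
  have h := inHalfPlane_arg hz
  have h1 : ContinuousAt (contourInt (fun _ => 1) (fun X => X / (1 - X)) (arg (-z₀))) (z₀, φ₀) :=
    (contDiffAt_contourInt isTemperate_one isDiscFun_geom h).continuousAt
  refine h1.congr ?_
  filter_upwards [(isOpen_inHalfPlane (arg (-z₀))).mem_nhds h] with p hp
  exact contourInt_one_eq_axisInt hp p.2

lemma continuousAt_potential {X : Type*} [TopologicalSpace X] {s : Finset ι} (c : ι → ℝ)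
    {f : X → ℂ} {z : X → ι → ℂ} {φ : X → ι → ℝ} {x : X} (hf : ContinuousAt f x)
    (hz : ∀ γ ∈ s, ContinuousAt (fun y => z y γ) x) (hz0 : ∀ γ ∈ s, z x γ ≠ 0)
    (hφ : ∀ γ ∈ s, ContinuousAt (fun y => φ y γ) x) :
    ContinuousAt (fun y => potential s c (f y) (z y) (φ y)) x := by
  refine (continuous_im.continuousAt.comp hf).add
    (tendsto_finsetSum _ fun γ hγ => tendsto_const_nhds.mul (Tendsto.sub ?_ ?_))
  · exact (continuous_re.tendsto _).comp (Tendsto.comp (f := fun y => (z y γ, φ y γ))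
      (continuousAt_axisInt (hz0 γ hγ) (φ x γ)) ((hz γ hγ).prodMk_nhds (hφ γ hγ)))
  · exact (Real.continuousAt_log (norm_ne_zero_iff.2 (hz0 γ hγ))).tendsto.comp (hz γ hγ).norm

lemma continuousAt_barrierPotential {X : Type*} [TopologicalSpace X] {s : Finset ι} (c : ι → ℝ)
    {t : Finset J} (ε δ : ℝ) {f : X → ℂ} {z : X → ι → ℂ} {b : X → J → ℂ} {φ : X → ι → ℝ} {x : X}
    (hf : ContinuousAt f x)
    (hz : ∀ γ ∈ s, ContinuousAt (fun y => z y γ) x) (hz0 : ∀ γ ∈ s, z x γ ≠ 0)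
    (hb : ∀ j ∈ t, ContinuousAt (fun y => b y j) x) (hφ : ∀ γ ∈ s, ContinuousAt (fun y => φ y γ) x) :
    ContinuousAt (fun y => barrierPotential s c t ε δ (f y) (z y) (b y) (φ y)) x := by
  refine ((continuousAt_potential c hf hz hz0 hφ).sub (tendsto_const_nhds.mul
    (tendsto_finsetSum _ fun j hj => (hb j hj).norm.pow 2))).sub (tendsto_const_nhds.mul
    (tendsto_finsetSum _ fun γ hγ => ?_))
  exact (Real.continuousAt_log (norm_ne_zero_iff.2 (hz0 γ hγ))).tendsto.comp (hz γ hγ).norm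

lemma le_potential {s : Finset ι} {c : ι → ℝ} (hc : ∀ γ ∈ s, 0 ≤ c γ) (f : ℂ) {z : ι → ℂ}
    (hz : ∀ γ ∈ s, z γ ≠ 0) (φ : ι → ℝ) :
    f.im - ∑ γ ∈ s, c γ * (2 + ‖z γ‖) ≤ potential s c f z φ := by
  rw [potential, sub_eq_add_neg, ← Finset.sum_neg_distrib]
  gcongr with γ hγ
  rw [← mul_neg]
  refine mul_le_mul_of_nonneg_left ?_ (hc γ hγ)
  have hpos : 0 < ‖z γ‖ := norm_pos_iff.2 (hz γ hγ)
  have h1 := log_sub_two_le_re_axisInt hpos (φ γ)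
  have h2 : Real.log ‖z γ‖ ≤ Real.log (min ‖z γ‖ 1) + ‖z γ‖ := by
    rcases le_total ‖z γ‖ 1 with h | h
    · rw [min_eq_left h]; linarith
    · rw [min_eq_right h, Real.log_one]
      linarith [Real.log_le_sub_one_of_pos hpos]
  linarith

/-- Along a holomorphic disc, the barrier potential has no minimum: the potential is annihilated by
the Laplace operator in the disc coordinate and the angles, whereas the barrier is strictly
subharmonic. -/
theorem not_eventually_barrierPotential_le {s : Finset ι} {c : ι → ℝ} {t : Finset J} {ε δ : ℝ}
    (hε : 0 < ε) {f : ℂ → ℂ} {z : ι → ℂ → ℂ} {b : J → ℂ → ℂ}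
    (hf : ∀ᶠ w in 𝓝 0, DifferentiableAt ℂ f w)
    (hz : ∀ γ ∈ s, ∀ᶠ w in 𝓝 0, DifferentiableAt ℂ (z γ) w) (hz0 : ∀ γ ∈ s, z γ 0 ≠ 0)
    (hb : ∀ j ∈ t, ∀ᶠ w in 𝓝 0, DifferentiableAt ℂ (b j) w)
    (hb0 : ∃ j ∈ t, deriv (b j) 0 ≠ 0) (φ : ι → ℝ) :
    ¬ ∀ᶠ w in 𝓝 (0 : ℂ), ∀ φ' : ι → ℝ,
      barrierPotential s c t ε δ (f 0) (fun γ => z γ 0) (fun j => b j 0) φ ≤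
        barrierPotential s c t ε δ (f w) (fun γ => z γ w) (fun j => b j w) φ' := by
  intro hmin
  set G : ℂ → (ι → ℝ) → ℝ := fun w φ' =>
    barrierPotential s c t ε δ (f w) (fun γ => z γ w) (fun j => b j w) φ' with hG
  -- With these speeds of the angles, the contour integrals satisfy the Laplace equation.
  set m : ι → ℝ := fun γ => 2 * ‖deriv (z γ) 0‖ with hm
  have hre : Tendsto (fun t : ℝ => (t : ℂ)) (𝓝 0) (𝓝 0) := by
    simpa using (continuous_ofReal.tendsto (0 : ℝ))
  have him : Tendsto (fun t : ℝ => (t : ℂ) * I) (𝓝 0) (𝓝 0) := by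
    have : Continuous fun t : ℝ => (t : ℂ) * I := by fun_prop
    simpa using this.tendsto 0
  -- A minimum in the disc coordinate and the angles is a local minimum of the sum of the
  -- restrictions to three curves, so the sum of the three second derivatives is non-negative.
  have hloc : IsLocalMin (fun t : ℝ => G t φ + G (t * I) φ + G 0 (fun γ => φ γ + m γ * t)) 0 := by
    filter_upwards [hre.eventually hmin, him.eventually hmin] with t h1 h2
    have h3 := hmin.self_of_nhds (fun γ => φ γ + m γ * t)
    simp only [ofReal_zero, zero_mul, mul_zero, add_zero]
    exact add_le_add (add_le_add (h1 φ) (h2 φ)) h3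
  have hdf := (hasDeriv2At_holomorphic hf).add (hasDeriv2At_const (f 0))
  -- the logarithms
  have hlog : ∀ γ ∈ s, HasDeriv2At (fun t : ℝ => Real.log ‖z γ t‖ + Real.log ‖z γ (t * I)‖ +
      Real.log ‖z γ 0‖) 0 := fun γ hγ => by
    have h0 := hz0 γ hγ
    have hdiv : ∀ᶠ w in 𝓝 (0 : ℂ), z γ w / z γ 0 ∈ slitPlane := by
      have h1 : ContinuousAt (fun w => z γ w / z γ 0) 0 :=
        (hz γ hγ).self_of_nhds.continuousAt.div_const _
      refine h1.eventually (isOpen_slitPlane.mem_nhds ?_)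
      simp [div_self h0]
    have h2 := hasDeriv2At_holomorphic (f := fun w => log (z γ w / z γ 0)) (by
      filter_upwards [hz γ hγ, hdiv] with w h1 h2 using (h1.div_const _).clog h2)
    have h3 := (h2.clm reCLM).add (hasDeriv2At_const (3 * Real.log ‖z γ 0‖))
    simp only [reCLM_apply, zero_re, add_zero] at h3
    refine h3.congr ?_
    have hne : ∀ᶠ w in 𝓝 (0 : ℂ), z γ w ≠ 0 :=
      (hz γ hγ).self_of_nhds.continuousAt.eventually_ne h0
    filter_upwards [hre.eventually hne, him.eventually hne] with t h1 h2
    rw [add_re, log_re, log_re, norm_div, norm_div, Real.log_div (norm_ne_zero_iff.2 h1)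
      (norm_ne_zero_iff.2 h0), Real.log_div (norm_ne_zero_iff.2 h2) (norm_ne_zero_iff.2 h0)]
    ring
  have hax : ∀ γ ∈ s, HasDeriv2At (fun t : ℝ => (axisInt (fun _ => 1) ‖z γ t‖ (φ γ)).re +
      (axisInt (fun _ => 1) ‖z γ (t * I)‖ (φ γ)).re +
      (axisInt (fun _ => 1) ‖z γ 0‖ (φ γ + m γ * t)).re) 0 := fun γ hγ => by
    have hα := inHalfPlane_arg (hz0 γ hγ)
    have h1 := (hasDeriv2At_contourInt_laplace (hz γ hγ) isDiscFun_geom (φ γ) hα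
      (m := m γ) (by rw [hm]; ring)).clm reCLM
    simp only [reCLM_apply, zero_re] at h1
    refine h1.congr ?_
    have hev : ∀ᶠ w in 𝓝 (0 : ℂ), InHalfPlane (arg (-z γ 0)) (z γ w) := by
      have h2 : ContinuousAt (fun w => ((z γ w, (0 : ℝ)) : ℂ × ℝ)) 0 :=
        (hz γ hγ).self_of_nhds.continuousAt.prodMk continuousAt_const
      exact h2.eventually ((isOpen_inHalfPlane _).mem_nhds hα)
    filter_upwards [hre.eventually hev, him.eventually hev] with t h2 h3
    rw [contourInt_one_eq_axisInt h2, contourInt_one_eq_axisInt h3, contourInt_one_eq_axisInt hα]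
    simp only [add_re]
  have hnorm : ∀ j ∈ t, HasDeriv2At (fun t : ℝ => ‖b j t‖ ^ 2 + ‖b j (t * I)‖ ^ 2 + ‖b j 0‖ ^ 2)
      (4 * ‖deriv (b j) 0‖ ^ 2) := fun j hj => by
    have := (hasDeriv2At_norm_sq (hb j hj)).add (hasDeriv2At_const (‖b j 0‖ ^ 2))
    rwa [add_zero] at this
  have hmul : ∀ {h : ℝ → ℝ} {d : ℝ} (a : ℝ), HasDeriv2At h d → HasDeriv2At (fun t => a * h t) (a * d) :=
    fun a h => h.clm (a • ContinuousLinearMap.id ℝ ℝ)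
  have htot := (((hdf.clm imCLM).add (HasDeriv2At.sum s fun γ hγ =>
    hmul (c γ) ((hax γ hγ).sub (hlog γ hγ)))).sub (hmul ε (HasDeriv2At.sum t hnorm))).sub
    (hmul δ (HasDeriv2At.sum s hlog))
  have hd := (htot.congr (g := fun t : ℝ => G t φ + G (t * I) φ + G 0 (fun γ => φ γ + m γ * t))
    (Eventually.of_forall fun t => ?_)).nonneg_of_isLocalMin hloc
  · simp only [imCLM_apply, add_zero, zero_im, sub_zero, mul_zero, Finset.sum_const_zero,
      zero_sub] at hd
    obtain ⟨j, hj, hj0⟩ := hb0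
    have h1 : 0 < ∑ j ∈ t, 4 * ‖deriv (b j) 0‖ ^ 2 :=
      Finset.sum_pos' (fun i _ => by positivity) ⟨j, hj, by
        have := norm_pos_iff.2 hj0
        positivity⟩
    have h2 := mul_pos hε h1
    linarith
  · simp only [hG, barrierPotential, potential, imCLM_apply, add_im, Finset.sum_add_distrib,
      mul_add, mul_sub, Finset.sum_sub_distrib]
    ring

end Potential

/-! ### Propagation of positivity along compact submanifolds -/

section Submanifold

variable {r : ℕ} {B : Type*} [TopologicalSpace B] [ChartedSpace (Fin r → ℂ) B]

/-- The points near which a set is a complex submanifold form a relatively open subset. -/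
lemma eventually_isComplexSubmanifoldAt {S : Set B} {k : ℕ} {x : B}
    (h : IsComplexSubmanifoldAt (r := r) S k x) :
    ∀ᶠ y in 𝓝 x, y ∈ S → IsComplexSubmanifoldAt (r := r) S k y := by
  obtain ⟨φ, hφ, hxs, V, hV, hS⟩ := h
  filter_upwards [φ.open_source.mem_nhds hxs] with y hy hyS
  refine ⟨φ, hφ, hy, V, hV, fun w hw => ?_⟩
  have h1 := (hS y hy).1 hyS
  rw [hS w hw]
  constructor
  · intro h2
    simpa using V.sub_mem h2 h1
  · intro h2
    simpa using V.add_mem h2 h1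

/-- Through every point of a positive-dimensional complex submanifold there is a non-constant
holomorphic disc contained in the submanifold. -/
lemma exists_disc [IsManifold 𝓘(ℂ, Fin r → ℂ) 1 B] {S : Set B} {k : ℕ} {x : B}
    (hk : 1 ≤ k) (h : IsComplexSubmanifoldAt (r := r) S k x) :
    ∃ (d : ℂ → B) (η : Fin r → ℂ), η ≠ 0 ∧ d 0 = x ∧ ContinuousAt d 0 ∧ (∀ᶠ w in 𝓝 0, d w ∈ S) ∧
      (∀ f : B → ℂ, ∀ᶠ w in 𝓝 0, HolAt (r := r) f (d w) → DifferentiableAt ℂ (f ∘ d) w) ∧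
      ∀ f : B → ℂ, HolAt (r := r) f x → deriv (f ∘ d) 0 = holDiff f x η := by
  obtain ⟨φ, hφ', hxs, V, hV, hS⟩ := h
  have hφ : φ ∈ IsManifold.maximalAtlas 𝓘(ℂ, Fin r → ℂ) 1 B :=
    IsManifold.maximalAtlas_subset_of_le le_top hφ'
  have hxt := φ.map_source hxs
  have hVne : V ≠ ⊥ := by
    rintro rfl
    rw [finrank_bot] at hV
    omega
  obtain ⟨η, hηV, hη⟩ := V.exists_mem_ne_zero_of_ne_bot hVne
  obtain ⟨T, hT⟩ := exists_chart_equiv hφ hxt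
  have hline : Tendsto (fun w : ℂ => φ x + w • η) (𝓝 0) (𝓝 (φ x)) := by
    simpa using (continuous_line (φ x) η).tendsto 0
  have htarget : ∀ᶠ w in 𝓝 (0 : ℂ), φ x + w • η ∈ φ.target :=
    hline.eventually (φ.open_target.mem_nhds hxt)
  refine ⟨fun w => φ.symm (φ x + w • η), T η, ?_, by simp [φ.left_inv hxs], ?_, ?_, ?_, ?_⟩
  · simpa using hη
  · refine ContinuousAt.comp (g := φ.symm) ?_ (continuous_line (φ x) η).continuousAt
    simpa using φ.continuousAt_symm hxt
  · filter_upwards [htarget] with w hw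
    rw [hS _ (φ.map_target hw), φ.right_inv hw, add_sub_cancel_left]
    exact V.smul_mem w hηV
  · intro f
    filter_upwards [htarget] with w hw hf
    exact (hasDerivAt_line (f := f ∘ φ.symm) (HolAt.comp_symm hφ hw hf)).differentiableAt
  · intro f hf
    have hf' : HolAt (r := r) f (φ.symm (φ x)) := by rwa [φ.left_inv hxs]
    have h1 := (hasDerivAt_line (f := f ∘ φ.symm) (x := φ x) (v := η) (w := 0)
      (by simpa using HolAt.comp_symm hφ hxt hf')).deriv
    rw [zero_smul, add_zero, hT f hf', φ.left_inv hxs] at h1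
    exact h1

variable {ι J : Type*}

/-- The positivity of a potential propagates from the boundary of a compact submanifold to its
interior. If the potential were non-positive at some interior point, the barrier potential, for
small `ε` and `δ`, would have a minimum at an interior point off the zeros of the `Z γ`, which
`not_eventually_barrierPotential_le` excludes. -/
theorem potential_pos_of_boundary [IsManifold 𝓘(ℂ, Fin r → ℂ) 1 B] {S U : Set B}
    (hS : IsCompact S) (hU : IsOpen U) (hSU : S ⊆ U) {s : Finset ι} {c : ι → ℝ}
    (hc : ∀ γ ∈ s, 0 ≤ c γ) {Z : ι → B → ℂ} (hZ : ∀ γ ∈ s, ∀ y ∈ U, HolAt (r := r) (Z γ) y)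
    {f : B → ℂ} (hf : ∀ y ∈ U, (∀ γ ∈ s, Z γ y ≠ 0) → HolAt (r := r) f y)
    (hlow : ∀ y ∈ S, ¬ (∀ γ ∈ s, Z γ y ≠ 0) →
      ∃ C : ℝ, ∀ᶠ y' in 𝓝 y, (∀ γ ∈ s, Z γ y' ≠ 0) → -C ≤ (f y').im)
    {t : Finset J} {b : J → B → ℂ} (hb : ∀ j ∈ t, ∀ y ∈ U, HolAt (r := r) (b j) y)
    (hspan : ∀ y ∈ S, ∀ η ≠ 0, ∃ j ∈ t, holDiff (r := r) (b j) y η ≠ 0) {k : ℕ} (hk : 1 ≤ k)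
    (hbd : ∀ y ∈ S, ¬ IsComplexSubmanifoldAt (r := r) S k y →
      (∀ γ ∈ s, Z γ y ≠ 0) ∧ ∀ φ, 0 < potential s c (f y) (fun γ => Z γ y) φ)
    {x : B} (hx : x ∈ S) (hxZ : ∀ γ ∈ s, Z γ x ≠ 0) (φ : ι → ℝ) :
    0 < potential s c (f x) (fun γ => Z γ x) φ := by
  classical
  by_contra hcon
  push Not at hcon
  set box : Set (ι → ℝ) := Set.pi univ fun _ : ι => Icc (0 : ℝ) (2 * Real.pi) with hbox
  have hboxc : IsCompact box := isCompact_univ_pi fun _ => isCompact_Icc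
  obtain ⟨φ₀, hφ₀, hφeq⟩ := exists_angle_mem_Icc φ
  rw [hφeq] at hcon
  have hZc : ∀ γ ∈ s, ∀ y ∈ U, ContinuousAt (Z γ) y := fun γ hγ y hy => (hZ γ hγ y hy).continuousAt
  have hbc : ∀ j ∈ t, ∀ y ∈ U, ContinuousAt (b j) y := fun j hj y hy => (hb j hj y hy).continuousAt
  have hfst : ∀ {h : B → ℂ} {y : B} (ψ : ι → ℝ), ContinuousAt h y →
      ContinuousAt (fun p : B × (ι → ℝ) => h p.1) (y, ψ) := fun ψ h =>
    ContinuousAt.comp (f := Prod.fst) h continuousAt_fst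
  -- a positive lower bound at the points where `S` is not a submanifold
  set N : Set B := {y ∈ S | ¬ IsComplexSubmanifoldAt (r := r) S k y} with hN
  have hNc : IsCompact N := by
    have : N = S ∩ {y | ∀ᶠ y' in 𝓝 y, y' ∈ S → IsComplexSubmanifoldAt (r := r) S k y'}ᶜ := by
      ext y
      constructor
      · exact fun h => ⟨h.1, fun h' => h.2 (Filter.Eventually.self_of_nhds h' h.1)⟩
      · exact fun h => ⟨h.1, fun h' => h.2 (eventually_isComplexSubmanifoldAt h')⟩
    rw [this]
    exact hS.inter_right isOpen_setOfPred_eventually_nhds.isClosed_compl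
  obtain ⟨μ, hμ, hμN⟩ : ∃ μ > 0, ∀ y ∈ N, ∀ ψ ∈ box,
      μ ≤ potential s c (f y) (fun γ => Z γ y) ψ := by
    rcases N.eq_empty_or_nonempty with hNe | hNe
    · exact ⟨1, one_pos, by simp [hNe]⟩
    · obtain ⟨p, hp, hmin⟩ := (hNc.prod hboxc).exists_isMinOn (hNe.prod ⟨φ₀, hφ₀⟩)
        (f := fun p : B × (ι → ℝ) => potential s c (f p.1) (fun γ => Z γ p.1) p.2)
        (fun p hp => by
          have hpU := hSU hp.1.1
          have hpZ := (hbd p.1 hp.1.1 hp.1.2).1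
          exact (continuousAt_potential c (hfst p.2 (hf _ hpU hpZ).continuousAt)
            (fun γ hγ => hfst p.2 (hZc γ hγ _ hpU)) hpZ
            (fun γ _ => (continuous_apply γ).continuousAt.comp continuousAt_snd)).continuousWithinAt)
      exact ⟨_, (hbd p.1 hp.1.1 hp.1.2).2 p.2, fun y hy ψ hψ => hmin (a := (y, ψ)) ⟨hy, hψ⟩⟩
  -- bounds for the barrier
  obtain ⟨Q, hQ⟩ := hS.exists_bound_of_continuousOn (f := fun y => ∑ j ∈ t, ‖b j y‖ ^ 2)
    fun y hy => (tendsto_finsetSum _ fun j hj =>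
      ((hbc j hj y (hSU hy)).norm.continuousWithinAt.tendsto.pow 2))
  have hQ0 : 0 ≤ Q := (norm_nonneg _).trans (hQ x hx)
  have hxN : IsCompact (insert x N) := hNc.insert x
  obtain ⟨Λ, hΛ⟩ := hxN.exists_bound_of_continuousOn (f := fun y => ∑ γ ∈ s, Real.log ‖Z γ y‖)
    fun y hy => by
      have h1 : y ∈ S ∧ ∀ γ ∈ s, Z γ y ≠ 0 := by
        rcases hy with rfl | hy
        · exact ⟨hx, hxZ⟩
        · exact ⟨hy.1, (hbd y hy.1 hy.2).1⟩
      refine (tendsto_finsetSum _ fun γ hγ => ?_)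
      exact (Real.continuousAt_log (norm_ne_zero_iff.2 (h1.2 γ hγ))).tendsto.comp
        (hZc γ hγ y (hSU h1.1)).norm.continuousWithinAt.tendsto
  have hΛ0 : 0 ≤ Λ := (norm_nonneg _).trans (hΛ x (mem_insert x N))
  -- With these constants each part of the barrier changes the values at `x`, and at the points
  -- where `S` is not a submanifold, by at most `μ / 4`.
  set ε : ℝ := μ / (4 * (Q + 1)) with hε
  set δ : ℝ := μ / (4 * (Λ + 1)) with hδ
  have hε0 : 0 < ε := by positivity
  have hδ0 : 0 < δ := by positivity
  have hεQ : ε * Q ≤ μ / 4 := by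
    rw [hε, div_mul_eq_mul_div, div_le_div_iff₀ (by positivity) (by norm_num)]
    nlinarith
  have hδΛ : δ * Λ < μ / 4 := by
    rw [hδ, div_mul_eq_mul_div, div_lt_div_iff₀ (by positivity) (by norm_num)]
    nlinarith
  set G : B × (ι → ℝ) → ℝ := fun p =>
    barrierPotential s c t ε δ (f p.1) (fun γ => Z γ p.1) (fun j => b j p.1) p.2 with hG
  -- Extended by zero to the zeros of the `Z γ`, the function `exp (-G)` is upper semicontinuous, so
  -- it attains its maximum.
  set E : B × (ι → ℝ) → ℝ := fun p => if ∀ γ ∈ s, Z γ p.1 ≠ 0 then Real.exp (-G p) else 0 with hE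
  have hEreg : ∀ {p : B × (ι → ℝ)}, (∀ γ ∈ s, Z γ p.1 ≠ 0) → E p = Real.exp (-G p) := fun h =>
    if_pos h
  have hEsing : ∀ {p : B × (ι → ℝ)}, ¬ (∀ γ ∈ s, Z γ p.1 ≠ 0) → E p = 0 := fun h => if_neg h
  have hev : ∀ y ∈ U, (∀ γ ∈ s, Z γ y ≠ 0) → ∀ᶠ y' in 𝓝 y, ∀ γ ∈ s, Z γ y' ≠ 0 := fun y hy h =>
    (Finset.eventually_all s).2 fun γ hγ => (hZc γ hγ y hy).eventually_ne (h γ hγ)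
  have husc : UpperSemicontinuousOn E (S ×ˢ box) := by
    intro p hp a ha
    have hpU := hSU hp.1
    refine Filter.Eventually.filter_mono nhdsWithin_le_nhds ?_
    by_cases hpZ : ∀ γ ∈ s, Z γ p.1 ≠ 0
    · have hGc : ContinuousAt G p := continuousAt_barrierPotential c ε δ
        (hfst p.2 (hf _ hpU hpZ).continuousAt)
        (fun γ hγ => hfst p.2 (hZc γ hγ _ hpU)) hpZ (fun j hj => hfst p.2 (hbc j hj _ hpU))
        (fun γ _ => (continuous_apply γ).continuousAt.comp continuousAt_snd)
      rw [hEreg hpZ] at ha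
      have h1 := (Real.continuous_exp.continuousAt.comp hGc.neg).eventually (gt_mem_nhds ha)
      filter_upwards [h1, continuousAt_fst.eventually (hev _ hpU hpZ)] with p' h2 h3
      rw [hEreg h3]
      exact h2
    · have ha0 : 0 < a := by rwa [hEsing hpZ] at ha
      obtain ⟨C, hC⟩ := hlow p.1 hp.1 hpZ
      -- A majorant of `E` near the zeros: the factors `|Z γ| ^ δ` come from the poles of the
      -- barrier, the rest is bounded.
      set K : B → ℝ := fun y => Real.exp (C + ∑ γ ∈ s, c γ * (2 + ‖Z γ y‖) +
        ε * ∑ j ∈ t, ‖b j y‖ ^ 2) * ∏ γ ∈ s, ‖Z γ y‖ ^ δ with hK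
      have hKc : ContinuousAt K p.1 := by
        refine ContinuousAt.mul (Real.continuous_exp.continuousAt.comp
          ((tendsto_const_nhds.add (tendsto_finsetSum _ fun γ hγ => ?_)).add
          (tendsto_const_nhds.mul (tendsto_finsetSum _ fun j hj => ?_))))
          (tendsto_finsetProd _ fun γ hγ => ?_)
        · exact tendsto_const_nhds.mul (tendsto_const_nhds.add (hZc γ hγ _ hpU).norm)
        · exact (hbc j hj _ hpU).norm.pow 2
        · exact (hZc γ hγ _ hpU).norm.rpow_const (Or.inr hδ0.le)
      have hK0 : K p.1 = 0 := by
        push Not at hpZ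
        obtain ⟨γ, hγ, hγ0⟩ := hpZ
        simp only [hK]
        rw [Finset.prod_eq_zero hγ (by simp [hγ0, Real.zero_rpow hδ0.ne']), mul_zero]
      have h1 := hKc.eventually (gt_mem_nhds (by rwa [hK0] : K p.1 < a))
      filter_upwards [continuousAt_fst.eventually (h1.and hC)] with p' h2
      refine lt_of_le_of_lt ?_ h2.1
      by_cases hZ' : ∀ γ ∈ s, Z γ p'.1 ≠ 0
      · rw [hEreg hZ', hK]
        have hprod : ∏ γ ∈ s, ‖Z γ p'.1‖ ^ δ = Real.exp (δ * ∑ γ ∈ s, Real.log ‖Z γ p'.1‖) := by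
          rw [Finset.mul_sum, Real.exp_sum]
          refine Finset.prod_congr rfl fun γ hγ => ?_
          rw [Real.rpow_def_of_pos (norm_pos_iff.2 (hZ' γ hγ)), mul_comm]
        simp only
        rw [hprod, ← Real.exp_add, Real.exp_le_exp]
        have h3 := le_potential hc (f p'.1) hZ' p'.2
        have h4 := h2.2 hZ'
        simp only [hG, barrierPotential]
        linarith
      · rw [hEsing hZ']
        exact mul_nonneg (Real.exp_pos _).le
          (Finset.prod_nonneg fun γ _ => Real.rpow_nonneg (norm_nonneg _) _)
  obtain ⟨p, hp, hmax⟩ := UpperSemicontinuousOn.exists_isMaxOn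
    (⟨(x, φ₀), hx, hφ₀⟩ : (S ×ˢ box).Nonempty) (hS.prod hboxc) husc
  have hExpos : Real.exp (-(μ / 4)) < E (x, φ₀) := by
    rw [hEreg hxZ, Real.exp_lt_exp, neg_lt_neg_iff]
    have h1 := (abs_le.1 (hΛ x (mem_insert x N))).1
    have h2 : 0 ≤ ε * ∑ j ∈ t, ‖b j x‖ ^ 2 :=
      mul_nonneg hε0.le (Finset.sum_nonneg fun j _ => by positivity)
    have h3 := mul_le_mul_of_nonneg_left h1 hδ0.le
    simp only [hG, barrierPotential]
    linarith
  have hEp : Real.exp (-(μ / 4)) < E p := hExpos.trans_le (hmax (a := (x, φ₀)) ⟨hx, hφ₀⟩)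
  have hpZ : ∀ γ ∈ s, Z γ p.1 ≠ 0 := by
    by_contra h
    rw [hEsing h] at hEp
    exact absurd hEp (not_lt.2 (Real.exp_pos _).le)
  rw [hEreg hpZ, Real.exp_lt_exp, neg_lt_neg_iff] at hEp
  have hpS : IsComplexSubmanifoldAt (r := r) S k p.1 := by
    by_contra h
    have hpN : p.1 ∈ N := ⟨hp.1, h⟩
    have h1 := hμN p.1 hpN p.2 hp.2
    have h2 := (abs_le.1 (hΛ p.1 (mem_insert_of_mem x hpN))).2
    have h3 := mul_le_mul_of_nonneg_left h2 hδ0.le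
    have h4 := mul_le_mul_of_nonneg_left ((le_abs_self _).trans (hQ p.1 hp.1)) hε0.le
    simp only [hG, barrierPotential] at hEp
    linarith
  -- at an interior minimum, restrict to a holomorphic disc
  obtain ⟨d, η, hη, hd0, hdc, hdS, hdf, hdd⟩ := exists_disc hk hpS
  have hpU := hSU hp.1
  rw [ContinuousAt, hd0] at hdc
  have hdU : ∀ᶠ w in 𝓝 0, d w ∈ U := hdc.eventually (hU.mem_nhds hpU)
  have hdZ : ∀ᶠ w in 𝓝 0, ∀ γ ∈ s, Z γ (d w) ≠ 0 := hdc.eventually (hev _ hpU hpZ)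
  refine not_eventually_barrierPotential_le (s := s) (c := c) (t := t) (ε := ε) (δ := δ) hε0
    (f := f ∘ d) (z := fun γ => Z γ ∘ d) (b := fun j => b j ∘ d) ?_ ?_ ?_ ?_ ?_ p.2 ?_
  · filter_upwards [hdf f, hdU, hdZ] with w h1 h2 h3 using h1 (hf _ h2 h3)
  · intro γ hγ
    filter_upwards [hdf (Z γ), hdU] with w h1 h2 using h1 (hZ γ hγ _ h2)
  · intro γ hγ
    simpa [hd0] using hpZ γ hγ
  · intro j hj
    filter_upwards [hdf (b j), hdU] with w h1 h2 using h1 (hb j hj _ h2)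
  · obtain ⟨j, hj, hj0⟩ := hspan p.1 hp.1 η hη
    exact ⟨j, hj, by rwa [hdd (b j) (hb j hj _ hpU)]⟩
  · filter_upwards [hdS, hdZ] with w h1 h2 φ'
    obtain ⟨φ'', hφ'', hφeq''⟩ := exists_angle_mem_Icc φ'
    have h3 := hmax (a := (d w, φ'')) ⟨h1, hφ''⟩
    simp only at h3
    rw [Set.mem_ofPred_eq, hEreg hpZ, hEreg h2, Real.exp_le_exp, neg_le_neg_iff] at h3
    simp only [hG, barrierPotential, Function.comp_apply, hd0] at h3 ⊢
    rw [hφeq'']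
    exact h3

end Submanifold

/-! ### Symplectic frames of the charge lattice at a point -/

section Frames

variable {r : ℕ} {B : Type*} [TopologicalSpace B] [ChartedSpace (Fin r → ℂ) B]
  {R : TopologicalSpace.Opens B} {D : ChargeData r B R} {x : R}

/-- Symplectic relations between finitely many charges at one point. -/
structure IsFrameAt (D : ChargeData r B R) (x : R) {ι : Type*} [DecidableEq ι]
    (e m : ι → D.charge.Fiber x) (p : ι → ℤ) : Prop where
  p_ne_zero : ∀ i, p i ≠ 0
  pair_me : ∀ i j, D.pair x (m i) (e j) = if i = j then p i else 0
  pair_ee : ∀ i j, D.pair x (e i) (e j) = 0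
  pair_mm : ∀ i j, D.pair x (m i) (m j) = 0

lemma IsSymplecticFrame.isFrameAt {Ua : Set R} {e m : Fin r → ∀ x, D.charge.Fiber x} {p : Fin r → ℤ}
    (h : IsSymplecticFrame D Ua e m p) (hx : x ∈ Ua) :
    IsFrameAt D x (fun i => e i x) (fun i => m i x) p :=
  ⟨h.p_ne_zero, h.pair_me x hx, h.pair_ee x hx, h.pair_mm x hx⟩

lemma pair_flavor (γ : D.charge.Fiber x) (f : D.Flavor) : D.pair x γ (D.flavor x f) = 0 := by
  rw [D.pair_antisymm, (D.radical x _).2 ⟨f, rfl⟩ γ, neg_zero]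

section

variable {ι : Type*} [DecidableEq ι] {e m : ι → D.charge.Fiber x} {p : ι → ℤ}

lemma IsFrameAt.pair_em (h : IsFrameAt D x e m p) (i j : ι) :
    D.pair x (e i) (m j) = if i = j then -p i else 0 := by
  rw [D.pair_antisymm, h.pair_me]
  rcases eq_or_ne i j with rfl | hij
  · simp
  · simp [hij, hij.symm]

variable [Fintype ι]

lemma IsFrameAt.pair_m_sum (h : IsFrameAt D x e m p) (a b : ι → ℤ) (j : ι) :
    D.pair x (m j) (∑ i, a i • e i + ∑ i, b i • m i) = a j * p j := by
  simp [h.pair_me, h.pair_mm]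

lemma IsFrameAt.pair_e_sum (h : IsFrameAt D x e m p) (a b : ι → ℤ) (j : ι) :
    D.pair x (e j) (∑ i, a i • e i + ∑ i, b i • m i) = -(b j * p j) := by
  simp [h.pair_em, h.pair_ee]

/-- Some multiple of `γ`, made orthogonal to a frame. -/
def frameProj (e m : ι → D.charge.Fiber x) (p : ι → ℤ) (γ : D.charge.Fiber x) : D.charge.Fiber x :=
  (∏ i, p i) • γ - (∑ i, ((∏ j ∈ Finset.univ.erase i, p j) * D.pair x (m i) γ) • e i +
    ∑ i, (-((∏ j ∈ Finset.univ.erase i, p j) * D.pair x (e i) γ)) • m i)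

lemma IsFrameAt.pair_m_frameProj (h : IsFrameAt D x e m p) (γ : D.charge.Fiber x) (j : ι) :
    D.pair x (m j) (frameProj e m p γ) = 0 := by
  rw [frameProj, map_sub, h.pair_m_sum, map_zsmul, smul_eq_mul,
    ← Finset.prod_erase_mul _ _ (Finset.mem_univ j)]
  ring

lemma IsFrameAt.pair_e_frameProj (h : IsFrameAt D x e m p) (γ : D.charge.Fiber x) (j : ι) :
    D.pair x (e j) (frameProj e m p γ) = 0 := by
  rw [frameProj, map_sub, h.pair_e_sum, map_zsmul, smul_eq_mul,
    ← Finset.prod_erase_mul _ _ (Finset.mem_univ j)]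
  ring

lemma pair_frameProj_of_orthogonal {δ : D.charge.Fiber x} (he : ∀ i, D.pair x δ (e i) = 0)
    (hm : ∀ i, D.pair x δ (m i) = 0) (γ : D.charge.Fiber x) :
    D.pair x δ (frameProj e m p γ) = (∏ i, p i) * D.pair x δ γ := by
  simp [frameProj, he, hm]

end

/-- Fewer than `r` pairs of charges do not span `Γ ⊗ ℚ`. -/
lemma exists_orthogonal_not_flavor {ι : Type*} [Fintype ι] {e m : ι → D.charge.Fiber x}
    (hcard : Fintype.card ι < r) :
    ∃ γ : D.charge.Fiber x, (∀ i, D.pair x (m i) γ = 0) ∧ (∀ i, D.pair x (e i) γ = 0) ∧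
      γ ∉ (D.flavor x).range := by
  by_contra! hcon
  let T : D.charge.Fiber x →ₗ[ℤ] (ι → ℤ) × (ι → ℤ) :=
    LinearMap.prod (LinearMap.pi fun i => (D.pair x (m i)).toIntLinearMap)
      (LinearMap.pi fun i => (D.pair x (e i)).toIntLinearMap)
  have hker : LinearMap.ker T ≤ LinearMap.range (D.flavor x).toIntLinearMap := by
    intro γ hγ
    have hγ' : T γ = 0 := hγ
    obtain ⟨f, hf⟩ := hcon γ (fun i => congrFun (congrArg Prod.fst hγ') i)
      (fun i => congrFun (congrArg Prod.snd hγ') i)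
    exact ⟨f, hf⟩
  have h1 := Submodule.finrank_quotient_add_finrank (LinearMap.ker T)
  rw [T.quotKerEquivRange.finrank_eq] at h1
  have h2 : Module.finrank ℤ (LinearMap.range T) ≤ 2 * Fintype.card ι := by
    refine (Submodule.finrank_le _).trans ?_
    simp [Module.finrank_prod]
    omega
  have h3 : Module.finrank ℤ (LinearMap.ker T) ≤ Module.finrank ℤ D.Flavor :=
    (Submodule.finrank_mono hker).trans (LinearMap.finrank_range_le _)
  have h4 := D.rank x
  omega

section Full

variable {e m : Fin r → D.charge.Fiber x} {p : Fin r → ℤ}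

/-- A frame of `r` pairs spans `Γ ⊗ ℚ`. -/
lemma IsFrameAt.exists_multiple (h : IsFrameAt D x e m p) (γ : D.charge.Fiber x) :
    ∃ (n : ℤ) (f : D.Flavor) (a b : Fin r → ℤ), n ≠ 0 ∧
      n • γ = D.flavor x f + (∑ i, a i • e i + ∑ i, b i • m i) := by
  let T : ℤ × D.Flavor × (Fin r → ℤ) × (Fin r → ℤ) →ₗ[ℤ] D.charge.Fiber x :=
    AddMonoidHom.toIntLinearMap
      { toFun := fun q => q.1 • γ - (D.flavor x q.2.1 +
          (∑ i, q.2.2.1 i • e i + ∑ i, q.2.2.2 i • m i))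
        map_zero' := by simp
        map_add' := fun q q' => by
          simp only [Prod.fst_add, Prod.snd_add, Pi.add_apply, add_smul, map_add,
            Finset.sum_add_distrib]
          abel }
  have hT : ∀ q, T q = q.1 • γ - (D.flavor x q.2.1 +
    (∑ i, q.2.2.1 i • e i + ∑ i, q.2.2.2 i • m i)) := fun q => rfl
  -- The source has rank `1 + rank Γ_f + 2 r`, the target `rank Γ_f + 2 r`.
  have hni : ¬ Function.Injective T := fun hinj => by
    have h1 := LinearMap.finrank_le_finrank_of_injective hinj
    have h2 := D.rank x
    simp only [Module.finrank_prod, Module.finrank_self, Module.finrank_fintype_fun_eq_card,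
      Fintype.card_fin] at h1
    omega
  rw [injective_iff_map_eq_zero] at hni
  push Not at hni
  obtain ⟨⟨n, f, a, b⟩, hq, hne⟩ := hni
  rw [hT, sub_eq_zero] at hq
  refine ⟨n, f, a, b, ?_, hq⟩
  rintro rfl
  simp only [zero_smul] at hq
  refine hne ?_
  have ha : a = 0 := funext fun j => by
    have := congrArg (D.pair x (m j)) hq
    rw [map_add, h.pair_m_sum, pair_flavor, map_zero, zero_add] at this
    exact (mul_eq_zero.1 this.symm).resolve_right (h.p_ne_zero j)
  have hb : b = 0 := funext fun j => by
    have := congrArg (D.pair x (e j)) hq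
    rw [map_add, h.pair_e_sum, pair_flavor, map_zero, zero_add] at this
    exact (mul_eq_zero.1 (neg_eq_zero.1 this.symm)).resolve_right (h.p_ne_zero j)
  subst ha hb
  have hf : f = 0 := D.flavor_injective x (by simpa using hq.symm)
  simp [hf]

/-- Expansion of linear forms on `Γ` in a symplectic frame. -/
lemma IsFrameAt.expansion (h : IsFrameAt D x e m p) (L : D.charge.Fiber x →+ ℂ)
    (hL : ∀ f, L (D.flavor x f) = 0) (γ : D.charge.Fiber x) :
    L γ = ∑ i, ((D.pair x (m i) γ : ℂ) / p i * L (e i) - (D.pair x (e i) γ : ℂ) / p i * L (m i)) := by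
  obtain ⟨n, f, a, b, hn, hγ⟩ := h.exists_multiple γ
  have hn' : (n : ℂ) ≠ 0 := by exact_mod_cast hn
  refine mul_left_cancel₀ hn' ?_
  have h1 : (n : ℂ) * L γ = ∑ i, (a i : ℂ) * L (e i) + ∑ i, (b i : ℂ) * L (m i) := by
    have := congrArg L hγ
    simpa [map_sum, hL, zsmul_eq_mul] using this
  have ha : ∀ j, (n : ℂ) * D.pair x (m j) γ = a j * p j := fun j => by
    have := congrArg (D.pair x (m j)) hγ
    rw [map_add, h.pair_m_sum, pair_flavor, zero_add, map_zsmul, smul_eq_mul] at this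
    exact_mod_cast this
  have hb : ∀ j, (n : ℂ) * D.pair x (e j) γ = -(b j * p j) := fun j => by
    have := congrArg (D.pair x (e j)) hγ
    rw [map_add, h.pair_e_sum, pair_flavor, zero_add, map_zsmul, smul_eq_mul] at this
    exact_mod_cast this
  rw [h1, Finset.mul_sum, ← Finset.sum_add_distrib]
  refine Finset.sum_congr rfl fun i _ => ?_
  have hp : (p i : ℂ) ≠ 0 := by exact_mod_cast h.p_ne_zero i
  have e1 : (n : ℂ) * (D.pair x (m i) γ / p i * L (e i) - D.pair x (e i) γ / p i * L (m i)) =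
      (n * D.pair x (m i) γ) / p i * L (e i) - (n * D.pair x (e i) γ) / p i * L (m i) := by ring
  rw [e1, ha, hb]
  field_simp
  ring

/-- For a linear form on `Γ`, the number `Im ∑ conj (L e_i) L m_i / p_i` depends only on the `e_i`:
two choices of the `m_i` differ by a real symmetric matrix. -/
lemma IsFrameAt.im_sum_eq (h : IsFrameAt D x e m p) {m' : Fin r → D.charge.Fiber x} {p' : Fin r → ℤ}
    (h' : IsFrameAt D x e m' p') (L : D.charge.Fiber x →+ ℂ) (hL : ∀ f, L (D.flavor x f) = 0) :
    (∑ i, conj (L (e i)) * (L (m' i) / p' i)).im = (∑ i, conj (L (e i)) * (L (m i) / p i)).im := by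
  -- the matrix of the difference
  set s : Fin r → Fin r → ℝ := fun i j => (D.pair x (m j) (m' i) : ℝ) / p j / p' i with hs
  have hexp : ∀ i, L (m' i) / p' i = L (m i) / p i + ∑ j, (s i j : ℂ) * L (e j) := fun i => by
    have hp' : (p' i : ℂ) ≠ 0 := by exact_mod_cast h'.p_ne_zero i
    have hp : (p i : ℂ) ≠ 0 := by exact_mod_cast h.p_ne_zero i
    rw [h.expansion L hL (m' i), Finset.sum_sub_distrib, sub_div, sub_eq_add_neg, add_comm]
    congr 1
    · simp only [h'.pair_em]
      rw [Finset.sum_eq_single i (fun j _ hj => by simp [hj]) (by simp)]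
      simp only [if_true, Int.cast_neg]
      field_simp
    · rw [Finset.sum_div]
      refine Finset.sum_congr rfl fun j _ => ?_
      simp only [hs]
      push_cast
      ring
  have hsymm : ∀ i j, s i j = s j i := fun i j => by
    -- `⟨m'_i, m'_j⟩ = 0`
    have h0 := h.exists_multiple (m' j)
    obtain ⟨n, f, a, b, hn, hγ⟩ := h0
    have hn' : (n : ℝ) ≠ 0 := by exact_mod_cast hn
    have e1 := congrArg (D.pair x (m' i)) hγ
    have e2 := fun k => congrArg (D.pair x (m k)) hγ
    have e3 := fun k => congrArg (D.pair x (e k)) hγ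
    simp only [map_zsmul, smul_eq_mul, map_add (D.pair x _) (D.flavor x f), pair_flavor,
      h.pair_m_sum, h.pair_e_sum, zero_add, h'.pair_mm, h'.pair_em, mul_zero] at e1 e2 e3
    simp only [map_add, map_sum, map_zsmul, h'.pair_me, smul_eq_mul] at e1
    rw [Finset.sum_eq_single i (fun k _ hk => by simp [hk.symm]) (by simp)] at e1
    have e4 : ∀ k, D.pair x (m' i) (m k) = -D.pair x (m k) (m' i) := fun k => D.pair_antisymm x _ _
    have hb : ∀ k, (b k : ℝ) * p k = if k = j then (n : ℝ) * p' j else 0 := fun k => by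
      have := e3 k
      rcases eq_or_ne k j with rfl | hk
      · simp only [if_true] at this ⊢
        exact_mod_cast (by linarith : b k * p k = n * p' k)
      · simp only [hk, if_false] at this ⊢
        exact_mod_cast (by linarith : b k * p k = 0)
    rw [Finset.sum_eq_single j (fun k _ hk => by
      have h1 := hb k
      simp only [hk, if_false, mul_eq_zero, Int.cast_eq_zero, h.p_ne_zero k, or_false] at h1
      simp [h1]) (by simp)] at e1
    simp only [if_true, e4] at e1
    have hpi : (p i : ℝ) ≠ 0 := by exact_mod_cast h.p_ne_zero i
    have hpj : (p j : ℝ) ≠ 0 := by exact_mod_cast h.p_ne_zero j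
    have hpi' : (p' i : ℝ) ≠ 0 := by exact_mod_cast h'.p_ne_zero i
    have hpj' : (p' j : ℝ) ≠ 0 := by exact_mod_cast h'.p_ne_zero j
    have f1 : (0 : ℝ) = a i * p' i + b j * (-D.pair x (m j) (m' i)) := by exact_mod_cast e1
    have f2 : (n : ℝ) * D.pair x (m i) (m' j) = a i * p i := by exact_mod_cast e2 i
    have f3 : (b j : ℝ) * p j = n * p' j := by simpa using hb j
    simp only [hs]
    rw [div_div, div_div, div_eq_div_iff (mul_ne_zero hpj hpi') (mul_ne_zero hpi hpj')]
    refine mul_left_cancel₀ hn' ?_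
    linear_combination (-(D.pair x (m j) (m' i) : ℝ) * p i) * f3 - p j * p' i * f2 + p i * p j * f1
  rw [← sub_eq_zero, ← sub_im, ← Finset.sum_sub_distrib]
  have hdiff : ∑ i, (conj (L (e i)) * (L (m' i) / p' i) - conj (L (e i)) * (L (m i) / p i)) =
      ∑ i, ∑ j, (s i j : ℂ) * (conj (L (e i)) * L (e j)) := by
    refine Finset.sum_congr rfl fun i _ => ?_
    rw [hexp i, mul_add, add_sub_cancel_left, Finset.mul_sum]
    exact Finset.sum_congr rfl fun j _ => by ring
  rw [hdiff, ← conj_eq_iff_im, map_sum, Finset.sum_comm]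
  refine Finset.sum_congr rfl fun j _ => ?_
  rw [map_sum]
  refine Finset.sum_congr rfl fun i _ => ?_
  simp only [map_mul, conj_ofReal, conj_conj]
  rw [hsymm j i]
  ring

lemma IsFrameAt.gram_mul (h : IsFrameAt D x e m p) :
    D.gram x (Sum.elim e m) * Matrix.fromBlocks 0 (Matrix.diagonal fun i => (p i : ℂ)⁻¹)
      (-Matrix.diagonal fun i => (p i : ℂ)⁻¹) 0 = 1 := by
  have hg : D.gram x (Sum.elim e m) = Matrix.fromBlocks 0 (-Matrix.diagonal fun i => (p i : ℂ))
      (Matrix.diagonal fun i => (p i : ℂ)) 0 := by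
    ext i j
    rcases i with i | i <;> rcases j with j | j
    · simp [ChargeData.gram, h.pair_ee]
    · simp [ChargeData.gram, h.pair_em, Matrix.diagonal_apply]
    · simp [ChargeData.gram, h.pair_me, Matrix.diagonal_apply]
    · simp [ChargeData.gram, h.pair_mm]
  have hp : ∀ i, (p i : ℂ) ≠ 0 := fun i => by exact_mod_cast h.p_ne_zero i
  rw [hg, Matrix.fromBlocks_multiply, ← Matrix.fromBlocks_one]
  simp [Matrix.diagonal_mul_diagonal, hp]

lemma IsFrameAt.isGaugeBasis (h : IsFrameAt D x e m p) : D.IsGaugeBasis x (Sum.elim e m) := by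
  intro h0
  have := congrArg Matrix.det h.gram_mul
  rw [Matrix.det_mul, h0, zero_mul, Matrix.det_one] at this
  exact zero_ne_one this

lemma IsFrameAt.dualPair_eq (h : IsFrameAt D x e m p) (f g : Fin r ⊕ Fin r → ℂ) :
    D.dualPair x (Sum.elim e m) f g =
      ∑ i, (f (.inr i) * g (.inl i) - f (.inl i) * g (.inr i)) / p i := by
  rw [ChargeData.dualPair, Matrix.inv_eq_right_inv h.gram_mul]
  simp only [Fintype.sum_sum_type, Matrix.fromBlocks_apply₁₁, Matrix.fromBlocks_apply₁₂,
    Matrix.fromBlocks_apply₂₁, Matrix.fromBlocks_apply₂₂, Matrix.zero_apply, Matrix.neg_apply,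
    Matrix.diagonal_apply, mul_zero, zero_mul, Finset.sum_const_zero, zero_add, add_zero,
    mul_ite, ite_mul, mul_neg, neg_mul, Finset.sum_neg_distrib, Finset.sum_ite_eq, Finset.mem_univ,
    if_true, neg_add, neg_neg]
  rw [← Finset.sum_neg_distrib, ← Finset.sum_add_distrib]
  refine Finset.sum_congr rfl fun i _ => ?_
  ring

end Full

end Frames

/-! ### The differentials of the central charges in a frame -/

section Differential

variable {r : ℕ} {B : Type*} [TopologicalSpace B] [ChartedSpace (Fin r → ℂ) B]
  {R : TopologicalSpace.Opens B}

lemma holDiff_add {X : Type*} [TopologicalSpace X] [ChartedSpace (Fin r → ℂ) X] {f g : X → ℂ} {x : X}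
    (hf : MDifferentiableAt 𝓘(ℂ, Fin r → ℂ) 𝓘(ℂ) f x)
    (hg : MDifferentiableAt 𝓘(ℂ, Fin r → ℂ) 𝓘(ℂ) g x) :
    holDiff (r := r) (fun y => f y + g y) x = holDiff f x + holDiff g x :=
  mfderiv_add hf hg

lemma holDiff_const {X : Type*} [TopologicalSpace X] [ChartedSpace (Fin r → ℂ) X] {x : X} (c : ℂ) :
    holDiff (r := r) (fun _ : X => c) x = 0 := mfderiv_const

lemma dZ_add (D : ChargeData r B R) (x : R) (a b : D.charge.Fiber x) :
    D.dZ x (a + b) = D.dZ x a + D.dZ x b := by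
  simp only [ChargeData.dZ, map_add]
  exact holDiff_add (D.Z_holomorphic x a).self_of_nhds (D.Z_holomorphic x b).self_of_nhds

lemma dZ_flavor (D : ChargeData r B R) (x : R) (f : D.Flavor) : D.dZ x (D.flavor x f) = 0 := by
  rw [ChargeData.dZ, ← holDiff_const (r := r) (x := x) (D.Z x (D.flavor x f))]
  refine Filter.EventuallyEq.mfderiv_eq ?_
  filter_upwards [D.flavor_flat x] with y hy
  rw [← hy f, D.Z_flavor]

/-- The values of the differentials `dZ_γ` on a tangent vector. -/
def dZHom (D : ChargeData r B R) (x : R) (v : Fin r → ℂ) : D.charge.Fiber x →+ ℂ where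
  toFun γ := D.dZ x γ v
  map_zero' := by
    have := dZ_flavor D x 0
    rw [map_zero] at this
    rw [this]; rfl
  map_add' a b := by rw [dZ_add]; rfl

lemma dZHom_apply (D : ChargeData r B R) (x : R) (v : Fin r → ℂ) (γ : D.charge.Fiber x) :
    dZHom D x v γ = D.dZ x γ v := rfl

lemma dZHom_flavor (D : ChargeData r B R) (x : R) (v : Fin r → ℂ) (f : D.Flavor) :
    dZHom D x v (D.flavor x f) = 0 := by
  rw [dZHom_apply, dZ_flavor]; rfl

section

variable {D : ChargeData r B R} {x : R} {e m : Fin r → D.charge.Fiber x} {p : Fin r → ℤ}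

lemma IsFrameAt.dZ_expansion (h : IsFrameAt D x e m p) (γ : D.charge.Fiber x) (v : Fin r → ℂ) :
    D.dZ x γ v = ∑ i, ((D.pair x (m i) γ : ℂ) / p i * D.dZ x (e i) v -
      (D.pair x (e i) γ : ℂ) / p i * D.dZ x (m i) v) :=
  h.expansion (dZHom D x v) (dZHom_flavor D x v) γ

lemma IsFrameAt.dZdZbar_re (h : IsFrameAt D x e m p) (v : Fin r → ℂ) :
    (D.dZdZbar x (Sum.elim e m) v (I • v)).re =
      4 * (∑ i, conj (D.dZ x (e i) v) * (D.dZ x (m i) v / p i)).im := by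
  have h1 : D.dZdZbar x (Sum.elim e m) v (I • v) =
      ∑ i, 4 * ((conj (D.dZ x (e i) v) * (D.dZ x (m i) v / p i)).im : ℂ) := by
    rw [ChargeData.dZdZbar, h.dualPair_eq, h.dualPair_eq, ← Finset.sum_sub_distrib]
    refine Finset.sum_congr rfl fun i _ => ?_
    simp only [Sum.elim_inl, Sum.elim_inr, map_smul, smul_eq_mul, map_mul, conj_I]
    rw [im_eq_sub_conj]
    simp only [map_mul, map_div₀, conj_conj, map_intCast]
    have hI : I ≠ 0 := I_ne_zero
    have hp : (p i : ℂ) ≠ 0 := by exact_mod_cast h.p_ne_zero i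
    field_simp
    rw [I_sq]
    ring
  rw [h1, ← Finset.mul_sum, ← ofReal_sum, ← im_sum]
  norm_cast

lemma IsFrameAt.dZdZ_eq (h : IsFrameAt D x e m p) (v w : Fin r → ℂ) :
    D.dZdZ x (Sum.elim e m) v w =
      2 * ∑ i, (D.dZ x (m i) v / p i * D.dZ x (e i) w - D.dZ x (e i) v * (D.dZ x (m i) w / p i)) := by
  rw [ChargeData.dZdZ, h.dualPair_eq, h.dualPair_eq, ← Finset.sum_sub_distrib, Finset.mul_sum]
  refine Finset.sum_congr rfl fun i _ => ?_
  simp only [Sum.elim_inl, Sum.elim_inr]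
  ring

end

section

variable {D : BPSData r B R} {x : R} {e m : Fin r → D.charge.Fiber x} {p : Fin r → ℤ}

lemma IsFrameAt.im_sum_pos (h : IsFrameAt D.toChargeData x e m p) {v : Fin r → ℂ} (hv : v ≠ 0) :
    0 < (∑ i, conj (D.dZ x (e i) v) * (D.dZ x (m i) v / p i)).im := by
  have h1 := D.kahler x _ h.isGaugeBasis v hv
  rw [h.dZdZbar_re] at h1
  linarith

/-- The Kähler condition implies that the `Z_{e_i}` are local coordinates. -/
lemma IsFrameAt.det_ne_zero (h : IsFrameAt D.toChargeData x e m p) :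
    (formMatrix fun i => D.dZ x (e i)).det ≠ 0 := by
  intro h0
  obtain ⟨v, hv, hv0⟩ := Matrix.exists_mulVec_eq_zero_iff.2 h0
  have h1 : ∀ i, D.dZ x (e i) v = 0 := fun i => by
    have := congrFun hv0 i
    rwa [formMatrix_mulVec] at this
  have := h.im_sum_pos hv
  simp [h1] at this

lemma IsFrameAt.sum_symm (h : IsFrameAt D.toChargeData x e m p) (v w : Fin r → ℂ) :
    ∑ i, D.dZ x (m i) v / p i * D.dZ x (e i) w = ∑ i, D.dZ x (e i) v * (D.dZ x (m i) w / p i) := by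
  have h1 := D.dZdZ_eq_zero x _ h.isGaugeBasis v w
  rw [h.dZdZ_eq, Finset.sum_sub_distrib] at h1
  have h2 := (mul_eq_zero.1 h1).resolve_left two_ne_zero
  exact sub_eq_zero.1 h2

end

end Differential

section Adapted

variable {r : ℕ} {B : Type*} [TopologicalSpace B] [ChartedSpace (Fin r → ℂ) B]
  {R : TopologicalSpace.Opens B} {D : BPSData r B R} {U : Set B} (A : DiscriminantAssumptions D U)
  {x : R}

lemma pair_loc_light (hx : x.1 ∈ U) (ε : A.Loc) (γ : A.Light) :
    D.pair x (A.loc x ε) (A.light x γ) = 0 :=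
  (A.loc_range x hx _).1 ⟨ε, rfl⟩ γ

lemma dZ_loc (hx : x.1 ∈ U) (hU : IsOpen U) (ε : A.Loc) :
    D.dZ x (A.loc x ε) = holDiff (r := r) (A.Zloc ε) x.1 := by
  rw [← holDiff_comp_val ((A.Zloc_holomorphic ε).mdifferentiableAt (hU.mem_nhds hx))]
  refine Filter.EventuallyEq.mfderiv_eq ?_
  filter_upwards [A.loc_flat x hx, eventually_opens.2 (hU.eventually_mem hx)] with y hy hyU
  rw [← hy, Function.comp_apply, A.Zloc_eq ε y hyU]

lemma IsFrameAt.cons {D : ChargeData r B R} {k : ℕ} {e m : Fin k → D.charge.Fiber x} {p : Fin k → ℤ}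
    (h : IsFrameAt D x e m p) {e' m' : D.charge.Fiber x} {q : ℤ} (hq : q ≠ 0)
    (hme : D.pair x m' e' = q) (h1 : ∀ i, D.pair x (m i) e' = 0) (h2 : ∀ i, D.pair x (e i) e' = 0)
    (h3 : ∀ i, D.pair x (m i) m' = 0) (h4 : ∀ i, D.pair x (e i) m' = 0) :
    IsFrameAt D x (Fin.cons e' e : Fin (k + 1) → _) (Fin.cons m' m : Fin (k + 1) → _)
      (Fin.cons q p : Fin (k + 1) → ℤ) := by
  have hself : ∀ a, D.pair x a a = 0 := fun a => by
    have := D.pair_antisymm x a a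
    omega
  have hz : ∀ {a b}, D.pair x a b = 0 → D.pair x b a = 0 := fun {a b} h => by
    rw [D.pair_antisymm, h, neg_zero]
  refine ⟨fun i => ?_, fun i j => ?_, fun i j => ?_, fun i j => ?_⟩
  · refine Fin.cases ?_ (fun i => ?_) i
    · simpa using hq
    · simpa using h.p_ne_zero i
  · refine Fin.cases ?_ (fun i => ?_) i <;> refine Fin.cases ?_ (fun j => ?_) j
    · simpa using hme
    · simpa [(Fin.succ_ne_zero j).symm] using hz (h4 j)
    · simpa [Fin.succ_ne_zero i] using h1 i
    · simpa [Fin.succ_inj] using h.pair_me i j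
  · refine Fin.cases ?_ (fun i => ?_) i <;> refine Fin.cases ?_ (fun j => ?_) j
    · simpa using hself _
    · simpa using hz (h2 j)
    · simpa using h2 i
    · simpa using h.pair_ee i j
  · refine Fin.cases ?_ (fun i => ?_) i <;> refine Fin.cases ?_ (fun j => ?_) j
    · simpa using hself _
    · simpa using hz (h3 j)
    · simpa using h3 i
    · simpa using h.pair_mm i j

/-- At every regular point there is a symplectic frame all of whose electric charges are local: a
symplectic basis adapted to the isotropic sublattice of light charges. -/
lemma exists_adapted_frame (hx : x.1 ∈ U) :
    ∃ (ε : Fin r → A.Loc) (m : Fin r → D.charge.Fiber x) (p : Fin r → ℤ),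
      IsFrameAt D.toChargeData x (fun i => A.loc x (ε i)) m p := by
  suffices H : ∀ k ≤ r, ∃ (ε : Fin k → A.Loc) (m : Fin k → D.charge.Fiber x) (p : Fin k → ℤ),
      IsFrameAt D.toChargeData x (fun i => A.loc x (ε i)) m p from H r le_rfl
  intro k
  induction k with
  | zero => exact fun _ => ⟨Fin.elim0, Fin.elim0, Fin.elim0, ⟨fun i => i.elim0, fun i => i.elim0,
      fun i => i.elim0, fun i => i.elim0⟩⟩
  | succ k ih =>
    intro hk
    obtain ⟨ε, m, p, h⟩ := ih (by omega)
    set e : Fin k → D.charge.Fiber x := fun i => A.loc x (ε i) with he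
    have hP : ∏ i, p i ≠ 0 := Finset.prod_ne_zero_iff.2 fun i _ => h.p_ne_zero i
    -- a local charge orthogonal to the frame and not in the radical suffices
    suffices H : ∃ ε' : A.Loc, (∀ i, D.pair x (m i) (A.loc x ε') = 0) ∧
        (∀ i, D.pair x (e i) (A.loc x ε') = 0) ∧ A.loc x ε' ∉ (D.flavor x).range by
      obtain ⟨ε', h1, h2, h3⟩ := H
      rw [← D.radical] at h3
      push Not at h3
      obtain ⟨δ, hδ⟩ := h3
      have h4 : D.pair x (A.loc x ε') (frameProj e m p δ) ≠ 0 := by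
        rw [pair_frameProj_of_orthogonal (D := D.toChargeData)
          (fun i => by rw [D.pair_antisymm, h2, neg_zero])
          (fun i => by rw [D.pair_antisymm, h1, neg_zero])]
        exact mul_ne_zero hP hδ
      refine ⟨Fin.cons ε' ε, Fin.cons (frameProj e m p δ) m,
        Fin.cons (D.pair x (frameProj e m p δ) (A.loc x ε')) p, ?_⟩
      have := h.cons (e' := A.loc x ε') (m' := frameProj e m p δ) (by
        rw [D.pair_antisymm]; exact neg_ne_zero.2 h4) rfl h1 h2 (h.pair_m_frameProj δ)
        (h.pair_e_frameProj δ)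
      convert this using 1
      funext i
      refine Fin.cases ?_ (fun i => ?_) i <;> simp [he]
    -- If the light charges do not all project into the radical, one of the projections will do: it
    -- is local, because light charges are local and the electric charges pair to zero with them.
    -- Otherwise, every charge orthogonal to the frame is orthogonal to the light charges, hence
    -- local.
    by_cases hlight : ∃ γ : A.Light, frameProj e m p (A.light x γ) ∉ (D.flavor x).range
    · obtain ⟨γ, hγ⟩ := hlight
      have hloc : frameProj e m p (A.light x γ) ∈ (A.loc x).range := by
        rw [frameProj]
        have hmem : ∀ ε', A.loc x ε' ∈ (A.loc x).range := fun ε' => ⟨ε', rfl⟩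
        refine sub_mem (zsmul_mem (hmem _) _) (add_mem (sum_mem fun i _ => zsmul_mem (hmem _) _)
          (sum_mem fun i _ => ?_))
        rw [he]
        simp only
        rw [pair_loc_light A hx]
        simp
      obtain ⟨ε', hε'⟩ := hloc
      refine ⟨ε', ?_⟩
      rw [hε']
      exact ⟨h.pair_m_frameProj _, h.pair_e_frameProj _, hγ⟩
    · push Not at hlight
      obtain ⟨γ, h1, h2, h3⟩ := exists_orthogonal_not_flavor (D := D.toChargeData) (e := e) (m := m)
        (by simpa using (by omega : k < r))
      have hloc : γ ∈ (A.loc x).range := by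
        rw [A.loc_range x hx]
        intro γ'
        have h4 := pair_frameProj_of_orthogonal (D := D.toChargeData) (δ := γ) (e := e) (m := m)
          (p := p) (fun i => by rw [D.pair_antisymm, h2, neg_zero])
          (fun i => by rw [D.pair_antisymm, h1, neg_zero]) (A.light x γ')
        obtain ⟨f, hf⟩ := hlight γ'
        rw [← hf, pair_flavor] at h4
        exact (mul_eq_zero.1 h4.symm).resolve_left hP
      obtain ⟨ε', rfl⟩ := hloc
      exact ⟨ε', h1, h2, h3⟩

end Adapted

/-! ### Analytic continuation of the period matrix around the discriminant -/

section Continuation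

variable {r : ℕ} {B : Type*} [TopologicalSpace B] [ChartedSpace (Fin r → ℂ) B]
  {R : TopologicalSpace.Opens B}

lemma holAt_comp {f : B → ℂ} {g : ℂ → ℂ} {g' : ℂ} {x : B} (hf : HolAt (r := r) f x)
    (hg : HasDerivAt g g' (f x)) :
    HolAt (r := r) (fun y => g (f y)) x ∧
      holDiff (r := r) (fun y => g (f y)) x = g' • holDiff f x := by
  have hg' : MDifferentiableAt 𝓘(ℂ) 𝓘(ℂ) g (f x) := hg.differentiableAt.mdifferentiableAt
  refine ⟨MDifferentiableAt.comp x hg' hf, ?_⟩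
  have h1 : holDiff (r := r) (g ∘ f) x = (mfderiv 𝓘(ℂ) 𝓘(ℂ) g (f x)).comp (holDiff (r := r) f x) :=
    mfderiv_comp x hg' hf
  rw [mfderiv_eq_fderiv] at h1
  change holDiff (r := r) (g ∘ f) x = _
  rw [h1]
  ext1 v
  have h2 : fderiv ℂ g (f x) (holDiff (r := r) f x v) = holDiff (r := r) f x v * deriv g (f x) := by
    rw [hg.hasFDerivAt.fderiv, hg.deriv]
    simp
  exact h2.trans (by rw [hg.deriv, mul_comm]; rfl)

lemma holAt_const_mul {f : B → ℂ} {x : B} (hf : HolAt (r := r) f x) (c : ℂ) :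
    HolAt (r := r) (fun y => c * f y) x ∧ holDiff (r := r) (fun y => c * f y) x = c • holDiff f x :=
  holAt_comp hf (by simpa using (hasDerivAt_id (f x)).const_mul c)

lemma holAt_add {f g : B → ℂ} {x : B} (hf : HolAt (r := r) f x) (hg : HolAt (r := r) g x) :
    HolAt (r := r) (fun y => f y + g y) x :=
  MDifferentiableAt.add hf hg

lemma holAt_const (c : ℂ) (x : B) : HolAt (r := r) (fun _ : B => c) x := mdifferentiableAt_const

lemma holAt_sum {ι : Type*} (s : Finset ι) {f : ι → B → ℂ} {x : B}
    (hf : ∀ i ∈ s, HolAt (r := r) (f i) x) :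
    HolAt (r := r) (fun y => ∑ i ∈ s, f i y) x ∧
      holDiff (r := r) (fun y => ∑ i ∈ s, f i y) x = ∑ i ∈ s, holDiff (f i) x := by
  classical
  induction s using Finset.induction_on with
  | empty => simpa using ⟨holAt_const 0 x, holDiff_const 0⟩
  | insert a s ha ih =>
    have h1 := hf a (Finset.mem_insert_self a s)
    have h2 := ih fun i hi => hf i (Finset.mem_insert_of_mem hi)
    simp only [Finset.sum_insert ha]
    exact ⟨holAt_add h1 h2.1, by rw [holDiff_add h1 h2.1, h2.2]⟩

/-- A branch near `z₀` of `log (z / π)`. -/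
def logBranch (z₀ z : ℂ) : ℂ := log (z / z₀) + log (z₀ / Real.pi)

lemma exp_logBranch {z₀ z : ℂ} (h0 : z₀ ≠ 0) (h : z ≠ 0) : exp (logBranch z₀ z) = z / Real.pi := by
  have hpi : (Real.pi : ℂ) ≠ 0 := by exact_mod_cast Real.pi_ne_zero
  rw [logBranch, exp_add, exp_log (div_ne_zero h h0), exp_log (div_ne_zero h0 hpi)]
  field_simp

/-- The real part does not depend on the branch. -/
lemma re_logBranch {z₀ z : ℂ} (h0 : z₀ ≠ 0) (h : z ≠ 0) :
    (logBranch z₀ z).re = Real.log ‖z‖ - Real.log Real.pi := by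
  rw [logBranch, add_re, log_re, log_re, norm_div, norm_div, norm_real,
    Real.norm_of_nonneg Real.pi_pos.le, Real.log_div (norm_ne_zero_iff.2 h) (norm_ne_zero_iff.2 h0),
    Real.log_div (norm_ne_zero_iff.2 h0) Real.pi_ne_zero]
  ring

lemma hasDerivAt_logBranch {z₀ z : ℂ} (h : z / z₀ ∈ slitPlane) (h0 : z₀ ≠ 0) :
    HasDerivAt (logBranch z₀) (1 / z) z := by
  have hz : z ≠ 0 := by
    rintro rfl
    simp at h
  have := (((hasDerivAt_id z).div_const z₀).clog h).add_const (log (z₀ / Real.pi))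
  convert! this using 1
  simp only [id]
  field_simp

lemma hasDerivAt_mul_logBranch {z₀ z : ℂ} (h : z / z₀ ∈ slitPlane) (h0 : z₀ ≠ 0) :
    HasDerivAt (fun z => z * (logBranch z₀ z - 1)) (logBranch z₀ z) z := by
  have hz : z ≠ 0 := by
    rintro rfl
    simp at h
  convert! (hasDerivAt_id z).mul ((hasDerivAt_logBranch h h0).sub_const 1) using 1
  simp only [id]
  field_simp
  ring

/-- The extension by zero of the central charge of a flat local section. -/
def Zext (D : ChargeData r B R) (y : R) (γ : D.charge.Fiber y) : B → ℂ :=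
  zeroExt fun y' => D.Z y' (D.charge.tr y y' γ)

lemma eventually_Zext (D : ChargeData r B R) (y : R) (γ : D.charge.Fiber y) :
    ∀ᶠ y' in 𝓝 y, HolAt (r := r) (Zext D y γ) y'.1 ∧
      D.dZ y' (D.charge.tr y y' γ) = holDiff (Zext D y γ) y'.1 := by
  filter_upwards [D.Z_holomorphic y γ, D.charge.tr_tr y] with y' h1 h2
  refine ⟨holAt_zeroExt.2 h1, ?_⟩
  rw [Zext, holDiff_zeroExt h1, ChargeData.dZ]
  refine Filter.EventuallyEq.mfderiv_eq ?_
  filter_upwards [h2] with z hz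
  rw [hz γ]

/-- The function `∑ i, conj (v i) (∂ (n i) / ∂ v) / p i`, derivatives being taken in the coordinates
`a j`. -/
def energyFun (a n : Fin r → B → ℂ) (p : Fin r → ℤ) (v : Fin r → ℂ) (b : B) : ℂ :=
  ∑ i, conj (v i) * (slope (fun j => holDiff (a j) b) (holDiff (n i) b) v / p i)

lemma holAt_energyFun [IsManifold 𝓘(ℂ, Fin r → ℂ) 1 B] {a n : Fin r → B → ℂ} {x : B}
    (ha : ∀ i, ∀ᶠ y in 𝓝 x, HolAt (r := r) (a i) y) (hn : ∀ i, ∀ᶠ y in 𝓝 x, HolAt (r := r) (n i) y)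
    (hdet : (formMatrix fun i => holDiff (a i) x).det ≠ 0) (p : Fin r → ℤ) (v : Fin r → ℂ) :
    HolAt (r := r) (energyFun a n p v) x := by
  refine (holAt_sum Finset.univ fun i _ => ?_).1
  have h1 := (holAt_const_mul (holAt_slope ha (hn i) hdet v) (conj (v i) / p i)).1
  refine h1.congr_of_eventuallyEq (Eventually.of_forall fun y => ?_)
  simp only
  ring

variable {D : BPSData r B R} {U : Set B} (A : DiscriminantAssumptions D U)

/-- `m` completes the local charges `ε` to a symplectic frame at `y`, with prescribed pairings with
the light charges. -/
structure IsAdapted (ε : Fin r → A.Loc) (p : Fin r → ℤ) (c : Fin r → A.Light → ℤ) (y : R)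
    (m : Fin r → D.charge.Fiber y) : Prop where
  frame : IsFrameAt D.toChargeData y (fun i => A.loc y (ε i)) m p
  pair_light : ∀ i γ, D.pair y (m i) (A.light y γ) = c i γ

variable {A} {ε : Fin r → A.Loc} {p : Fin r → ℤ} {c : Fin r → A.Light → ℤ}

lemma eventually_isAdapted {y : R} (hy : y.1 ∈ U) : ∀ᶠ y' in 𝓝 y, ∀ m : Fin r → D.charge.Fiber y,
    IsAdapted A ε p c y' (fun i => D.charge.tr y y' (m i)) ↔ IsAdapted A ε p c y m := by
  filter_upwards [D.pair_flat y, A.loc_flat y hy] with y' h1 h2 m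
  constructor
  · intro h
    refine ⟨⟨h.frame.p_ne_zero, fun i j => ?_, fun i j => ?_, fun i j => ?_⟩, fun i γ => ?_⟩
    · rw [← h1, ← h2]; exact h.frame.pair_me i j
    · rw [← h1, ← h2, ← h2]; exact h.frame.pair_ee i j
    · rw [← h1]; exact h.frame.pair_mm i j
    · rw [← h.pair_light i γ, DiscriminantAssumptions.light, ← h1, ← h2]; rfl
  · intro h
    refine ⟨⟨h.frame.p_ne_zero, fun i j => ?_, fun i j => ?_, fun i j => ?_⟩, fun i γ => ?_⟩
    · rw [h2, h1]; exact h.frame.pair_me i j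
    · rw [h2, h2, h1]; exact h.frame.pair_ee i j
    · rw [h1]; exact h.frame.pair_mm i j
    · rw [DiscriminantAssumptions.light, h2, h1]; exact h.pair_light i γ

/-- The value `∑ i, conj (v i) dZ_{m i} (t) / p i` at the tangent vector `t` with
`dZ_{e i} (t) = v i`. -/
def energyAt (A : DiscriminantAssumptions D U) (ε : Fin r → A.Loc) (p : Fin r → ℤ) (v : Fin r → ℂ)
    (y : R) (m : Fin r → D.charge.Fiber y) : ℂ :=
  ∑ i, conj (v i) * (slope (fun j => D.dZ y (A.loc y (ε j))) (D.dZ y (m i)) v / p i)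

lemma IsAdapted.energyAt_eq {y : R} {m : Fin r → D.charge.Fiber y} (h : IsAdapted A ε p c y m)
    (v : Fin r → ℂ) : ∃ t : Fin r → ℂ, (∀ i, D.dZ y (A.loc y (ε i)) t = v i) ∧
      energyAt A ε p v y = fun m' => ∑ i, conj (D.dZ y (A.loc y (ε i)) t) * (D.dZ y (m' i) t / p i) := by
  refine ⟨(formMatrix fun i => D.dZ y (A.loc y (ε i)))⁻¹.mulVec v, fun i =>
    apply_formMatrix_inv h.frame.det_ne_zero v i, ?_⟩
  funext m'
  refine Finset.sum_congr rfl fun i _ => ?_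
  rw [apply_formMatrix_inv h.frame.det_ne_zero v i]
  rfl

/-- The imaginary part of the energy does not depend on the choice of the magnetic charges. -/
lemma IsAdapted.energyAt_im_eq {y : R} {m m' : Fin r → D.charge.Fiber y}
    (h : IsAdapted A ε p c y m) (h' : IsAdapted A ε p c y m') (v : Fin r → ℂ) :
    (energyAt A ε p v y m').im = (energyAt A ε p v y m).im := by
  obtain ⟨t, -, ht⟩ := h.energyAt_eq v
  rw [ht]
  exact h.frame.im_sum_eq h'.frame (dZHom D.toChargeData y t) (dZHom_flavor D.toChargeData y t)

/-- Up to a positive factor, the imaginary part of the energy is the Kähler norm of a tangent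
vector. -/
lemma IsAdapted.energyAt_pos {y : R} {m : Fin r → D.charge.Fiber y} (h : IsAdapted A ε p c y m)
    {v : Fin r → ℂ} (hv : v ≠ 0) : 0 < (energyAt A ε p v y m).im := by
  obtain ⟨t, ht0, ht⟩ := h.energyAt_eq v
  rw [ht]
  refine h.frame.im_sum_pos fun h0 => hv (funext fun i => ?_)
  rw [← ht0 i, h0, map_zero]; rfl

/-- The coefficients of the light charges in the electric charges, evaluated on `v`. -/
def lightWeight (A : DiscriminantAssumptions D U) (p : Fin r → ℤ) (c : Fin r → A.Light → ℤ)
    (v : Fin r → ℂ) (γ : A.Light) : ℂ := ∑ i, (c i γ : ℂ) / p i * v i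

lemma IsAdapted.dZ_light {y : R} (hy : y.1 ∈ U) {m : Fin r → D.charge.Fiber y}
    (h : IsAdapted A ε p c y m) (t : Fin r → ℂ) (γ : A.Light) :
    D.dZ y (A.light y γ) t = lightWeight A p c (fun i => D.dZ y (A.loc y (ε i)) t) γ := by
  rw [h.frame.dZ_expansion, lightWeight]
  refine Finset.sum_congr rfl fun i _ => ?_
  rw [pair_loc_light A hy, h.pair_light]
  simp

lemma IsAdapted.slope_light {y : R} (hy : y.1 ∈ U) {m : Fin r → D.charge.Fiber y}
    (h : IsAdapted A ε p c y m) (v : Fin r → ℂ) (γ : A.Light) :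
    slope (fun j => D.dZ y (A.loc y (ε j))) (D.dZ y (A.light y γ)) v = lightWeight A p c v γ := by
  rw [slope, h.dZ_light hy]
  simp only [apply_formMatrix_inv h.frame.det_ne_zero v]

/-- The logarithmic correction to the central charges, evaluated on `v`. -/
def logCorrection (A : DiscriminantAssumptions D U) (p : Fin r → ℤ) (c : Fin r → A.Light → ℤ)
    (v : Fin r → ℂ) (y b : B) : ℂ :=
  1 / (4 * Real.pi * I) * ∑ γ ∈ A.active, ((A.omega γ * ‖lightWeight A p c v γ‖ ^ 2 : ℝ) : ℂ) *
    logBranch (A.Zloc (A.lightToLoc γ) y) (A.Zloc (A.lightToLoc γ) b)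

lemma Zloc_ne_zero {b : B} (hb : b ∈ U) (hbR : b ∈ R) {γ : A.Light} (hγ : γ ∈ A.active) :
    A.Zloc (A.lightToLoc γ) b ≠ 0 := fun h => (A.discriminant_eq b hb).2 ⟨γ, hγ, h⟩ hbR

lemma mem_of_Zloc_ne_zero {b : B} (hb : b ∈ U)
    (h : ∀ γ ∈ A.active, A.Zloc (A.lightToLoc γ) b ≠ 0) : b ∈ R := by
  by_contra hbR
  obtain ⟨γ, hγ, h0⟩ := (A.discriminant_eq b hb).1 hbR
  exact h γ hγ h0

lemma holAt_Zloc (hU : IsOpen U) {b : B} (hb : b ∈ U) (γ : A.Loc) : HolAt (r := r) (A.Zloc γ) b :=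
  (A.Zloc_holomorphic γ).mdifferentiableAt (hU.mem_nhds hb)

/-- The imaginary part of the correction is single-valued: the ambiguity of the logarithms is purely
imaginary, and contributes to the real part only. -/
lemma logCorrection_im {y b : B} (hy : y ∈ U) (hyR : y ∈ R) (hb : b ∈ U) (hbR : b ∈ R)
    (v : Fin r → ℂ) : (logCorrection A p c v y b).im = -(∑ γ ∈ A.active,
      A.omega γ * ‖lightWeight A p c v γ‖ ^ 2 / (4 * Real.pi) *
        (Real.log ‖A.Zloc (A.lightToLoc γ) b‖ - Real.log Real.pi)) := by
  have h1 : (1 / (4 * Real.pi * I) : ℂ) = ((1 / (4 * Real.pi) : ℝ) : ℂ) * (-I) := by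
    have hpi : (Real.pi : ℂ) ≠ 0 := by exact_mod_cast Real.pi_ne_zero
    push_cast
    field_simp
    rw [I_sq, neg_neg]
  rw [logCorrection, h1, mul_assoc, im_ofReal_mul, neg_mul, neg_im, I_mul_im, re_sum, mul_neg,
    Finset.mul_sum]
  congr 1
  refine Finset.sum_congr rfl fun γ hγ => ?_
  rw [re_ofReal_mul, re_logBranch (Zloc_ne_zero hy hyR hγ) (Zloc_ne_zero hb hbR hγ)]
  ring

lemma eventually_slitPlane (hU : IsOpen U) {y : B} (hy : y ∈ U) (hyR : y ∈ R) :
    ∀ᶠ b in 𝓝 y, ∀ γ ∈ A.active,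
      A.Zloc (A.lightToLoc γ) b / A.Zloc (A.lightToLoc γ) y ∈ slitPlane := by
  refine (Finset.eventually_all _).2 fun γ hγ => ?_
  have h1 : ContinuousAt (fun b => A.Zloc (A.lightToLoc γ) b / A.Zloc (A.lightToLoc γ) y) y :=
    (holAt_Zloc hU hy _).continuousAt.div_const _
  refine h1.eventually (isOpen_slitPlane.mem_nhds ?_)
  simp [div_self (Zloc_ne_zero hy hyR hγ)]

end Continuation

section Continuation

variable {r : ℕ} {B : Type*} [TopologicalSpace B] [ChartedSpace (Fin r → ℂ) B]
  {R : TopologicalSpace.Opens B} {D : BPSData r B R} {U : Set B} {A : DiscriminantAssumptions D U}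
  {ε : Fin r → A.Loc} {p : Fin r → ℤ} {c : Fin r → A.Light → ℤ}

lemma exists_isConnected_nhd (r : ℕ) {B : Type*} [TopologicalSpace B]
    [ChartedSpace (Fin r → ℂ) B] {R : TopologicalSpace.Opens B} {x : R} {P : R → Prop} (h : ∀ᶠ y in 𝓝 x, P y) :
    ∃ V : Set R, IsOpen V ∧ IsConnected V ∧ x ∈ V ∧ ∀ y ∈ V, P y := by
  have : LocallyConnectedSpace R := ChartedSpace.locallyConnectedSpace (Fin r → ℂ) R
  obtain ⟨V, hV, hVo, hxV, hVc⟩ := locallyConnectedSpace_iff_subsets_isOpen_isConnected.1 this x _ h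
  exact ⟨V, hVo, hVc, hxV, hV⟩

lemma slope_add (α : Fin r → (Fin r → ℂ) →L[ℂ] ℂ) (β β' : (Fin r → ℂ) →L[ℂ] ℂ) (v : Fin r → ℂ) :
    slope α (β + β') v = slope α β v + slope α β' v := rfl

lemma slope_smul (α : Fin r → (Fin r → ℂ) →L[ℂ] ℂ) (a : ℂ) (β : (Fin r → ℂ) →L[ℂ] ℂ)
    (v : Fin r → ℂ) : slope α (a • β) v = a * slope α β v := rfl

lemma slope_sum {J : Type*} (s : Finset J) (α : Fin r → (Fin r → ℂ) →L[ℂ] ℂ)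
    (β : J → (Fin r → ℂ) →L[ℂ] ℂ) (v : Fin r → ℂ) :
    slope α (∑ j ∈ s, β j) v = ∑ j ∈ s, slope α (β j) v := by
  simp only [slope, sum_apply]

/-- The formula for the central charges determines the energy near `x` up to the contribution of
functions that are holomorphic on `U`. -/
lemma IsAdapted.exists_energyAt_eq (hU : IsOpen U) {x : R} (hx : x.1 ∈ U)
    {m : Fin r → D.charge.Fiber x} (h : IsAdapted A ε p c x m) (v : Fin r → ℂ) :
    ∃ Zt : Fin r → B → ℂ, (∀ i, MDifferentiableOn 𝓘(ℂ, Fin r → ℂ) 𝓘(ℂ) (Zt i) U) ∧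
      ∀ᶠ y in 𝓝 x, energyAt A ε p v y (fun i => D.charge.tr x y (m i)) =
        energyFun (fun i => A.Zloc (ε i)) Zt p v y.1 + logCorrection A p c v x.1 y.1 := by
  have hZx : ∀ γ ∈ A.active, A.Zloc (A.lightToLoc γ) x.1 ≠ 0 := fun γ hγ => Zloc_ne_zero hx x.2 hγ
  have hev : ∀ᶠ y in 𝓝 x, (y.1 ∈ U ∧ (∀ γ ∈ A.active,
      A.Zloc (A.lightToLoc γ) y.1 / A.Zloc (A.lightToLoc γ) x.1 ∈ slitPlane)) ∧
      IsAdapted A ε p c y (fun i => D.charge.tr x y (m i)) ∧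
      (∀ᶠ z in 𝓝 y, ∀ γ, D.charge.tr y z (D.charge.tr x y γ) = D.charge.tr x z γ) ∧
      (∀ i, HolAt (r := r) (Zext D.toChargeData x (m i)) y.1 ∧
        D.dZ y (D.charge.tr x y (m i)) = holDiff (Zext D.toChargeData x (m i)) y.1) := by
    refine (eventually_opens.2 ((hU.eventually_mem hx).and (eventually_slitPlane hU hx x.2))).and
      (?_ : ∀ᶠ y in 𝓝 x, _)
    filter_upwards [eventually_isAdapted (ε := ε) (p := p) (c := c) hx, D.charge.tr_tr x,
      eventually_all.2 fun i => eventually_Zext D.toChargeData x (m i)] with y h1 h2 h3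
    exact ⟨(h1 m).2 h, h2, h3⟩
  obtain ⟨V, hVo, hVc, hxV, hV⟩ := exists_isConnected_nhd r hev
  -- Branches on `V` of the logarithms of the light central charges.
  set lg : A.Light → R → ℂ := fun γ y =>
    logBranch (A.Zloc (A.lightToLoc γ) x.1) (A.Zloc (A.lightToLoc γ) y.1) with hlg
  have hZy : ∀ y ∈ V, ∀ γ ∈ A.active, A.Zloc (A.lightToLoc γ) y.1 ≠ 0 := fun y hy γ hγ =>
    Zloc_ne_zero (hV y hy).1.1 y.2 hγ
  have hlog : ∀ γ ∈ A.active, ContinuousOn (lg γ) V ∧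
      ∀ y ∈ V, exp (lg γ y) = D.Z y (A.loc y (A.lightToLoc γ)) / Real.pi := by
    refine fun γ hγ => ⟨fun y hy => ContinuousAt.continuousWithinAt ?_, fun y hy => ?_⟩
    · exact ContinuousAt.comp (g := logBranch _) (f := fun y : R => A.Zloc (A.lightToLoc γ) y.1)
        (hasDerivAt_logBranch ((hV y hy).1.2 γ hγ) (hZx γ hγ)).continuousAt
        (ContinuousAt.comp (g := A.Zloc _) (holAt_Zloc hU (hV y hy).1.1 _).continuousAt
          continuous_subtype_val.continuousAt)
    · rw [← A.Zloc_eq _ y (hV y hy).1.1]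
      exact exp_logBranch (hZx γ hγ) (hZy y hy γ hγ)
  have hcc := fun i => A.central_charge V hVo hVc (fun y hy => (hV y hy).1.1)
    (fun y => D.charge.tr x y (m i)) (fun y hy => by
      filter_upwards [(hV y hy).2.2.1] with z hz using (hz (m i)).symm) lg hlog
  choose Zt hZt hZtV using hcc
  refine ⟨Zt, hZt, ?_⟩
  filter_upwards [hVo.mem_nhds hxV] with y hy
  have hyU := (hV y hy).1.1
  have hdZ : ∀ i, D.dZ y (D.charge.tr x y (m i)) = holDiff (r := r) (Zt i) y.1 +
      (1 / (4 * Real.pi * I) : ℂ) • ∑ γ ∈ A.active, ((c i γ : ℂ) * A.omega γ) •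
        lg γ y • D.dZ y (A.light y γ) := by
    intro i
    have h1 : Zext D.toChargeData x (m i) =ᶠ[𝓝 y.1] fun b => Zt i b + 1 / (4 * Real.pi * I) *
        ∑ γ ∈ A.active, ((c i γ : ℂ) * A.omega γ) * (A.Zloc (A.lightToLoc γ) b *
          (logBranch (A.Zloc (A.lightToLoc γ) x.1) (A.Zloc (A.lightToLoc γ) b) - 1)) := by
      refine eventually_opens.1 ?_
      filter_upwards [hVo.mem_nhds hy] with z hz
      rw [Zext, zeroExt_val, hZtV i z hz]
      congr 2
      refine Finset.sum_congr rfl fun γ _ => ?_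
      have hp : D.pair z (D.charge.tr x z (m i)) (A.loc z (A.lightToLoc γ)) = c i γ :=
        (hV z hz).2.1.pair_light i γ
      rw [hp, ← A.Zloc_eq _ z (hV z hz).1.1]
      ring
    have hZt' : HolAt (r := r) (Zt i) y.1 := (hZt i).mdifferentiableAt (hU.mem_nhds hyU)
    have h2 : ∀ γ ∈ A.active, HolAt (r := r) (fun b => A.Zloc (A.lightToLoc γ) b *
          (logBranch (A.Zloc (A.lightToLoc γ) x.1) (A.Zloc (A.lightToLoc γ) b) - 1)) y.1 ∧
        holDiff (r := r) (fun b => A.Zloc (A.lightToLoc γ) b *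
          (logBranch (A.Zloc (A.lightToLoc γ) x.1) (A.Zloc (A.lightToLoc γ) b) - 1)) y.1 =
          lg γ y • holDiff (A.Zloc (A.lightToLoc γ)) y.1 := fun γ hγ =>
      holAt_comp (g := fun z => z * (logBranch (A.Zloc (A.lightToLoc γ) x.1) z - 1))
        (holAt_Zloc hU hyU _) (hasDerivAt_mul_logBranch ((hV y hy).1.2 γ hγ) (hZx γ hγ))
    have h3 := fun γ hγ => holAt_const_mul (h2 γ hγ).1 ((c i γ : ℂ) * A.omega γ)
    have h4 := holAt_sum A.active fun γ hγ => (h3 γ hγ).1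
    have h5 := holAt_const_mul h4.1 (1 / (4 * Real.pi * I))
    rw [((hV y hy).2.2.2 i).2, holDiff_congr h1, holDiff_add hZt' h5.1, h5.2, h4.2]
    congr 2
    refine Finset.sum_congr rfl fun γ hγ => ?_
    rw [(h3 γ hγ).2, (h2 γ hγ).2, ← dZ_loc A hyU hU]
    rfl
  have hα : (fun j => D.dZ y (A.loc y (ε j))) = fun j => holDiff (r := r) (A.Zloc (ε j)) y.1 :=
    funext fun j => dZ_loc A hyU hU _
  have hsl : ∀ i, slope (fun j => D.dZ y (A.loc y (ε j))) (D.dZ y (D.charge.tr x y (m i))) v =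
      slope (fun j => holDiff (r := r) (A.Zloc (ε j)) y.1) (holDiff (r := r) (Zt i) y.1) v +
      1 / (4 * Real.pi * I) * ∑ γ ∈ A.active, ((c i γ : ℂ) * A.omega γ) *
        (lg γ y * lightWeight A p c v γ) := by
    intro i
    rw [hdZ i, slope_add, slope_smul, slope_sum, ← hα]
    congr 2
    refine Finset.sum_congr rfl fun γ _ => ?_
    rw [slope_smul, slope_smul, (hV y hy).2.1.slope_light hyU]
  rw [energyAt, energyFun, logCorrection, Finset.mul_sum]
  simp only [hsl, add_div, mul_add, Finset.sum_add_distrib]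
  congr 1
  simp only [Finset.mul_sum, Finset.sum_div]
  rw [Finset.sum_comm]
  refine Finset.sum_congr rfl fun γ _ => ?_
  have h6 : ((A.omega γ * ‖lightWeight A p c v γ‖ ^ 2 : ℝ) : ℂ) =
      A.omega γ * (lightWeight A p c v γ * ∑ i, (c i γ : ℂ) / p i * conj (v i)) := by
    have h7 : conj (lightWeight A p c v γ) = ∑ i, (c i γ : ℂ) / p i * conj (v i) := by
      simp [lightWeight]
    rw [← h7, mul_conj, normSq_eq_norm_sq]
    push_cast
    rfl
  rw [h6, Finset.mul_sum, Finset.mul_sum, Finset.sum_mul, Finset.mul_sum]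
  refine Finset.sum_congr rfl fun i _ => ?_
  simp only [hlg]
  ring

end Continuation

section Continuation

variable {r : ℕ} {B : Type*} [TopologicalSpace B] [ChartedSpace (Fin r → ℂ) B]
  {R : TopologicalSpace.Opens B} {D : BPSData r B R} {U : Set B} {A : DiscriminantAssumptions D U}
  {ε : Fin r → A.Loc} {p : Fin r → ℤ} {c : Fin r → A.Light → ℤ}

/-- The sum of the logarithms of the light central charges in the expression of the energy. -/
def logSum (A : DiscriminantAssumptions D U) (p : Fin r → ℤ) (c : Fin r → A.Light → ℤ)
    (v : Fin r → ℂ) (b : B) : ℝ :=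
  ∑ γ ∈ A.active, A.omega γ * ‖lightWeight A p c v γ‖ ^ 2 / (4 * Real.pi) *
    (Real.log ‖A.Zloc (A.lightToLoc γ) b‖ - Real.log Real.pi)

lemma IsAdapted.det_ne_zero (hU : IsOpen U) {y : R} (hy : y.1 ∈ U) {m : Fin r → D.charge.Fiber y}
    (h : IsAdapted A ε p c y m) :
    (formMatrix fun j => holDiff (r := r) (A.Zloc (ε j)) y.1).det ≠ 0 := by
  have h1 := h.frame.det_ne_zero
  rwa [funext fun j => dZ_loc A hy hU (ε j)] at h1

lemma holAt_energyFun_Zloc [IsManifold 𝓘(ℂ, Fin r → ℂ) 1 B] (hU : IsOpen U) {Zt : Fin r → B → ℂ}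
    (hZt : ∀ i, MDifferentiableOn 𝓘(ℂ, Fin r → ℂ) 𝓘(ℂ) (Zt i) U) {b : B} (hb : b ∈ U)
    (hdet : (formMatrix fun j => holDiff (r := r) (A.Zloc (ε j)) b).det ≠ 0) (v : Fin r → ℂ) :
    HolAt (r := r) (energyFun (fun i => A.Zloc (ε i)) Zt p v) b := by
  refine holAt_energyFun (fun i => ?_) (fun i => ?_) hdet p v
  · filter_upwards [hU.mem_nhds hb] with b' hb' using holAt_Zloc hU hb' _
  · filter_upwards [hU.mem_nhds hb] with b' hb' using (hZt i).mdifferentiableAt (hU.mem_nhds hb')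

/-- The energy has no monodromy around the discriminant: the local formula extends to the
connected component. -/
lemma IsAdapted.exists_of_mem_connectedComponentIn [IsManifold 𝓘(ℂ, Fin r → ℂ) 1 B]
    (hR : IsDivisor (r := r) (R : Set B)ᶜ) (hU : IsOpen U) {x : R} (hx : x.1 ∈ U)
    {m : Fin r → D.charge.Fiber x} (h : IsAdapted A ε p c x m) (v : Fin r → ℂ) :
    ∃ Zt : Fin r → B → ℂ, (∀ i, MDifferentiableOn 𝓘(ℂ, Fin r → ℂ) 𝓘(ℂ) (Zt i) U) ∧
      ∀ y : R, y.1 ∈ connectedComponentIn U x.1 → ∃ m', IsAdapted A ε p c y m' ∧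
        (energyAt A ε p v y m').im =
          (energyFun (fun i => A.Zloc (ε i)) Zt p v y.1).im - logSum A p c v y.1 := by
  obtain ⟨Zt, hZt, hxZt⟩ := h.exists_energyAt_eq hU hx v
  refine ⟨Zt, hZt, ?_⟩
  set P : B → Prop := fun b => ∃ hb : b ∈ R, ∃ m', IsAdapted A ε p c ⟨b, hb⟩ m' ∧
    (energyAt A ε p v ⟨b, hb⟩ m').im =
      (energyFun (fun i => A.Zloc (ε i)) Zt p v b).im - logSum A p c v b with hP
  have : LocallyConnectedSpace B := ChartedSpace.locallyConnectedSpace (Fin r → ℂ) B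
  have hU0 : IsOpen (connectedComponentIn U x.1) := hU.connectedComponentIn
  -- Off the discriminant, the validity of the formula near a point is a locally constant condition
  -- on the point: two local formulas differ by the imaginary part of a holomorphic function, which
  -- vanishes near one point of a small ball if and only if it vanishes on the ball.
  have hmain : ∀ b ∈ connectedComponentIn U x.1, b ∉ (R : Set B)ᶜ →
      ∀ᶠ b' in 𝓝 b, ((∀ᶠ w in 𝓝 b', P w) ↔ ∀ᶠ w in 𝓝 b, P w) := by
    intro b hb hbR
    have hbR' : b ∈ R := not_not.1 hbR
    have hbU := connectedComponentIn_subset U x.1 hb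
    by_cases hQ : ∃ m', IsAdapted A ε p c ⟨b, hbR'⟩ m'
    · obtain ⟨m₁, hm₁⟩ := hQ
      obtain ⟨Zt₁, hZt₁, hev₁⟩ := hm₁.exists_energyAt_eq hU hbU v
      have hg : ∀ᶠ w in 𝓝 b, HolAt (r := r) (fun w => energyFun (fun i => A.Zloc (ε i)) Zt₁ p v w +
          (-1) * energyFun (fun i => A.Zloc (ε i)) Zt p v w) w := by
        have h1 := eventually_opens_exists (eventually_isAdapted (ε := ε) (p := p) (c := c)
          (y := ⟨b, hbR'⟩) hbU)
        filter_upwards [h1, hU.mem_nhds hbU] with w ⟨hwR, hw⟩ hwU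
        have h2 := ((hw m₁).2 hm₁).det_ne_zero hU hwU
        exact holAt_add (holAt_energyFun_Zloc hU hZt₁ hwU h2 v)
          (holAt_const_mul (holAt_energyFun_Zloc hU hZt hwU h2 v) (-1)).1
      have hPg : ∀ᶠ w in 𝓝 b, (P w ↔ (energyFun (fun i => A.Zloc (ε i)) Zt₁ p v w +
          (-1) * energyFun (fun i => A.Zloc (ε i)) Zt p v w).im = 0) := by
        have h1 := eventually_opens_exists ((eventually_isAdapted (ε := ε) (p := p) (c := c)
          (y := ⟨b, hbR'⟩) hbU).and hev₁)
        filter_upwards [h1, hU.mem_nhds hbU] with w ⟨hwR, hw, hen⟩ hwU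
        have h3 := (hw m₁).2 hm₁
        have h4 : (energyAt A ε p v ⟨w, hwR⟩ fun i =>
            D.charge.tr ⟨b, hbR'⟩ ⟨w, hwR⟩ (m₁ i)).im =
            (energyFun (fun i => A.Zloc (ε i)) Zt₁ p v w).im - logSum A p c v w := by
          rw [hen, add_im, logCorrection_im hbU hbR' hwU hwR]
          rfl
        rw [add_im, neg_one_mul, neg_im]
        constructor
        · rintro ⟨_, m', hm', he⟩
          rw [h3.energyAt_im_eq hm', h4] at he
          linarith
        · intro he
          refine ⟨hwR, _, h3, ?_⟩
          rw [h4]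
          linarith
      obtain ⟨N, hN, hNo, hNP, hNg⟩ := exists_nhd_im_eq_zero hg hPg
      have hb' := mem_of_mem_nhds hN
      have key : ∀ b₁ ∈ N, ∀ b₂ ∈ N, (∀ᶠ w in 𝓝 b₁, P w) → ∀ᶠ w in 𝓝 b₂, P w := by
        intro b₁ h₁ b₂ h₂ hw
        filter_upwards [hNo.mem_nhds h₂] with w hwN
        refine (hNP w hwN).2 (hNg b₁ h₁ w hwN ?_)
        filter_upwards [hw, hNo.mem_nhds h₁] with w' hw' hw'N using (hNP w' hw'N).1 hw'
      filter_upwards [hN] with b' hb'N using ⟨key b' hb'N b hb', key b hb' b' hb'N⟩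
    -- If there is no adapted frame at `b`, there is none nearby, by transport.
    · have hno : ∀ᶠ w in 𝓝 b, ¬ P w := by
        have h1 := eventually_opens_exists ((eventually_isAdapted (ε := ε) (p := p) (c := c)
          (y := ⟨b, hbR'⟩) hbU).and (D.charge.tr_bijective ⟨b, hbR'⟩))
        filter_upwards [h1] with w ⟨hwR, hw, hbij⟩
        rintro ⟨_, m', hm', -⟩
        choose m₁ hm₁ using fun i => hbij.2 (m' i)
        refine hQ ⟨m₁, (hw m₁).1 ?_⟩
        rwa [funext hm₁]
      filter_upwards [hno.eventually_nhds] with b' hb'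
      exact ⟨fun h1 => absurd h1.self_of_nhds hb'.self_of_nhds,
        fun h1 => absurd h1.self_of_nhds hno.self_of_nhds⟩
  have hxP : ∀ᶠ w in 𝓝 x.1, P w := by
    have h1 := eventually_opens_exists ((eventually_isAdapted (ε := ε) (p := p) (c := c)
      (y := x) hx).and hxZt)
    filter_upwards [h1, hU.mem_nhds hx] with w ⟨hwR, hw, hen⟩ hwU
    refine ⟨hwR, _, (hw m).2 h, ?_⟩
    rw [hen, add_im, logCorrection_im hx x.2 hwU hwR]
    rfl
  intro y hy
  have h2 := (iff_of_locally_off_divisor hR hU0 isPreconnected_connectedComponentIn hmain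
    (mem_connectedComponentIn hx) hy (not_not.2 x.2) (not_not.2 y.2)).1 hxP
  obtain ⟨_, h3⟩ := h2.self_of_nhds
  exact h3

end Continuation

/-! ### Positivity of the corrected energy -/

section Positivity

variable {r : ℕ} {B : Type*} [TopologicalSpace B] [ChartedSpace (Fin r → ℂ) B]

lemma isOpen_diff_connectedComponentIn [LocallyConnectedSpace B] {U : Set B} (hU : IsOpen U)
    (x : B) : IsOpen (U \ connectedComponentIn U x) := by
  refine isOpen_iff_mem_nhds.2 fun y hy => ?_
  refine mem_of_superset ((hU.connectedComponentIn (x := y)).mem_nhds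
    (mem_connectedComponentIn hy.1)) fun z hz => ⟨connectedComponentIn_subset U y hz, fun hz' => ?_⟩
  have h1 := connectedComponentIn_eq hz
  have h2 := connectedComponentIn_eq hz'
  exact hy.2 (h2.trans h1.symm ▸ mem_connectedComponentIn hy.1)

lemma IsComplexSubmanifoldAt.inter_open [IsManifold 𝓘(ℂ, Fin r → ℂ) ω B] {S : Set B} {k : ℕ}
    {y : B} (h : IsComplexSubmanifoldAt (r := r) S k y) {U : Set B} (hU : IsOpen U) (hy : y ∈ U) :
    IsComplexSubmanifoldAt (r := r) (S ∩ U) k y := by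
  obtain ⟨φ, hφ, hyφ, V, hV, hS⟩ := h
  refine ⟨φ.restr U, restr_mem_maximalAtlas _ hφ hU, ?_, V, hV, fun z hz => ?_⟩
  · rw [φ.restr_source' U hU]
    exact ⟨hyφ, hy⟩
  · rw [φ.restr_source' U hU] at hz
    rw [mem_inter_iff, and_iff_left hz.2]
    exact hS z hz.1

variable {R : TopologicalSpace.Opens B} {D : BPSData r B R} {U : Set B}
  (A : DiscriminantAssumptions D U)

/-- Additivity at regular points extends to `U`, since the regular points are dense. -/
lemma Zloc_add (hR : IsDivisor (r := r) (R : Set B)ᶜ) (hU : IsOpen U) (a b : A.Loc) {y : B}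
    (hy : y ∈ U) : A.Zloc (a + b) y = A.Zloc a y + A.Zloc b y := by
  by_contra hne
  have h1 : ContinuousAt (fun y => A.Zloc (a + b) y - (A.Zloc a y + A.Zloc b y)) y :=
    (holAt_Zloc hU hy _).continuousAt.sub
      ((holAt_Zloc hU hy _).continuousAt.add (holAt_Zloc hU hy _).continuousAt)
  have h2 := h1.eventually_ne (sub_ne_zero.2 hne)
  obtain ⟨z, hzR, hz, hzU⟩ := ((frequently_mem_of_isDivisor hR y).and_eventually
    (h2.and (hU.eventually_mem hy))).exists
  refine hz ?_
  rw [A.Zloc_eq _ ⟨z, not_not.1 hzR⟩ hzU, A.Zloc_eq _ ⟨z, not_not.1 hzR⟩ hzU,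
    A.Zloc_eq _ ⟨z, not_not.1 hzR⟩ hzU, map_add, map_add, sub_self]

/-- The differentials of finitely many local central charges separate tangent vectors. -/
lemma exists_holDiff_Zloc_ne_zero (hR : IsDivisor (r := r) (R : Set B)ᶜ) (hU : IsOpen U) {y : B}
    (hy : y ∈ U) {η : Fin r → ℂ} (hη : η ≠ 0) :
    ∃ j, holDiff (r := r) (A.Zloc (Module.Free.chooseBasis ℤ A.Loc j)) y η ≠ 0 := by
  by_contra hcon
  push Not at hcon
  have hadd : ∀ a b, holDiff (r := r) (A.Zloc (a + b)) y η =
      holDiff (r := r) (A.Zloc a) y η + holDiff (r := r) (A.Zloc b) y η := fun a b => by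
    rw [holDiff_congr (g := fun y => A.Zloc a y + A.Zloc b y) (by
      filter_upwards [hU.mem_nhds hy] with z hz using Zloc_add A hR hU a b hz),
      holDiff_add (holAt_Zloc hU hy _) (holAt_Zloc hU hy _)]
    rfl
  have hz : ∀ a, holDiff (r := r) (A.Zloc a) y η = 0 := by
    let F : A.Loc →+ ℂ := AddMonoidHom.mk' (fun a => holDiff (r := r) (A.Zloc a) y η) hadd
    have h0 : F.toIntLinearMap = 0 := (Module.Free.chooseBasis ℤ A.Loc).ext hcon
    exact fun a => LinearMap.congr_fun h0 a
  have h1 : ∀ L : (Fin r → ℂ) →L[ℂ] ℂ, L η = 0 := fun L => by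
    have hL : L ∈ Submodule.span ℂ (Set.range fun γ => holDiff (r := r) (A.Zloc γ) y) := by
      rw [A.Zloc_span y hy]; trivial
    induction hL using Submodule.span_induction with
    | mem L hL => obtain ⟨a, rfl⟩ := hL; exact hz a
    | zero => rfl
    | add L L' _ _ h h' => rw [add_apply, h, h', add_zero]
    | smul a L _ h => rw [smul_apply, h, smul_zero]
  exact hη (funext fun i => h1 (ContinuousLinearMap.proj i))

variable {A} {ε : Fin r → A.Loc} {p : Fin r → ℤ} {c : Fin r → A.Light → ℤ}

/-- Positivity of the corrected energy over `U'`: the lower bound for the integrals over the axis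
turns the correction of the Kähler form into a lower bound for the contributions of the light
charges. -/
lemma IsAdapted.energy_pos_of_mem_U' {y : R} (hy : y.1 ∈ A.U')
    {m : Fin r → D.charge.Fiber y} (h : IsAdapted A ε p c y m) {v : Fin r → ℂ} (hv : v ≠ 0)
    (φ : A.Light → ℝ) : 0 < (energyAt A ε p v y m).im + ∑ γ ∈ A.active,
      A.omega γ * ‖lightWeight A p c v γ‖ ^ 2 / (4 * Real.pi) *
        (axisInt (fun _ => 1) ‖D.Z y (A.light y γ)‖ (φ γ)).re := by
  have hyU := A.U'_subset hy
  obtain ⟨t, ht0, ht⟩ := h.energyAt_eq v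
  have ht1 : t ≠ 0 := by
    rintro rfl
    exact hv (funext fun i => by rw [← ht0 i, map_zero]; rfl)
  have hw : ∀ γ, D.dZ y (A.loc y (A.lightToLoc γ)) t = lightWeight A p c v γ := fun γ => by
    rw [← funext ht0]
    exact h.dZ_light hyU t γ
  have h1 := A.U'_kahler y hy _ h.frame.isGaugeBasis t ht1
  have hs : ∀ γ ∈ A.active, 0 < ‖D.Z y (A.light y γ)‖ := fun γ hγ => by
    rw [DiscriminantAssumptions.light, ← A.Zloc_eq _ y hyU]
    exact norm_pos_iff.2 (Zloc_ne_zero hyU y.2 hγ)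
  have hpi := Real.sqrt_pos.2 Real.pi_pos
  set d : A.Light → ℝ := fun γ =>
    Real.sqrt ‖D.Z y (A.light y γ)‖ * (Real.exp (2 * ‖D.Z y (A.light y γ)‖) - 1) with hd
  have hterm : ∀ γ ∈ A.active, -(1 / 4) * (1 / Real.sqrt Real.pi *
      (A.omega γ / d γ * ‖lightWeight A p c v γ‖ ^ 2)) ≤
      A.omega γ * ‖lightWeight A p c v γ‖ ^ 2 / (4 * Real.pi) *
        (axisInt (fun _ => 1) ‖D.Z y (A.light y γ)‖ (φ γ)).re := fun γ hγ => by
    have h2 := neg_sqrt_div_le_re_axisInt (hs γ hγ) (φ γ)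
    have h3 : 0 ≤ (A.omega γ : ℝ) * ‖lightWeight A p c v γ‖ ^ 2 / (4 * Real.pi) := by positivity
    refine le_trans (le_of_eq ?_) (mul_le_mul_of_nonneg_left h2 h3)
    have h4 : Real.pi = Real.sqrt Real.pi * Real.sqrt Real.pi :=
      (Real.mul_self_sqrt Real.pi_pos.le).symm
    change _ = _ * -(Real.sqrt Real.pi / d γ)
    rw [show (4 * Real.pi) = 4 * (Real.sqrt Real.pi * Real.sqrt Real.pi) by rw [← h4]]
    have h5 : 0 < d γ := mul_pos (Real.sqrt_pos.2 (hs γ hγ))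
      (sub_pos.2 (Real.one_lt_exp_iff.2 (by have := hs γ hγ; positivity)))
    field_simp
  have h2 := Finset.sum_le_sum hterm
  rw [ht]
  rw [sub_re, h.frame.dZdZbar_re] at h1
  simp only [hw, map_smul, smul_eq_mul] at h1
  have h3 : (I / (2 * Real.sqrt Real.pi) * ∑ γ ∈ A.active, (A.omega γ : ℂ) / (d γ : ℂ) *
      (lightWeight A p c v γ * conj (I * lightWeight A p c v γ) -
        I * lightWeight A p c v γ * conj (lightWeight A p c v γ))).re =
      ∑ γ ∈ A.active, 1 / Real.sqrt Real.pi * (A.omega γ / d γ * ‖lightWeight A p c v γ‖ ^ 2) := by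
    rw [Finset.mul_sum, re_sum]
    refine Finset.sum_congr rfl fun γ _ => ?_
    have h4 : (lightWeight A p c v γ * conj (I * lightWeight A p c v γ) -
        I * lightWeight A p c v γ * conj (lightWeight A p c v γ)) =
        -2 * I * ((‖lightWeight A p c v γ‖ ^ 2 : ℝ) : ℂ) := by
      rw [← normSq_eq_norm_sq, ← mul_conj, map_mul, conj_I]
      ring
    rw [h4]
    have h5 : (I / (2 * Real.sqrt Real.pi) * ((A.omega γ : ℂ) / (d γ : ℂ) *
        (-2 * I * ((‖lightWeight A p c v γ‖ ^ 2 : ℝ) : ℂ)))) =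
        ((1 / Real.sqrt Real.pi * (A.omega γ / d γ * ‖lightWeight A p c v γ‖ ^ 2) : ℝ) : ℂ) := by
      push_cast
      linear_combination (-(1 / (Real.sqrt Real.pi : ℂ)) * ((A.omega γ : ℂ) / (d γ : ℂ) *
        (‖lightWeight A p c v γ‖ : ℂ) ^ 2)) * I_sq
    rw [h5, ofReal_re]
  have h6 := h1.trans_eq (congrArg₂ _ rfl h3)
  rw [← Finset.mul_sum] at h2
  linarith

lemma holAt_prod {ι : Type*} (s : Finset ι) {f : ι → B → ℂ} {x : B}
    (hf : ∀ i ∈ s, HolAt (r := r) (f i) x) : HolAt (r := r) (fun y => ∏ i ∈ s, f i y) x := by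
  classical
  induction s using Finset.induction_on with
  | empty => simpa using holAt_const 1 x
  | insert a s ha ih =>
    simp only [Finset.prod_insert ha]
    exact MDifferentiableAt.mul (hf a (Finset.mem_insert_self a s))
      (ih fun i hi => hf i (Finset.mem_insert_of_mem hi))

/-- A weighted sum of logarithms is bounded below by a multiple of the logarithm of the product,
when the factors are bounded. -/
lemma sum_mul_log_ge {ι : Type*} {s : Finset ι} {c : ι → ℝ} (hc : ∀ i ∈ s, 0 ≤ c i) {z : ι → ℂ}
    (hz : ∀ i ∈ s, z i ≠ 0) {L : ℝ} (hL : 0 ≤ L) (hzL : ∀ i ∈ s, ‖z i‖ ≤ Real.exp L) :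
    (∑ i ∈ s, c i) * Real.log ‖∏ i ∈ s, z i‖ - (∑ i ∈ s, c i) * (s.card * L) ≤
      ∑ i ∈ s, c i * Real.log ‖z i‖ := by
  classical
  rw [← mul_sub, Finset.sum_mul]
  refine Finset.sum_le_sum fun i hi => mul_le_mul_of_nonneg_left ?_ (hc i hi)
  have hlog : ∀ j ∈ s, Real.log ‖z j‖ ≤ L := fun j hj =>
    (Real.log_le_iff_le_exp (norm_pos_iff.2 (hz j hj))).2 (hzL j hj)
  rw [norm_prod, Real.log_prod fun j hj => norm_ne_zero_iff.2 (hz j hj),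
    ← Finset.add_sum_erase s _ hi]
  have h1 : ∑ j ∈ s.erase i, Real.log ‖z j‖ ≤ (s.erase i).card • L :=
    Finset.sum_le_card_nsmul _ _ _ fun j hj => hlog j (Finset.mem_of_mem_erase hj)
  have h2 : ((s.erase i).card : ℝ) ≤ s.card := by
    exact_mod_cast Finset.card_le_card (Finset.erase_subset i s)
  have h3 := mul_le_mul_of_nonneg_right h2 hL
  rw [nsmul_eq_mul] at h1
  linarith

/-- The energy, corrected by the contributions of the light charges with arbitrary independent
angles, is positive on `U`. It is a potential on the component of `x` in `U`, and positive on the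
boundary of the submanifold through `x`. -/
theorem IsAdapted.energy_pos [IsManifold 𝓘(ℂ, Fin r → ℂ) ω B]
    (hR : IsDivisor (r := r) (R : Set B)ᶜ) (hU : IsOpen U) {x : R} (hx : x.1 ∈ U)
    {m : Fin r → D.charge.Fiber x} (h : IsAdapted A ε p c x m) {v : Fin r → ℂ} (hv : v ≠ 0)
    (φ : A.Light → ℝ) : 0 < (energyAt A ε p v x m).im + ∑ γ ∈ A.active,
      A.omega γ * ‖lightWeight A p c v γ‖ ^ 2 / (4 * Real.pi) *
        (axisInt (fun _ => 1) ‖D.Z x (A.light x γ)‖ (φ γ)).re := by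
  have : IsManifold 𝓘(ℂ, Fin r → ℂ) 1 B := IsManifold.of_le (n := ω) le_top
  have : LocallyConnectedSpace B := ChartedSpace.locallyConnectedSpace (Fin r → ℂ) B
  obtain ⟨Zt, hZt, hform⟩ := h.exists_of_mem_connectedComponentIn hR hU hx v
  set U₀ := connectedComponentIn U x.1 with hU₀
  have hU₀o : IsOpen U₀ := hU.connectedComponentIn
  have hU₀U : U₀ ⊆ U := connectedComponentIn_subset U x.1
  have hx₀ : x.1 ∈ U₀ := mem_connectedComponentIn hx
  obtain ⟨S, bS, k, -, hSc, hSU, hxS, -, hbS, hk, hsub, -⟩ := A.submanifold x.1 hx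
  set C : A.Light → ℝ := fun γ => A.omega γ * ‖lightWeight A p c v γ‖ ^ 2 / (4 * Real.pi) with hC
  have hC0 : ∀ γ ∈ A.active, 0 ≤ C γ := fun γ _ => by
    have := Real.pi_pos
    simp only [hC]
    positivity
  set f : B → ℂ := fun b => energyFun (fun i => A.Zloc (ε i)) Zt p v b +
    ((∑ γ ∈ A.active, C γ * Real.log Real.pi : ℝ) : ℂ) * I with hf
  set Zγ : A.Light → B → ℂ := fun γ => A.Zloc (A.lightToLoc γ) with hZγ
  have hfim : ∀ b, (f b).im = (energyFun (fun i => A.Zloc (ε i)) Zt p v b).im - logSum A p c v b +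
      ∑ γ ∈ A.active, C γ * Real.log ‖Zγ γ b‖ := fun b => by
    rw [hf, add_im, im_ofReal_mul, I_im, mul_one, logSum]
    simp only [mul_sub, Finset.sum_sub_distrib]
    ring
  have hpot : ∀ b φ, potential A.active C (f b) (fun γ => Zγ γ b) φ =
      (energyFun (fun i => A.Zloc (ε i)) Zt p v b).im - logSum A p c v b +
      ∑ γ ∈ A.active, C γ * (axisInt (fun _ => 1) ‖Zγ γ b‖ (φ γ)).re := fun b φ => by
    rw [potential, hfim]
    simp only [mul_sub, Finset.sum_sub_distrib]
    ring
  have hfhol : ∀ y ∈ U₀, (∀ γ ∈ A.active, Zγ γ y ≠ 0) → HolAt (r := r) f y := fun y hy hyZ => by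
    have hyR := mem_of_Zloc_ne_zero (hU₀U hy) hyZ
    obtain ⟨m', hm', -⟩ := hform ⟨y, hyR⟩ hy
    exact holAt_add (holAt_energyFun_Zloc hU hZt (hU₀U hy) (hm'.det_ne_zero hU (hU₀U hy)) v)
      (holAt_const _ _)
  have hpos : 0 < potential A.active C (f x.1) (fun γ => Zγ γ x.1) φ := by
    refine potential_pos_of_boundary (S := S ∩ U₀) (t := Finset.univ)
      (b := fun j => A.Zloc (Module.Free.chooseBasis ℤ A.Loc j)) (k := k) ?_ hU₀o
      inter_subset_right hC0 (fun γ _ y hy => holAt_Zloc hU (hU₀U hy) _) hfhol (fun y hy _ => ?_)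
      (fun j _ y hy => holAt_Zloc hU (hU₀U hy) _) (fun y hy η hη => ?_) hk
      (fun y hy hns => ?_) ⟨hxS, hx₀⟩ (fun γ hγ => Zloc_ne_zero hx x.2 hγ) φ
    · have h1 : S ∩ U₀ = S \ (U \ U₀) := by
        ext y
        exact ⟨fun hy => ⟨hy.1, fun h2 => h2.2 hy.2⟩, fun hy => ⟨hy.1, by
          by_contra h3
          exact hy.2 ⟨hSU hy.1, h3⟩⟩⟩
      rw [h1]
      exact hSc.diff (isOpen_diff_connectedComponentIn hU x.1)
    -- Along the discriminant, `Im f` is locally bounded below: the uncorrected energy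
    -- is positive, so its imaginary part is bounded below by logarithms.
    · have hne : ∀ y', (∏ γ ∈ A.active, Zγ γ y') ≠ 0 ↔ ∀ γ ∈ A.active, Zγ γ y' ≠ 0 := fun y' =>
        Finset.prod_ne_zero_iff
      obtain ⟨L, hL0, hL⟩ : ∃ L : ℝ, 0 ≤ L ∧ ∀ γ ∈ A.active, ‖Zγ γ y‖ < Real.exp L := by
        refine ⟨∑ γ ∈ A.active, ‖Zγ γ y‖, Finset.sum_nonneg fun _ _ => norm_nonneg _,
          fun γ hγ => ?_⟩
        have h1 := Finset.single_le_sum (f := fun γ => ‖Zγ γ y‖) (fun _ _ => norm_nonneg _) hγ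
        have h2 := Real.add_one_le_exp (∑ γ ∈ A.active, ‖Zγ γ y‖)
        linarith
      have hLev : ∀ᶠ y' in 𝓝 y, ∀ γ ∈ A.active, ‖Zγ γ y'‖ < Real.exp L :=
        (Finset.eventually_all _).2 fun γ hγ =>
          (holAt_Zloc hU (hU₀U hy.2) _).continuousAt.norm.eventually (gt_mem_nhds (hL γ hγ))
      have hkey := exists_le_im_of_log_le_manifold (r := r) (x := y)
        (q := fun y' => ∏ γ ∈ A.active, Zγ γ y') (F := f) (c := ∑ γ ∈ A.active, C γ)
        (C := (∑ γ ∈ A.active, C γ) * (A.active.card * L)) ?_ ?_ ?_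
        (Finset.sum_nonneg hC0) ?_
      · obtain ⟨C', hC'⟩ := hkey
        exact ⟨C', hC'.mono fun y' h1 h2 => h1 ((hne y').2 h2)⟩
      · filter_upwards [hU₀o.mem_nhds hy.2] with y' hy'
        exact holAt_prod _ fun γ _ => holAt_Zloc hU (hU₀U hy') _
      · refine ((frequently_mem_of_isDivisor hR y).and_eventually
          (hU₀o.eventually_mem hy.2)).mono fun y' hy' => (hne y').2 fun γ hγ =>
            Zloc_ne_zero (hU₀U hy'.2) (not_not.1 hy'.1) hγ
      · filter_upwards [hU₀o.mem_nhds hy.2] with y' hy' hq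
        exact hfhol y' hy' ((hne y').1 hq)
      · filter_upwards [hU₀o.mem_nhds hy.2, hLev] with y' hy' hL' hq
        have hq' := (hne y').1 hq
        refine (sum_mul_log_ge hC0 hq' hL0 fun γ hγ => (hL' γ hγ).le).trans ?_
        have hyR := mem_of_Zloc_ne_zero (hU₀U hy') hq'
        obtain ⟨m', hm', he⟩ := hform ⟨y', hyR⟩ hy'
        have h1 := hm'.energyAt_pos hv
        rw [he] at h1
        rw [hfim]
        linarith
    · obtain ⟨j, hj⟩ := exists_holDiff_Zloc_ne_zero A hR hU (hU₀U hy.2) hη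
      exact ⟨j, Finset.mem_univ j, hj⟩
    -- The points where `S` is not a submanifold are boundary points, hence lie in `U'`.
    · have hyb : y ∈ bS := by
        by_contra hyb
        exact hns ((hsub y ⟨hy.1, hyb⟩).inter_open hU₀o hy.2)
      have hyU' := hbS hyb
      have hyR := A.U'_regular y hyU'
      obtain ⟨m', hm', he⟩ := hform ⟨y, hyR⟩ hy.2
      refine ⟨fun γ hγ => Zloc_ne_zero (hU₀U hy.2) hyR hγ, fun ψ => ?_⟩
      rw [hpot]
      have h1 := hm'.energy_pos_of_mem_U' hyU' hv ψ
      rw [he] at h1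
      refine h1.trans_eq ?_
      congr 1
      refine Finset.sum_congr rfl fun γ _ => ?_
      rw [DiscriminantAssumptions.light, ← A.Zloc_eq _ _ (hU₀U hy.2)]
  obtain ⟨m', hm', he⟩ := hform x hx₀
  rw [hpot, ← he, h.energyAt_im_eq hm'] at hpos
  refine hpos.trans_eq ?_
  congr 1
  refine Finset.sum_congr rfl fun γ _ => ?_
  rw [DiscriminantAssumptions.light, ← A.Zloc_eq _ _ hx]

end Positivity

/-! ### Logarithms of the model coordinates -/

section ModelLog

variable {J : Type*}

/-- The logarithm of a model coordinate, as a function of the central charges and angles of the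
charge itself and of the light charges. -/
def modelLog (s : Finset J) (ζ : ℂ) (α : J → ℝ) (w : J → ℂ) (z₀ : ℂ) (φ₀ : ℝ) (z : J → ℂ)
    (φ : J → ℝ) : ℂ :=
  1 / ζ * z₀ + ζ * conj z₀ + φ₀ * I - 1 / (4 * Real.pi * I) * ∑ j ∈ s, w j *
    contourInt (fun u => modelKernel ζ (u + α j * I)) (fun X => Complex.log (1 - X)) (α j) (z j, φ j)

/-- The derivative of the contribution of a light charge to the logarithm of a model coordinate. -/
def response (ζ : ℂ) (α : ℝ) (z : ℂ) (φ : ℝ) (z' : ℂ) (φ' : ℝ) : ℂ :=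
  1 / (4 * Real.pi * I) *
    (contourInt (fun u => modelKernel ζ (u + α * I) * exp (-(u + α * I)))
        (fun X => X / (1 - X)) α (z, φ) * z' +
      contourInt (fun u => modelKernel ζ (u + α * I) * exp (u + α * I))
        (fun X => X / (1 - X)) α (z, φ) * conj z' +
      I * contourInt (fun u => modelKernel ζ (u + α * I)) (fun X => X / (1 - X)) α (z, φ) * φ')

lemma contourInt_eulerDeriv_log (k : ℝ → ℂ) {α : ℝ} {p : ℂ × ℝ} (h : InHalfPlane α p.1) :
    contourInt k (eulerDeriv fun X => Complex.log (1 - X)) α p =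
      -contourInt k (fun X => X / (1 - X)) α p := by
  rw [contourInt, contourInt, ← integral_neg]
  congr 1
  ext u
  rw [eulerDeriv_log (norm_exp_logX_lt_one h _ _), mul_neg]

lemma contourDeriv_log_apply (ζ : ℂ) {α : ℝ} {z : ℂ} {φ : ℝ} (h : InHalfPlane α z) (z' : ℂ)
    (φ' : ℝ) : 1 / (4 * Real.pi * I) * contourDeriv (fun u => modelKernel ζ (u + α * I))
      (fun X => Complex.log (1 - X)) α (z, φ) (z', φ') = -response ζ α z φ z' φ' := by
  rw [contourDeriv, contourInt_eulerDeriv_log _ h, contourInt_eulerDeriv_log _ h,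
    contourInt_eulerDeriv_log _ h, response]
  simp only [add_apply, smul_apply, dzForm, dzbarForm, dphiForm, smul_eq_mul,
    ContinuousLinearMap.comp_apply, ContinuousLinearMap.coe_fst', ContinuousLinearMap.coe_snd',
    ContinuousLinearEquiv.coe_coe, conjCLE_apply, ofRealCLM_apply]
  ring

variable {E : Type*} [NormedAddCommGroup E] [NormedSpace ℝ E]

lemma contDiffAt_modelLog {s : Finset J} {ζ : ℂ} (hζ : ζ ≠ 0) {α : J → ℝ} (w : J → ℂ)
    {z₀ : E → ℂ} {φ₀ : E → ℝ} {z : J → E → ℂ} {φ : J → E → ℝ} {q : E}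
    (hα : ∀ j ∈ s, exp (α j * I) ≠ ζ / ‖ζ‖) (hz : ∀ j ∈ s, InHalfPlane (α j) (z j q))
    (hz₀ : ContDiffAt ℝ ∞ z₀ q) (hφ₀ : ContDiffAt ℝ ∞ φ₀ q)
    (hzj : ∀ j ∈ s, ContDiffAt ℝ ∞ (z j) q) (hφj : ∀ j ∈ s, ContDiffAt ℝ ∞ (φ j) q) :
    ContDiffAt ℝ ∞ (fun q => modelLog s ζ α w (z₀ q) (φ₀ q) (fun j => z j q) fun j => φ j q) q := by
  have h1 : ContDiffAt ℝ ∞ (fun q => conj (z₀ q)) q := conjCLE.contDiff.contDiffAt.comp q hz₀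
  have h2 : ContDiffAt ℝ ∞ (fun q => (φ₀ q : ℂ)) q := ofRealCLM.contDiff.contDiffAt.comp q hφ₀
  refine (((contDiffAt_const.mul hz₀).add (contDiffAt_const.mul h1)).add
    (h2.mul contDiffAt_const)).sub (contDiffAt_const.mul (ContDiffAt.sum fun j hj =>
      contDiffAt_const.mul ?_))
  exact ContDiffAt.comp (g := contourInt _ _ _) q
    (contDiffAt_contourInt (isTemperate_modelKernel hζ (hα j hj)) isDiscFun_log (hz j hj))
    ((hzj j hj).prodMk (hφj j hj))

lemma fderiv_modelLog_apply {s : Finset J} {ζ : ℂ} (hζ : ζ ≠ 0) {α : J → ℝ} (w : J → ℂ)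
    {z₀ : E → ℂ} {φ₀ : E → ℝ} {z : J → E → ℂ} {φ : J → E → ℝ} {q : E}
    (hα : ∀ j ∈ s, exp (α j * I) ≠ ζ / ‖ζ‖) (hz : ∀ j ∈ s, InHalfPlane (α j) (z j q))
    {z₀' : E →L[ℝ] ℂ} {φ₀' : E →L[ℝ] ℝ} {z' : J → E →L[ℝ] ℂ} {φ' : J → E →L[ℝ] ℝ}
    (hz₀ : HasFDerivAt z₀ z₀' q) (hφ₀ : HasFDerivAt φ₀ φ₀' q)
    (hzj : ∀ j ∈ s, HasFDerivAt (z j) (z' j) q) (hφj : ∀ j ∈ s, HasFDerivAt (φ j) (φ' j) q)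
    (v : E) :
    fderiv ℝ (fun q => modelLog s ζ α w (z₀ q) (φ₀ q) (fun j => z j q) fun j => φ j q) q v =
      1 / ζ * z₀' v + ζ * conj (z₀' v) + φ₀' v * I +
        ∑ j ∈ s, w j * response ζ (α j) (z j q) (φ j q) (z' j v) (φ' j v) := by
  have h1 : HasFDerivAt (fun q => conj (z₀ q)) ((conjCLE : ℂ →L[ℝ] ℂ).comp z₀') q :=
    conjCLE.hasFDerivAt.comp q hz₀
  have h2 : HasFDerivAt (fun q => (φ₀ q : ℂ)) (ofRealCLM.comp φ₀') q :=
    ofRealCLM.hasFDerivAt.comp q hφ₀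
  have h3 : ∀ j ∈ s, HasFDerivAt (fun q => contourInt (fun u => modelKernel ζ (u + α j * I))
      (fun X => Complex.log (1 - X)) (α j) (z j q, φ j q)) ((contourDeriv
        (fun u => modelKernel ζ (u + α j * I)) (fun X => Complex.log (1 - X)) (α j)
        (z j q, φ j q)).comp ((z' j).prod (φ' j))) q := fun j hj =>
    HasFDerivAt.comp (g := contourInt _ _ _) q
      (hasFDerivAt_contourInt (p := (z j q, φ j q)) (isTemperate_modelKernel hζ (hα j hj))
      isDiscFun_log (hz j hj)) ((hzj j hj).prodMk (hφj j hj))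
  have h4 := (((hz₀.const_mul (1 / ζ)).add (h1.const_mul ζ)).add (h2.mul_const I)).sub
    ((HasFDerivAt.fun_sum fun j hj => (h3 j hj).const_mul (w j)).const_mul (1 / (4 * Real.pi * I)))
  have h5 : fderiv ℝ (fun q => modelLog s ζ α w (z₀ q) (φ₀ q) (fun j => z j q) fun j => φ j q) q =
      _ := h4.fderiv
  rw [h5]
  simp only [sub_apply, add_apply, smul_apply, sum_apply, smul_eq_mul,
    ContinuousLinearMap.comp_apply, ContinuousLinearMap.prod_apply, ContinuousLinearEquiv.coe_coe,
    conjCLE_apply, ofRealCLM_apply]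
  rw [sub_eq_add_neg, Finset.mul_sum, ← Finset.sum_neg_distrib]
  congr 1
  · ring
  · refine Finset.sum_congr rfl fun j hj => ?_
    rw [mul_left_comm, contourDeriv_log_apply ζ (hz j hj)]
    ring

/-- The vector `(ζ⁻¹ + conj ζ) / 2`. -/
def halfSum (ζ : ℂ) : ℂ := (ζ⁻¹ + conj ζ) / 2

/-- The real number `(|ζ|² - |ζ|⁻²) / 2`. -/
def halfDiff (ζ : ℂ) : ℝ := (‖ζ‖ ^ 2 - (‖ζ‖ ^ 2)⁻¹) / 2

lemma halfSum_ne_zero {ζ : ℂ} (hζ : ζ ≠ 0) : halfSum ζ ≠ 0 := by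
  intro h
  have h1 : ζ * halfSum ζ = ((1 + ‖ζ‖ ^ 2 : ℝ) : ℂ) / 2 := by
    rw [halfSum, ← normSq_eq_norm_sq]
    push_cast
    rw [← mul_conj]
    field_simp
  rw [h, mul_zero] at h1
  have h2 : ((1 + ‖ζ‖ ^ 2 : ℝ) : ℂ) = 0 := by
    rw [eq_comm, div_eq_zero_iff] at h1
    exact h1.resolve_right two_ne_zero
  have h3 : (1 + ‖ζ‖ ^ 2 : ℝ) = 0 := by exact_mod_cast h2
  have := sq_nonneg ‖ζ‖
  linarith

/-- On the directions that leave the real part of the semi-flat logarithm unchanged, the pole of the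
kernel at `ζ` cancels. -/
lemma modelKernel_mul_eq {ζ v : ℂ} (hζ : ζ ≠ 0) (h : exp v ≠ ζ) :
    modelKernel ζ v * (halfSum ζ * exp v - conj (halfSum ζ) * exp (-v) - halfDiff ζ) =
      halfSum ζ * exp v + conj (halfSum ζ) * exp (-v) + 2 * (‖halfSum ζ‖ ^ 2 : ℝ) := by
  have h1 : exp v - ζ ≠ 0 := sub_ne_zero.2 h
  have h2 : exp v ≠ 0 := exp_ne_zero v
  have h3 : conj ζ ≠ 0 := by simpa using hζ
  rw [← normSq_eq_norm_sq, ← mul_conj, halfDiff, ← normSq_eq_norm_sq, modelKernel, exp_neg]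
  push_cast
  rw [← mul_conj]
  simp only [halfSum, map_div₀, map_add, map_inv₀, conj_conj, map_ofNat]
  field_simp
  ring

lemma sub_sub_integral_eq {a b c a' b' c' : ℝ → ℂ} (ha : Integrable a) (hb : Integrable b)
    (hc : Integrable c) (ha' : Integrable a') (hb' : Integrable b') (hc' : Integrable c')
    (h : ∀ u, a u - b u - c u = a' u + (b' u + c' u)) :
    (∫ u, a u) - (∫ u, b u) - ∫ u, c u = (∫ u, a' u) + ((∫ u, b' u) + ∫ u, c' u) := by
  rw [← integral_sub ha hb, ← integral_sub (f := fun u => a u - b u) (ha.sub hb) hc,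
    ← integral_add hb' hc', ← integral_add (g := fun u => b' u + c' u) ha' (hb'.add hc')]
  exact integral_congr_ae (Eventually.of_forall h)

/-- The response in the directions that leave the real part of the semi-flat logarithm
unchanged. -/
theorem response_eq {ζ : ℂ} (hζ : ζ ≠ 0) {α : ℝ} {z : ℂ} (φ : ℝ)
    (hα : exp (α * I) ≠ ζ / ‖ζ‖) (hz : InHalfPlane α z) (ρ : ℝ) :
    response ζ α z φ (I * conj (halfSum ζ) * ρ) (halfDiff ζ * ρ) =
      -(ρ / (4 * Real.pi)) * ((2 * ‖halfSum ζ‖ ^ 2 : ℝ) * axisInt (fun _ => 1) ‖z‖ φ +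
        ((2 * (halfSum ζ * (-z / ‖z‖)).re : ℝ) : ℂ) * axisInt Real.cosh ‖z‖ φ) := by
  have hK := isTemperate_modelKernel hζ hα
  have hne : ∀ u : ℝ, exp (u + α * I) ≠ ζ := fun u =>
    exp_ne_of_direction_ne (by simpa using hα)
  have hF := isDiscFun_geom
  have i1 := integrable_integrand (hK.mul_exp_neg α) hF hz φ
  have i2 := integrable_integrand (hK.mul_exp α) hF hz φ
  have i3 := integrable_integrand hK hF hz φ
  have j1 := integrable_integrand (by simpa only [one_mul] using isTemperate_one.mul_exp_neg α) hF hz φ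
  have j2 := integrable_integrand (by simpa only [one_mul] using isTemperate_one.mul_exp α) hF hz φ
  have j3 := integrable_integrand isTemperate_one hF hz φ
  have hpi : (Real.pi : ℂ) ≠ 0 := by exact_mod_cast Real.pi_ne_zero
  rw [← contourInt_exp_add_eq_axisInt hz φ, ← contourInt_one_eq_axisInt hz φ]
  have key : halfSum ζ * contourInt (fun u => modelKernel ζ (u + α * I) * exp (u + α * I))
        (fun X => X / (1 - X)) α (z, φ) - conj (halfSum ζ) *
      contourInt (fun u => modelKernel ζ (u + α * I) * exp (-(u + α * I)))
        (fun X => X / (1 - X)) α (z, φ) -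
      halfDiff ζ * contourInt (fun u => modelKernel ζ (u + α * I)) (fun X => X / (1 - X)) α (z, φ) =
      2 * (‖halfSum ζ‖ ^ 2 : ℝ) * contourInt (fun _ => 1) (fun X => X / (1 - X)) α (z, φ) +
      (halfSum ζ * contourInt (fun u => exp (u + α * I)) (fun X => X / (1 - X)) α (z, φ) +
      conj (halfSum ζ) * contourInt (fun u => exp (-(u + α * I)))
        (fun X => X / (1 - X)) α (z, φ)) := by
    simp only [contourInt]
    rw [← integral_const_mul, ← integral_const_mul, ← integral_const_mul, ← integral_const_mul,
      ← integral_const_mul, ← integral_const_mul]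
    refine sub_sub_integral_eq (i2.const_mul _) (i1.const_mul _) (i3.const_mul _) (j3.const_mul _)
      (j2.const_mul _) (j1.const_mul _) fun u => ?_
    have h1 := modelKernel_mul_eq hζ (hne u)
    linear_combination (exp (logX z φ (u + α * I)) / (1 - exp (logX z φ (u + α * I)))) * h1
  have h3 : response ζ α z φ (I * conj (halfSum ζ) * ρ) (halfDiff ζ * ρ) =
      -(ρ / (4 * Real.pi)) * (halfSum ζ *
        contourInt (fun u => modelKernel ζ (u + α * I) * exp (u + α * I))
        (fun X => X / (1 - X)) α (z, φ) - conj (halfSum ζ) *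
      contourInt (fun u => modelKernel ζ (u + α * I) * exp (-(u + α * I)))
        (fun X => X / (1 - X)) α (z, φ) -
      halfDiff ζ * contourInt (fun u => modelKernel ζ (u + α * I))
        (fun X => X / (1 - X)) α (z, φ)) := by
    rw [response]
    simp only [map_mul, conj_I, conj_conj, conj_ofReal]
    push_cast
    field_simp
    ring
  rw [h3, key]
  push_cast
  ring

end ModelLog

/-! ### Convergence and local form of the model coordinates -/

section LocalForm

variable {r : ℕ} {B : Type*} [TopologicalSpace B] [ChartedSpace (Fin r → ℂ) B]
  {R : TopologicalSpace.Opens B} {D : BPSData r B R} {U : Set B} (A : DiscriminantAssumptions D U)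
  (S : SectorialDecomposition)

lemma Z_light_ne_zero {x : R} (hx : x.1 ∈ U) {γ : A.Light} (hγ : γ ∈ A.active) :
    D.Z x (A.light x γ) ≠ 0 := by
  rw [DiscriminantAssumptions.light, ← A.Zloc_eq _ x hx]
  exact Zloc_ne_zero hx x.2 hγ

lemma continuousAt_Z_light (hU : IsOpen U) {x : R} (hx : x.1 ∈ U) (γ : A.Light) :
    ContinuousAt (fun y : R => D.Z y (A.light y γ)) x := by
  have h1 : ContinuousAt (fun y : R => A.Zloc (A.lightToLoc γ) y.1) x :=
    ContinuousAt.comp (g := A.Zloc _) (holAt_Zloc hU hx _).continuousAt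
      continuous_subtype_val.continuousAt
  refine h1.congr ?_
  filter_upwards [eventually_opens.2 (hU.eventually_mem hx)] with y hy
  exact A.Zloc_eq _ y hy

lemma integrand_eq {x : R} {θ : D.charge.Fiber x → Real.Angle} {γ : A.Light} {φ : ℝ}
    (h : (φ : Real.Angle) = θ (A.light x γ)) (ζ : ℂ) :
    A.integrand x θ ζ γ = modelIntegrand ζ (D.Z x (A.light x γ)) φ := by
  funext ζ'
  rw [DiscriminantAssumptions.integrand, modelIntegrand, Xsf, h]

variable {A S}

/-- Near `x`, the integrals defining the model coordinates are integrals over a fixed ray, the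
indices of the sectors being locally constant modulo `2 K`. -/
theorem exists_rayIntegralMinus_eq (hU : IsOpen U) {Ua : Set R} (hUaU : ∀ x ∈ Ua, x.1 ∈ U)
    (hS : A.IsGoodOn S Ua) {ζ : ℂ} (hζ : ζ ≠ 0) {k : ℤ} (hk : k = 0 ∨ k = 1 ∨ k = -1) {x : R}
    (hx : x ∈ Ua) {γ : A.Light} (hγ : γ ∈ A.active) :
    ∃ α : ℝ, exp (α * I) ≠ ζ / ‖ζ‖ ∧ InHalfPlane α (D.Z x (A.light x γ)) ∧
      (∀ θ, RayIntegralMinusConverges (A.integrand x θ ζ γ) (A.contourAngle S x k γ)) ∧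
      ∀ᶠ y in 𝓝 x, ∀ (θ : D.charge.Fiber y → Real.Angle) (φ : ℝ),
        (φ : Real.Angle) = θ (A.light y γ) →
        rayIntegralMinus (A.integrand y θ ζ γ) (A.contourAngle S y k γ) =
          contourInt (fun u => modelKernel ζ (u + α * I)) (fun X => Complex.log (1 - X)) α
            (D.Z y (A.light y γ), φ) := by
  have hZ := Z_light_ne_zero A (hUaU x hx) hγ
  have h0 := S.inHalfPlane_rayAngle hZ hk
  obtain ⟨ε₀, hε, hεπ, hav, h1⟩ := exists_rotation ζ h0
  have hmain : ∀ z φ, InHalfPlane (A.contourAngle S x k γ) z →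
      InHalfPlane (A.contourAngle S x k γ - ε₀) z → _ := fun z φ h h' =>
    rayIntegralMinus_modelIntegrand hζ hε hεπ hav h h' φ
  refine ⟨A.contourAngle S x k γ - ε₀, hav ε₀ ⟨hε, le_rfl⟩, h1, fun θ => ?_, ?_⟩
  · obtain ⟨φ, hφ⟩ : ∃ φ : ℝ, (φ : Real.Angle) = θ (A.light x γ) := ⟨_, Real.Angle.coe_toReal _⟩
    rw [integrand_eq A hφ]
    exact (hmain _ φ h0 h1).1
  · have hc := continuousAt_Z_light A hU (hUaU x hx) γ
    have hhp : ∀ β, InHalfPlane β (D.Z x (A.light x γ)) →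
        ∀ᶠ y in 𝓝 x, InHalfPlane β (D.Z y (A.light y γ)) := fun β hβ =>
      (ContinuousAt.prodMk hc (continuousAt_const (y := (0 : ℝ)))).eventually
        ((isOpen_inHalfPlane β).eventually_mem hβ)
    have hidx : ∀ᶠ y in 𝓝 x, ∃ j : ℤ, S.index (-D.Z y (A.light y γ)) =
        S.index (-D.Z x (A.light x γ)) + 2 * S.K * j :=
      hc.neg.eventually (S.eventually_index_eq (neg_ne_zero.2 hZ) (hS x hx γ hγ))
    filter_upwards [hhp _ h0, hhp _ h1, hidx] with y hy0 hy1 ⟨j, hj⟩ θ φ hφ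
    have hang : A.contourAngle S y k γ = A.contourAngle S x k γ + 2 * Real.pi * j := by
      rw [DiscriminantAssumptions.contourAngle, hj, add_right_comm, S.rayAngle_add_mul]
      rfl
    rw [integrand_eq A hφ, hang, rayIntegralMinus_add_two_pi_int]
    exact (hmain _ φ hy0 hy1).2

/-- Near `x`, the model coordinates are exponentials of `modelLog`. -/
theorem exists_Xmodel_eq (hU : IsOpen U) {Ua : Set R} (hUaU : ∀ x ∈ Ua, x.1 ∈ U)
    (hS : A.IsGoodOn S Ua) {ζ : ℂ} (hζ : ζ ≠ 0) {k : ℤ} (hk : k = 0 ∨ k = 1 ∨ k = -1) {x : R}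
    (hx : x ∈ Ua) :
    ∃ α : A.Light → ℝ, (∀ γ ∈ A.active, exp (α γ * I) ≠ ζ / ‖ζ‖) ∧
      (∀ γ ∈ A.active, InHalfPlane (α γ) (D.Z x (A.light x γ))) ∧
      ∀ᶠ y in 𝓝 x, ∀ (θ : D.charge.Fiber y → Real.Angle) (φ : A.Light → ℝ),
        (∀ γ, (φ γ : Real.Angle) = θ (A.light y γ)) → ∀ (g : D.charge.Fiber y) (φ₀ : ℝ),
        (φ₀ : Real.Angle) = θ g → A.Xmodel S k y θ ζ g =
          exp (modelLog A.active ζ α (fun γ => A.omega γ * D.pair y g (A.light y γ)) (D.Z y g) φ₀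
            (fun γ => D.Z y (A.light y γ)) φ) := by
  have H := fun γ hγ => exists_rayIntegralMinus_eq hU hUaU hS hζ hk hx (γ := γ) hγ
  choose! α hα1 hα2 _ hα4 using H
  refine ⟨α, hα1, hα2, ?_⟩
  filter_upwards [(Finset.eventually_all A.active).2 hα4] with y hy θ φ hφ g φ₀ hφ₀
  rw [DiscriminantAssumptions.Xmodel, Xsf, ← hφ₀, Real.Angle.toCircle_coe, Circle.coe_exp,
    ← exp_add, ← exp_add, modelLog]
  congr 1
  rw [neg_mul, ← sub_eq_add_neg]
  congr 2
  refine Finset.sum_congr rfl fun γ hγ => ?_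
  rw [hy γ hγ θ (φ γ) (hφ γ)]

end LocalForm

/-! ### Smoothness in charts -/

section RealCharts

variable {r : ℕ} {X : Type*} [TopologicalSpace X] [ChartedSpace (Fin r → ℂ) X]

lemma hasFDerivAt_chart {f : X → ℂ} {x : X} (hf : HolAt (r := r) f x) :
    HasFDerivAt (f ∘ (chartAt (Fin r → ℂ) x).symm) (holDiff (r := r) f x)
      (chartAt (Fin r → ℂ) x x) := by
  have h1 := ((mdifferentiableAt_iff _ _).1 hf).2
  simp only [writtenInExtChartAt, extChartAt, mfld_simps, differentiableWithinAt_univ] at h1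
  have h2 : holDiff (r := r) f x = fderiv ℂ (f ∘ (chartAt (Fin r → ℂ) x).symm)
      (chartAt (Fin r → ℂ) x x) := by
    rw [holDiff, hf.mfderiv]
    simp only [writtenInExtChartAt, extChartAt, mfld_simps, fderivWithin_univ]
    rfl
  rw [h2]
  exact DifferentiableAt.hasFDerivAt h1

lemma realDiff_eq {f : X → ℂ} {x : X} {f' : (Fin r → ℂ) →L[ℝ] ℂ} (hc : ContinuousAt f x)
    (hf : HasFDerivAt (f ∘ (chartAt (Fin r → ℂ) x).symm) f' (chartAt (Fin r → ℂ) x x)) :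
    realDiff (r := r) f x = f' := by
  have h1 : MDifferentiableAt 𝓘(ℝ, Fin r → ℂ) 𝓘(ℝ, ℂ) f x := by
    refine (mdifferentiableAt_iff _ _).2 ⟨hc, ?_⟩
    simp only [writtenInExtChartAt, extChartAt, mfld_simps, differentiableWithinAt_univ]
    exact hf.differentiableAt
  rw [realDiff, h1.mfderiv]
  simp only [writtenInExtChartAt, extChartAt, mfld_simps, fderivWithin_univ]
  exact hf.fderiv

lemma eventually_contDiffAt_chart [IsManifold 𝓘(ℂ, Fin r → ℂ) 1 X] {f : X → ℂ} {x : X}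
    (hf : ∀ᶠ y in 𝓝 x, HolAt (r := r) f y) :
    ∀ᶠ z in 𝓝 (chartAt (Fin r → ℂ) x x),
      ContDiffAt ℝ ∞ (f ∘ (chartAt (Fin r → ℂ) x).symm) z := by
  set φ := chartAt (Fin r → ℂ) x
  have hφ : φ ∈ IsManifold.maximalAtlas 𝓘(ℂ, Fin r → ℂ) 1 X := IsManifold.chart_mem_maximalAtlas x
  obtain ⟨ρ, hρ, ht, hb, -⟩ := exists_ball_chart φ (mem_chart_source _ x) hf
  have h1 : DifferentiableOn ℂ (f ∘ φ.symm) (ball (φ x) ρ) := fun z hz =>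
    (HolAt.comp_symm hφ (ht hz) (hb z hz)).differentiableWithinAt
  filter_upwards [ball_mem_nhds (φ x) hρ] with z hz
  exact (contDiffAt_of_differentiableOn isOpen_ball h1 hz).restrict_scalars ℝ

end RealCharts

/-! ### The derivatives of the model coordinates -/

section ModelForm

variable {r : ℕ} {B : Type*} [TopologicalSpace B] [ChartedSpace (Fin r → ℂ) B]
  {R : TopologicalSpace.Opens B} {D : BPSData r B R} {U : Set B} (A : DiscriminantAssumptions D U)
  {S : SectorialDecomposition}

/-- The derivative of the logarithm of the model coordinate of the charge `γ` in the direction of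
the tangent vector `t` of the base and the infinitesimal change `σ` of the angles. -/
def modelForm (ζ : ℂ) (α φ : A.Light → ℝ) (x : R) (t : Fin r → ℂ) (σ : D.charge.Fiber x → ℝ)
    (γ : D.charge.Fiber x) : ℂ :=
  1 / ζ * D.dZ x γ t + ζ * conj (D.dZ x γ t) + σ γ * I +
    ∑ γ' ∈ A.active, A.omega γ' * D.pair x γ (A.light x γ') *
      response ζ (α γ') (D.Z x (A.light x γ')) (φ γ') (D.dZ x (A.light x γ') t) (σ (A.light x γ'))

variable {A} {Ua : Set R} {e m : Fin r → ∀ x, D.charge.Fiber x} {p : Fin r → ℤ}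

/-- `angleShift` as a linear form in the angles. -/
def angleForm (D : ChargeData r B R) (e m : Fin r → ∀ x, D.charge.Fiber x) (p : Fin r → ℤ) (x : R)
    (γ : D.charge.Fiber x) : (Fin r ⊕ Fin r → ℝ) →L[ℝ] ℝ :=
  ∑ i, (((D.pair x (m i x) γ : ℝ) / p i) • ContinuousLinearMap.proj (.inl i) -
    ((D.pair x (e i x) γ : ℝ) / p i) • ContinuousLinearMap.proj (.inr i))

lemma angleForm_apply (D : ChargeData r B R) (e m : Fin r → ∀ x, D.charge.Fiber x) (p : Fin r → ℤ)
    (x : R) (γ : D.charge.Fiber x) (s : Fin r ⊕ Fin r → ℝ) :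
    angleForm D e m p x γ s = angleShift D e m p s x γ := by
  simp [angleForm, angleShift, sum_apply]

lemma IsSymplecticFrame.eventually_eq (h : IsSymplecticFrame D.toChargeData Ua e m p) {x : R}
    (hx : x ∈ Ua) : ∀ᶠ y in 𝓝 x, ∀ j : Fin r ⊕ Fin r,
      (Sum.elim e m j : ∀ y, D.charge.Fiber y) y = D.charge.tr x y ((Sum.elim e m j : ∀ y, D.charge.Fiber y) x) := by
  refine eventually_all.2 fun j => ?_
  rcases j with i | i
  · exact h.flat_e i x hx
  · exact h.flat_m i x hx

lemma IsSymplecticFrame.eventually_angleShift (h : IsSymplecticFrame D.toChargeData Ua e m p)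
    {x : R} (hx : x ∈ Ua) : ∀ᶠ y in 𝓝 x, ∀ s γ,
      angleShift D.toChargeData e m p s y (D.charge.tr x y γ) =
        angleShift D.toChargeData e m p s x γ := by
  filter_upwards [h.eventually_eq hx, D.pair_flat x] with y h1 h2 s γ
  have he : ∀ i, e i y = D.charge.tr x y (e i x) := fun i => h1 (.inl i)
  have hm : ∀ i, m i y = D.charge.tr x y (m i x) := fun i => h1 (.inr i)
  simp only [angleShift, he, hm, h2]

/-- In a chart, the model coordinates are exponentials of smooth functions whose derivatives are
given by `modelForm`. -/
theorem exists_chart_modelMap_eq [IsManifold 𝓘(ℂ, Fin r → ℂ) 1 B] (hU : IsOpen U)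
    (hUaU : ∀ x ∈ Ua, x.1 ∈ U) (hS : A.IsGoodOn S Ua) {ζ : ℂ} (hζ : ζ ≠ 0) {k : ℤ}
    (hk : k = 0 ∨ k = 1 ∨ k = -1) (h : IsSymplecticFrame D.toChargeData Ua e m p) {W : Set R}
    {θ₀ : ∀ x, D.charge.Fiber x → Real.Angle} (hWUa : W ⊆ Ua)
    (hθ₀ : IsFlatCharacterOn D.toChargeData W θ₀) {x : R} (hx : x ∈ W) (s : Fin r ⊕ Fin r → ℝ) :
    ∃ (α φ : A.Light → ℝ) (Y : Fin r ⊕ Fin r → (Fin r → ℂ) × (Fin r ⊕ Fin r → ℝ) → ℂ),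
      (∀ γ ∈ A.active, exp (α γ * I) ≠ ζ / ‖ζ‖) ∧
      (∀ γ ∈ A.active, InHalfPlane (α γ) (D.Z x (A.light x γ))) ∧
      (∀ γ, (φ γ : Real.Angle) = charAt D.toChargeData e m p θ₀ x s (A.light x γ)) ∧
      (∀ j, ∀ᶠ q in 𝓝 (chartAt (Fin r → ℂ) x x, s), ContDiffAt ℝ ∞ (Y j) q) ∧
      (∀ j t s', fderiv ℝ (Y j) (chartAt (Fin r → ℂ) x x, s) (t, s') =
        modelForm A ζ α φ x t (angleShift D.toChargeData e m p s' x)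
          ((Sum.elim e m j : ∀ y, D.charge.Fiber y) x)) ∧
      ∀ᶠ y in 𝓝 x, ∀ s' j, A.modelMap S k ζ e m p θ₀ (y, s') j =
        exp (Y j (chartAt (Fin r → ℂ) x y, s')) := by
  have hxa := hWUa hx
  obtain ⟨α, hα, hαZ, hX⟩ := exists_Xmodel_eq hU hUaU hS hζ hk hxa
  set ψ := chartAt (Fin r → ℂ) x with hψ
  set g : Fin r ⊕ Fin r → D.charge.Fiber x := fun j =>
    (Sum.elim e m j : ∀ y, D.charge.Fiber y) x with hg
  set Zc : D.charge.Fiber x → (Fin r → ℂ) → ℂ := fun γ =>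
    (fun y => D.Z y (D.charge.tr x y γ)) ∘ ψ.symm with hZc
  set ang : D.charge.Fiber x → (Fin r ⊕ Fin r → ℝ) → ℝ := fun γ s' =>
    (θ₀ x γ).toReal + angleForm D.toChargeData e m p x γ s' with hang
  have hZy : ∀ {y}, y ∈ ψ.source → ∀ γ, Zc γ (ψ y) = D.Z y (D.charge.tr x y γ) := fun hy γ =>
    congrArg (fun y => D.Z y (D.charge.tr x y γ)) (ψ.left_inv hy)
  have hZ0 : ∀ γ, Zc γ (ψ x) = D.Z x γ := fun γ => by
    rw [hZy (mem_chart_source _ x), D.charge.tr_self]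
  set q₀ : (Fin r → ℂ) × (Fin r ⊕ Fin r → ℝ) := (ψ x, s) with hq₀
  set zd : D.charge.Fiber x → ((Fin r → ℂ) × (Fin r ⊕ Fin r → ℝ) →L[ℝ] ℂ) := fun γ =>
    ((D.dZ x γ).restrictScalars ℝ).comp (ContinuousLinearMap.fst ℝ _ _) with hzd
  set ad : D.charge.Fiber x → ((Fin r → ℂ) × (Fin r ⊕ Fin r → ℝ) →L[ℝ] ℝ) := fun γ =>
    (angleForm D.toChargeData e m p x γ).comp (ContinuousLinearMap.snd ℝ _ _) with had'
  have hZd : ∀ γ, HasFDerivAt (fun q : (Fin r → ℂ) × (Fin r ⊕ Fin r → ℝ) => Zc γ q.1)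
      (zd γ) q₀ := fun γ =>
    HasFDerivAt.comp (g := Zc γ) q₀
      ((hasFDerivAt_chart (D.Z_holomorphic x γ).self_of_nhds).restrictScalars ℝ) hasFDerivAt_fst
  have hZs : ∀ γ, ∀ᶠ q in 𝓝 q₀,
      ContDiffAt ℝ ∞ (fun q : (Fin r → ℂ) × (Fin r ⊕ Fin r → ℝ) => Zc γ q.1) q := fun γ => by
    have h1 : ∀ᶠ z in 𝓝 q₀.1, ContDiffAt ℝ ∞ (Zc γ) z :=
      eventually_contDiffAt_chart (X := R) (D.Z_holomorphic x γ)
    filter_upwards [continuousAt_fst.eventually h1] with q hq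
    exact ContDiffAt.comp (g := Zc γ) q hq contDiffAt_fst
  have had : ∀ γ, HasFDerivAt (fun q : (Fin r → ℂ) × (Fin r ⊕ Fin r → ℝ) => ang γ q.2)
      (ad γ) q₀ := fun γ =>
    ((angleForm D.toChargeData e m p x γ).hasFDerivAt.comp q₀ hasFDerivAt_snd).const_add _
  have has : ∀ γ q, ContDiffAt ℝ ∞ (fun q : (Fin r → ℂ) × (Fin r ⊕ Fin r → ℝ) => ang γ q.2) q :=
    fun γ q => contDiffAt_const.add
      ((angleForm D.toChargeData e m p x γ).contDiff.contDiffAt.comp q contDiffAt_snd)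
  have hαZ' : ∀ γ ∈ A.active, InHalfPlane (α γ) (Zc (A.light x γ) q₀.1) := fun γ hγ => by
    rw [hq₀, hZ0]; exact hαZ γ hγ
  have hangle : ∀ γ s', (ang γ s' : Real.Angle) =
      θ₀ x γ + (angleShift D.toChargeData e m p s' x γ : Real.Angle) := fun γ s' => by
    simp only [hang, Real.Angle.coe_add, Real.Angle.coe_toReal, angleForm_apply]
  refine ⟨α, fun γ => ang (A.light x γ) s, fun j q => modelLog A.active ζ α
    (fun γ => A.omega γ * D.pair x (g j) (A.light x γ)) (Zc (g j) q.1) (ang (g j) q.2)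
    (fun γ => Zc (A.light x γ) q.1) (fun γ => ang (A.light x γ) q.2), hα, hαZ, fun γ => hangle _ s,
    fun j => ?_, fun j t s' => ?_, ?_⟩
  · have h1 : ∀ᶠ q in 𝓝 q₀, ∀ γ ∈ A.active, InHalfPlane (α γ) (Zc (A.light x γ) q.1) :=
      (Finset.eventually_all _).2 fun γ hγ => by
        have h2 : ContinuousAt (fun q : (Fin r → ℂ) × (Fin r ⊕ Fin r → ℝ) =>
            (Zc (A.light x γ) q.1, (0 : ℝ))) q₀ :=
          (hZd (A.light x γ)).continuousAt.prodMk continuousAt_const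
        exact h2.eventually ((isOpen_inHalfPlane (α γ)).eventually_mem (hαZ' γ hγ))
    filter_upwards [h1, hZs (g j), (Finset.eventually_all A.active).2 fun γ _ => hZs (A.light x γ)]
      with q hq1 hq2 hq3
    exact contDiffAt_modelLog (E := (Fin r → ℂ) × (Fin r ⊕ Fin r → ℝ)) (q := q)
      (z := fun γ q => Zc (A.light x γ) q.1)
      (φ := fun γ q => ang (A.light x γ) q.2) hζ _ hα hq1 hq2 (has _ q) hq3 fun γ _ => has _ q
  · have hd := fderiv_modelLog_apply (E := (Fin r → ℂ) × (Fin r ⊕ Fin r → ℝ)) (s := A.active) (q := q₀)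
      (z₀ := fun q => Zc (g j) q.1)
      (φ₀ := fun q => ang (g j) q.2) (z := fun γ q => Zc (A.light x γ) q.1)
      (φ := fun γ q => ang (A.light x γ) q.2) hζ
      (fun γ => A.omega γ * D.pair x (g j) (A.light x γ)) hα hαZ' (z₀' := zd (g j)) (φ₀' := ad (g j))
      (z' := fun γ => zd (A.light x γ)) (φ' := fun γ => ad (A.light x γ)) (hZd (g j)) (had (g j))
      (fun γ _ => hZd (A.light x γ)) (fun γ _ => had (A.light x γ)) (t, s')
    refine hd.trans ?_
    simp only [hzd, had', ContinuousLinearMap.comp_apply, ContinuousLinearMap.coe_fst',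
      ContinuousLinearMap.coe_snd', ContinuousLinearMap.coe_restrictScalars', angleForm_apply,
      modelForm, hq₀, hZ0]
    rfl
  · filter_upwards [hX, h.eventually_eq hxa, h.eventually_angleShift hxa, D.pair_flat x,
      A.loc_flat x (hUaU x hxa), (hθ₀ x hx).2, ψ.open_source.mem_nhds (mem_chart_source _ x)]
      with y h1 h2 h3 h4 h5 h6 h7 s' j
    have hl : ∀ γ, A.light y γ = D.charge.tr x y (A.light x γ) := fun γ => h5 _
    have hch : ∀ γ, charAt D.toChargeData e m p θ₀ y s' (D.charge.tr x y γ) = ang γ s' := fun γ => by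
      rw [hangle, charAt, h6, h3]
    have hmm : A.modelMap S k ζ e m p θ₀ (y, s') j = A.Xmodel S k y
        (charAt D.toChargeData e m p θ₀ y s') ζ ((Sum.elim e m j : ∀ y, D.charge.Fiber y) y) := by
      rcases j with i | i <;> rfl
    rw [hmm, h1 (charAt D.toChargeData e m p θ₀ y s') (fun γ => ang (A.light x γ) s')
      (fun γ => by rw [hl, hch]) _ (ang (g j) s') (by rw [h2, hch])]
    simp only [hl, h2, h4, hZy h7]
    rfl

end ModelForm

/-! ### The real part of the derivative in the light directions -/

section SemiFlat

/-- The angles do not contribute to the real part of a semi-flat logarithm. -/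
lemma re_semiflat (ζ z : ℂ) (σ : ℝ) :
    (1 / ζ * z + ζ * conj z + σ * I).re = 2 * (halfSum ζ * z).re := by
  have h1 : (ζ * conj z).re = (conj ζ * z).re := by
    rw [← conj_re, map_mul, conj_conj]
  rw [add_re, add_re, h1, re_ofReal_mul, I_re, halfSum, ← add_re, one_div]
  have h2 : (ζ⁻¹ + conj ζ) / 2 * z = ((1 / 2 : ℝ) : ℂ) * (ζ⁻¹ * z + conj ζ * z) := by
    push_cast; ring
  rw [h2, re_ofReal_mul]
  ring

lemma semiflat_eq {ζ : ℂ} (hζ : ζ ≠ 0) (ρ : ℝ) :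
    1 / ζ * (I * conj (halfSum ζ) * ρ) + ζ * conj (I * conj (halfSum ζ) * ρ) =
      -(halfDiff ζ * ρ : ℝ) * I := by
  have h3 : conj ζ ≠ 0 := by simpa using hζ
  rw [halfDiff, ← normSq_eq_norm_sq]
  push_cast
  rw [← mul_conj]
  simp only [halfSum, map_mul, map_div₀, map_add, map_inv₀, conj_conj, map_ofNat, conj_I,
    conj_ofReal]
  field_simp
  ring

/-- The infinitesimal variations of the central charge and the angle that leave a semi-flat
logarithm unchanged. -/
lemma exists_eq_of_semiflat_eq_zero {ζ : ℂ} (hζ : ζ ≠ 0) {z : ℂ} {σ : ℝ}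
    (h : 1 / ζ * z + ζ * conj z + σ * I = 0) :
    ∃ ρ : ℝ, z = I * conj (halfSum ζ) * ρ ∧ σ = halfDiff ζ * ρ := by
  have hc := halfSum_ne_zero hζ
  have h1 : (halfSum ζ * z).re = 0 := by
    have := re_semiflat ζ z σ
    rw [h, zero_re] at this
    linarith
  have hz : z = I * conj (halfSum ζ) * (((halfSum ζ * z).im / normSq (halfSum ζ) : ℝ) : ℂ) := by
    have h2 : halfSum ζ * z = ((halfSum ζ * z).im : ℂ) * I := by
      apply Complex.ext <;> simp [h1]
    have h3 : (normSq (halfSum ζ) : ℂ) ≠ 0 := by exact_mod_cast normSq_eq_zero.not.2 hc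
    rw [ofReal_div]
    refine mul_left_cancel₀ hc ?_
    rw [h2]
    field_simp
    rw [← mul_conj]
    simp only [im_ofReal_mul, I_im, mul_one]
    ring
  refine ⟨_, hz, ?_⟩
  rw [hz, semiflat_eq hζ, ← add_mul] at h
  have h4 := (mul_eq_zero.1 h).resolve_right I_ne_zero
  rw [← ofReal_neg, ← ofReal_add, ofReal_eq_zero] at h4
  linarith

end SemiFlat

section Parity

variable {r : ℕ} {B : Type*} [TopologicalSpace B] [ChartedSpace (Fin r → ℂ) B]
  {R : TopologicalSpace.Opens B} {D : BPSData r B R} {U : Set B} {A : DiscriminantAssumptions D U}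

lemma IsTwistedCharacter.map_neg {x : R} {θ : D.charge.Fiber x → Real.Angle}
    (h : IsTwistedCharacter D.toChargeData x θ) (a : D.charge.Fiber x) : θ (-a) = -θ a := by
  have h0 : θ 0 = 0 := by
    have := h.map_add 0 0
    simpa using this
  have hp : D.pair x a a = 0 := by
    have := D.pair_antisymm x a a
    omega
  have h1 := h.map_add a (-a)
  rw [add_neg_cancel, h0, _root_.map_neg, hp] at h1
  simp only [neg_zero, Int.cast_zero, mul_zero, Real.Angle.coe_zero, add_zero] at h1
  exact eq_neg_of_add_eq_zero_right h1.symm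

variable (A)

lemma light_neg (x : R) (γ : A.Light) : A.light x (-γ) = -A.light x γ := by
  simp [DiscriminantAssumptions.light]

lemma omega_neg {x : R} (hx : x.1 ∈ U) (γ : A.Light) : A.omega (-γ) = A.omega γ := by
  have h1 := A.omega_eq x hx (-γ)
  have h2 := A.omega_eq x hx γ
  have h3 : A.loc x (A.lightToLoc (-γ)) = -A.loc x (A.lightToLoc γ) := light_neg A x γ
  rw [h3, D.Ω_neg, h2] at h1
  exact_mod_cast h1.symm

lemma sum_active_neg {x : R} (hx : x.1 ∈ U) (g : A.Light → ℝ) :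
    ∑ γ ∈ A.active, g (-γ) = ∑ γ ∈ A.active, g γ := by
  have h : ∀ γ, γ ∈ A.active ↔ -γ ∈ A.active := fun γ => by
    rw [A.mem_active, A.mem_active, omega_neg A hx]
  exact Finset.sum_equiv (Equiv.neg A.Light) h fun γ _ => rfl

/-- Charge conjugation kills the contributions that are odd in the charge. -/
lemma sum_active_eq_zero {x : R} (hx : x.1 ∈ U) {g : A.Light → ℝ} (hg : ∀ γ, g (-γ) = -g γ) :
    ∑ γ ∈ A.active, g γ = 0 := by
  have h := sum_active_neg A hx g
  simp only [hg, Finset.sum_neg_distrib] at h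
  linarith

variable {A} {x : R} {θ : D.charge.Fiber x → Real.Angle} {φ : A.Light → ℝ}

lemma axisInt_light_neg (hθ : IsTwistedCharacter D.toChargeData x θ)
    (hφ : ∀ γ, (φ γ : Real.Angle) = θ (A.light x γ)) (g : ℝ → ℝ) (γ : A.Light) :
    axisInt g ‖D.Z x (A.light x (-γ))‖ (φ (-γ)) =
      conj (axisInt g ‖D.Z x (A.light x γ)‖ (φ γ)) := by
  rw [← axisInt_neg, light_neg, _root_.map_neg, norm_neg]
  refine axisInt_congr_angle _ _ ?_
  rw [hφ, light_neg, hθ.map_neg, ← hφ, Real.Angle.coe_neg]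

lemma sum_im_axisInt_eq_zero (hx : x.1 ∈ U) (hθ : IsTwistedCharacter D.toChargeData x θ)
    (hφ : ∀ γ, (φ γ : Real.Angle) = θ (A.light x γ)) {b c : A.Light → ℝ}
    (hb : ∀ γ, b (-γ) = -b γ) (hc : ∀ γ, c (-γ) = -c γ) :
    ∑ γ ∈ A.active, A.omega γ * b γ * c γ *
      (axisInt (fun _ => 1) ‖D.Z x (A.light x γ)‖ (φ γ)).im = 0 := by
  refine sum_active_eq_zero A hx fun γ => ?_
  rw [axisInt_light_neg hθ hφ, conj_im, omega_neg A hx, hb, hc]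
  ring

/-- The weighted sum of the real parts of the responses to a variation that leaves the real parts of
the semi-flat logarithms of the light charges unchanged. -/
lemma sum_re_response {ζ : ℂ} (hζ : ζ ≠ 0) {α : A.Light → ℝ} (hx : x.1 ∈ U)
    (hθ : IsTwistedCharacter D.toChargeData x θ) (hφ : ∀ γ, (φ γ : Real.Angle) = θ (A.light x γ))
    (hα : ∀ γ ∈ A.active, exp (α γ * I) ≠ ζ / ‖ζ‖)
    (hαZ : ∀ γ ∈ A.active, InHalfPlane (α γ) (D.Z x (A.light x γ))) {b ρ : A.Light → ℝ}
    (hb : ∀ γ, b (-γ) = -b γ) (hρ : ∀ γ, ρ (-γ) = -ρ γ) :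
    ∑ γ ∈ A.active, A.omega γ * b γ * (response ζ (α γ) (D.Z x (A.light x γ)) (φ γ)
        (I * conj (halfSum ζ) * ρ γ) (halfDiff ζ * ρ γ)).re =
      -(2 * ‖halfSum ζ‖ ^ 2 * (1 / (4 * Real.pi) * ∑ γ ∈ A.active, A.omega γ * b γ * ρ γ *
        (axisInt (fun _ => 1) ‖D.Z x (A.light x γ)‖ (φ γ)).re)) := by
  have h1 : ∀ γ ∈ A.active, A.omega γ * b γ * (response ζ (α γ) (D.Z x (A.light x γ)) (φ γ)
        (I * conj (halfSum ζ) * ρ γ) (halfDiff ζ * ρ γ)).re =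
      -(2 * ‖halfSum ζ‖ ^ 2 * (1 / (4 * Real.pi) * (A.omega γ * b γ * ρ γ *
        (axisInt (fun _ => 1) ‖D.Z x (A.light x γ)‖ (φ γ)).re))) -
      A.omega γ * b γ * ρ γ / (4 * Real.pi) *
        (2 * (halfSum ζ * (-D.Z x (A.light x γ) / ‖D.Z x (A.light x γ)‖)).re) *
        (axisInt Real.cosh ‖D.Z x (A.light x γ)‖ (φ γ)).re := fun γ hγ => by
    rw [response_eq hζ (φ γ) (hα γ hγ) (hαZ γ hγ)]
    have h2 : (-((ρ γ : ℂ) / (4 * Real.pi))) = ((-(ρ γ / (4 * Real.pi)) : ℝ) : ℂ) := by push_cast; rfl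
    rw [h2, re_ofReal_mul, add_re, re_ofReal_mul, re_ofReal_mul]
    ring
  rw [Finset.sum_congr rfl h1, Finset.sum_sub_distrib, Finset.sum_neg_distrib, ← Finset.mul_sum,
    ← Finset.mul_sum, sum_active_eq_zero A hx (g := fun γ => A.omega γ * b γ * ρ γ / (4 * Real.pi) *
        (2 * (halfSum ζ * (-D.Z x (A.light x γ) / ‖D.Z x (A.light x γ)‖)).re) *
        (axisInt Real.cosh ‖D.Z x (A.light x γ)‖ (φ γ)).re), sub_zero]
  intro γ
  rw [axisInt_light_neg hθ hφ, conj_re, omega_neg A hx, hb, hρ, light_neg, _root_.map_neg, norm_neg,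
    neg_neg]
  have h2 : (halfSum ζ * (-D.Z x (A.light x γ) / ‖D.Z x (A.light x γ)‖)).re =
      -(halfSum ζ * (D.Z x (A.light x γ) / ‖D.Z x (A.light x γ)‖)).re := by
    rw [neg_div, mul_neg, neg_re]
  rw [h2]
  ring

end Parity

/-! ### Injectivity of the differential -/

section Injective

variable {r : ℕ} {B : Type*} [TopologicalSpace B] [ChartedSpace (Fin r → ℂ) B]
  {R : TopologicalSpace.Opens B} {D : BPSData r B R} {U : Set B} {A : DiscriminantAssumptions D U}
  {x : R} {θ : D.charge.Fiber x → Real.Angle} {α φ : A.Light → ℝ} {ζ : ℂ} {t : Fin r → ℂ}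

/-- The dependence of `modelForm` on the charge. -/
def modelHom (A : DiscriminantAssumptions D U) (ζ : ℂ) (α φ : A.Light → ℝ) (x : R) (t : Fin r → ℂ)
    (σ : D.charge.Fiber x →+ ℝ) : D.charge.Fiber x →+ ℂ :=
  AddMonoidHom.mk' (modelForm A ζ α φ x t σ) fun a b => by
    simp only [modelForm, dZ_add, map_add, add_apply, AddMonoidHom.add_apply, Int.cast_add,
      ofReal_add, mul_add, add_mul, Finset.sum_add_distrib]
    ring

lemma modelHom_flavor {σ : D.charge.Fiber x →+ ℝ} (hσ : ∀ f, σ (D.flavor x f) = 0) (f : D.Flavor) :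
    modelHom A ζ α φ x t σ (D.flavor x f) = 0 := by
  have h1 : ∀ γ, D.pair x (D.flavor x f) γ = 0 := fun γ => (D.radical x _).2 ⟨f, rfl⟩ γ
  change modelForm A ζ α φ x t σ (D.flavor x f) = 0
  simp [modelForm, dZ_flavor, h1, hσ]

lemma modelForm_loc (hx : x.1 ∈ U) (σ : D.charge.Fiber x → ℝ) (ε : A.Loc) :
    modelForm A ζ α φ x t σ (A.loc x ε) = 1 / ζ * D.dZ x (A.loc x ε) t +
      ζ * conj (D.dZ x (A.loc x ε) t) + σ (A.loc x ε) * I := by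
  simp [modelForm, pair_loc_light A hx]

/-- The differential of the model coordinates is injective. The logarithms of the local charges are
semi-flat, so on the kernel the variations of the local charges are given by real numbers `u i`, and
those of the light charges by real numbers `ρ γ`. The real parts of the equations for the magnetic
charges then say that the corrected energy of the vector vanishes. -/
theorem eq_zero_of_modelForm_eq_zero [IsManifold 𝓘(ℂ, Fin r → ℂ) ω B]
    (hR : IsDivisor (r := r) (R : Set B)ᶜ) (hU : IsOpen U) (hζ : ζ ≠ 0) (hx : x.1 ∈ U)
    (hθ : IsTwistedCharacter D.toChargeData x θ) (hφ : ∀ γ, (φ γ : Real.Angle) = θ (A.light x γ))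
    (hα : ∀ γ ∈ A.active, exp (α γ * I) ≠ ζ / ‖ζ‖)
    (hαZ : ∀ γ ∈ A.active, InHalfPlane (α γ) (D.Z x (A.light x γ)))
    {σ : D.charge.Fiber x →+ ℝ} (h0 : ∀ γ, modelForm A ζ α φ x t σ γ = 0) :
    t = 0 ∧ ∀ γ, σ γ = 0 := by
  have hc := halfSum_ne_zero hζ
  have hloc : ∀ ε : A.Loc, ∃ ρ : ℝ, D.dZ x (A.loc x ε) t = I * conj (halfSum ζ) * ρ ∧
      σ (A.loc x ε) = halfDiff ζ * ρ := fun ε => by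
    have h1 := h0 (A.loc x ε)
    rw [modelForm_loc hx] at h1
    exact exists_eq_of_semiflat_eq_zero hζ h1
  obtain ⟨ε, m, p, hfr⟩ := exists_adapted_frame A hx
  set c : Fin r → A.Light → ℤ := fun i γ => D.pair x (m i) (A.light x γ) with hcdef
  have had : IsAdapted A ε p c x m := ⟨hfr, fun i γ => rfl⟩
  choose u hu hσu using fun i => hloc (ε i)
  set v : Fin r → ℂ := fun i => D.dZ x (A.loc x (ε i)) t with hv
  set ρ : A.Light → ℝ := fun γ => ∑ i, (c i γ : ℝ) / p i * u i with hρdef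
  have hρodd : ∀ γ, ρ (-γ) = -ρ γ := fun γ => by
    simp only [hρdef, hcdef, light_neg, _root_.map_neg, Int.cast_neg, neg_div, neg_mul,
      Finset.sum_neg_distrib]
  have hweight : ∀ γ, lightWeight A p c v γ = I * conj (halfSum ζ) * ρ γ := fun γ => by
    simp only [lightWeight, hv, hu, hρdef]
    push_cast
    rw [Finset.mul_sum]
    refine Finset.sum_congr rfl fun i _ => ?_
    ring
  have hlight : ∀ γ, D.dZ x (A.light x γ) t = I * conj (halfSum ζ) * ρ γ := fun γ => by
    rw [had.dZ_light hx, hweight]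
  have hσlight : ∀ γ, σ (A.light x γ) = halfDiff ζ * ρ γ := fun γ => by
    obtain ⟨ρ', h1, h2⟩ := hloc (A.lightToLoc γ)
    have h3 := (hlight γ).symm.trans h1
    have h4 : (ρ γ : ℂ) = ρ' :=
      mul_left_cancel₀ (mul_ne_zero I_ne_zero ((map_ne_zero _).2 hc)) h3
    rw [ofReal_inj.1 h4]
    exact h2
  have ht : t = 0 := by
    by_contra ht0
    have hinj : ∀ t' : Fin r → ℂ, (∀ i, D.dZ x (A.loc x (ε i)) t' = 0) → t' = 0 := fun t' h1 =>
      Matrix.eq_zero_of_mulVec_eq_zero hfr.det_ne_zero (funext fun i => by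
        rw [formMatrix_mulVec, h1]; rfl)
    have hv0 : v ≠ 0 := fun h1 => ht0 (hinj t fun i => congrFun h1 i)
    have hpos := had.energy_pos hR hU hx hv0 φ
    obtain ⟨t', ht', hen⟩ := had.energyAt_eq v
    obtain rfl : t' = t := by
      rw [← sub_eq_zero]
      exact hinj _ fun i => by rw [map_sub, ht']; exact sub_self _
    rw [hen] at hpos
    simp only [hu] at hpos
    -- the real part of the form on the magnetic charges determines the energy
    have hm : ∀ i, 2 * (halfSum ζ * D.dZ x (m i) t').re = -∑ γ ∈ A.active, A.omega γ * c i γ *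
        (response ζ (α γ) (D.Z x (A.light x γ)) (φ γ) (I * conj (halfSum ζ) * ρ γ)
          (halfDiff ζ * ρ γ)).re := fun i => by
      have h1 := congrArg re (h0 (m i))
      rw [modelForm, add_re, re_semiflat, zero_re, re_sum] at h1
      rw [eq_neg_iff_add_eq_zero, ← h1]
      congr 1
      refine Finset.sum_congr rfl fun γ _ => ?_
      rw [hlight, hσlight]
      have h2 : (A.omega γ : ℂ) * (D.pair x (m i) (A.light x γ) : ℂ) =
          ((A.omega γ * c i γ : ℝ) : ℂ) := by push_cast; rfl
      rw [h2, re_ofReal_mul]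
    have henergy : (∑ i, conj (I * conj (halfSum ζ) * u i) * (D.dZ x (m i) t' / p i)).im =
        -(‖halfSum ζ‖ ^ 2 * (1 / (4 * Real.pi) * ∑ γ ∈ A.active, A.omega γ * ρ γ * ρ γ *
        (axisInt (fun _ => 1) ‖D.Z x (A.light x γ)‖ (φ γ)).re)) := by
      have h3 := sum_re_response hζ hx hθ hφ hα hαZ hρodd hρodd
      have h4 : (∑ i, conj (I * conj (halfSum ζ) * u i) * (D.dZ x (m i) t' / p i)).im =
          ∑ i, -(u i / p i) / 2 * (2 * (halfSum ζ * D.dZ x (m i) t').re) := by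
        rw [im_sum]
        refine Finset.sum_congr rfl fun i _ => ?_
        have h5 : conj (I * conj (halfSum ζ) * u i) * (D.dZ x (m i) t' / p i) =
            ((-(u i / p i) : ℝ) : ℂ) * (I * (halfSum ζ * D.dZ x (m i) t')) := by
          simp only [map_mul, conj_I, conj_conj, conj_ofReal]
          push_cast
          ring
        rw [h5, im_ofReal_mul, I_mul_im]
        ring
      rw [h4]
      simp only [hm]
      have h6 : ∑ i, -(u i / p i) / 2 * -∑ γ ∈ A.active, A.omega γ * c i γ *
          (response ζ (α γ) (D.Z x (A.light x γ)) (φ γ) (I * conj (halfSum ζ) * ρ γ)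
            (halfDiff ζ * ρ γ)).re = 1 / 2 * ∑ γ ∈ A.active, A.omega γ * ρ γ *
          (response ζ (α γ) (D.Z x (A.light x γ)) (φ γ) (I * conj (halfSum ζ) * ρ γ)
            (halfDiff ζ * ρ γ)).re := by
        simp only [← Finset.sum_neg_distrib, Finset.mul_sum]
        rw [Finset.sum_comm]
        refine Finset.sum_congr rfl fun γ _ => ?_
        generalize (response ζ (α γ) (D.Z x (A.light x γ)) (φ γ) (I * conj (halfSum ζ) * ρ γ)
            (halfDiff ζ * ρ γ)).re = y
        simp only [hρdef, Finset.mul_sum, Finset.sum_mul]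
        refine Finset.sum_congr rfl fun i _ => ?_
        ring
      rw [h6, h3]
      ring
    rw [henergy] at hpos
    have hzero : ∑ γ ∈ A.active, A.omega γ * ‖lightWeight A p c v γ‖ ^ 2 / (4 * Real.pi) *
        (axisInt (fun _ => 1) ‖D.Z x (A.light x γ)‖ (φ γ)).re =
        ‖halfSum ζ‖ ^ 2 * (1 / (4 * Real.pi) * ∑ γ ∈ A.active, A.omega γ * ρ γ * ρ γ *
        (axisInt (fun _ => 1) ‖D.Z x (A.light x γ)‖ (φ γ)).re) := by
      rw [Finset.mul_sum, Finset.mul_sum]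
      refine Finset.sum_congr rfl fun γ _ => ?_
      rw [hweight, norm_mul, norm_mul, norm_I, RCLike.norm_conj, norm_real, one_mul, mul_pow,
        Real.norm_eq_abs, sq_abs]
      ring
    rw [hzero] at hpos
    linarith
  -- The variations `ρ γ` of the light angles vanish with `t`, and so does the response.
  refine ⟨ht, fun γ => ?_⟩
  have hρ0 : ∀ γ, ρ γ = 0 := fun γ => by
    have h1 := hlight γ
    rw [ht, map_zero, eq_comm] at h1
    exact ofReal_eq_zero.1 ((mul_eq_zero.1 h1).resolve_left
      (mul_ne_zero I_ne_zero ((map_ne_zero _).2 hc)))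
  have h1 := h0 γ
  simp only [modelForm, ht, map_zero, hσlight, hρ0, mul_zero, response, ofReal_zero, add_zero,
    Finset.sum_const_zero, zero_add] at h1
  exact ofReal_eq_zero.1 ((mul_eq_zero.1 h1).resolve_right I_ne_zero)

end Injective

/-! ### The model coordinates are local diffeomorphisms -/

section LocalDiffeo

/-- The inverse function theorem for maps that are smooth near a point. -/
lemma exists_openPartialHomeomorph_contDiffOn {E F : Type*} [NormedAddCommGroup E]
    [NormedSpace ℝ E] [CompleteSpace E] [NormedAddCommGroup F] [NormedSpace ℝ F] {f : E → F} {a : E}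
    (hf : ∀ᶠ q in 𝓝 a, ContDiffAt ℝ ∞ f q) {f' : E ≃L[ℝ] F}
    (hf' : HasFDerivAt f (f' : E →L[ℝ] F) a) :
    ∃ Φ : OpenPartialHomeomorph E F, a ∈ Φ.source ∧ (∀ q, Φ q = f q) ∧
      ContDiffOn ℝ ∞ Φ Φ.source ∧ ContDiffOn ℝ ∞ Φ.symm Φ.target := by
  have hn : (∞ : WithTop ℕ∞) ≠ 0 := by simp
  have ha := hf.self_of_nhds
  set Φ₀ := ha.toOpenPartialHomeomorph f hf' hn with hΦ₀
  have h1 : ∀ᶠ q in 𝓝 a, fderiv ℝ f q ∈ range ContinuousLinearEquiv.toContinuousLinearMap := by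
    refine (ha.continuousAt_fderiv hn).eventually ?_
    rw [hf'.fderiv]
    exact ContinuousLinearEquiv.nhds f'
  obtain ⟨N, hN, hNo, haN⟩ := _root_.eventually_nhds_iff.1 (hf.and h1)
  have hΦ : ∀ q, Φ₀.restr N q = f q := fun q => rfl
  have hsrc : (Φ₀.restr N).source ⊆ N := by
    rw [Φ₀.restr_source' N hNo]
    exact inter_subset_right
  refine ⟨Φ₀.restr N, ?_, hΦ, fun q hq => ((hN q (hsrc hq)).1).contDiffWithinAt, fun w hw => ?_⟩
  · rw [Φ₀.restr_source' N hNo]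
    exact ⟨ha.mem_toOpenPartialHomeomorph_source hf' hn, haN⟩
  · have h2 := hN _ (hsrc ((Φ₀.restr N).map_target hw))
    obtain ⟨L, hL⟩ := h2.2
    refine ((Φ₀.restr N).contDiffAt_symm hw (f₀' := L) ?_ h2.1).contDiffWithinAt
    have h3 := (h2.1.differentiableAt hn).hasFDerivAt
    rw [← hL] at h3
    exact h3

lemma isManifold_real {r : ℕ} {X : Type*} [TopologicalSpace X] [ChartedSpace (Fin r → ℂ) X]
    [IsManifold 𝓘(ℂ, Fin r → ℂ) ω X] : IsManifold 𝓘(ℝ, Fin r → ℂ) ∞ X := by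
  refine isManifold_of_contDiffOn _ _ _ fun e e' he he' => ?_
  have h1 := ((contDiffGroupoid ω 𝓘(ℂ, Fin r → ℂ)).compatible he he')
  rw [contDiffGroupoid, mem_groupoid_of_pregroupoid] at h1
  have h2 : ContDiffOn ℂ ω _ _ := h1.1
  exact (h2.restrict_scalars ℝ).of_le le_top

/-- A map that is a local diffeomorphism in a chart is a local diffeomorphism. -/
lemma isLocalDiffeomorphAt_of_chart {r : ℕ} {X : Type*} [TopologicalSpace X]
    [ChartedSpace (Fin r → ℂ) X] [IsManifold 𝓘(ℝ, Fin r → ℂ) ∞ X] {V F : Type*}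
    [NormedAddCommGroup V] [NormedSpace ℝ V] [NormedAddCommGroup F] [NormedSpace ℝ F]
    {f : X × V → F} {x : X} {s : V} (Φ : OpenPartialHomeomorph ((Fin r → ℂ) × V) F)
    (hx : (chartAt (Fin r → ℂ) x x, s) ∈ Φ.source) (h1 : ContDiffOn ℝ ∞ Φ Φ.source)
    (h2 : ContDiffOn ℝ ∞ Φ.symm Φ.target)
    (hf : ∀ᶠ y in 𝓝 x, ∀ s', f (y, s') = Φ (chartAt (Fin r → ℂ) x y, s')) :
    IsLocalDiffeomorphAt (𝓘(ℝ, Fin r → ℂ).prod 𝓘(ℝ, V)) 𝓘(ℝ, F) ∞ f (x, s) := by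
  obtain ⟨N, hN, hNo, hxN⟩ := _root_.eventually_nhds_iff.1 hf
  set ψ := chartAt (Fin r → ℂ) x
  set T : OpenPartialHomeomorph (X × V) F :=
    ((ψ.restr N).prod (OpenPartialHomeomorph.refl V)).trans Φ with hT
  have hsrc : ∀ q ∈ T.source, (q.1 ∈ ψ.source ∧ q.1 ∈ N) ∧ (ψ q.1, q.2) ∈ Φ.source := fun q hq => by
    rw [hT, OpenPartialHomeomorph.trans_source] at hq
    have h3 : q.1 ∈ (ψ.restr N).source := hq.1.1
    rw [ψ.restr_source' N hNo] at h3
    exact ⟨h3, hq.2⟩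
  have htgt : ∀ w ∈ T.target, w ∈ Φ.target ∧ (Φ.symm w).1 ∈ ψ.target := fun w hw => by
    rw [hT, OpenPartialHomeomorph.trans_target] at hw
    have h3 : (Φ.symm w).1 ∈ (ψ.restr N).target := hw.2.1
    exact ⟨hw.1, h3.1⟩
  refine ⟨⟨T.toPartialEquiv, T.open_source, T.open_target, ?_, ?_⟩, ?_, ?_⟩
  · have h3 : ContMDiffOn (𝓘(ℝ, Fin r → ℂ).prod 𝓘(ℝ, V)) 𝓘(ℝ, (Fin r → ℂ) × V) ∞
        (fun q : X × V => (ψ q.1, q.2)) T.source :=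
      ((contMDiffOn_chart (x := x)).comp contMDiffOn_fst fun q hq => (hsrc q hq).1.1).prodMk_space
        contMDiffOn_snd
    exact h1.contMDiffOn.comp h3 fun q hq => (hsrc q hq).2
  · have h3 : ContMDiffOn 𝓘(ℝ, F) 𝓘(ℝ, Fin r → ℂ) ∞ (fun w => (Φ.symm w).1) T.target :=
      (contDiff_fst.comp_contDiffOn (h2.mono fun w hw => (htgt w hw).1)).contMDiffOn
    have h4 : ContMDiffOn 𝓘(ℝ, F) 𝓘(ℝ, V) ∞ (fun w => (Φ.symm w).2) T.target :=
      (contDiff_snd.comp_contDiffOn (h2.mono fun w hw => (htgt w hw).1)).contMDiffOn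
    exact ((contMDiffOn_chart_symm (x := x)).comp h3 fun w hw => (htgt w hw).2).prodMk h4
  · change (x, s) ∈ T.source
    rw [hT, OpenPartialHomeomorph.trans_source]
    refine ⟨⟨?_, mem_univ _⟩, hx⟩
    change x ∈ (ψ.restr N).source
    rw [ψ.restr_source' N hNo]
    exact ⟨mem_chart_source _ x, hxN⟩
  · intro q hq
    exact hN _ (hsrc q hq).1.2 _

variable {r : ℕ} {B : Type*} [TopologicalSpace B] [ChartedSpace (Fin r → ℂ) B]
  {R : TopologicalSpace.Opens B} {D : BPSData r B R} {U : Set B} {A : DiscriminantAssumptions D U}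
  {S : SectorialDecomposition} {Ua : Set R} {e m : Fin r → ∀ x, D.charge.Fiber x} {p : Fin r → ℤ}

/-- `angleShift` as a homomorphism. -/
def angleHom (D : ChargeData r B R) (e m : Fin r → ∀ x, D.charge.Fiber x) (p : Fin r → ℤ)
    (s : Fin r ⊕ Fin r → ℝ) (x : R) : D.charge.Fiber x →+ ℝ :=
  AddMonoidHom.mk' (angleShift D e m p s x) fun a b => by
    simp only [angleShift, map_add, Int.cast_add, ← Finset.sum_add_distrib]
    refine Finset.sum_congr rfl fun i _ => ?_
    ring

lemma angleHom_flavor (D : ChargeData r B R) (e m : Fin r → ∀ x, D.charge.Fiber x) (p : Fin r → ℤ)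
    (s : Fin r ⊕ Fin r → ℝ) (x : R) (f : D.Flavor) : angleHom D e m p s x (D.flavor x f) = 0 := by
  change angleShift D e m p s x (D.flavor x f) = 0
  simp [angleShift, pair_flavor]

/-- A homomorphism that kills the flavor lattice and a symplectic frame is zero. -/
lemma IsFrameAt.eq_zero {D : ChargeData r B R} {x : R} {e m : Fin r → D.charge.Fiber x}
    {p : Fin r → ℤ} (h : IsFrameAt D x e m p) {L : D.charge.Fiber x →+ ℂ}
    (hL : ∀ f, L (D.flavor x f) = 0) (he : ∀ i, L (e i) = 0) (hm : ∀ i, L (m i) = 0)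
    (γ : D.charge.Fiber x) : L γ = 0 := by
  rw [h.expansion L hL]
  simp [he, hm]

/-- The differential is injective between spaces of the same real dimension `4 r`, so the inverse
function theorem applies in a chart. -/
theorem isLocalDiffeomorphAt_modelMap [IsManifold 𝓘(ℂ, Fin r → ℂ) ω B]
    (hR : IsDivisor (r := r) (R : Set B)ᶜ) (hU : IsOpen U)
    (hUaU : ∀ x ∈ Ua, x.1 ∈ U) (hS : A.IsGoodOn S Ua) {ζ : ℂ} (hζ : ζ ≠ 0) {k : ℤ}
    (hk : k = 0 ∨ k = 1 ∨ k = -1) (h : IsSymplecticFrame D.toChargeData Ua e m p) {W : Set R}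
    {θ₀ : ∀ x, D.charge.Fiber x → Real.Angle} (hWUa : W ⊆ Ua)
    (hθ₀ : IsFlatCharacterOn D.toChargeData W θ₀) {x : R} (hx : x ∈ W) (s : Fin r ⊕ Fin r → ℝ) :
    IsLocalDiffeomorphAt (𝓘(ℝ, Fin r → ℂ).prod 𝓘(ℝ, Fin r ⊕ Fin r → ℝ))
      𝓘(ℝ, Fin r ⊕ Fin r → ℂ) ∞ (A.modelMap S k ζ e m p θ₀) (x, s) := by
  have : IsManifold 𝓘(ℂ, Fin r → ℂ) 1 B := IsManifold.of_le (n := ω) le_top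
  have : IsManifold 𝓘(ℝ, Fin r → ℂ) ∞ R := isManifold_real
  have hxa := hWUa hx
  obtain ⟨α, φ, Y, hα, hαZ, hφ, hYs, hYd, hY⟩ :=
    exists_chart_modelMap_eq hU hUaU hS hζ hk h hWUa hθ₀ hx s
  set q₀ : (Fin r → ℂ) × (Fin r ⊕ Fin r → ℝ) := (chartAt (Fin r → ℂ) x x, s) with hq₀
  set G : (Fin r → ℂ) × (Fin r ⊕ Fin r → ℝ) → Fin r ⊕ Fin r → ℂ := fun q j => exp (Y j q) with hG
  have hGs : ∀ᶠ q in 𝓝 q₀, ContDiffAt ℝ ∞ G q := by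
    filter_upwards [eventually_all.2 hYs] with q hq
    exact contDiffAt_pi.2 fun j => (contDiff_exp (𝕜 := ℝ)).contDiffAt.comp q (hq j)
  have hn : (∞ : WithTop ℕ∞) ≠ 0 := by simp
  have hYf : ∀ j, HasFDerivAt (Y j) (fderiv ℝ (Y j) q₀) q₀ := fun j =>
    ((hYs j).self_of_nhds.differentiableAt hn).hasFDerivAt
  set G' : (Fin r → ℂ) × (Fin r ⊕ Fin r → ℝ) →L[ℝ] (Fin r ⊕ Fin r → ℂ) :=
    ContinuousLinearMap.pi fun j => exp (Y j q₀) • fderiv ℝ (Y j) q₀ with hG'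
  have hGd : HasFDerivAt G G' q₀ := hasFDerivAt_pi.2 fun j => (hYf j).cexp
  have hfr := h.isFrameAt hxa
  have hinj : ∀ v, G' v = 0 → v = 0 := by
    rintro ⟨t, s'⟩ hv
    have h1 : ∀ j, modelForm A ζ α φ x t (angleShift D.toChargeData e m p s' x)
        ((Sum.elim e m j : ∀ y, D.charge.Fiber y) x) = 0 := fun j => by
      have h2 : exp (Y j q₀) * fderiv ℝ (Y j) q₀ (t, s') = 0 := congrFun hv j
      rw [← hYd]
      exact (mul_eq_zero.1 h2).resolve_left (exp_ne_zero _)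
    set σ := angleHom D.toChargeData e m p s' x
    have h3 : ∀ γ, modelHom A ζ α φ x t σ γ = 0 :=
      hfr.eq_zero (modelHom_flavor (angleHom_flavor _ _ _ _ _ _)) (fun i => h1 (.inl i))
        (fun i => h1 (.inr i))
    obtain ⟨h4, h5⟩ := eq_zero_of_modelForm_eq_zero hR hU hζ (hUaU x hxa)
      (isTwistedCharacter_charAt e m p hθ₀ hx s) hφ hα hαZ h3
    refine Prod.ext h4 (funext fun j => ?_)
    rcases j with i | i
    · exact (angleShift_e h s' hxa i).symm.trans (h5 _)
    · exact (angleShift_m h s' hxa i).symm.trans (h5 _)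
  have hdim : Module.finrank ℝ ((Fin r → ℂ) × (Fin r ⊕ Fin r → ℝ)) =
      Module.finrank ℝ (Fin r ⊕ Fin r → ℂ) := by
    simp [Module.finrank_prod, Module.finrank_pi_fintype, Complex.finrank_real_complex]
    ring
  set L : ((Fin r → ℂ) × (Fin r ⊕ Fin r → ℝ)) ≃L[ℝ] (Fin r ⊕ Fin r → ℂ) :=
    (LinearEquiv.ofInjectiveOfFinrankEq G'.toLinearMap
      ((injective_iff_map_eq_zero _).2 hinj) hdim).toContinuousLinearEquiv with hL
  have hLG : (L : _ →L[ℝ] _) = G' := ContinuousLinearMap.ext fun v => rfl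
  obtain ⟨Φ, hΦx, hΦ, hΦ1, hΦ2⟩ := exists_openPartialHomeomorph_contDiffOn hGs (f' := L)
    (by rw [hLG]; exact hGd)
  refine isLocalDiffeomorphAt_of_chart Φ hΦx hΦ1 hΦ2 ?_
  filter_upwards [hY] with y hy s'
  funext j
  rw [hy, hΦ]

end LocalDiffeo

/-! ### The matrix `V` -/

section VMatrix

variable {r : ℕ} {B : Type*} [TopologicalSpace B] [ChartedSpace (Fin r → ℂ) B]
  {R : TopologicalSpace.Opens B} {D : BPSData r B R} {U : Set B} {A : DiscriminantAssumptions D U}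
  {x : R} {e m : Fin r → D.charge.Fiber x} {p : Fin r → ℤ} {θ : D.charge.Fiber x → Real.Angle}
  {φ : A.Light → ℝ}

lemma IsFrameAt.dZ_coordVector (h : IsFrameAt D.toChargeData x e m p) (i j : Fin r) :
    D.dZ x (e i) (coordVector D x e j) = if i = j then 1 else 0 := by
  have h1 := formMatrix_mulVec (fun i => D.dZ x (e i)) (coordVector D x e j) i
  rw [← h1]
  change ((formMatrix fun i => D.dZ x (e i)) * (formMatrix fun i => D.dZ x (e i))⁻¹) i j = _
  rw [Matrix.mul_nonsing_inv _ (isUnit_iff_ne_zero.2 h.det_ne_zero), Matrix.one_apply]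

lemma periodMatrix_apply (x : R) (e m : Fin r → D.charge.Fiber x) (p : Fin r → ℤ) (i j : Fin r) :
    periodMatrix D x e m p i j = D.dZ x (m i) (coordVector D x e j) / p i := by
  have h1 := formMatrix_mulVec (fun i => D.dZ x (m i)) (coordVector D x e j) i
  rw [← h1, periodMatrix, Matrix.mul_apply, Matrix.mulVec, dotProduct, Finset.sum_div]
  refine Finset.sum_congr rfl fun k _ => ?_
  simp only [formMatrix, coordVector, Matrix.of_apply]
  ring

/-- The periods are the coefficients of the magnetic differentials in the electric ones. -/
lemma IsFrameAt.dZ_magnetic (h : IsFrameAt D.toChargeData x e m p) (t : Fin r → ℂ) (j : Fin r) :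
    D.dZ x (m j) t / p j = ∑ i, D.dZ x (e i) t * periodMatrix D x e m p i j := by
  have h1 := h.sum_symm t (coordVector D x e j)
  simp only [h.dZ_coordVector, ← periodMatrix_apply] at h1
  simpa using h1

lemma IsFrameAt.periodMatrix_symm (h : IsFrameAt D.toChargeData x e m p) (i j : Fin r) :
    periodMatrix D x e m p i j = periodMatrix D x e m p j i := by
  rw [periodMatrix_apply x e m p j i, h.dZ_magnetic]
  simp [h.dZ_coordVector]

/-- On the ray `ℓ_γ`, the logarithm of the semi-flat coordinate is `-2 |Z_γ| cosh u + i θ_γ`. -/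
lemma ellIntegral_eq {γ : A.Light} (hZ : D.Z x (A.light x γ) ≠ 0) {φ : ℝ}
    (hφ : (φ : Real.Angle) = θ (A.light x γ)) :
    A.ellIntegral x θ γ = axisInt (fun _ => 1) ‖D.Z x (A.light x γ)‖ φ := by
  rw [← contourInt_one_eq_axisInt (inHalfPlane_arg hZ), contourInt,
    DiscriminantAssumptions.ellIntegral, rayIntegral_eq]
  refine integral_congr_ae (Eventually.of_forall fun u => ?_)
  simp only [Xsf, ← hφ, exp_logX_eq, one_mul]

/-- The entries of `V` are real: the imaginary parts of the integrals are odd in the charge, whereas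
their coefficients are even. -/
lemma V_apply (hx : x.1 ∈ U) (hθ : IsTwistedCharacter D.toChargeData x θ)
    (hφ : ∀ γ, (φ γ : Real.Angle) = θ (A.light x γ)) (i j : Fin r) :
    A.V x θ e m p i j = (((periodMatrix D x e m p i j).im + 1 / (4 * Real.pi) *
      ∑ γ ∈ A.active, A.omega γ * (D.pair x (m i) (A.light x γ) / p i) *
        (D.pair x (m j) (A.light x γ) / p j) *
        (axisInt (fun _ => 1) ‖D.Z x (A.light x γ)‖ (φ γ)).re : ℝ) : ℂ) := by
  have hodd : ∀ (i : Fin r) γ, (D.pair x (m i) (A.light x (-γ)) / p i : ℝ) =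
      -(D.pair x (m i) (A.light x γ) / p i) := fun i γ => by
    rw [light_neg, _root_.map_neg, Int.cast_neg, neg_div]
  have him := sum_im_axisInt_eq_zero hx hθ hφ
    (b := fun γ => D.pair x (m i) (A.light x γ) / p i)
    (c := fun γ => D.pair x (m j) (A.light x γ) / p j) (hodd i) (hodd j)
  have hterm : ∑ γ ∈ A.active, (A.omega γ : ℂ) * (p i : ℂ)⁻¹ * (p j : ℂ)⁻¹ *
      (D.pair x (m i) (A.light x γ) : ℂ) * (D.pair x (m j) (A.light x γ) : ℂ) *
      A.ellIntegral x θ γ = ((∑ γ ∈ A.active, A.omega γ * (D.pair x (m i) (A.light x γ) / p i) *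
        (D.pair x (m j) (A.light x γ) / p j) *
        (axisInt (fun _ => 1) ‖D.Z x (A.light x γ)‖ (φ γ)).re : ℝ) : ℂ) +
      ((∑ γ ∈ A.active, A.omega γ * (D.pair x (m i) (A.light x γ) / p i) *
        (D.pair x (m j) (A.light x γ) / p j) *
        (axisInt (fun _ => 1) ‖D.Z x (A.light x γ)‖ (φ γ)).im : ℝ) : ℂ) * I := by
    push_cast
    rw [Finset.sum_mul, ← Finset.sum_add_distrib]
    refine Finset.sum_congr rfl fun γ hγ => ?_
    rw [ellIntegral_eq (Z_light_ne_zero A hx hγ) (hφ γ)]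
    conv_lhs => rw [← re_add_im (axisInt (fun _ => 1) ‖D.Z x (A.light x γ)‖ (φ γ))]
    ring
  rw [him] at hterm
  rw [DiscriminantAssumptions.V, Matrix.of_apply, hterm]
  push_cast
  ring

/-- The quadratic form of `V` is the corrected energy in real directions. -/
theorem posDef_V [IsManifold 𝓘(ℂ, Fin r → ℂ) ω B] (hR : IsDivisor (r := r) (R : Set B)ᶜ)
    (hU : IsOpen U) (hx : x.1 ∈ U) (h : IsFrameAt D.toChargeData x e m p)
    (he : ∀ i, e i ∈ (A.loc x).range) (hθ : IsTwistedCharacter D.toChargeData x θ) :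
    ((A.V x θ e m p).map Complex.re).PosDef := by
  obtain ⟨φ, hφ⟩ : ∃ φ : A.Light → ℝ, ∀ γ, (φ γ : Real.Angle) = θ (A.light x γ) :=
    ⟨fun γ => (θ (A.light x γ)).toReal, fun γ => Real.Angle.coe_toReal _⟩
  choose ε hε using he
  obtain rfl : (fun i => A.loc x (ε i)) = e := funext hε
  set c : Fin r → A.Light → ℤ := fun i γ => D.pair x (m i) (A.light x γ) with hc
  have had : IsAdapted A ε p c x m := ⟨h, fun _ _ => rfl⟩
  refine Matrix.PosDef.of_dotProduct_mulVec_pos ?_ fun u hu => ?_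
  · ext i j
    rw [Matrix.conjTranspose_apply, star_trivial, Matrix.map_apply, Matrix.map_apply,
      V_apply hx hθ hφ, V_apply hx hθ hφ, ofReal_re, ofReal_re, h.periodMatrix_symm j i]
    congr 2
    exact Finset.sum_congr rfl fun γ _ => by ring
  · have hv : (fun i => (u i : ℂ)) ≠ 0 := fun h0 =>
      hu (funext fun i => ofReal_eq_zero.1 (congrFun h0 i))
    have hpos := had.energy_pos hR hU hx hv φ
    obtain ⟨t, ht, hen⟩ := had.energyAt_eq fun i => (u i : ℂ)
    rw [hen] at hpos
    simp only [h.dZ_magnetic, ht, conj_ofReal] at hpos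
    refine hpos.trans_eq ?_
    have h1 : ∀ γ, ‖lightWeight A p c (fun i => (u i : ℂ)) γ‖ ^ 2 =
        (∑ i, (c i γ : ℝ) / p i * u i) * ∑ j, (c j γ : ℝ) / p j * u j := fun γ => by
      have h2 : lightWeight A p c (fun i => (u i : ℂ)) γ =
          ((∑ i, (c i γ : ℝ) / p i * u i : ℝ) : ℂ) := by
        rw [lightWeight]; push_cast; rfl
      rw [h2, norm_real, Real.norm_eq_abs, sq_abs, sq]
    have h3 : (∑ i, (u i : ℂ) * ∑ j, (u j : ℂ) *
        periodMatrix D x (fun i => A.loc x (ε i)) m p j i).im = ∑ i, u i * ∑ j, u j *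
        (periodMatrix D x (fun i => A.loc x (ε i)) m p i j).im := by
      simp only [im_sum, im_ofReal_mul, h.periodMatrix_symm]
    rw [h3]
    simp only [h1, dotProduct, Matrix.mulVec, star_trivial, Matrix.map_apply, V_apply hx hθ hφ,
      ofReal_re, add_mul, Finset.sum_add_distrib, mul_add]
    congr 1
    · refine Finset.sum_congr rfl fun i _ => ?_
      rw [Finset.mul_sum, Finset.mul_sum]
      exact Finset.sum_congr rfl fun j _ => by ring
    · simp only [Finset.sum_mul, Finset.mul_sum, Finset.sum_div]
      rw [Finset.sum_comm]
      refine Finset.sum_congr rfl fun i _ => ?_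
      rw [Finset.sum_comm]
      refine Finset.sum_congr rfl fun j _ => Finset.sum_congr rfl fun γ _ => ?_
      simp only [hc]
      field_simp

end VMatrix

/-! ### The Jacobian determinant -/

section Blocks

open Matrix

variable {r : ℕ}

/-- The determinant of the block matrix of the derivatives. The angles of the magnetic charges enter
only the second row. -/
lemma det_jacobian_blocks {c c' q q' : ℂ} (hc : c ≠ 0)
    (H X X' G P P' : Matrix (Fin r) (Fin r) ℂ) :
    (fromBlocks (fromBlocks 1 0 H 1) (fromBlocks (q • 1) (q' • 1) X X')
      (fromBlocks 0 0 G 0) (fromBlocks (c • 1) (c' • 1) P P')).det =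
      (c • P' - c' • P - (c * q' - c' * q) • G).det := by
  set TL : Matrix (Fin r ⊕ Fin r) (Fin r ⊕ Fin r) ℂ := fromBlocks 1 0 H 1
  set BL : Matrix (Fin r ⊕ Fin r) (Fin r ⊕ Fin r) ℂ := fromBlocks 0 0 G 0
  have h1 : BL * TL = BL := by simp [BL, TL, fromBlocks_multiply]
  have h2 : TL.det = 1 := by simp [TL]
  -- Subtracting the rows of the electric angles eliminates the block `BL`, as `BL * TL = BL`.
  have h3 : fromBlocks 1 0 (-BL) 1 * fromBlocks TL (fromBlocks (q • 1) (q' • 1) X X') BL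
      (fromBlocks (c • 1) (c' • 1) P P') = fromBlocks TL (fromBlocks (q • 1) (q' • 1) X X') 0
      (fromBlocks (c • 1) (c' • 1) (P - q • G) (P' - q' • G)) := by
    rw [fromBlocks_multiply]
    congr 1
    · simp
    · simp
    · rw [neg_mul, h1, one_mul, neg_add_cancel]
    · simp [BL, fromBlocks_multiply, fromBlocks_neg, fromBlocks_add, sub_eq_neg_add]
  have h4 := congrArg det h3
  rw [det_mul, det_fromBlocks_zero₁₂, det_fromBlocks_zero₂₁, h2] at h4
  simp only [det_one, one_mul] at h4
  rw [h4]
  have h5 : fromBlocks (c • (1 : Matrix (Fin r) (Fin r) ℂ)) (c' • 1) (P - q • G) (P' - q' • G) *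
      fromBlocks 1 (-(c' • 1)) 0 (c • 1) = fromBlocks (c • 1) 0 (P - q • G)
        (c • P' - c' • P - (c * q' - c' * q) • G) := by
    rw [fromBlocks_multiply]
    congr 1
    · simp
    · simp [smul_smul, mul_comm]
    · simp
    · simp only [Matrix.mul_neg, Matrix.mul_smul, mul_one, smul_sub, smul_smul, sub_smul,
        mul_comm c']
      abel
  have h6 := congrArg det h5
  rw [det_mul, det_fromBlocks_zero₁₂, det_fromBlocks_zero₂₁, det_one, one_mul, mul_comm] at h6
  refine mul_left_cancel₀ ?_ h6
  simp [hc]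

end Blocks

section Jacobian

variable {r : ℕ} {B : Type*} [TopologicalSpace B] [ChartedSpace (Fin r → ℂ) B]
  {R : TopologicalSpace.Opens B} {D : BPSData r B R} {U : Set B} {A : DiscriminantAssumptions D U}
  {S : SectorialDecomposition} {Ua : Set R} {e m : Fin r → ∀ x, D.charge.Fiber x} {p : Fin r → ℤ}

/-- The logarithmic derivatives of the model coordinates are given by `modelForm`. -/
theorem exists_dlog_modelMap_eq [IsManifold 𝓘(ℂ, Fin r → ℂ) 1 B] (hU : IsOpen U)
    (hUaU : ∀ x ∈ Ua, x.1 ∈ U) (hS : A.IsGoodOn S Ua) {ζ : ℂ} (hζ : ζ ≠ 0) {k : ℤ}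
    (hk : k = 0 ∨ k = 1 ∨ k = -1) (h : IsSymplecticFrame D.toChargeData Ua e m p) {W : Set R}
    {θ₀ : ∀ x, D.charge.Fiber x → Real.Angle} (hWUa : W ⊆ Ua)
    (hθ₀ : IsFlatCharacterOn D.toChargeData W θ₀) {x : R} (hx : x ∈ W) (s : Fin r ⊕ Fin r → ℝ) :
    ∃ (α φ : A.Light → ℝ) (L : Fin r ⊕ Fin r → (Fin r → ℂ) × (Fin r ⊕ Fin r → ℝ) →L[ℝ] ℂ),
      (∀ γ ∈ A.active, exp (α γ * I) ≠ ζ / ‖ζ‖) ∧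
      (∀ γ ∈ A.active, InHalfPlane (α γ) (D.Z x (A.light x γ))) ∧
      (∀ γ, (φ γ : Real.Angle) = charAt D.toChargeData e m p θ₀ x s (A.light x γ)) ∧
      (∀ j t s', L j (t, s') = modelForm A ζ α φ x t (angleShift D.toChargeData e m p s' x)
          ((Sum.elim e m j : ∀ y, D.charge.Fiber y) x)) ∧
      (∀ i j, dlogFiber (A.modelMap S k ζ e m p θ₀) (x, s) i j = L i (0, Pi.single j 1)) ∧
      ∀ i v, dlogBase (A.modelMap S k ζ e m p θ₀) (x, s) i v = L i (v, 0) := by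
  obtain ⟨α, φ, Y, hα, hαZ, hφ, hYs, hYd, hY⟩ :=
    exists_chart_modelMap_eq hU hUaU hS hζ hk h hWUa hθ₀ hx s
  set ψ := chartAt (Fin r → ℂ) x with hψ
  set q₀ : (Fin r → ℂ) × (Fin r ⊕ Fin r → ℝ) := (ψ x, s) with hq₀
  have hn : (∞ : WithTop ℕ∞) ≠ 0 := by simp
  have hYf : ∀ j, HasFDerivAt (Y j) (fderiv ℝ (Y j) q₀) q₀ := fun j =>
    ((hYs j).self_of_nhds.differentiableAt hn).hasFDerivAt
  have hF : ∀ j, A.modelMap S k ζ e m p θ₀ (x, s) j = exp (Y j q₀) := hY.self_of_nhds s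
  refine ⟨α, φ, fun j => fderiv ℝ (Y j) q₀, hα, hαZ, hφ, hYd, fun i j => ?_, fun i v => ?_⟩
  · have h1 : HasFDerivAt (fun s' => exp (Y i (ψ x, s')))
        (exp (Y i q₀) • (fderiv ℝ (Y i) q₀).comp (ContinuousLinearMap.inr ℝ _ _)) s :=
      (HasFDerivAt.comp (g := Y i) (f := fun s' => (ψ x, s')) s (hYf i)
        (hasFDerivAt_prodMk_right (𝕜 := ℝ) (ψ x) s)).cexp
    have h2 : (fun s' => A.modelMap S k ζ e m p θ₀ (x, s') i) = fun s' => exp (Y i (ψ x, s')) :=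
      funext fun s' => hY.self_of_nhds s' i
    rw [dlogFiber, h2, h1.fderiv, hF]
    change exp (Y i q₀) * _ / exp (Y i q₀) = _
    rw [mul_div_cancel_left₀ _ (exp_ne_zero _)]
    rfl
  · have h1 : HasFDerivAt (fun z => exp (Y i (z, s)))
        (exp (Y i q₀) • (fderiv ℝ (Y i) q₀).comp (ContinuousLinearMap.inl ℝ _ _)) (ψ x) :=
      (HasFDerivAt.comp (g := Y i) (f := fun z => (z, s)) (ψ x) (hYf i)
        (hasFDerivAt_prodMk_left (𝕜 := ℝ) (ψ x) s)).cexp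
    have h2 : (fun y => A.modelMap S k ζ e m p θ₀ (y, s) i) =ᶠ[𝓝 x]
        (fun z => exp (Y i (z, s))) ∘ ψ := by
      filter_upwards [hY] with y hy using hy s i
    have hψx : x ∈ ψ.source := mem_chart_source _ x
    have h3 : realDiff (r := r) (fun y => A.modelMap S k ζ e m p θ₀ (y, s) i) x =
        exp (Y i q₀) • (fderiv ℝ (Y i) q₀).comp (ContinuousLinearMap.inl ℝ _ _) := by
      refine realDiff_eq ?_ (h1.congr_of_eventuallyEq ?_)
      · exact (h1.continuousAt.comp (ψ.continuousAt hψx)).congr h2.symm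
      · have h4 := (ψ.symm.continuousAt (ψ.map_source hψx))
        rw [ContinuousAt, ψ.left_inv hψx] at h4
        filter_upwards [h4.eventually h2, ψ.open_target.mem_nhds (ψ.map_source hψx)] with z hz hzt
        rw [Function.comp_apply, hz, Function.comp_apply, ψ.right_inv hzt]
    rw [dlogBase, h3, hF]
    change exp (Y i q₀) * _ / exp (Y i q₀) = _
    rw [mul_div_cancel_left₀ _ (exp_ne_zero _)]
    rfl

end Jacobian

section Determinant

variable {r : ℕ} {B : Type*} [TopologicalSpace B] [ChartedSpace (Fin r → ℂ) B]
  {R : TopologicalSpace.Opens B} {D : BPSData r B R} {U : Set B} {A : DiscriminantAssumptions D U}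
  {S : SectorialDecomposition} {Ua : Set R} {e m : Fin r → ∀ x, D.charge.Fiber x} {p : Fin r → ℤ}

/-- The derivative of the real part of the logarithm of a magnetic coordinate in the direction
in which only the `j`-th electric coordinate varies, its logarithm being constant. -/
lemma re_modelForm_magnetic {ζ : ℂ} (hζ : ζ ≠ 0) {x : R} (hxU : x.1 ∈ U) (hx : x ∈ Ua)
    (h : IsSymplecticFrame D.toChargeData Ua e m p) (he : ∀ i, e i x ∈ (A.loc x).range)
    {θ : D.charge.Fiber x → Real.Angle} (hθ : IsTwistedCharacter D.toChargeData x θ)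
    {α φ : A.Light → ℝ} (hφ : ∀ γ, (φ γ : Real.Angle) = θ (A.light x γ))
    (hα : ∀ γ ∈ A.active, exp (α γ * I) ≠ ζ / ‖ζ‖)
    (hαZ : ∀ γ ∈ A.active, InHalfPlane (α γ) (D.Z x (A.light x γ))) (i j : Fin r) :
    (((p i : ℝ)⁻¹ * (modelForm A ζ α φ x
        ((I * conj (halfSum ζ)) • coordVector D x (fun l => e l x) j)
        (angleShift D.toChargeData e m p (halfDiff ζ • Pi.single (.inl j) 1) x) (m i x)).re : ℝ) : ℂ) =
      -2 * (‖halfSum ζ‖ ^ 2 : ℝ) * A.V x θ (fun l => e l x) (fun l => m l x) p i j := by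
  have hfr := h.isFrameAt hx
  have hpe : ∀ i γ, D.pair x (e i x) (A.light x γ) = 0 := fun i γ => by
    obtain ⟨ε, hε⟩ := he i
    rw [← hε, pair_loc_light A hxU]
  set b : Fin r → A.Light → ℝ := fun i γ => D.pair x (m i x) (A.light x γ) / p i with hb
  have hodd : ∀ i γ, b i (-γ) = -b i γ := fun i γ => by
    simp only [hb, light_neg, _root_.map_neg, Int.cast_neg, neg_div]
  have hdZ : ∀ γ, D.dZ x (A.light x γ) ((I * conj (halfSum ζ)) •
      coordVector D x (fun l => e l x) j) = I * conj (halfSum ζ) * b j γ := fun γ => by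
    rw [map_smul, hfr.dZ_expansion]
    simp [hfr.dZ_coordVector, hpe, hb]
  have hσ : ∀ γ, angleShift D.toChargeData e m p (halfDiff ζ • Pi.single (.inl j) 1) x
      (A.light x γ) = halfDiff ζ * b j γ := fun γ => by
    simp only [angleShift, hpe, hb, Pi.smul_apply, smul_eq_mul]
    rw [Finset.sum_eq_single j]
    · simp; ring
    · intro i _ hij
      simp [hij]
    · simp
  have hp : (p i : ℝ) ≠ 0 := by exact_mod_cast h.p_ne_zero i
  have hmag : D.dZ x (m i x) ((I * conj (halfSum ζ)) • coordVector D x (fun l => e l x) j) =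
      I * conj (halfSum ζ) * ((p i : ℝ) *
        periodMatrix D x (fun l => e l x) (fun l => m l x) p i j) := by
    have hp' : (p i : ℂ) ≠ 0 := by exact_mod_cast h.p_ne_zero i
    rw [map_smul, periodMatrix_apply, smul_eq_mul, ofReal_intCast, mul_div_cancel₀ _ hp']
  have hsum := sum_re_response hζ hxU hθ hφ hα hαZ (hodd i) (hodd j)
  have hterm : (∑ γ ∈ A.active, (A.omega γ : ℂ) * D.pair x (m i x) (A.light x γ) *
      response ζ (α γ) (D.Z x (A.light x γ)) (φ γ) (I * conj (halfSum ζ) * b j γ)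
        ((halfDiff ζ * b j γ : ℝ))).re = p i * ∑ γ ∈ A.active, A.omega γ * b i γ *
      (response ζ (α γ) (D.Z x (A.light x γ)) (φ γ) (I * conj (halfSum ζ) * b j γ)
        (halfDiff ζ * b j γ)).re := by
    rw [re_sum, Finset.mul_sum]
    refine Finset.sum_congr rfl fun γ _ => ?_
    have h1 : (A.omega γ : ℂ) * (D.pair x (m i x) (A.light x γ) : ℂ) =
        ((p i * (A.omega γ * b i γ) : ℝ) : ℂ) := by
      simp only [hb]
      rw [mul_left_comm, mul_div_cancel₀ _ hp]
      push_cast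
      rfl
    rw [h1, re_ofReal_mul]
    ring
  rw [V_apply hxU hθ hφ, modelForm]
  simp only [hdZ, hσ]
  rw [add_re, re_semiflat, hterm, hsum, hmag]
  have h2 : halfSum ζ * (I * conj (halfSum ζ) * ((p i : ℝ) *
      periodMatrix D x (fun l => e l x) (fun l => m l x) p i j)) =
      ((p i * ‖halfSum ζ‖ ^ 2 : ℝ) : ℂ) *
        (I * periodMatrix D x (fun l => e l x) (fun l => m l x) p i j) := by
    rw [← normSq_eq_norm_sq, ofReal_mul, ← mul_conj]
    ring
  rw [h2, re_ofReal_mul, I_mul_re]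
  rw [← ofReal_ofNat, ← ofReal_neg, ← ofReal_mul, ← ofReal_mul, ofReal_inj]
  have h8 : ∀ w y : ℝ, (p i : ℝ)⁻¹ * (2 * (p i * ‖halfSum ζ‖ ^ 2 * -w) +
      p i * -(2 * ‖halfSum ζ‖ ^ 2 * y)) = -2 * ‖halfSum ζ‖ ^ 2 * (w + y) := fun w y => by
    field_simp
    ring
  exact h8 _ _

/-- The number `(ζ⁻¹ - conj ζ) / (2 i)`. -/
def halfTwist (ζ : ℂ) : ℂ := -I * ((ζ⁻¹ - conj ζ) / 2)

lemma im_semiflat (ζ z : ℂ) :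
    (1 / ζ * z + ζ * conj z).im = 2 * (halfTwist ζ * z).re := by
  have h1 : (ζ * conj z).im = -(conj ζ * z).im := by
    rw [← conj_im, map_mul, conj_conj]
  have h2 : halfTwist ζ * z = ((1 / 2 : ℝ) : ℂ) * (-I * (ζ⁻¹ * z - conj ζ * z)) := by
    rw [halfTwist]; push_cast; ring
  rw [add_im, h1, h2, re_ofReal_mul, neg_mul, neg_re, I_mul_re, sub_im, one_div]
  ring

lemma halfSum_mul_conj_halfTwist {ζ : ℂ} (hζ : ζ ≠ 0) :
    halfSum ζ * conj (halfTwist ζ) - conj (halfSum ζ) * halfTwist ζ = -(I * halfDiff ζ) := by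
  have h3 : conj ζ ≠ 0 := by simpa using hζ
  rw [halfDiff, ← normSq_eq_norm_sq]
  push_cast
  rw [← mul_conj]
  simp only [halfSum, halfTwist, map_mul, map_neg, map_div₀, map_add, map_sub, map_inv₀, conj_conj,
    map_ofNat, conj_I]
  field_simp
  ring

/-- The Wirtinger derivatives of `w ↦ 2 Re (c w)`. -/
lemma wirtinger_re (c : ℂ) : (((2 * (c * 1).re : ℝ) : ℂ) - I * ((2 * (c * I).re : ℝ) : ℂ)) / 2 = c ∧
    (((2 * (c * 1).re : ℝ) : ℂ) + I * ((2 * (c * I).re : ℝ) : ℂ)) / 2 = conj c := by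
  constructor <;> apply Complex.ext <;> simp [neg_div]

/-- The Jacobian determinant of coordinates whose electric logarithms are semi-flat and whose
magnetic logarithms depend on the magnetic angles as the semi-flat ones do. -/
lemma det_jacobianMatrix_eq {ζ : ℂ} (hζ : ζ ≠ 0) {x : R} {s : Fin r ⊕ Fin r → ℝ}
    (h : IsFrameAt D.toChargeData x (fun i => e i x) (fun i => m i x) p)
    {F : R × (Fin r ⊕ Fin r → ℝ) → Fin r ⊕ Fin r → ℂ}
    {L : Fin r ⊕ Fin r → (Fin r → ℂ) × (Fin r ⊕ Fin r → ℝ) →L[ℝ] ℂ}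
    (hfib : ∀ i j, dlogFiber F (x, s) i j = L i (0, Pi.single j 1))
    (hbase : ∀ i v, dlogBase F (x, s) i v = L i (v, 0))
    (hLe : ∀ i t s', L (.inl i) (t, s') = 1 / ζ * D.dZ x (e i x) t +
      ζ * conj (D.dZ x (e i x) t) + s' (.inl i) * I)
    (hLm : ∀ i j, L (.inr i) (0, Pi.single (.inr j) 1) = if i = j then I else 0) :
    (jacobianMatrix D e p F (x, s)).det = (Matrix.of fun i j => I * (((p i : ℝ)⁻¹ *
      (L (.inr i) ((I * conj (halfSum ζ)) • coordVector D x (fun l => e l x) j,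
        halfDiff ζ • Pi.single (.inl j) 1)).re : ℝ) : ℂ)).det := by
  set v : Fin r → Fin r → ℂ := coordVector D x fun l => e l x with hv
  set H : Matrix (Fin r) (Fin r) ℂ := Matrix.of fun i j =>
    (((p i : ℝ)⁻¹ * (L (.inr i) (0, Pi.single (.inl j) 1)).im : ℝ) : ℂ) with hH
  set G : Matrix (Fin r) (Fin r) ℂ := Matrix.of fun i j =>
    (((p i : ℝ)⁻¹ * (L (.inr i) (0, Pi.single (.inl j) 1)).re : ℝ) : ℂ) with hG
  set d : (ℂ → ℝ) → Fin r → (Fin r → ℂ) → ℂ := fun part i t =>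
    (((p i : ℝ)⁻¹ * part (L (.inr i) (t, 0)) : ℝ) : ℂ) with hd
  set P : Matrix (Fin r) (Fin r) ℂ := Matrix.of fun i j =>
    (d re i (v j) - I * d re i (I • v j)) / 2 with hP
  set P' : Matrix (Fin r) (Fin r) ℂ := Matrix.of fun i j =>
    (d re i (v j) + I * d re i (I • v j)) / 2 with hP'
  have hjac : jacobianMatrix D e p F (x, s) =
      Matrix.fromBlocks (Matrix.fromBlocks 1 0 H 1)
        (Matrix.fromBlocks (halfTwist ζ • 1) (conj (halfTwist ζ) • 1)
          (Matrix.of fun i j => (d im i (v j) - I * d im i (I • v j)) / 2)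
          (Matrix.of fun i j => (d im i (v j) + I * d im i (I • v j)) / 2))
        (Matrix.fromBlocks 0 0 G 0)
        (Matrix.fromBlocks (halfSum ζ • 1) (conj (halfSum ζ) • 1) P P') := by
    have hbr : ∀ i j (w : ℂ), (L (.inl i) (w • v j, 0)).re =
        if i = j then 2 * (halfSum ζ * w).re else 0 := fun i j w => by
      rw [hLe, re_semiflat, map_smul, h.dZ_coordVector]
      split_ifs <;> simp
    have hbi : ∀ i j (w : ℂ), (L (.inl i) (w • v j, 0)).im =
        if i = j then 2 * (halfTwist ζ * w).re else 0 := fun i j w => by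
      rw [hLe, Pi.zero_apply, ofReal_zero, zero_mul, add_zero, im_semiflat, map_smul,
        h.dZ_coordVector]
      split_ifs <;> simp
    have hone : ∀ i j, (L (.inl i) (v j, 0)) = L (.inl i) ((1 : ℂ) • v j, 0) := fun i j => by
      rw [one_smul]
    obtain ⟨w1, w2⟩ := wirtinger_re (halfSum ζ)
    obtain ⟨w3, w4⟩ := wirtinger_re (halfTwist ζ)
    ext row col
    rcases row with (i | i) | (i | i) <;> rcases col with (j | j) | (j | j)
    · by_cases hij : i = j <;> simp [jacobianMatrix, hfib, hLe, hij]
    · simp [jacobianMatrix, hfib, hLe]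
    · simp only [jacobianMatrix, Matrix.of_apply, Sum.elim_inl, id, hbase, one_mul,
        Matrix.fromBlocks_apply₁₂, Matrix.fromBlocks_apply₁₁, Matrix.smul_apply, Matrix.one_apply,
        smul_eq_mul, mul_ite, mul_one, mul_zero, hone, hbi, ← hv]
      split_ifs
      · simpa using w3
      · simp
    · simp only [jacobianMatrix, Matrix.of_apply, Sum.elim_inl, id, hbase, one_mul,
        Matrix.fromBlocks_apply₁₂, Matrix.smul_apply, Matrix.one_apply,
        smul_eq_mul, mul_ite, mul_one, mul_zero, hone, hbi, ← hv]
      split_ifs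
      · simpa using w4
      · simp
    · simp [jacobianMatrix, hfib, hH]
    · by_cases hij : i = j
      · subst hij
        simp [jacobianMatrix, hfib, hLm, h.p_ne_zero i]
      · simp [jacobianMatrix, hfib, hLm, hij]
    · simp [jacobianMatrix, hbase, hd, hv]
    · simp [jacobianMatrix, hbase, hd, hv]
    · simp [jacobianMatrix, hfib, hLe]
    · simp [jacobianMatrix, hfib, hLe]
    · simp only [jacobianMatrix, Matrix.of_apply, Sum.elim_inl, Sum.elim_inr, id, hbase, one_mul,
        Matrix.fromBlocks_apply₂₂, Matrix.fromBlocks_apply₁₁, Matrix.smul_apply, Matrix.one_apply,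
        smul_eq_mul, mul_ite, mul_one, mul_zero, hone, hbr, ← hv]
      split_ifs
      · simpa using w1
      · simp
    · simp only [jacobianMatrix, Matrix.of_apply, Sum.elim_inl, Sum.elim_inr, id, hbase, one_mul,
        Matrix.fromBlocks_apply₂₂, Matrix.fromBlocks_apply₁₂, Matrix.smul_apply, Matrix.one_apply,
        smul_eq_mul, mul_ite, mul_one, mul_zero, hone, hbr, ← hv]
      split_ifs
      · simpa using w2
      · simp
    · simp [jacobianMatrix, hfib, hG]
    · by_cases hij : i = j
      · subst hij
        simp [jacobianMatrix, hfib, hLm]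
      · simp [jacobianMatrix, hfib, hLm, hij]
    · simp [jacobianMatrix, hbase, hP, hd, hv]
    · simp [jacobianMatrix, hbase, hP', hd, hv]
  rw [hjac, det_jacobian_blocks (halfSum_ne_zero hζ), halfSum_mul_conj_halfTwist hζ]
  congr 1
  ext i j
  -- The combination of the columns left over by the elimination is the derivative in the direction
  -- in which the logarithm of the `j`-th electric coordinate is constant.
  have h2 : L (.inr i) ((I * conj (halfSum ζ)) • v j, halfDiff ζ • Pi.single (.inl j) 1) =
      ((halfSum ζ).im : ℂ) * L (.inr i) (v j, 0) + ((halfSum ζ).re : ℂ) * L (.inr i) (I • v j, 0) +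
        (halfDiff ζ : ℂ) * L (.inr i) (0, Pi.single (.inl j) 1) := by
    have h3 : (((I * conj (halfSum ζ)) • v j, halfDiff ζ • Pi.single (.inl j) 1) :
        (Fin r → ℂ) × (Fin r ⊕ Fin r → ℝ)) = (halfSum ζ).im • (v j, 0) +
        (halfSum ζ).re • (I • v j, 0) + halfDiff ζ • (0, Pi.single (.inl j) 1) := by
      refine Prod.ext ?_ (by simp)
      have h4 : I * conj (halfSum ζ) = (halfSum ζ).im + (halfSum ζ).re * I := by
        apply Complex.ext <;> simp
      rw [h4]
      funext l
      simp
      ring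
    rw [h3, map_add, map_add, map_smul, map_smul, map_smul]
    simp only [real_smul]
  rw [Matrix.of_apply, h2, add_re, add_re, re_ofReal_mul, re_ofReal_mul, re_ofReal_mul]
  simp only [Matrix.sub_apply, Matrix.smul_apply, smul_eq_mul, hP, hP', hG, hd, Matrix.of_apply]
  have h7 : conj (halfSum ζ) = (halfSum ζ).re - (halfSum ζ).im * I := by
    apply Complex.ext <;> simp
  rw [h7]
  nth_rewrite 1 [← re_add_im (halfSum ζ)]
  push_cast
  ring

/-- When the electric charges are local, they do not pair with the light charges, and
`det_jacobianMatrix_eq` applies; by `re_modelForm_magnetic`, the remaining `r × r` matrix is a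
multiple of `V`. -/
theorem det_jacobianMatrix_modelMap [IsManifold 𝓘(ℂ, Fin r → ℂ) 1 B] (hU : IsOpen U)
    (hUaU : ∀ x ∈ Ua, x.1 ∈ U) (hS : A.IsGoodOn S Ua) {ζ : ℂ} (hζ : ζ ≠ 0) {k : ℤ}
    (hk : k = 0 ∨ k = 1 ∨ k = -1) (h : IsSymplecticFrame D.toChargeData Ua e m p)
    (he : ∀ i, ∀ x ∈ Ua, e i x ∈ (A.loc x).range) {W : Set R}
    {θ₀ : ∀ x, D.charge.Fiber x → Real.Angle} (hWUa : W ⊆ Ua)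
    (hθ₀ : IsFlatCharacterOn D.toChargeData W θ₀) {x : R} (hx : x ∈ W) (s : Fin r ⊕ Fin r → ℝ) :
    (jacobianMatrix D e p (A.modelMap S k ζ e m p θ₀) (x, s)).det =
      ((‖halfSum ζ‖ ^ (2 * r) : ℝ) : ℂ) * (-2 * I) ^ r *
        (A.V x (charAt D.toChargeData e m p θ₀ x s) (fun i => e i x) (fun i => m i x) p).det := by
  obtain ⟨α, φ, L, hα, hαZ, hφ, hL, hfib, hbase⟩ :=
    exists_dlog_modelMap_eq hU hUaU hS hζ hk h hWUa hθ₀ hx s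
  have hxa := hWUa hx
  have hxU := hUaU x hxa
  have hθ := isTwistedCharacter_charAt e m p hθ₀ hx s
  have hpe : ∀ i γ, D.pair x (e i x) (A.light x γ) = 0 := fun i γ => by
    obtain ⟨ε, hε⟩ := he i x hxa
    rw [← hε, pair_loc_light A hxU]
  have hLe : ∀ i t s', L (.inl i) (t, s') = 1 / ζ * D.dZ x (e i x) t +
      ζ * conj (D.dZ x (e i x) t) + s' (.inl i) * I := fun i t s' => by
    rw [hL, ← angleShift_e h s' hxa i]
    obtain ⟨ε, hε⟩ := he i x hxa
    change modelForm A ζ α φ x t _ (e i x) = _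
    rw [← hε, modelForm_loc hxU]
  have hLm : ∀ i j, L (.inr i) (0, Pi.single (.inr j) 1) = if i = j then I else 0 := fun i j => by
    have h1 : ∀ γ, angleShift D.toChargeData e m p (Pi.single (.inr j) 1) x (A.light x γ) = 0 :=
      fun γ => by simp [angleShift, hpe]
    rw [hL]
    change modelForm A ζ α φ x 0 _ (m i x) = _
    rw [modelForm, angleShift_m h _ hxa]
    by_cases hij : i = j <;> simp [h1, response, hij]
  rw [det_jacobianMatrix_eq hζ (h.isFrameAt hxa) hfib hbase hLe hLm]
  have hmat : (Matrix.of fun i j => I * (((p i : ℝ)⁻¹ *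
      (L (.inr i) ((I * conj (halfSum ζ)) • coordVector D x (fun l => e l x) j,
        halfDiff ζ • Pi.single (.inl j) 1)).re : ℝ) : ℂ)) =
      (-2 * I * (‖halfSum ζ‖ ^ 2 : ℝ)) •
        A.V x (charAt D.toChargeData e m p θ₀ x s) (fun i => e i x) (fun i => m i x) p := by
    ext i j
    have h1 := re_modelForm_magnetic hζ hxU hxa h (fun i => he i x hxa) hθ hφ hα hαZ i j
    rw [Matrix.of_apply, Matrix.smul_apply, smul_eq_mul, hL]
    refine (congrArg (I * ·) h1).trans ?_
    ring
  rw [hmat, Matrix.det_smul, Fintype.card_fin, mul_pow, pow_mul, ← ofReal_pow]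
  ring

end Determinant

end CoulombModel

end

theorem mainTheorem6 {r : ℕ} {B : Type*} [TopologicalSpace B] [T2Space B] [ConnectedSpace B]
    [ChartedSpace (Fin r → ℂ) B] [IsManifold 𝓘(ℂ, Fin r → ℂ) ω B]
    (R : TopologicalSpace.Opens B) (hR : IsDivisor (r := r) (R : Set B)ᶜ)
    (D : BPSData r B R) (u : B) (hu : u ∉ R) (U : Set B) (hU : IsOpen U) (huU : u ∈ U)
    (A : DiscriminantAssumptions D U)
    (Ua : Set R) (hUa : IsOpen Ua) (hUa_contractible : ContractibleSpace Ua)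
    (hUaU : ∀ x ∈ Ua, x.1 ∈ U)
    (S : SectorialDecomposition) (hS : A.IsGoodOn S Ua) :
    -- the defining integrals converge
    (∀ ζ : ℂ, ζ ≠ 0 → ∀ k : ℤ, k = 0 ∨ k = 1 ∨ k = -1 →
      ∀ x ∈ Ua, ∀ θ, IsTwistedCharacter D.toChargeData x θ → ∀ γ ∈ A.active,
        RayIntegralMinusConverges (A.integrand x θ ζ γ) (A.contourAngle S x k γ)) ∧
    -- the model twisted characters are valid coordinates
    (∀ ζ : ℂ, ζ ≠ 0 → ∀ k : ℤ, k = 0 ∨ k = 1 ∨ k = -1 →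
      ∀ (e m : Fin r → ∀ x, D.charge.Fiber x) (p : Fin r → ℤ),
        IsFrobeniusLift D.toChargeData Ua e m p →
      ∀ (W : Set R) (θ₀ : ∀ x, D.charge.Fiber x → Real.Angle), IsOpen W → W ⊆ Ua →
        IsFlatCharacterOn D.toChargeData W θ₀ →
        IsLocalDiffeomorphOn
          (𝓘(ℝ, Fin r → ℂ).prod 𝓘(ℝ, Fin r ⊕ Fin r → ℝ)) 𝓘(ℝ, Fin r ⊕ Fin r → ℂ) ∞
          (A.modelMap S k ζ e m p θ₀) (W ×ˢ Set.univ)) ∧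
    -- the matrix `V` and the Jacobian, for frames with `e_i` in `Γ̂_local`
    (∀ (e m : Fin r → ∀ x, D.charge.Fiber x) (p : Fin r → ℤ),
        IsSymplecticFrame D.toChargeData Ua e m p →
        (∀ i, ∀ x ∈ Ua, e i x ∈ (A.loc x).range) →
      (∀ x ∈ Ua, (aMatrix D x (fun i => e i x)).det ≠ 0) ∧
      (∀ x ∈ Ua, ∀ θ, IsTwistedCharacter D.toChargeData x θ →
        (∀ i j, (A.V x θ (fun i => e i x) (fun i => m i x) p i j).im = 0) ∧
        ((A.V x θ (fun i => e i x) (fun i => m i x) p).map Complex.re).PosDef) ∧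
      ∀ ζ : ℂ, ζ ≠ 0 → ∀ k : ℤ, k = 0 ∨ k = 1 ∨ k = -1 →
      ∀ (W : Set R) (θ₀ : ∀ x, D.charge.Fiber x → Real.Angle), IsOpen W → W ⊆ Ua →
        IsFlatCharacterOn D.toChargeData W θ₀ →
      ∀ x ∈ W, ∀ s : Fin r ⊕ Fin r → ℝ,
        (jacobianMatrix D e p (A.modelMap S k ζ e m p θ₀) (x, s)).det =
          ((‖(ζ⁻¹ + conj ζ) / 2‖ ^ (2 * r) : ℝ) : ℂ) * (-2 * Complex.I) ^ r *
            (A.V x (charAt D.toChargeData e m p θ₀ x s)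
              (fun i => e i x) (fun i => m i x) p).det) := by
  have : IsManifold 𝓘(ℂ, Fin r → ℂ) 1 B := IsManifold.of_le (n := ω) le_top
  refine ⟨fun ζ hζ k hk x hx θ _ γ hγ => ?_, fun ζ hζ k hk e m p h W θ₀ _ hWUa hθ₀ q => ?_,
    fun e m p h he => ⟨fun x hx => ?_, fun x hx θ hθ => ⟨fun i j => ?_, ?_⟩, ?_⟩⟩
  · obtain ⟨-, -, -, hconv, -⟩ := exists_rayIntegralMinus_eq hU hUaU hS hζ hk hx hγ
    exact hconv θ
  · exact isLocalDiffeomorphAt_modelMap hR hU hUaU hS hζ hk h.toIsSymplecticFrame hWUa hθ₀ q.2.1 _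
  · exact (h.isFrameAt hx).det_ne_zero
  · rw [V_apply (hUaU x hx) hθ (φ := fun γ => (θ (A.light x γ)).toReal)
      fun γ => Real.Angle.coe_toReal _]
    exact Complex.ofReal_im _
  · exact posDef_V hR hU (hUaU x hx) (h.isFrameAt hx) (fun i => he i x hx) hθ
  · intro ζ hζ k hk W θ₀ _ hWUa hθ₀ x hx s
    exact det_jacobianMatrix_modelMap hU hUaU hS hζ hk h he hWUa hθ₀ hx s
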